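/- Let $\Omega=(a,b)\times(c,d)\subset\mathbb R^2$ with $a<b$, $c<d$. Let $\Gamma_1$ be the union of its bottom and top sides and $\Gamma_2$ the union of its left and right sides, where the point $(a,y)$ is identified with $(b,y)$ for $y\in[c,d]$. Fix $\alpha,\beta,\gamma>0$, $\rho>0$ and integers $s\ge 2$, $p\ge 1$. Let $H^s(\Omega,\Gamma_1)=\{v\in H^s(\Omega): v_{|\Gamma_1}\in H^s(\Gamma_1)\}$ with $\|v\|_{H^s(\Omega,\Gamma_1)}^2=\|v\|_{H^s(\Omega)}^2+\|v_{|\Gamma_1}\|_{H^s(\Gamma_1)}^2$. Here $v_{|\Gamma_1}$ is the trace, $H^0(\Gamma_1)=L^2(\Gamma_1)$, and for $k\ge 1$ the space $H^k(\Gamma_1)$ consists of the $w\in H^{k-1}(\Gamma_1)$ whose (weak) tangential gradient $\nabla_\Gamma w$ on the two open sides lies in $H^{k-1}(\Gamma_1)^2$, with $\|w\|^2_{H^k(\Gamma_1)}=\|w\|^2_{H^{k-1}(\Gamma_1)}+\|\nabla_\Gamma w\|^2_{H^{k-1}(\Gamma_1)}$. Let $\mathcal T_h$ be a finite partition of $\Omega$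 into disjoint open triangles $T$ with $\overline\Omega=\bigcup_{T\in\mathcal T_h}\overline T$ and $h=\max_T\operatorname{diam}T$, quasi-uniform with constant $\rho$: each $T$ contains a disc of radius $\rho h$. Let $\mathcal E_h^0$ be the set of interior edges (common segments of positive length of the closures of two elements), $\mathcal E_h^{\Gamma_2}$ the set of periodic edges (common segments of positive length of the closures of an element at the left side and an element at the right side, after the identification), and $\mathcal E_h^{\Gamma_1}$ the set of edges of elements contained in $\Gamma_1$. Let $\mathcal R_h^{\Gamma_1}$ be the set of ridges, i.e. the end points of the edges in $\mathcal E_h^{\Gamma_1}$, with the corners $(a,y)$ and $(b,y)$ identified for $y\in\{c,d\}$. On an edge in $\mathcal E_h^0\cup\mathcal E_h^{\Gamma_2}$ put $[w]=w^+\mathbf n^++w^-\mathbf n^-$ and $\{\nabla w\}=\tfrac12(\nabla w^++\nabla w^-)$, where $w^\pm$, $\nabla w^\pm$ are the traces from the two elements and $\mathbf n^\pm$ their outward unit normals. At a ridge $r$ shared by the boundary edges $e^\pm$ put $[w]_r=w_{|e^+}(r)\mathbf n_r^++w_{|e^-}(r)\mathbf n_r^-$ and $\{\nabla_\Gamma w\}_r=\tfrac12(\nabla_\Gamma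 w_{|e^+}(r)+\nabla_\Gamma w_{|e^-}(r))$, where $\mathbf n_r^\pm$ is the unit tangent vector to $\Gamma_1$ pointing out of $e^\pm$. With $\sigma=\gamma/h$ set $$ \begin{aligned} |||w|||^2={}&\sum_{T\in\mathcal T_h}\|\nabla w\|_{L^2(T)}^2+\sum_{e\in\mathcal E_h^0\cup\mathcal E_h^{\Gamma_2}}\Big(\sigma\|[w]\|_{L^2(e)}^2+\tfrac1\sigma\|\{\nabla w\}\|_{L^2(e)}^2\Big)+\alpha\|w\|_{L^2(\Gamma_1)}^2\\ &+\beta\sum_{e\in\mathcal E_h^{\Gamma_1}}\|\nabla_\Gamma w\|_{L^2(e)}^2+\sum_{r\in\mathcal R_h^{\Gamma_1}}\Big(\beta\sigma|[w]_r|^2+\tfrac{\beta}{\sigma}|\{\nabla_\Gamma w\}_r|^2\Big). \end{aligned} $$ For $v\in H^s(\Omega,\Gamma_1)$ let $I_p^hv$ be the piecewise Lagrange interpolant: on each $T\in\mathcal T_h$ it is the polynomial of total degree at most $p$ that agrees with the continuous representative of $v$ on $\overline\Omega$ at all points of $\overline T$ whose barycentric coordinates are integer multiples of $1/p$. Then there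 is a constant $C>0$, depending only on $\Omega,\alpha,\beta,\gamma,\rho,s,p$, such that for every such mesh $\mathcal T_h$ and every $v\in H^s(\Omega,\Gamma_1)$ $$|||v-I_p^hv|||\le C\,h^{\min(s-1,p)}\,\|v\|_{H^s(\Omega,\Gamma_1)}.$$ -/

import Mathlib

open MeasureTheory Filter Topology
open scoped ENNReal ContDiff

noncomputable section

namespace DGDyn

/-- The Euclidean plane. -/
abbrev Plane : Type := EuclideanSpace ℝ (Fin 2)

/-- The point with coordinates `(x, y)`. -/
def pt (x y : ℝ) : Plane := !₂[x, y]

/-! ### Sobolev spaces on planar domains -/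

/-- The classical partial derivative in the `i`-th coordinate. -/
def pderiv (i : Fin 2) (f : Plane → ℝ) : Plane → ℝ :=
  fun x => fderiv ℝ f x (EuclideanSpace.single i 1)

/-- The classical derivative `∂^α` for the multi-index `α = (α₁, α₂)`. -/
def mderiv (α : ℕ × ℕ) (f : Plane → ℝ) : Plane → ℝ :=
  (pderiv 0)^[α.1] ((pderiv 1)^[α.2] f)

/-- `g` is a weak derivative `∂^α u` on the open set `D`. -/
def IsWeakDeriv (D : Set Plane) (α : ℕ × ℕ) (u g : Plane → ℝ) : Prop :=
  LocallyIntegrableOn u D ∧ LocallyIntegrableOn g D ∧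
    ∀ φ : Plane → ℝ, ContDiff ℝ ∞ φ → HasCompactSupport φ → tsupport φ ⊆ D →
      ∫ x in D, u x * mderiv α φ x = (-1) ^ (α.1 + α.2) * ∫ x in D, g x * φ x

open Classical in
/-- The weak derivative `∂^α u` on `D` (unique almost everywhere on `D`); zero if there is none. -/
def weakDeriv (D : Set Plane) (α : ℕ × ℕ) (u : Plane → ℝ) : Plane → ℝ :=
  if h : ∃ g, IsWeakDeriv D α u g then h.choose else 0

/-- The squared `L²` norm with respect to `μ`, with values in `[0, ∞]`. -/
def l2sq {X : Type*} [MeasurableSpace X] (μ : Measure X) (u : X → ℝ) : ℝ≥0∞ :=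
  ∫⁻ x, ‖u x‖ₑ ^ 2 ∂μ

/-- `u ∈ H^s(D)`: all weak derivatives of order at most `s` exist and lie in `L²(D)`. -/
def MemHs (D : Set Plane) (s : ℕ) (u : Plane → ℝ) : Prop :=
  MemLp u 2 (volume.restrict D) ∧
    ∀ α : ℕ × ℕ, α.1 + α.2 ≤ s → ∃ g, IsWeakDeriv D α u g ∧ MemLp g 2 (volume.restrict D)

/-- `‖u‖²_{H^s(D)} = ∑_{|α| ≤ s} ‖∂^α u‖²_{L²(D)}`. -/
def hsNormSq (D : Set Plane) (s : ℕ) (u : Plane → ℝ) : ℝ≥0∞ :=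
  ∑ α ∈ (Finset.range (s + 1) ×ˢ Finset.range (s + 1)).filter (fun α => α.1 + α.2 ≤ s),
    l2sq (volume.restrict D) (weakDeriv D α u)

/-- The components of the weak gradient. -/
def weakGrad (D : Set Plane) (u : Plane → ℝ) (i : Fin 2) : Plane → ℝ :=
  weakDeriv D (if i = 0 then (1, 0) else (0, 1)) u

/-- Arc length on the boundary of `D`. -/
def bdryMeasure (D : Set Plane) : Measure Plane :=
  (Measure.hausdorffMeasure 1 : Measure Plane).restrict (frontier D)

/-- `g ∈ L²(∂D)` is the trace of `u ∈ H¹(D)`: smooth functions `φ n` converge to `u` in `H¹(D)`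
while their restrictions to `∂D` converge to `g` in `L²(∂D)`. On a bounded Lipschitz domain every
`u ∈ H¹(D)` has exactly one such `g`, up to boundary null sets. -/
def IsTrace (D : Set Plane) (u g : Plane → ℝ) : Prop :=
  MemHs D 1 u ∧ MemLp g 2 (bdryMeasure D) ∧
    ∃ φ : ℕ → Plane → ℝ, (∀ n, ContDiff ℝ ∞ (φ n)) ∧
      Tendsto (fun n => l2sq (volume.restrict D) (fun x => φ n x - u x)) atTop (𝓝 0) ∧
      (∀ i, Tendsto (fun n => l2sq (volume.restrict D)
        (fun x => pderiv i (φ n) x - weakGrad D u i x)) atTop (𝓝 0)) ∧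
      Tendsto (fun n => l2sq (bdryMeasure D) (fun x => φ n x - g x)) atTop (𝓝 0)

open Classical in
/-- The trace of `u ∈ H¹(D)` on `∂D`; zero if there is none. -/
def trace (D : Set Plane) (u : Plane → ℝ) : Plane → ℝ :=
  if h : ∃ g, IsTrace D u g then h.choose else 0

open Classical in
/-- The representative of the almost-everywhere class of `u` on the open set `U` that is continuous
on the closure of `U`; zero if there is none. -/
def contRep {X : Type*} [TopologicalSpace X] [MeasureSpace X] (U : Set X) (u : X → ℝ) : X → ℝ :=
  if h : ∃ f : X → ℝ, ContinuousOn f (closure U) ∧ f =ᵐ[volume.restrict U] u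
    then h.choose else 0

/-! ### Sobolev spaces on straight boundary pieces

A horizontal boundary piece is parametrised by arc length, that is, by its abscissa `x`. There the
tangential gradient `∇_Γ u` is `(u', 0)`. -/

/-- `g` is the weak derivative of `u` on the open set `J ⊆ ℝ`. -/
def IsWeakDeriv1 (J : Set ℝ) (u g : ℝ → ℝ) : Prop :=
  LocallyIntegrableOn u J ∧ LocallyIntegrableOn g J ∧
    ∀ φ : ℝ → ℝ, ContDiff ℝ ∞ φ → HasCompactSupport φ → tsupport φ ⊆ J →
      ∫ x in J, u x * deriv φ x = - ∫ x in J, g x * φ x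

open Classical in
/-- The weak derivative of `u` on `J`; zero if there is none. -/
def weakDeriv1 (J : Set ℝ) (u : ℝ → ℝ) : ℝ → ℝ :=
  if h : ∃ g, IsWeakDeriv1 J u g then h.choose else 0

/-- `u ∈ H^s(J)`, where `H^{s+1} = {u ∈ H^s : ∇_Γ u ∈ H^s}` and `H^0 = L²`. -/
def MemHs1 (J : Set ℝ) : ℕ → (ℝ → ℝ) → Prop
  | 0, u => MemLp u 2 (volume.restrict J)
  | s + 1, u => MemHs1 J s u ∧ ∃ g, IsWeakDeriv1 J u g ∧ MemHs1 J s g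

/-- `‖u‖²_{H^{s+1}(J)} = ‖u‖²_{H^s(J)} + ‖∇_Γ u‖²_{H^s(J)}`, starting from the `L²` norm. -/
def hsNormSq1 (J : Set ℝ) : ℕ → (ℝ → ℝ) → ℝ≥0∞
  | 0, u => l2sq (volume.restrict J) u
  | s + 1, u => hsNormSq1 J s u + hsNormSq1 J s (weakDeriv1 J u)

/-! ### The domain and the space `H^s(Ω, Γ₁)` -/

/-- The rectangle `Ω = (a, b) × (c, d)`. The part `Γ₁` of its boundary consists of the bottom side
`x₂ = c` and the top side `x₂ = d`, the part `Γ₂` of the left and the right side. -/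
def rect (a b c d : ℝ) : Set Plane := {x | a < x 0 ∧ x 0 < b ∧ c < x 1 ∧ x 1 < d}

/-- The trace of `v` on the horizontal side of `Ω` at height `y`, as a function of the abscissa. -/
def sideTrace (a b c d : ℝ) (v : Plane → ℝ) (y : ℝ) : ℝ → ℝ :=
  fun x => trace (rect a b c d) v (pt x y)

/-- `v ∈ H^s(Ω, Γ₁)`: `v ∈ H^s(Ω)` and `v|_{Γ₁} ∈ H^s(Γ₁)`. -/
def MemHsGamma (a b c d : ℝ) (s : ℕ) (v : Plane → ℝ) : Prop :=
  MemHs (rect a b c d) s v ∧ MemHs1 (Set.Ioo a b) s (sideTrace a b c d v c) ∧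
    MemHs1 (Set.Ioo a b) s (sideTrace a b c d v d)

/-- `‖v‖_{H^s(Ω, Γ₁)} = (‖v‖²_{H^s(Ω)} + ‖v|_{Γ₁}‖²_{H^s(Γ₁)})^{1/2}`. -/
def hsGammaNorm (a b c d : ℝ) (s : ℕ) (v : Plane → ℝ) : ℝ≥0∞ :=
  (hsNormSq (rect a b c d) s v + (hsNormSq1 (Set.Ioo a b) s (sideTrace a b c d v c) +
    hsNormSq1 (Set.Ioo a b) s (sideTrace a b c d v d))) ^ (1 / 2 : ℝ)

/-! ### Meshes -/

/-- A nondegenerate triangle, given by its vertices. -/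
abbrev Tri : Type := Affine.Triangle ℝ Plane

/-- The closed triangle. -/
def closedTri (T : Tri) : Set Plane := convexHull ℝ (Set.range T.points)

/-- The open triangle. -/
def openTri (T : Tri) : Set Plane := interior (closedTri T)

/-- `𝒯` is a partition of `Ω` into disjoint open triangles whose closures cover the closure
of `Ω`. -/
def IsMesh (Ω : Set Plane) (𝒯 : Finset Tri) : Prop :=
  (∀ T ∈ 𝒯, ∀ T' ∈ 𝒯, T ≠ T' → Disjoint (openTri T) (openTri T')) ∧
    closure Ω = ⋃ T ∈ 𝒯, closedTri T

/-- The mesh size `h = max {diam T : T ∈ 𝒯}`. -/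
def meshSize (𝒯 : Finset Tri) : ℝ := sSup ((fun T => Metric.diam (closedTri T)) '' (𝒯 : Set Tri))

/-- Quasi-uniformity with constant `ρ`: each triangle contains a disc of radius `ρ h`. -/
def QuasiUniform (ρ : ℝ) (𝒯 : Finset Tri) : Prop :=
  ∀ T ∈ 𝒯, ∃ z : Plane, Metric.ball z (ρ * meshSize 𝒯) ⊆ openTri T

/-! ### Piecewise Lagrange interpolation -/

/-- `q` has total degree at most `p` and agrees with `f` at the Lagrange nodes of order `p` of `T`,
that is, at the points with barycentric coordinates `(i₀/p, i₁/p, i₂/p)`, `i₀ + i₁ + i₂ = p`. -/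
def IsLagrange (T : Tri) (p : ℕ) (f : Plane → ℝ) (q : MvPolynomial (Fin 2) ℝ) : Prop :=
  q.totalDegree ≤ p ∧ ∀ i : Fin 3 → ℕ, ∑ k, i k = p →
    MvPolynomial.eval (fun j => (∑ k, ((i k : ℝ) / p) • T.points k : Plane) j) q =
      f (∑ k, ((i k : ℝ) / p) • T.points k)

open Classical in
/-- The Lagrange interpolation polynomial of degree `p` of `f` on `T`; it exists and is unique
for `p ≥ 1`. -/
def lagrangePoly (T : Tri) (p : ℕ) (f : Plane → ℝ) : MvPolynomial (Fin 2) ℝ :=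
  if h : ∃ q, IsLagrange T p f q then h.choose else 0

/-- The piecewise Lagrange interpolant `I_p^h v` on the mesh `𝒯` of `Ω`. Point values of `v` are
those of its continuous representative on the closure of `Ω`. -/
def interp (Ω : Set Plane) (𝒯 : Finset Tri) (p : ℕ) (v : Plane → ℝ) : Plane → ℝ :=
  fun x => ∑ T ∈ 𝒯, (openTri T).indicator
    (fun y => MvPolynomial.eval (fun j => y j) (lagrangePoly T p (contRep Ω v))) x

/-! ### The mesh-dependent norm

On an element `T`, the values of a broken function `w` and of its gradient on `∂T` are the traces
taken from inside `T`. -/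

/-- The trace of `w|_T` on `∂T`. -/
def elTrace (T : Tri) (w : Plane → ℝ) : Plane → ℝ := trace (openTri T) w

/-- The trace of the `i`-th component of `∇ (w|_T)` on `∂T`. -/
def elGradTrace (T : Tri) (w : Plane → ℝ) (i : Fin 2) : Plane → ℝ :=
  trace (openTri T) (weakGrad (openTri T) w i)

/-- `|w|²_{H¹(𝒯)} = ∑_T ‖∇ w‖²_{L²(T)}`. -/
def brokenH1Sq (𝒯 : Finset Tri) (w : Plane → ℝ) : ℝ≥0∞ :=
  ∑ T ∈ 𝒯, ∑ i, l2sq (volume.restrict (openTri T)) (weakGrad (openTri T) w i)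

/-- Arc length on the interface between two elements; it vanishes if they share no edge. -/
def ifaceMeasure (T T' : Tri) : Measure Plane :=
  (Measure.hausdorffMeasure 1 : Measure Plane).restrict (closedTri T ∩ closedTri T')

open Classical in
/-- `‖[w]‖²` over the interior edges. The normals from the two sides are opposite, so
`|[w]| = |w⁺ - w⁻|`. Each edge occurs for two ordered pairs of elements, hence the factor `1/2`. -/
def interiorJumpSq (𝒯 : Finset Tri) (w : Plane → ℝ) : ℝ≥0∞ :=
  2⁻¹ * ∑ T ∈ 𝒯, ∑ T' ∈ 𝒯.erase T,
    l2sq (ifaceMeasure T T') (fun x => elTrace T w x - elTrace T' w x)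

open Classical in
/-- `‖{∇ w}‖²` over the interior edges. -/
def interiorMeanGradSq (𝒯 : Finset Tri) (w : Plane → ℝ) : ℝ≥0∞ :=
  2⁻¹ * ∑ T ∈ 𝒯, ∑ T' ∈ 𝒯.erase T, ∑ i,
    l2sq (ifaceMeasure T T') (fun x => (elGradTrace T w i x + elGradTrace T' w i x) / 2)

/-- Arc length on the periodic edge shared by `T` (at the left side `x₁ = a`) and `T'` (at the right
side `x₁ = b`), where `(a, y)` is identified with `(b, y)`; the edge is placed on the left side. -/
def periodicMeasure (a b : ℝ) (T T' : Tri) : Measure Plane :=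
  (Measure.hausdorffMeasure 1 : Measure Plane).restrict
    {x | x 0 = a ∧ x ∈ closedTri T ∧ pt b (x 1) ∈ closedTri T'}

/-- `‖[w]‖²` over the periodic boundary edges. -/
def periodicJumpSq (a b : ℝ) (𝒯 : Finset Tri) (w : Plane → ℝ) : ℝ≥0∞ :=
  ∑ T ∈ 𝒯, ∑ T' ∈ 𝒯,
    l2sq (periodicMeasure a b T T') (fun x => elTrace T w x - elTrace T' w (pt b (x 1)))

/-- `‖{∇ w}‖²` over the periodic boundary edges. -/
def periodicMeanGradSq (a b : ℝ) (𝒯 : Finset Tri) (w : Plane → ℝ) : ℝ≥0∞ :=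
  ∑ T ∈ 𝒯, ∑ T' ∈ 𝒯, ∑ i, l2sq (periodicMeasure a b T T')
    (fun x => (elGradTrace T w i x + elGradTrace T' w i (pt b (x 1))) / 2)

/-- The closed set of abscissae of the intersection of the closed triangle `T` with the horizontal
line at height `y`. For `y = c` or `y = d` this is empty, a point, or a closed interval; in the
last case it is the boundary edge `e ⊆ Γ₁` of `T`. -/
def edgeAbs (T : Tri) (y : ℝ) : Set ℝ := {x | pt x y ∈ closedTri T}

/-- The open edge. -/
def edgeInt (T : Tri) (y : ℝ) : Set ℝ := interior (edgeAbs T y)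

/-- The trace of `w|_T` on the boundary edge of `T` at height `y`. -/
def edgeFun (T : Tri) (y : ℝ) (w : Plane → ℝ) : ℝ → ℝ := fun x => elTrace T w (pt x y)

/-- The tangential derivative of `w|_T` on the boundary edge of `T` at height `y`. -/
def edgeDeriv (T : Tri) (y : ℝ) (w : Plane → ℝ) : ℝ → ℝ :=
  weakDeriv1 (edgeInt T y) (edgeFun T y w)

/-- `‖w‖²_{L²}` over the part of `Γ₁` at height `y`. -/
def sideL2Sq (𝒯 : Finset Tri) (y : ℝ) (w : Plane → ℝ) : ℝ≥0∞ :=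
  ∑ T ∈ 𝒯, l2sq (volume.restrict (edgeInt T y)) (edgeFun T y w)

/-- `|w|²_{H¹} = ∑_e ‖∇_Γ w‖²_{L²(e)}` over the boundary edges at height `y`. -/
def sideH1Sq (𝒯 : Finset Tri) (y : ℝ) (w : Plane → ℝ) : ℝ≥0∞ :=
  ∑ T ∈ 𝒯, l2sq (volume.restrict (edgeInt T y)) (edgeDeriv T y w)

/-- The boundary edges of `T` and `T'` at height `y` share a ridge, which is the right end point of
the first and the left end point of the second; the corners `(a, y)` and `(b, y)` are identified. -/
def ShareRidge (a b y : ℝ) (T T' : Tri) : Prop :=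
  (edgeInt T y).Nonempty ∧ (edgeInt T' y).Nonempty ∧
    (sSup (edgeAbs T y) = sInf (edgeAbs T' y) ∨
      (sSup (edgeAbs T y) = b ∧ sInf (edgeAbs T' y) = a))

open Classical in
/-- `∑_r |[w]_r|²` over the ridges at height `y`. A ridge is the meeting point of exactly one pair
of edges `e⁻`, `e⁺`, and `w^±(r)` is the value at `r` of the continuous function `w|_{e^±}`. -/
def ridgeJumpSq (a b : ℝ) (𝒯 : Finset Tri) (y : ℝ) (w : Plane → ℝ) : ℝ≥0∞ :=
  ∑ T ∈ 𝒯, ∑ T' ∈ 𝒯, if ShareRidge a b y T T' then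
    ‖contRep (edgeInt T y) (edgeFun T y w) (sSup (edgeAbs T y)) -
      contRep (edgeInt T' y) (edgeFun T' y w) (sInf (edgeAbs T' y))‖ₑ ^ 2 else 0

open Classical in
/-- `∑_r |{∇_Γ w}_r|²` over the ridges at height `y`. -/
def ridgeMeanGradSq (a b : ℝ) (𝒯 : Finset Tri) (y : ℝ) (w : Plane → ℝ) : ℝ≥0∞ :=
  ∑ T ∈ 𝒯, ∑ T' ∈ 𝒯, if ShareRidge a b y T T' then
    ‖(contRep (edgeInt T y) (edgeDeriv T y w) (sSup (edgeAbs T y)) +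
      contRep (edgeInt T' y) (edgeDeriv T' y w) (sInf (edgeAbs T' y))) / 2‖ₑ ^ 2 else 0

/-- The penalty parameter `σ = γ / h`. -/
def penalty (γ : ℝ) (𝒯 : Finset Tri) : ℝ := γ / meshSize 𝒯

/-- The square of the interior part of the energy norm. -/
def bulkSq (a b γ : ℝ) (𝒯 : Finset Tri) (w : Plane → ℝ) : ℝ≥0∞ :=
  brokenH1Sq 𝒯 w
    + ENNReal.ofReal (penalty γ 𝒯) * (interiorJumpSq 𝒯 w + periodicJumpSq a b 𝒯 w)
    + ENNReal.ofReal (1 / penalty γ 𝒯) * (interiorMeanGradSq 𝒯 w + periodicMeanGradSq a b 𝒯 w)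

/-- The energy norm `|||w|||`. -/
def energyNorm (a b c d α β γ : ℝ) (𝒯 : Finset Tri) (w : Plane → ℝ) : ℝ≥0∞ :=
  (bulkSq a b γ 𝒯 w
    + ENNReal.ofReal α * (sideL2Sq 𝒯 c w + sideL2Sq 𝒯 d w)
    + ENNReal.ofReal β * (sideH1Sq 𝒯 c w + sideH1Sq 𝒯 d w)
    + ENNReal.ofReal (β * penalty γ 𝒯) * (ridgeJumpSq a b 𝒯 c w + ridgeJumpSq a b 𝒯 d w)
    + ENNReal.ofReal (β / penalty γ 𝒯) *
        (ridgeMeanGradSq a b 𝒯 c w + ridgeMeanGradSq a b 𝒯 d w)) ^ (1 / 2 : ℝ)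

end DGDyn

end

namespace DGDyn

/-! ### Squared `L²` norms -/

/-! Write `h` for the mesh size, `m = min (s - 1) p`, `n = m + 1 = min s (p + 1)`, and `w` for the
interpolation error. The squared energy norm splits into terms on the elements and terms on the
horizontal sides, and each is bounded by a constant times `h ^ (2 * m)` and the matching part of the
squared norm of `v`.

On an element the estimate is of Bramble–Hilbert type: `h ^ (2 * k) * |w|² ≤ C * h ^ (2 * n) *
|v|²`, with seminorms of order `k ≤ 2` on the left and `n` on the right (`wSemi_sub_polyFun_le`).
Let `P` be the polynomial of degree below `n` for which all derivatives of `v - P` of order below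
`n` have mean zero. Iterating the Poincaré inequality on the convex element bounds `v - P`. The
Sobolev inequality bounds its values at the nodes, and these control `P - I v` through the Lagrange
basis (`polyBound_of_nodes`). The scaled trace inequality `trace_tri` then carries the bounds on `w`
and on its gradient to the boundary of the element. Jumps and means, periodic ones included, are
estimated by the two one-sided traces separately. The mesh may have hanging nodes; all that is
needed is that boundedly many elements meet at a point, which an area comparison gives
(`IsMesh.card_le`).

On a horizontal side the trace of `v` is an `H^s` function of one variable, so its derivatives below
order `s` have continuous representatives that are primitives of one another. On an edge the
interpolant depends only on the nodes of that edge. Comparison with the Taylor polynomial at the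
left end point bounds the derivative error pointwise by `h ^ (n - 2)` times the `L¹` norm of the
`n`-th derivative (`IsEdge.abs_deriv_sub_le`). End points of edges are Lagrange nodes and `v` is
continuous, so `w` vanishes there: the ridge jumps are zero, and the error on the edge is the
integral of its derivative.

Constants depend on the element only through `ρ` and `h`. No reference element is used: the trace
and Sobolev inequalities come from integrating a one-dimensional inequality over parallelograms
inside the element. Everything is proved for smooth functions and passed to the limit by density on
bounded convex open sets (`exists_smooth_approx`). The same limits identify the abstractly chosen
traces with values of continuous representatives. -/

theorem enorm_sq_eq_ofReal (x : ℝ) : ‖x‖ₑ ^ 2 = ENNReal.ofReal (x ^ 2) := by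
  rw [Real.enorm_eq_ofReal_abs, ← ENNReal.ofReal_pow (abs_nonneg x), sq_abs]

theorem ennreal_add_sq_le (x y : ℝ≥0∞) : (x + y) ^ 2 ≤ 2 * x ^ 2 + 2 * y ^ 2 := by
  rcases eq_or_ne x ⊤ with rfl | hx
  · simp
  rcases eq_or_ne y ⊤ with rfl | hy
  · simp
  lift x to NNReal using hx
  lift y to NNReal using hy
  norm_cast
  rw [← NNReal.coe_le_coe]
  push_cast
  nlinarith [sq_nonneg ((x : ℝ) - y)]

theorem enorm_add_sq_le (x y : ℝ) : ‖x + y‖ₑ ^ 2 ≤ 2 * ‖x‖ₑ ^ 2 + 2 * ‖y‖ₑ ^ 2 :=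
  (pow_le_pow_left₀ (by positivity) (enorm_add_le x y) 2).trans (ennreal_add_sq_le _ _)

theorem enorm_sub_sq_le (x y : ℝ) : ‖x - y‖ₑ ^ 2 ≤ 2 * ‖x‖ₑ ^ 2 + 2 * ‖y‖ₑ ^ 2 := by
  simpa [sub_eq_add_neg] using enorm_add_sq_le x (-y)

section l2sq

variable {X : Type*} [MeasurableSpace X] {μ ν : Measure X} {f g : X → ℝ}

theorem l2sq_congr_ae (h : f =ᵐ[μ] g) : l2sq μ f = l2sq μ g :=
  lintegral_congr_ae (h.mono fun x hx => by simp only [hx])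

theorem l2sq_mono_measure (h : μ ≤ ν) : l2sq μ f ≤ l2sq ν f := lintegral_mono' h le_rfl

theorem aemeasurable_enorm_sq (hf : AEStronglyMeasurable f μ) :
    AEMeasurable (fun x => ‖f x‖ₑ ^ 2) μ := hf.enorm.pow_const 2

/-- Additivity of the lower integral needs only one measurable summand, so `g` stays arbitrary. -/
theorem l2sq_add_le (hf : AEStronglyMeasurable f μ) :
    l2sq μ (fun x => f x + g x) ≤ 2 * l2sq μ f + 2 * l2sq μ g := by
  unfold l2sq
  rw [← lintegral_const_mul' _ _ (by simp), ← lintegral_const_mul' _ _ (by simp),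
    ← lintegral_add_left' ((aemeasurable_enorm_sq hf).const_mul _)]
  exact lintegral_mono fun x => enorm_add_sq_le _ _

theorem l2sq_neg : l2sq μ (fun x => - f x) = l2sq μ f := by simp [l2sq]

theorem l2sq_sub_le (hf : AEStronglyMeasurable f μ) :
    l2sq μ (fun x => f x - g x) ≤ 2 * l2sq μ f + 2 * l2sq μ g := by
  simpa only [sub_eq_add_neg, l2sq_neg] using l2sq_add_le (g := fun x => - g x) hf

theorem l2sq_const_mul (c : ℝ) : l2sq μ (fun x => c * f x) = ‖c‖ₑ ^ 2 * l2sq μ f := by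
  simp only [l2sq, enorm_mul, mul_pow]
  exact lintegral_const_mul' _ _ (by finiteness)

theorem l2sq_sub_comm : l2sq μ (fun x => f x - g x) = l2sq μ (fun x => g x - f x) := by
  rw [← l2sq_neg]; simp

theorem l2sq_eq_zero_iff (hf : AEStronglyMeasurable f μ) : l2sq μ f = 0 ↔ f =ᵐ[μ] 0 := by
  rw [l2sq, lintegral_eq_zero_iff' (aemeasurable_enorm_sq hf)]
  exact Filter.eventually_congr (.of_forall fun x => by simp)

theorem l2sq_eq_eLpNorm : l2sq μ f = eLpNorm f 2 μ ^ 2 := by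
  rw [eLpNorm_eq_lintegral_rpow_enorm_toReal (by simp) (by simp), l2sq, ← ENNReal.rpow_natCast,
    ← ENNReal.rpow_mul]
  simp

theorem l2sq_lt_top (hf : MemLp f 2 μ) : l2sq μ f < ⊤ := by
  rw [l2sq_eq_eLpNorm]; exact ENNReal.pow_lt_top hf.2

theorem memLp_of_l2sq_lt_top (hf : AEStronglyMeasurable f μ) (h : l2sq μ f < ⊤) :
    MemLp f 2 μ := by
  refine ⟨hf, ?_⟩
  rw [l2sq_eq_eLpNorm] at h
  simpa using h

theorem l2sq_le_of_bound {s : Set X} (hs : MeasurableSet s) {M : ℝ≥0∞}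
    (h : ∀ x ∈ s, ‖f x‖ₑ ≤ M) : l2sq (μ.restrict s) f ≤ M ^ 2 * μ s := by
  calc l2sq (μ.restrict s) f ≤ ∫⁻ x in s, M ^ 2 ∂μ :=
        setLIntegral_mono' hs fun x hx => pow_le_pow_left₀ (by positivity) (h x hx) 2
    _ = M ^ 2 * μ s := by simp

/-- Cauchy–Schwarz against the constant function. -/
theorem lintegral_sq_le {f : X → ℝ≥0∞} (hf : AEMeasurable f μ) :
    (∫⁻ x, f x ∂μ) ^ 2 ≤ μ Set.univ * ∫⁻ x, f x ^ 2 ∂μ := by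
  have h := ENNReal.lintegral_mul_le_Lp_mul_Lq μ (Real.HolderConjugate.two_two) hf
    (aemeasurable_const (b := (1 : ℝ≥0∞)))
  simp only [Pi.mul_apply, mul_one, ENNReal.one_rpow, lintegral_const, one_mul] at h
  calc (∫⁻ x, f x ∂μ) ^ 2
      ≤ ((∫⁻ x, f x ^ (2 : ℝ) ∂μ) ^ (1 / (2 : ℝ)) * μ Set.univ ^ (1 / (2 : ℝ))) ^ 2 := by
        gcongr
    _ = _ := by
        rw [mul_pow, ← ENNReal.rpow_natCast, ← ENNReal.rpow_natCast, ← ENNReal.rpow_mul,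
          ← ENNReal.rpow_mul]
        simp [mul_comm]

theorem l2sq_triangle (hf : AEStronglyMeasurable f μ) (hg : AEStronglyMeasurable g μ) (h : X → ℝ) :
    l2sq μ (fun x => f x - h x) ≤
      2 * l2sq μ (fun x => f x - g x) + 2 * l2sq μ (fun x => g x - h x) := by
  have := l2sq_add_le (g := fun x => g x - h x) (hf.sub hg)
  simpa [l2sq] using this

/-- `L²` limits are unique. -/
theorem ae_eq_of_tendsto_l2sq {φ : ℕ → X → ℝ} (hφ : ∀ n, AEStronglyMeasurable (φ n) μ)
    (hf : AEStronglyMeasurable f μ) (hg : AEStronglyMeasurable g μ)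
    (h1 : Tendsto (fun n => l2sq μ (fun x => φ n x - f x)) atTop (𝓝 0))
    (h2 : Tendsto (fun n => l2sq μ (fun x => φ n x - g x)) atTop (𝓝 0)) : f =ᵐ[μ] g := by
  have h0 : l2sq μ (fun x => f x - g x) = 0 := by
    refine le_antisymm (ge_of_tendsto' (f := fun n => 2 * l2sq μ (fun x => φ n x - f x) +
      2 * l2sq μ (fun x => φ n x - g x)) (x := atTop) ?_ fun n => ?_) bot_le
    · simpa using (ENNReal.Tendsto.const_mul h1 (.inr (by simp))).add
        (ENNReal.Tendsto.const_mul h2 (.inr (by simp)))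
    · rw [l2sq_sub_comm (f := φ n)]
      exact l2sq_triangle hf (hφ n) g
  filter_upwards [(l2sq_eq_zero_iff (hf.sub hg)).1 h0] with x hx
  simpa [sub_eq_zero] using hx

/-- If `φ n → f` in `L²` then the squared norm of `f` is at most `2` times any eventual bound. -/
theorem l2sq_le_of_tendsto {φ : ℕ → X → ℝ} (hφ : ∀ n, AEStronglyMeasurable (φ n) μ)
    (h1 : Tendsto (fun n => l2sq μ (fun x => φ n x - f x)) atTop (𝓝 0)) {B : ℕ → ℝ≥0∞} {b : ℝ≥0∞}
    (hB : Tendsto B atTop (𝓝 b))  (h2 : ∀ n, l2sq μ (φ n) ≤ B n) :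
    l2sq μ f ≤ 2 * b := by
  refine ge_of_tendsto' (f := fun n => 2 * B n + 2 * l2sq μ (fun x => φ n x - f x))
    (x := atTop) ?_ fun n => ?_
  · simpa using (ENNReal.Tendsto.const_mul hB (.inr (by simp))).add
        (ENNReal.Tendsto.const_mul h1 (.inr (by simp)))
  -- Since `f = φ n - (φ n - f)`, measurability of `φ n` suffices.
  · have := l2sq_sub_le (f := φ n) (g := fun x => φ n x - f x) (hφ n)
    simp only [sub_sub_cancel] at this
    exact this.trans (by gcongr; exact h2 n)

end l2sq

/-! ### One-dimensional estimates -/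

theorem enorm_sub_le_lintegral {F F' : ℝ → ℝ} (hF : ∀ x, HasDerivAt F (F' x) x)
    (hF' : Continuous F') {x y : ℝ} (hxy : x ≤ y) :
    ‖F y - F x‖ₑ ≤ ∫⁻ t in Set.Ioc x y, ‖F' t‖ₑ := by
  rw [← intervalIntegral.integral_eq_sub_of_hasDerivAt (fun t _ => hF t)
    (hF'.intervalIntegrable _ _), intervalIntegral.integral_of_le hxy]
  exact enorm_integral_le_lintegral_enorm _

/-- Average `|F 0|² ≤ 2 |F s|² + 2 |F s - F 0|²` over `s` in the unit interval; the increment is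
bounded by Cauchy–Schwarz. The planar trace and Sobolev inequalities are integrated forms of this
one. -/
theorem enorm_sq_zero_le {F F' : ℝ → ℝ} (hF : ∀ x, HasDerivAt F (F' x) x) (hF' : Continuous F') :
    ‖F 0‖ₑ ^ 2 ≤ 2 * (∫⁻ t in Set.Ioo (0 : ℝ) 1, ‖F t‖ₑ ^ 2) +
      2 * ∫⁻ t in Set.Ioo (0 : ℝ) 1, ‖F' t‖ₑ ^ 2 := by
  set D := ∫⁻ t in Set.Ioo (0 : ℝ) 1, ‖F' t‖ₑ ^ 2 with hD
  have hFc : Continuous F := continuous_iff_continuousAt.2 fun x => (hF x).continuousAt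
  have key : ∀ s ∈ Set.Ioo (0 : ℝ) 1, ‖F 0‖ₑ ^ 2 ≤ 2 * ‖F s‖ₑ ^ 2 + 2 * D := by
    intro s hs
    have h1 : ‖F s - F 0‖ₑ ^ 2 ≤ D := by
      calc ‖F s - F 0‖ₑ ^ 2 ≤ (∫⁻ t in Set.Ioc 0 s, ‖F' t‖ₑ) ^ 2 := by
            gcongr; exact enorm_sub_le_lintegral hF hF' hs.1.le
        _ ≤ (∫⁻ t in Set.Ioo (0 : ℝ) 1, ‖F' t‖ₑ) ^ 2 := by
            gcongr
            exact hs.2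
        _ ≤ (volume.restrict (Set.Ioo (0 : ℝ) 1)) Set.univ * D :=
            lintegral_sq_le hF'.enorm.measurable.aemeasurable
        _ = D := by simp
    have := enorm_sub_sq_le (F s) (F s - F 0)
    rw [sub_sub_cancel] at this
    exact this.trans (by gcongr)
  calc ‖F 0‖ₑ ^ 2 = ∫⁻ s in Set.Ioo (0 : ℝ) 1, ‖F 0‖ₑ ^ 2 := by simp
    _ ≤ ∫⁻ s in Set.Ioo (0 : ℝ) 1, (2 * ‖F s‖ₑ ^ 2 + 2 * D) :=
        setLIntegral_mono' measurableSet_Ioo key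
    _ = _ := by
        rw [lintegral_add_right _ measurable_const, lintegral_const_mul' _ _ (by simp)]
        simp


/-! ### Calculus of smooth functions on the plane -/

@[simp] theorem pt_zero (x y : ℝ) : pt x y 0 = x := rfl

@[simp] theorem pt_one (x y : ℝ) : pt x y 1 = y := rfl

theorem pt_self (x : Plane) : pt (x 0) (x 1) = x := by
  ext i; fin_cases i <;> rfl

theorem plane_eq_sum (v : Plane) :
    v = v 0 • EuclideanSpace.single (0 : Fin 2) (1 : ℝ) + v 1 • EuclideanSpace.single 1 1 := by
  ext i; fin_cases i <;> simp

theorem contDiff_pderiv {f : Plane → ℝ} (hf : ContDiff ℝ ∞ f) (i : Fin 2) :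
    ContDiff ℝ ∞ (pderiv i f) :=
  (hf.fderiv_right (m := ∞) (by simp)).clm_apply contDiff_const

theorem contDiff_iterate_pderiv {f : Plane → ℝ} (hf : ContDiff ℝ ∞ f) (i : Fin 2) (n : ℕ) :
    ContDiff ℝ ∞ ((pderiv i)^[n] f) := by
  induction n with
  | zero => exact hf
  | succ n ih => rw [Function.iterate_succ_apply']; exact contDiff_pderiv ih i

theorem contDiff_mderiv {f : Plane → ℝ} (hf : ContDiff ℝ ∞ f) (α : ℕ × ℕ) :
    ContDiff ℝ ∞ (mderiv α f) :=
  contDiff_iterate_pderiv (contDiff_iterate_pderiv hf 1 _) 0 _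

theorem fderiv_apply_eq (f : Plane → ℝ) (x v : Plane) :
    fderiv ℝ f x v = v 0 * pderiv 0 f x + v 1 * pderiv 1 f x := by
  conv_lhs => rw [plane_eq_sum v]
  simp [pderiv]

theorem pderiv_comm {f : Plane → ℝ} (hf : ContDiff ℝ ∞ f) (i j : Fin 2) :
    pderiv i (pderiv j f) = pderiv j (pderiv i f) := by
  ext x
  have h2 : ContDiff ℝ 2 f := contDiff_infty.1 hf 2
  have hd : Differentiable ℝ (fderiv ℝ f) :=
    (hf.fderiv_right (m := ∞) (by simp)).differentiable (by simp)
  have hs : IsSymmSndFDerivAt ℝ f x := h2.contDiffAt.isSymmSndFDerivAt (by simp)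
  have key : ∀ k l : Fin 2, pderiv k (pderiv l f) x =
      fderiv ℝ (fderiv ℝ f) x (EuclideanSpace.single k 1) (EuclideanSpace.single l 1) := by
    intro k l
    have h := (hd x).hasFDerivAt.clm_apply
      (hasFDerivAt_const (EuclideanSpace.single l (1 : ℝ)) x)
    unfold pderiv
    rw [h.fderiv]
    simp
  rw [key, key, hs.eq]

theorem pderiv_iterate_comm {f : Plane → ℝ} (hf : ContDiff ℝ ∞ f) (i j : Fin 2) (n : ℕ) :
    pderiv i ((pderiv j)^[n] f) = (pderiv j)^[n] (pderiv i f) := by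
  induction n with
  | zero => rfl
  | succ n ih =>
    rw [Function.iterate_succ_apply', Function.iterate_succ_apply', ← ih,
      pderiv_comm (contDiff_iterate_pderiv hf j n)]

/-- The multi-index of the `i`-th partial derivative. -/
def unitIdx (i : Fin 2) : ℕ × ℕ := if i = 0 then (1, 0) else (0, 1)

@[simp] theorem unitIdx_zero : unitIdx 0 = (1, 0) := rfl

@[simp] theorem unitIdx_one : unitIdx 1 = (0, 1) := rfl

theorem mderiv_unitIdx (i : Fin 2) (f : Plane → ℝ) : mderiv (unitIdx i) f = pderiv i f := by
  fin_cases i <;> rfl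

@[simp] theorem mderiv_zero (f : Plane → ℝ) : mderiv (0, 0) f = f := rfl

theorem mderiv_pderiv {f : Plane → ℝ} (hf : ContDiff ℝ ∞ f) (α : ℕ × ℕ) (i : Fin 2) :
    mderiv α (pderiv i f) = mderiv (α + unitIdx i) f := by
  unfold mderiv
  fin_cases i
  · simp only [Fin.zero_eta, unitIdx_zero, Prod.fst_add, Prod.snd_add, add_zero,
      Function.iterate_succ_apply]
    rw [pderiv_iterate_comm hf]
  · simp only [Fin.mk_one, unitIdx_one, Prod.fst_add, Prod.snd_add, add_zero,
      Function.iterate_succ_apply]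

theorem pderiv_mderiv {f : Plane → ℝ} (hf : ContDiff ℝ ∞ f) (α : ℕ × ℕ) (i : Fin 2) :
    pderiv i (mderiv α f) = mderiv (α + unitIdx i) f := by
  unfold mderiv
  fin_cases i
  · simp only [Fin.zero_eta, unitIdx_zero, Prod.fst_add, Prod.snd_add, add_zero,
      Function.iterate_succ_apply']
  · simp only [Fin.mk_one, unitIdx_one, Prod.fst_add, Prod.snd_add, add_zero,
      Function.iterate_succ_apply']
    rw [pderiv_iterate_comm (contDiff_iterate_pderiv hf 1 _)]

theorem mderiv_mderiv {f : Plane → ℝ} (hf : ContDiff ℝ ∞ f) (α β : ℕ × ℕ) :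
    mderiv α (mderiv β f) = mderiv (α + β) f := by
  obtain ⟨a, b⟩ := α
  obtain ⟨c, d⟩ := β
  have h1 : ∀ (n : ℕ) (g : Plane → ℝ), ContDiff ℝ ∞ g → ∀ k,
      (pderiv 1)^[n] ((pderiv 0)^[k] g) = (pderiv 0)^[k] ((pderiv 1)^[n] g) := by
    intro n g hg k
    induction n with
    | zero => rfl
    | succ n ih =>
      rw [Function.iterate_succ_apply', ih, pderiv_iterate_comm (contDiff_iterate_pderiv hg 1 n),
        Function.iterate_succ_apply']
  simp only [mderiv, Prod.mk_add_mk]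
  rw [h1 _ _ (contDiff_iterate_pderiv hf 1 d), ← Function.iterate_add_apply,
    ← Function.iterate_add_apply]

theorem contDiff_const_smul' {f : Plane → ℝ} (hf : ContDiff ℝ ∞ f) (c : ℝ) :
    ContDiff ℝ ∞ (c • f) := contDiff_const.smul hf

theorem pderiv_add {f g : Plane → ℝ} (hf : ContDiff ℝ ∞ f) (hg : ContDiff ℝ ∞ g) (i : Fin 2) :
    pderiv i (f + g) = pderiv i f + pderiv i g := by
  ext x
  simp only [pderiv, Pi.add_apply]
  rw [fderiv_add (hf.differentiable (by simp) x) (hg.differentiable (by simp) x)]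
  simp

theorem pderiv_const_smul {f : Plane → ℝ} (hf : ContDiff ℝ ∞ f) (c : ℝ) (i : Fin 2) :
    pderiv i (c • f) = c • pderiv i f := by
  ext x
  simp only [pderiv, Pi.smul_apply]
  rw [fderiv_const_smul (hf.differentiable (by simp) x)]
  simp

theorem iterate_pderiv_add {f g : Plane → ℝ} (hf : ContDiff ℝ ∞ f) (hg : ContDiff ℝ ∞ g)
    (i : Fin 2) (n : ℕ) :
    (pderiv i)^[n] (f + g) = (pderiv i)^[n] f + (pderiv i)^[n] g := by
  induction n with
  | zero => rfl
  | succ n ih =>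
    simp only [Function.iterate_succ_apply', ih]
    exact pderiv_add (contDiff_iterate_pderiv hf i n) (contDiff_iterate_pderiv hg i n) i

theorem iterate_pderiv_const_smul {f : Plane → ℝ} (hf : ContDiff ℝ ∞ f) (c : ℝ)
    (i : Fin 2) (n : ℕ) :
    (pderiv i)^[n] (c • f) = c • (pderiv i)^[n] f := by
  induction n with
  | zero => rfl
  | succ n ih =>
    simp only [Function.iterate_succ_apply', ih]
    exact pderiv_const_smul (contDiff_iterate_pderiv hf i n) c i

theorem mderiv_add {f g : Plane → ℝ} (hf : ContDiff ℝ ∞ f) (hg : ContDiff ℝ ∞ g) (α : ℕ × ℕ) :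
    mderiv α (f + g) = mderiv α f + mderiv α g := by
  unfold mderiv
  rw [iterate_pderiv_add hf hg, iterate_pderiv_add (contDiff_iterate_pderiv hf 1 _)
    (contDiff_iterate_pderiv hg 1 _)]

theorem mderiv_const_smul {f : Plane → ℝ} (hf : ContDiff ℝ ∞ f) (c : ℝ) (α : ℕ × ℕ) :
    mderiv α (c • f) = c • mderiv α f := by
  unfold mderiv
  rw [iterate_pderiv_const_smul hf, iterate_pderiv_const_smul (contDiff_iterate_pderiv hf 1 _)]

theorem mderiv_sub {f g : Plane → ℝ} (hf : ContDiff ℝ ∞ f) (hg : ContDiff ℝ ∞ g) (α : ℕ × ℕ) :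
    mderiv α (f - g) = mderiv α f - mderiv α g := by
  have h : f - g = f + (-1 : ℝ) • g := by ext; simp [sub_eq_add_neg]
  rw [h, mderiv_add hf (contDiff_const_smul' hg _), mderiv_const_smul hg]
  ext; simp [sub_eq_add_neg]

/-- Derivatives of a function composed with `x ↦ w + μ x`. -/
theorem pderiv_comp_homothety {f : Plane → ℝ} (hf : ContDiff ℝ ∞ f) (w : Plane) (μ : ℝ)
    (i : Fin 2) :
    pderiv i (fun x => f (w + μ • x)) = μ • fun x => pderiv i f (w + μ • x) := by
  ext x
  have h1 : HasFDerivAt (fun x : Plane => w + μ • x) (μ • ContinuousLinearMap.id ℝ Plane) x :=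
    ((hasFDerivAt_id x).const_smul μ).const_add w
  have h2 := ((hf.differentiable (by simp) (w + μ • x)).hasFDerivAt).comp x h1
  have h3 := h2.fderiv
  simp only [Function.comp_def] at h3
  simp only [pderiv, h3]
  simp

theorem contDiff_comp_homothety {f : Plane → ℝ} (hf : ContDiff ℝ ∞ f) (w : Plane) (μ : ℝ) :
    ContDiff ℝ ∞ (fun x => f (w + μ • x)) :=
  hf.comp (contDiff_const.add (contDiff_id.const_smul μ))

theorem iterate_pderiv_comp_homothety {f : Plane → ℝ} (hf : ContDiff ℝ ∞ f) (w : Plane) (μ : ℝ)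
    (i : Fin 2) (n : ℕ) :
    (pderiv i)^[n] (fun x => f (w + μ • x)) = μ ^ n • fun x => (pderiv i)^[n] f (w + μ • x) := by
  induction n with
  | zero => simp
  | succ n ih =>
    have h := contDiff_iterate_pderiv hf i n
    rw [Function.iterate_succ_apply', ih, pderiv_const_smul (contDiff_comp_homothety h w μ),
      pderiv_comp_homothety h, smul_smul, pow_succ]
    simp only [Function.iterate_succ_apply']

theorem mderiv_comp_homothety {f : Plane → ℝ} (hf : ContDiff ℝ ∞ f) (w : Plane) (μ : ℝ)
    (α : ℕ × ℕ) :
    mderiv α (fun x => f (w + μ • x)) = μ ^ (α.1 + α.2) • fun x => mderiv α f (w + μ • x) := by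
  have h := contDiff_iterate_pderiv hf 1 α.2
  unfold mderiv
  rw [iterate_pderiv_comp_homothety hf, iterate_pderiv_const_smul (contDiff_comp_homothety h w μ),
    iterate_pderiv_comp_homothety h, smul_smul, ← pow_add, add_comm]

theorem hasCompactSupport_pderiv {f : Plane → ℝ} (hf : HasCompactSupport f) (i : Fin 2) :
    HasCompactSupport (pderiv i f) :=
  hf.fderiv_apply ℝ _

theorem tsupport_pderiv_subset (f : Plane → ℝ) (i : Fin 2) :
    tsupport (pderiv i f) ⊆ tsupport f :=
  tsupport_fderiv_apply_subset ℝ _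

theorem hasCompactSupport_mderiv {f : Plane → ℝ} (hf : HasCompactSupport f) (α : ℕ × ℕ) :
    HasCompactSupport (mderiv α f) := by
  have h : ∀ (i : Fin 2) (n : ℕ) (g : Plane → ℝ), HasCompactSupport g →
      HasCompactSupport ((pderiv i)^[n] g) := by
    intro i n g hg
    induction n with
    | zero => exact hg
    | succ n ih => rw [Function.iterate_succ_apply']; exact hasCompactSupport_pderiv ih i
  exact h 0 _ _ (h 1 _ _ hf)

theorem tsupport_mderiv_subset (f : Plane → ℝ) (α : ℕ × ℕ) :
    tsupport (mderiv α f) ⊆ tsupport f := by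
  have h : ∀ (i : Fin 2) (n : ℕ) (g : Plane → ℝ), tsupport ((pderiv i)^[n] g) ⊆ tsupport g := by
    intro i n g
    induction n with
    | zero => exact subset_rfl
    | succ n ih =>
      rw [Function.iterate_succ_apply']; exact (tsupport_pderiv_subset _ i).trans ih
  exact (h 0 _ _).trans (h 1 _ _)

/-! ### Polynomials as smooth functions -/

/-- The polynomial function of a bivariate polynomial. -/
noncomputable def polyFun (q : MvPolynomial (Fin 2) ℝ) : Plane → ℝ := fun x => MvPolynomial.eval (fun j => x j) q

theorem polyFun_add (q r : MvPolynomial (Fin 2) ℝ) : polyFun (q + r) = polyFun q + polyFun r := by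
  ext x; simp [polyFun]

theorem polyFun_sub (q r : MvPolynomial (Fin 2) ℝ) : polyFun (q - r) = polyFun q - polyFun r := by
  ext x; simp [polyFun]

theorem hasFDerivAt_polyFun (q : MvPolynomial (Fin 2) ℝ) (x : Plane) :
    HasFDerivAt (polyFun q) (∑ i, polyFun (MvPolynomial.pderiv i q) x •
      (EuclideanSpace.proj i : Plane →L[ℝ] ℝ)) x := by
  induction q using MvPolynomial.induction_on with
  | C a =>
    have : polyFun (MvPolynomial.C a) = fun _ => a := by ext; simp [polyFun]
    rw [this]
    simpa [polyFun] using hasFDerivAt_const a x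
  | add p q hp hq =>
    rw [polyFun_add]
    refine (hp.add hq).congr_fderiv ?_
    simp only [map_add, polyFun_add, Pi.add_apply, add_smul, Finset.sum_add_distrib]
  | mul_X p n hp =>
    have h1 : polyFun (p * MvPolynomial.X n) = fun x => polyFun p x * x n := by
      ext; simp [polyFun]
    rw [h1]
    have h2 : HasFDerivAt (fun x : Plane => x n) (EuclideanSpace.proj n : Plane →L[ℝ] ℝ) x :=
      (EuclideanSpace.proj n : Plane →L[ℝ] ℝ).hasFDerivAt
    refine (hp.mul h2).congr_fderiv ?_
    ext v
    fin_cases n <;>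
    simp [polyFun, MvPolynomial.pderiv_X, Pi.single_apply] <;> ring

theorem contDiff_polyFun (q : MvPolynomial (Fin 2) ℝ) : ContDiff ℝ ∞ (polyFun q) := by
  induction q using MvPolynomial.induction_on with
  | C a =>
    have : polyFun (MvPolynomial.C a) = fun _ => a := by ext; simp [polyFun]
    rw [this]
    exact contDiff_const
  | add p q hp hq => rw [polyFun_add]; exact hp.add hq
  | mul_X p n hp =>
    have h1 : polyFun (p * MvPolynomial.X n) = fun x => polyFun p x * x n := by
      ext; simp [polyFun]
    rw [h1]
    exact hp.mul (EuclideanSpace.proj n : Plane →L[ℝ] ℝ).contDiff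

theorem pderiv_polyFun (q : MvPolynomial (Fin 2) ℝ) (i : Fin 2) :
    pderiv i (polyFun q) = polyFun (MvPolynomial.pderiv i q) := by
  ext x
  rw [pderiv, (hasFDerivAt_polyFun q x).fderiv]
  fin_cases i <;> simp

theorem iterate_pderiv_polyFun (q : MvPolynomial (Fin 2) ℝ) (i : Fin 2) (n : ℕ) :
    (pderiv i)^[n] (polyFun q) = polyFun ((MvPolynomial.pderiv i)^[n] q) := by
  induction n with
  | zero => rfl
  | succ n ih => simp only [Function.iterate_succ_apply', ih, pderiv_polyFun]

theorem mderiv_polyFun (q : MvPolynomial (Fin 2) ℝ) (α : ℕ × ℕ) :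
    mderiv α (polyFun q) =
      polyFun ((MvPolynomial.pderiv 0)^[α.1] ((MvPolynomial.pderiv 1)^[α.2] q)) := by
  rw [mderiv, iterate_pderiv_polyFun, iterate_pderiv_polyFun]

/-! ### Parallelograms -/

/-- The determinant of two plane vectors. -/
noncomputable def det2 (u v : Plane) : ℝ := u 0 * v 1 - u 1 * v 0

theorem lintegral_pt (f : Plane → ℝ≥0∞) (hf : Measurable f) :
    ∫⁻ x, f x = ∫⁻ s, ∫⁻ t, f (pt s t) := by
  have h1 := (EuclideanSpace.volume_preserving_symm_measurableEquiv_toLp (Fin 2)).symm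
  have h2 := (volume_preserving_finTwoArrow ℝ).symm
  rw [← h1.lintegral_comp hf, ← h2.lintegral_comp (by fun_prop), Measure.volume_eq_prod,
    lintegral_prod _ (by fun_prop)]
  rfl

/-- The affine map `z ↦ A + z₀ u + z₁ v`. -/
noncomputable def parMap (A u v : Plane) (s t : ℝ) : Plane := A + s • u + t • v

/-- Change of variables for the linear map with columns `u` and `v`, followed by a translation. -/
theorem lintegral_parMap (A u v : Plane) (f : Plane → ℝ≥0∞) (hf : Measurable f)
    (h : det2 u v ≠ 0) :
    ENNReal.ofReal |det2 u v| * ∫⁻ s, ∫⁻ t, f (parMap A u v s t) = ∫⁻ x, f x := by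
  let M : Matrix (Fin 2) (Fin 2) ℝ := !![u 0, v 0; u 1, v 1]
  let L : Plane →ₗ[ℝ] Plane := Matrix.toEuclideanLin M
  have hdet : LinearMap.det L = det2 u v := by
    have : LinearMap.det L = M.det := by
      simp only [L]
      rw [Matrix.toEuclideanLin, Matrix.toLpLin_eq_toLin, LinearMap.det_toLin]
    rw [this, Matrix.det_fin_two_of, det2]; ring
  have hL : ∀ s t, L (pt s t) = s • u + t • v := by
    intro s t
    ext i
    fin_cases i <;>
    simp [L, M, Matrix.toEuclideanLin, Matrix.toLpLin, pt]
  have hm := Measure.map_linearMap_addHaar_eq_smul_addHaar (volume : Measure Plane)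
    (f := L) (by rw [hdet]; exact h)
  have hLm : Measurable L := (LinearMap.continuous_of_finiteDimensional L).measurable
  calc ENNReal.ofReal |det2 u v| * ∫⁻ s, ∫⁻ t, f (parMap A u v s t)
      = ENNReal.ofReal |det2 u v| * ∫⁻ z, f (A + L z) := by
        rw [lintegral_pt _ (by fun_prop)]
        simp only [hL, parMap, add_assoc]
    _ = ENNReal.ofReal |det2 u v| * ∫⁻ z, f (A + z) ∂(Measure.map L volume) := by
        rw [lintegral_map (by fun_prop) hLm]
    _ = ∫⁻ z, f (A + z) := by
        rw [hm, lintegral_smul_measure, hdet, smul_eq_mul, ← mul_assoc,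
          ← ENNReal.ofReal_mul (abs_nonneg _), abs_inv, mul_inv_cancel₀ (abs_ne_zero.2 h)]
        simp
    _ = ∫⁻ x, f x := lintegral_add_left_eq_self f A

/-- Integrals over a parallelogram contained in `D`. -/
theorem setLIntegral_parMap_le {A u v : Plane} {I J : Set ℝ} (hI : MeasurableSet I)
    (hJ : MeasurableSet J) {D : Set Plane} (hD : MeasurableSet D)
    (hsub : ∀ s ∈ I, ∀ t ∈ J, parMap A u v s t ∈ D) {f : Plane → ℝ≥0∞} (hf : Measurable f)
    (h : det2 u v ≠ 0) :
    ENNReal.ofReal |det2 u v| * ∫⁻ s in I, ∫⁻ t in J, f (parMap A u v s t) ≤ ∫⁻ x in D, f x := by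
  rw [← lintegral_indicator hD, ← lintegral_parMap A u v _ (hf.indicator hD) h,
    ← lintegral_indicator hI]
  refine mul_le_mul_right (lintegral_mono fun s => ?_) _
  by_cases hs : s ∈ I
  · rw [Set.indicator_of_mem hs, ← lintegral_indicator hJ]
    refine lintegral_mono fun t => ?_
    by_cases ht : t ∈ J
    · rw [Set.indicator_of_mem ht, Set.indicator_of_mem (hsub s hs t ht)]
    · simp [ht]
  · simp [hs]


/-! ### Trace and Sobolev estimates on parallelograms -/

/-- The derivative of `f` in direction `v`. -/
noncomputable def dirDeriv (v : Plane) (f : Plane → ℝ) : Plane → ℝ := v 0 • pderiv 0 f + v 1 • pderiv 1 f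

theorem contDiff_dirDeriv {f : Plane → ℝ} (hf : ContDiff ℝ ∞ f) (v : Plane) :
    ContDiff ℝ ∞ (dirDeriv v f) :=
  (contDiff_const.smul (contDiff_pderiv hf 0)).add (contDiff_const.smul (contDiff_pderiv hf 1))

theorem hasDerivAt_along {f : Plane → ℝ} (hf : ContDiff ℝ ∞ f) (A v : Plane) (t : ℝ) :
    HasDerivAt (fun t : ℝ => f (A + t • v)) (dirDeriv v f (A + t • v)) t := by
  have h1 : HasDerivAt (fun t : ℝ => A + t • v) v t := by
    simpa using ((hasDerivAt_id t).smul_const v).const_add A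
  have h2 := (hf.differentiable (by simp) (A + t • v)).hasFDerivAt.comp_hasDerivAt t h1
  rw [fderiv_apply_eq] at h2
  exact h2

theorem enorm_dirDeriv_sq_le (v : Plane) (f : Plane → ℝ) (x : Plane) :
    ‖dirDeriv v f x‖ₑ ^ 2 ≤ ENNReal.ofReal (‖v‖ ^ 2) * ∑ i, ‖pderiv i f x‖ₑ ^ 2 := by
  simp only [Fin.sum_univ_two, enorm_sq_eq_ofReal]
  rw [← ENNReal.ofReal_add (sq_nonneg _) (sq_nonneg _), ← ENNReal.ofReal_mul (by positivity)]
  apply ENNReal.ofReal_le_ofReal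
  rw [EuclideanSpace.norm_sq_eq, Fin.sum_univ_two, Real.norm_eq_abs, Real.norm_eq_abs, sq_abs,
    sq_abs]
  simp only [dirDeriv, Pi.add_apply, Pi.smul_apply, smul_eq_mul]
  -- By Lagrange's identity this square is the defect in the Cauchy–Schwarz inequality.
  nlinarith [sq_nonneg (v 0 * pderiv 1 f x - v 1 * pderiv 0 f x)]

theorem aestronglyMeasurable_of_contDiff {f : Plane → ℝ} (hf : ContDiff ℝ ∞ f)
    (μ : Measure Plane) : AEStronglyMeasurable f μ :=
  hf.continuous.aestronglyMeasurable

theorem l2sq_dirDeriv_le {f : Plane → ℝ} (hf : ContDiff ℝ ∞ f) (v : Plane) (μ : Measure Plane) :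
    l2sq μ (dirDeriv v f) ≤ ENNReal.ofReal (‖v‖ ^ 2) * ∑ i, l2sq μ (pderiv i f) := by
  unfold l2sq
  rw [← lintegral_finsetSum' _ fun i _ => aemeasurable_enorm_sq
    (aestronglyMeasurable_of_contDiff (contDiff_pderiv hf i) μ),
    ← lintegral_const_mul' _ _ (by simp)]
  exact lintegral_mono fun x => enorm_dirDeriv_sq_le v f x

theorem pderiv_dirDeriv {f : Plane → ℝ} (hf : ContDiff ℝ ∞ f) (v : Plane) (i : Fin 2) :
    pderiv i (dirDeriv v f) = dirDeriv v (pderiv i f) := by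
  unfold dirDeriv
  rw [pderiv_add (contDiff_const_smul' (contDiff_pderiv hf 0) _)
    (contDiff_const_smul' (contDiff_pderiv hf 1) _), pderiv_const_smul (contDiff_pderiv hf 0),
    pderiv_const_smul (contDiff_pderiv hf 1), pderiv_comm hf i 0, pderiv_comm hf i 1]

/-- Trace estimate on a side of a parallelogram contained in `D`. -/
theorem trace_parallelogram_le {A e v : Plane} {I : Set ℝ} (hI : MeasurableSet I)
    {D : Set Plane} (hD : MeasurableSet D)
    (hsub : ∀ t ∈ I, ∀ s ∈ Set.Ioo (0 : ℝ) 1, parMap A e v t s ∈ D) (h : det2 e v ≠ 0)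
    {f : Plane → ℝ} (hf : ContDiff ℝ ∞ f) :
    ENNReal.ofReal |det2 e v| * ∫⁻ t in I, ‖f (A + t • e)‖ₑ ^ 2 ≤
      2 * l2sq (volume.restrict D) f + 2 * l2sq (volume.restrict D) (dirDeriv v f) := by
  have hm1 : Measurable fun x => ‖f x‖ₑ ^ 2 := (hf.continuous.enorm.measurable).pow_const 2
  have hm2 : Measurable fun x => ‖dirDeriv v f x‖ₑ ^ 2 :=
    ((contDiff_dirDeriv hf v).continuous.enorm.measurable).pow_const 2
  have hmp : Measurable fun z : ℝ × ℝ => parMap A e v z.1 z.2 := by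
    unfold parMap; fun_prop
  calc ENNReal.ofReal |det2 e v| * ∫⁻ t in I, ‖f (A + t • e)‖ₑ ^ 2
      ≤ ENNReal.ofReal |det2 e v| * ∫⁻ t in I,
          (2 * (∫⁻ s in Set.Ioo (0 : ℝ) 1, ‖f (parMap A e v t s)‖ₑ ^ 2) +
            2 * ∫⁻ s in Set.Ioo (0 : ℝ) 1, ‖dirDeriv v f (parMap A e v t s)‖ₑ ^ 2) := by
        gcongr with t
        -- The one-dimensional inequality on the segment that leaves the side at parameter `t` in
        -- direction `v`.
        have := enorm_sq_zero_le (fun s => hasDerivAt_along hf (A + t • e) v s)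
          ((contDiff_dirDeriv hf v).continuous.comp (by fun_prop))
        simpa [parMap] using this
    _ = 2 * (ENNReal.ofReal |det2 e v| * ∫⁻ t in I, ∫⁻ s in Set.Ioo (0 : ℝ) 1,
          ‖f (parMap A e v t s)‖ₑ ^ 2) + 2 * (ENNReal.ofReal |det2 e v| *
          ∫⁻ t in I, ∫⁻ s in Set.Ioo (0 : ℝ) 1, ‖dirDeriv v f (parMap A e v t s)‖ₑ ^ 2) := by
        rw [lintegral_add_left, lintegral_const_mul' _ _ (by simp),
          lintegral_const_mul' _ _ (by simp)]
        · ring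
        · exact ((hm1.comp hmp).lintegral_prod_right' (ν := volume.restrict _)).const_mul _
    _ ≤ _ := by
        gcongr
        · exact setLIntegral_parMap_le hI measurableSet_Ioo hD hsub hm1 h
        · exact setLIntegral_parMap_le hI measurableSet_Ioo hD hsub hm2 h

/-- Sobolev estimate at a corner of a parallelogram contained in `D`. -/
theorem sobolev_parallelogram_le {A u v : Plane} {D : Set Plane} (hD : MeasurableSet D)
    (hsub : ∀ s ∈ Set.Ioo (0 : ℝ) 1, ∀ t ∈ Set.Ioo (0 : ℝ) 1, parMap A u v s t ∈ D)
    (h : det2 u v ≠ 0) {f : Plane → ℝ} (hf : ContDiff ℝ ∞ f) {r : ℝ} (hu : ‖u‖ ≤ r)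
    (hv : ‖v‖ ≤ r) :
    ENNReal.ofReal |det2 u v| * ‖f A‖ₑ ^ 2 ≤
      4 * l2sq (volume.restrict D) f +
      8 * ENNReal.ofReal (r ^ 2) * ∑ i, l2sq (volume.restrict D) (pderiv i f) +
      4 * ENNReal.ofReal (r ^ 2) ^ 2 *
        ∑ i, ∑ j, l2sq (volume.restrict D) (pderiv i (pderiv j f)) := by
  -- From the corner to the side along `u`, then from the side to the interior along `v`. The second
  -- step is applied to `f` and to its derivative along `u`, which brings in second derivatives.
  have h1 := enorm_sq_zero_le (fun s => hasDerivAt_along hf A u s)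
    ((contDiff_dirDeriv hf u).continuous.comp (by fun_prop))
  simp only [zero_smul, add_zero] at h1
  have h2 := trace_parallelogram_le measurableSet_Ioo hD hsub h hf
  have h3 := trace_parallelogram_le measurableSet_Ioo hD hsub h (contDiff_dirDeriv hf u)
  set G := ∑ i, l2sq (volume.restrict D) (pderiv i f)
  set G2 := ∑ i, ∑ j, l2sq (volume.restrict D) (pderiv i (pderiv j f))
  have hru : ENNReal.ofReal (‖u‖ ^ 2) ≤ ENNReal.ofReal (r ^ 2) :=
    ENNReal.ofReal_le_ofReal (by gcongr)
  have hrv : ENNReal.ofReal (‖v‖ ^ 2) ≤ ENNReal.ofReal (r ^ 2) :=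
    ENNReal.ofReal_le_ofReal (by gcongr)
  have hdu : l2sq (volume.restrict D) (dirDeriv u f) ≤ ENNReal.ofReal (r ^ 2) * G :=
    (l2sq_dirDeriv_le hf u _).trans (by gcongr)
  have hdv : l2sq (volume.restrict D) (dirDeriv v f) ≤ ENNReal.ofReal (r ^ 2) * G :=
    (l2sq_dirDeriv_le hf v _).trans (by gcongr)
  have hduv : l2sq (volume.restrict D) (dirDeriv v (dirDeriv u f)) ≤
      ENNReal.ofReal (r ^ 2) ^ 2 * G2 := by
    calc _ ≤ ENNReal.ofReal (r ^ 2) * ∑ i, l2sq (volume.restrict D) (pderiv i (dirDeriv u f)) :=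
          (l2sq_dirDeriv_le (contDiff_dirDeriv hf u) v _).trans (by gcongr)
      _ ≤ ENNReal.ofReal (r ^ 2) * ∑ i, (ENNReal.ofReal (r ^ 2) *
            ∑ j, l2sq (volume.restrict D) (pderiv j (pderiv i f))) := by
          gcongr with i
          rw [pderiv_dirDeriv hf]
          exact (l2sq_dirDeriv_le (contDiff_pderiv hf i) u _).trans (by gcongr)
      _ = _ := by
          rw [← Finset.mul_sum, ← mul_assoc, ← sq, Finset.sum_comm]
  calc ENNReal.ofReal |det2 u v| * ‖f A‖ₑ ^ 2
      ≤ ENNReal.ofReal |det2 u v| * (2 * (∫⁻ t in Set.Ioo (0 : ℝ) 1, ‖f (A + t • u)‖ₑ ^ 2) +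
        2 * ∫⁻ t in Set.Ioo (0 : ℝ) 1, ‖dirDeriv u f (A + t • u)‖ₑ ^ 2) := by gcongr
    _ = 2 * (ENNReal.ofReal |det2 u v| * ∫⁻ t in Set.Ioo (0 : ℝ) 1, ‖f (A + t • u)‖ₑ ^ 2) +
        2 * (ENNReal.ofReal |det2 u v| *
          ∫⁻ t in Set.Ioo (0 : ℝ) 1, ‖dirDeriv u f (A + t • u)‖ₑ ^ 2) := by ring
    _ ≤ 2 * (2 * l2sq (volume.restrict D) f + 2 * (ENNReal.ofReal (r ^ 2) * G)) +
        2 * (2 * (ENNReal.ofReal (r ^ 2) * G) + 2 * (ENNReal.ofReal (r ^ 2) ^ 2 * G2)) := by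
        gcongr
        · exact h2.trans (by gcongr)
        · exact h3.trans (by gcongr)
    _ = _ := by ring

/-! ### The Poincaré inequality on convex sets -/

/-- Scaling of integrals under homotheties centred at `x`. -/
theorem setLIntegral_homothety_le {D : Set Plane} (hDm : MeasurableSet D) (hD : Convex ℝ D)
    {x : Plane} (hx : x ∈ D) {t : ℝ} (ht : 1 / 2 ≤ t) (ht1 : t ≤ 1) {g : Plane → ℝ≥0∞}
    (hg : Measurable g) :
    ∫⁻ y in D, g (x + t • (y - x)) ≤ 4 * ∫⁻ y in D, g y := by
  have ht0 : t ≠ 0 := by positivity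
  have h1 : ∀ f : Plane → ℝ≥0∞, Measurable f →
      ∫⁻ y, f (t • y) = ENNReal.ofReal |(t ^ 2)⁻¹| * ∫⁻ y, f y := by
    intro f hf
    rw [← lintegral_map hf (measurable_const_smul t), Measure.map_addHaar_smul _ ht0,
      lintegral_smul_measure]
    simp
  calc ∫⁻ y in D, g (x + t • (y - x)) ≤ ∫⁻ y, D.indicator g (x + t • (y - x)) := by
        rw [← lintegral_indicator hDm]
        refine lintegral_mono fun y => ?_
        by_cases hy : y ∈ D
        · rw [Set.indicator_of_mem hy, Set.indicator_of_mem]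
          exact hD.add_smul_sub_mem hx hy ⟨by linarith, ht1⟩
        · simp [hy]
    _ = ∫⁻ y, D.indicator g ((x - t • x) + t • y) := by
        congr 1; ext y; congr 1; rw [smul_sub]; abel
    _ = ENNReal.ofReal |(t ^ 2)⁻¹| * ∫⁻ y, D.indicator g ((x - t • x) + y) :=
        h1 (fun y => D.indicator g ((x - t • x) + y))
          ((hg.indicator hDm).comp (measurable_const_add _))
    _ = ENNReal.ofReal |(t ^ 2)⁻¹| * ∫⁻ y in D, g y := by
        rw [lintegral_add_left_eq_self (D.indicator g), lintegral_indicator hDm]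
    -- The Jacobian factor `t⁻²` is at most 4 because `t ≥ 1 / 2`.
    _ ≤ 4 * ∫⁻ y in D, g y := by
        gcongr
        rw [abs_of_nonneg (by positivity)]
        refine ENNReal.ofReal_le_of_le_toReal ?_
        rw [inv_le_comm₀ (by positivity) (by norm_num)]
        norm_num
        nlinarith

/-- The fundamental theorem of calculus along the segment from `x` to `y`, then Cauchy–Schwarz. -/
theorem enorm_sub_sq_le_lintegral {g : Plane → ℝ} (hg : ContDiff ℝ ∞ g) (x y : Plane) {h : ℝ}
    (hxy : ‖y - x‖ ≤ h) :
    ‖g y - g x‖ₑ ^ 2 ≤ ∫⁻ t in Set.Ioc (0 : ℝ) 1,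
      ENNReal.ofReal (h ^ 2) * ∑ i, ‖pderiv i g (x + t • (y - x))‖ₑ ^ 2 := by
  have hc : Continuous fun t : ℝ => dirDeriv (y - x) g (x + t • (y - x)) :=
    (contDiff_dirDeriv hg _).continuous.comp (by fun_prop)
  have h1 := enorm_sub_le_lintegral (fun t => hasDerivAt_along hg x (y - x) t) hc zero_le_one
  simp only [one_smul, add_sub_cancel, zero_smul, add_zero] at h1
  calc ‖g y - g x‖ₑ ^ 2
      ≤ (∫⁻ t in Set.Ioc (0 : ℝ) 1, ‖dirDeriv (y - x) g (x + t • (y - x))‖ₑ) ^ 2 := by gcongr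
    _ ≤ (volume.restrict (Set.Ioc (0 : ℝ) 1)) Set.univ *
          ∫⁻ t in Set.Ioc (0 : ℝ) 1, ‖dirDeriv (y - x) g (x + t • (y - x))‖ₑ ^ 2 :=
        lintegral_sq_le hc.enorm.measurable.aemeasurable
    _ ≤ _ := by
        simp only [Measure.restrict_apply MeasurableSet.univ, Set.univ_inter, Real.volume_Ioc,
          sub_zero, ENNReal.ofReal_one, one_mul]
        gcongr with t
        exact (enorm_dirDeriv_sq_le _ _ _).trans (by gcongr)

/-- A homothety centred at `x` degenerates as `t → 0`. For `t ≤ 1 / 2` the same point is the image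
of `x` under the homothety centred at `y` with ratio `1 - t`, so exchanging the two integrals keeps
the ratio at least `1 / 2`. -/
theorem lintegral_lintegral_segment_le {D : Set Plane} (hDm : MeasurableSet D) (hD : Convex ℝ D)
    {N : Plane → ℝ≥0∞} (hN : Measurable N) {t : ℝ} (ht : 0 ≤ t) (ht1 : t ≤ 1) :
    ∫⁻ x in D, ∫⁻ y in D, N (x + t • (y - x)) ≤ volume D * (4 * ∫⁻ x in D, N x) := by
  have main : ∀ t : ℝ, 1 / 2 ≤ t → t ≤ 1 →
      ∫⁻ x in D, ∫⁻ y in D, N (x + t • (y - x)) ≤ volume D * (4 * ∫⁻ x in D, N x) := by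
    intro t ht ht1
    calc _ ≤ ∫⁻ x in D, 4 * ∫⁻ x in D, N x :=
          setLIntegral_mono' hDm fun x hx => setLIntegral_homothety_le hDm hD hx ht ht1 hN
      _ = _ := by simp [mul_comm]
  rcases le_total (1 / 2) t with h | h
  · exact main t h ht1
  · rw [lintegral_lintegral_swap (by fun_prop)]
    convert main (1 - t) (by linarith) (by linarith) using 6 with y x
    module

/-- The Poincaré inequality on bounded convex sets. -/
theorem poincare {D : Set Plane} (hDm : MeasurableSet D) (hD : Convex ℝ D) {h : ℝ}
    (hdiam : ∀ x ∈ D, ∀ y ∈ D, ‖y - x‖ ≤ h) (h0 : volume D ≠ 0) (h1 : volume D ≠ ⊤)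
    {g : Plane → ℝ} (hg : ContDiff ℝ ∞ g) (hgi : IntegrableOn g D) (hmean : ∫ x in D, g x = 0) :
    l2sq (volume.restrict D) g ≤
      4 * ENNReal.ofReal (h ^ 2) * ∑ i, l2sq (volume.restrict D) (pderiv i g) := by
  set N : Plane → ℝ≥0∞ := fun x => ENNReal.ofReal (h ^ 2) * ∑ i, ‖pderiv i g x‖ₑ ^ 2 with hNdef
  have hNi : ∀ i : Fin 2, Measurable fun x => ‖pderiv i g x‖ₑ ^ 2 := fun i =>
    ((contDiff_pderiv hg i).continuous.enorm.measurable).pow_const 2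
  have hN : Measurable N := (Finset.measurable_fun_sum _ fun i _ => hNi i).const_mul _
  have hS : ∫⁻ x in D, N x =
      ENNReal.ofReal (h ^ 2) * ∑ i, l2sq (volume.restrict D) (pderiv i g) := by
    simp only [hNdef, l2sq]
    rw [lintegral_const_mul' _ _ (by simp), lintegral_finsetSum _ fun i _ => hNi i]
  have hgm : Measurable g := hg.continuous.measurable
  -- As `g` has mean zero, `|D| g x` is minus the integral of `g y - g x` over `y`; Cauchy–Schwarz
  -- gives the claim after cancelling one factor `|D|`.
  have hpt : ∀ x, volume D * ‖g x‖ₑ ^ 2 ≤ ∫⁻ y in D, ‖g y - g x‖ₑ ^ 2 := by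
    intro x
    have e1 : ∫ y in D, (g y - g x) = - (volume.real D * g x) := by
      have : IsFiniteMeasure (volume.restrict D) := ⟨by simpa using h1.lt_top⟩
      rw [integral_sub hgi (integrable_const _), hmean]
      simp
    have e2 : (volume D * ‖g x‖ₑ) ^ 2 ≤ volume D * ∫⁻ y in D, ‖g y - g x‖ₑ ^ 2 := by
      have e3 : volume D * ‖g x‖ₑ = ‖∫ y in D, (g y - g x)‖ₑ := by
        rw [e1, enorm_neg, enorm_mul, Real.enorm_eq_ofReal measureReal_nonneg,
          ofReal_measureReal h1]
      calc (volume D * ‖g x‖ₑ) ^ 2 ≤ (∫⁻ y in D, ‖g y - g x‖ₑ) ^ 2 := by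
            rw [e3]; gcongr; exact enorm_integral_le_lintegral_enorm _
        _ ≤ _ := by
            simpa using lintegral_sq_le (μ := volume.restrict D) (f := fun y => ‖g y - g x‖ₑ)
              (by fun_prop)
    have e4 : volume D * (volume D * ‖g x‖ₑ ^ 2) ≤ volume D * ∫⁻ y in D, ‖g y - g x‖ₑ ^ 2 := by
      rw [← mul_assoc, ← sq, ← mul_pow]; exact e2
    exact (ENNReal.mul_le_mul_iff_right h0 h1).1 e4
  have hdouble : volume D * l2sq (volume.restrict D) g ≤ volume D * (4 * ∫⁻ x in D, N x) := by
    calc volume D * l2sq (volume.restrict D) g = ∫⁻ x in D, volume D * ‖g x‖ₑ ^ 2 := by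
          rw [l2sq, lintegral_const_mul' _ _ h1]
      _ ≤ ∫⁻ x in D, ∫⁻ y in D, ‖g y - g x‖ₑ ^ 2 := lintegral_mono fun x => hpt x
      _ ≤ ∫⁻ x in D, ∫⁻ y in D, ∫⁻ t in Set.Ioc (0 : ℝ) 1, N (x + t • (y - x)) :=
          setLIntegral_mono' hDm fun x hx => setLIntegral_mono' hDm fun y hy =>
            enorm_sub_sq_le_lintegral hg x y (hdiam x hx y hy)
      _ = ∫⁻ x in D, ∫⁻ t in Set.Ioc (0 : ℝ) 1, ∫⁻ y in D, N (x + t • (y - x)) := by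
          congr 1; ext x
          rw [lintegral_lintegral_swap (by fun_prop)]
      _ = ∫⁻ t in Set.Ioc (0 : ℝ) 1, ∫⁻ x in D, ∫⁻ y in D, N (x + t • (y - x)) := by
          rw [lintegral_lintegral_swap]
          have hm : Measurable fun q : (Plane × ℝ) × Plane =>
              N (q.1.1 + q.1.2 • (q.2 - q.1.1)) := by fun_prop
          exact (hm.lintegral_prod_right' (ν := volume.restrict D)).aemeasurable
      _ ≤ ∫⁻ t in Set.Ioc (0 : ℝ) 1, volume D * (4 * ∫⁻ x in D, N x) :=
          setLIntegral_mono' measurableSet_Ioc fun t ht =>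
            lintegral_lintegral_segment_le hDm hD hN ht.1.le ht.2
      _ = _ := by simp
  have := (ENNReal.mul_le_mul_iff_right h0 h1).1 hdouble
  rwa [hS, ← mul_assoc] at this


/-! ### Polynomial approximation on convex sets -/

/-- The monomial function `x₀^j x₁^k`. -/
noncomputable def monoFun (j k : ℕ) : Plane → ℝ := fun x => x 0 ^ j * x 1 ^ k

theorem polyFun_monomial (c : ℝ) (j k : ℕ) :
    polyFun (MvPolynomial.C c * (MvPolynomial.X 0 ^ j * MvPolynomial.X 1 ^ k)) =
      c • monoFun j k := by
  ext x; simp [polyFun, monoFun]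

theorem contDiff_monoFun (j k : ℕ) : ContDiff ℝ ∞ (monoFun j k) := by
  have := contDiff_polyFun (MvPolynomial.C 1 * (MvPolynomial.X 0 ^ j * MvPolynomial.X 1 ^ k))
  rwa [polyFun_monomial, one_smul] at this

theorem pderiv_zero_monoFun (j k : ℕ) : pderiv 0 (monoFun j k) = (j : ℝ) • monoFun (j - 1) k := by
  have := polyFun_monomial 1 j k
  rw [one_smul] at this
  rw [← this, pderiv_polyFun]
  ext x
  simp [polyFun, monoFun, MvPolynomial.pderiv_X, Derivation.leibniz_pow]
  ring

theorem pderiv_one_monoFun (j k : ℕ) : pderiv 1 (monoFun j k) = (k : ℝ) • monoFun j (k - 1) := by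
  have := polyFun_monomial 1 j k
  rw [one_smul] at this
  rw [← this, pderiv_polyFun]
  ext x
  simp [polyFun, monoFun, MvPolynomial.pderiv_X, Derivation.leibniz_pow]
  ring

theorem mderiv_monoFun (j k : ℕ) (α : ℕ × ℕ) :
    mderiv α (monoFun j k) =
      ((j.descFactorial α.1 : ℝ) * (k.descFactorial α.2 : ℝ)) • monoFun (j - α.1) (k - α.2) := by
  have h1 : ∀ n, (pderiv 1)^[n] (monoFun j k) =
      (k.descFactorial n : ℝ) • monoFun j (k - n) := by
    intro n
    induction n with
    | zero => simp
    | succ n ih =>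
      rw [Function.iterate_succ_apply', ih, pderiv_const_smul (contDiff_monoFun _ _),
        pderiv_one_monoFun, smul_smul, Nat.descFactorial_succ, Nat.sub_sub]
      push_cast; rw [mul_comm]
  have h0 : ∀ n k', (pderiv 0)^[n] (monoFun j k') =
      (j.descFactorial n : ℝ) • monoFun (j - n) k' := by
    intro n k'
    induction n with
    | zero => simp
    | succ n ih =>
      rw [Function.iterate_succ_apply', ih, pderiv_const_smul (contDiff_monoFun _ _),
        pderiv_zero_monoFun, smul_smul, Nat.descFactorial_succ, Nat.sub_sub]
      push_cast; rw [mul_comm]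
  rw [mderiv, h1, iterate_pderiv_const_smul (contDiff_monoFun _ _), h0, smul_smul, mul_comm]

theorem mderiv_zero_fun (α : ℕ × ℕ) : mderiv α 0 = 0 := by
  have h : ContDiff ℝ ∞ (0 : Plane → ℝ) := contDiff_const
  simpa using mderiv_const_smul h 0 α

theorem mderiv_sum {ι : Type*} (s : Finset ι) {f : ι → Plane → ℝ}
    (hf : ∀ i ∈ s, ContDiff ℝ ∞ (f i)) (α : ℕ × ℕ) :
    mderiv α (∑ i ∈ s, f i) = ∑ i ∈ s, mderiv α (f i) := by
  classical
  induction s using Finset.induction_on with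
  | empty =>
    rw [Finset.sum_empty, Finset.sum_empty, mderiv_zero_fun]
  | insert a s ha ih =>
    rw [Finset.sum_insert ha, Finset.sum_insert ha, mderiv_add (hf a (by simp)),
      ih fun i hi => hf i (by simp [hi])]
    have : (∑ i ∈ s, f i) = fun x => ∑ i ∈ s, f i x := by ext; simp
    rw [this]
    exact ContDiff.sum fun i hi => hf i (by simp [hi])

theorem integrableOn_of_contDiff {f : Plane → ℝ} (hf : ContDiff ℝ ∞ f) {D : Set Plane}
    (hD : Bornology.IsBounded D) : IntegrableOn f D :=
  (hf.continuous.continuousOn.integrableOn_compact hD.isCompact_closure).mono_set subset_closure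

/-- Induction on the order, fixing the top degree before the lower ones: a homogeneous polynomial
`Q` of degree `n` matches the means of the derivatives of order `n`, and the induction hypothesis is
applied to `f - Q`. The correction it yields has vanishing derivatives of order `n`, so it does not
disturb this matching. -/
theorem exists_poly_mean_eq_zero {D : Set Plane} (hDb : Bornology.IsBounded D)
    (h0 : volume D ≠ 0) (n : ℕ) :
    ∀ f : Plane → ℝ, ContDiff ℝ ∞ f → ∃ P : MvPolynomial (Fin 2) ℝ, P.totalDegree ≤ n - 1 ∧
      (∀ α : ℕ × ℕ, n ≤ α.1 + α.2 → mderiv α (polyFun P) = 0) ∧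
      ∀ α : ℕ × ℕ, α.1 + α.2 < n → ∫ x in D, mderiv α (f - polyFun P) x = 0 := by
  induction n with
  | zero =>
    intro f _
    refine ⟨0, by simp, fun α _ => ?_, by simp⟩
    have : polyFun 0 = 0 := by ext; simp [polyFun]
    rw [this, mderiv_zero_fun]
  | succ n ih =>
    intro f hf
    have hvol : volume.real D ≠ 0 := by
      rw [Measure.real, ENNReal.toReal_ne_zero]
      exact ⟨h0, hDb.measure_lt_top.ne⟩
    let c : ℕ × ℕ → ℝ := fun β =>
      (volume.real D)⁻¹ * (∫ x in D, mderiv β f x) / (β.1.factorial * β.2.factorial)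
    let Q : MvPolynomial (Fin 2) ℝ := ∑ β ∈ Finset.HasAntidiagonal.antidiagonal n,
      MvPolynomial.C (c β) * (MvPolynomial.X 0 ^ β.1 * MvPolynomial.X 1 ^ β.2)
    have hQ : polyFun Q = ∑ β ∈ Finset.HasAntidiagonal.antidiagonal n, c β • monoFun β.1 β.2 := by
      ext x
      simp [Q, polyFun, monoFun]
    have hQd : ∀ α, mderiv α (polyFun Q) = ∑ β ∈ Finset.HasAntidiagonal.antidiagonal n,
        (c β * (β.1.descFactorial α.1 * β.2.descFactorial α.2)) •
          monoFun (β.1 - α.1) (β.2 - α.2) := by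
      intro α
      rw [hQ, mderiv_sum _ fun β _ => contDiff_const_smul' (contDiff_monoFun _ _) _]
      refine Finset.sum_congr rfl fun β _ => ?_
      rw [mderiv_const_smul (contDiff_monoFun _ _), mderiv_monoFun, smul_smul]
    -- Among monomials of degree `n`, only `x^α` survives `∂^α`: any other exponent is too small in
    -- one of the two coordinates. The factorials in `c` cancel those produced by differentiation.
    have hQn : ∀ α : ℕ × ℕ, α.1 + α.2 = n → mderiv α (polyFun Q) =
        fun _ => (volume.real D)⁻¹ * ∫ x in D, mderiv α f x := by
      intro α hα
      rw [hQd, Finset.sum_eq_single α]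
      · ext x
        simp only [Nat.descFactorial_self, Nat.sub_self, c, Pi.smul_apply, monoFun, pow_zero,
          smul_eq_mul, mul_one]
        exact div_mul_cancel₀ _ (by positivity)
      · intro β hβ hne
        rw [Finset.HasAntidiagonal.mem_antidiagonal] at hβ
        have : β.1.descFactorial α.1 * β.2.descFactorial α.2 = 0 := by
          rcases lt_trichotomy β.1 α.1 with h | h | h
          · rw [Nat.descFactorial_eq_zero_iff_lt.2 h, zero_mul]
          · exact absurd (Prod.ext h (by omega)) hne
          · rw [Nat.descFactorial_eq_zero_iff_lt.2 (by omega : β.2 < α.2), mul_zero]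
        rw [← Nat.cast_mul, this]; simp
      · intro h; exact absurd (Finset.HasAntidiagonal.mem_antidiagonal.2 hα) h
    have hQv : ∀ α : ℕ × ℕ, n + 1 ≤ α.1 + α.2 → mderiv α (polyFun Q) = 0 := by
      intro α hα
      rw [hQd]
      refine Finset.sum_eq_zero fun β hβ => ?_
      rw [Finset.HasAntidiagonal.mem_antidiagonal] at hβ
      have : β.1.descFactorial α.1 * β.2.descFactorial α.2 = 0 := by
        rcases lt_or_ge β.1 α.1 with h | h
        · rw [Nat.descFactorial_eq_zero_iff_lt.2 h, zero_mul]
        · rw [Nat.descFactorial_eq_zero_iff_lt.2 (by omega : β.2 < α.2), mul_zero]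
      rw [← Nat.cast_mul, this]; simp
    have hQdeg : Q.totalDegree ≤ n := by
      refine (MvPolynomial.totalDegree_finsetSum _ _).trans (Finset.sup_le fun β hβ => ?_)
      rw [Finset.HasAntidiagonal.mem_antidiagonal] at hβ
      refine (MvPolynomial.totalDegree_mul _ _).trans ?_
      rw [MvPolynomial.totalDegree_C, zero_add]
      refine (MvPolynomial.totalDegree_mul _ _).trans ?_
      rw [MvPolynomial.totalDegree_X_pow, MvPolynomial.totalDegree_X_pow, hβ]
    have hf1 : ContDiff ℝ ∞ (f - polyFun Q) := hf.sub (contDiff_polyFun Q)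
    obtain ⟨P, hP1, hP2, hP3⟩ := ih (f - polyFun Q) hf1
    refine ⟨Q + P, ?_, ?_, ?_⟩
    · exact (MvPolynomial.totalDegree_add _ _).trans (max_le hQdeg (hP1.trans (by omega)))
    · intro α hα
      rw [polyFun_add, mderiv_add (contDiff_polyFun _) (contDiff_polyFun _), hQv α hα,
        hP2 α (by omega), add_zero]
    · intro α hα
      rw [polyFun_add, ← sub_sub]
      rcases Nat.lt_succ_iff_lt_or_eq.1 hα with h | h
      · exact hP3 α h
      · rw [mderiv_sub hf1 (contDiff_polyFun _), hP2 α h.ge, sub_zero,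
          mderiv_sub hf (contDiff_polyFun _), hQn α h]
        have : IsFiniteMeasure (volume.restrict D) := ⟨by simpa using hDb.measure_lt_top⟩
        simp only [Pi.sub_apply]
        rw [integral_sub (integrableOn_of_contDiff (contDiff_mderiv hf α) hDb)
          (integrable_const _)]
        simp [mul_inv_cancel_left₀ hvol]

/-- `∑_{|α| = k} ‖∂^α f‖²`. -/
noncomputable def semiSq (μ : Measure Plane) (k : ℕ) (f : Plane → ℝ) : ℝ≥0∞ :=
  ∑ α ∈ Finset.HasAntidiagonal.antidiagonal k, l2sq μ (mderiv α f)

theorem sum_antidiagonal_unitIdx_le (F : ℕ × ℕ → ℝ≥0∞) (k : ℕ) (i : Fin 2) :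
    ∑ α ∈ Finset.HasAntidiagonal.antidiagonal k, F (α + unitIdx i) ≤ ∑ α ∈ Finset.HasAntidiagonal.antidiagonal (k + 1), F α := by
  fin_cases i
  · rw [Finset.Nat.sum_antidiagonal_succ]
    exact le_add_of_nonneg_left (by positivity)
  · rw [Finset.Nat.sum_antidiagonal_succ']
    exact le_add_of_nonneg_left (by positivity)

/-- Polynomial approximation in Sobolev seminorms on bounded convex sets. -/
theorem exists_poly_semiSq_le {D : Set Plane} (hDm : MeasurableSet D) (hD : Convex ℝ D)
    (hDb : Bornology.IsBounded D) {h : ℝ} (hdiam : ∀ x ∈ D, ∀ y ∈ D, ‖y - x‖ ≤ h)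
    (h0 : volume D ≠ 0) (n : ℕ) {f : Plane → ℝ} (hf : ContDiff ℝ ∞ f) :
    ∃ P : MvPolynomial (Fin 2) ℝ, P.totalDegree ≤ n - 1 ∧ ∀ k ≤ n,
      semiSq (volume.restrict D) k (f - polyFun P) ≤
        (8 * ENNReal.ofReal (h ^ 2)) ^ (n - k) * semiSq (volume.restrict D) n f := by
  obtain ⟨P, hP1, hP2, hP3⟩ := exists_poly_mean_eq_zero hDb h0 n f hf
  refine ⟨P, hP1, ?_⟩
  have hg : ContDiff ℝ ∞ (f - polyFun P) := hf.sub (contDiff_polyFun P)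
  -- Derivatives of order `n` of `P` vanish.
  have hn : semiSq (volume.restrict D) n (f - polyFun P) = semiSq (volume.restrict D) n f := by
    refine Finset.sum_congr rfl fun α hα => ?_
    rw [mderiv_sub hf (contDiff_polyFun _), hP2 α (Finset.HasAntidiagonal.mem_antidiagonal.1 hα).ge, sub_zero]
  -- Poincaré for each `∂^α (f - P)` of order `k`, all of mean zero. The constant 4 becomes 8
  -- because each of the two coordinate directions contributes at most the full seminorm of order `k
  -- + 1`.
  have step : ∀ k < n, semiSq (volume.restrict D) k (f - polyFun P) ≤
      8 * ENNReal.ofReal (h ^ 2) * semiSq (volume.restrict D) (k + 1) (f - polyFun P) := by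
    intro k hk
    calc semiSq (volume.restrict D) k (f - polyFun P)
        ≤ ∑ α ∈ Finset.HasAntidiagonal.antidiagonal k, 4 * ENNReal.ofReal (h ^ 2) * ∑ i,
            l2sq (volume.restrict D) (mderiv (α + unitIdx i) (f - polyFun P)) := by
          refine Finset.sum_le_sum fun α hα => ?_
          have hc := contDiff_mderiv hg α
          refine (poincare hDm hD hdiam h0 hDb.measure_lt_top.ne hc
            (integrableOn_of_contDiff hc hDb)
            (hP3 α ((Finset.HasAntidiagonal.mem_antidiagonal.1 hα).trans_lt hk))).trans_eq ?_
          simp only [pderiv_mderiv hg]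
      _ = 4 * ENNReal.ofReal (h ^ 2) * ∑ i, ∑ α ∈ Finset.HasAntidiagonal.antidiagonal k,
            l2sq (volume.restrict D) (mderiv (α + unitIdx i) (f - polyFun P)) := by
          rw [← Finset.mul_sum, Finset.sum_comm]
      _ ≤ 4 * ENNReal.ofReal (h ^ 2) * ∑ _i : Fin 2,
            semiSq (volume.restrict D) (k + 1) (f - polyFun P) := by
          gcongr with i
          exact sum_antidiagonal_unitIdx_le _ k i
      _ = _ := by rw [Fin.sum_univ_two]; ring
  intro k hk
  obtain ⟨j, rfl⟩ := Nat.exists_eq_add_of_le hk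
  rw [Nat.add_sub_cancel_left, ← hn]
  clear hn hP1 hP2 hP3
  induction j generalizing k with
  | zero => simp
  | succ j ih =>
    calc _ ≤ _ := step k (by omega)
      _ ≤ 8 * ENNReal.ofReal (h ^ 2) * ((8 * ENNReal.ofReal (h ^ 2)) ^ j *
          semiSq (volume.restrict D) (k + 1 + j) (f - polyFun P)) := by
        gcongr
        exact ih (k + 1) (fun i hi => step i (by omega)) (by omega)
      _ = _ := by rw [pow_succ, show k + 1 + j = k + (j + 1) by omega]; ring


/-! ### Weak derivatives -/

section test

variable {E : Type*} [NormedAddCommGroup E] [MeasurableSpace E] {μ : Measure E} {D : Set E} {g g' φ : E → ℝ}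

theorem integrable_mul_test [OpensMeasurableSpace E] (hg : LocallyIntegrableOn g D μ) (hφ : Continuous φ)
    (hc : HasCompactSupport φ) (hs : tsupport φ ⊆ D) : Integrable (fun x => g x * φ x) μ := by
  have h1 : IntegrableOn g (tsupport φ) μ := hg.integrableOn_compact_subset hs hc
  have h2 : IntegrableOn (fun x => g x * φ x) (tsupport φ) μ := h1.mul_continuousOn hφ.continuousOn hc
  exact (integrableOn_iff_integrable_of_support_subset
    ((Function.support_mul_subset_right _ _).trans (subset_tsupport φ))).1 h2

theorem setIntegral_mul_test (hs : tsupport φ ⊆ D) :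
    ∫ x in D, g x * φ x ∂μ = ∫ x, g x * φ x ∂μ := by
  refine setIntegral_eq_integral_of_forall_compl_eq_zero fun x hx => ?_
  rw [image_eq_zero_of_notMem_tsupport fun h => hx (hs h), mul_zero]

theorem ae_eq_of_forall_test [NormedSpace ℝ E] [FiniteDimensional ℝ E] [BorelSpace E] (hD : IsOpen D) (hg : LocallyIntegrableOn g D μ)
    (hg' : LocallyIntegrableOn g' D μ)
    (h : ∀ φ : E → ℝ, ContDiff ℝ ∞ φ → HasCompactSupport φ → tsupport φ ⊆ D →
      ∫ x in D, g x * φ x ∂μ = ∫ x in D, g' x * φ x ∂μ) : g =ᵐ[μ.restrict D] g' := by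
  have := hD.ae_eq_zero_of_integral_contDiff_smul_eq_zero (μ := μ) (hg.sub hg') fun φ h1 h2 h3 => by
    have e := h φ h1 h2 h3
    rw [setIntegral_mul_test h3, setIntegral_mul_test h3] at e
    simp only [Pi.sub_apply, smul_eq_mul, mul_comm (φ _), sub_mul]
    rw [integral_sub (integrable_mul_test hg h1.continuous h2 h3)
      (integrable_mul_test hg' h1.continuous h2 h3), e, sub_self]
  rw [EventuallyEq, ae_restrict_iff' hD.measurableSet]
  filter_upwards [this] with x hx hxD
  simpa [sub_eq_zero] using hx hxD

end test

variable {D : Set Plane} {α : ℕ × ℕ} {u g g' : Plane → ℝ}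

theorem IsWeakDeriv.ae_unique (hD : IsOpen D) (h : IsWeakDeriv D α u g)
    (h' : IsWeakDeriv D α u g') : g =ᵐ[volume.restrict D] g' :=
  ae_eq_of_forall_test hD h.2.1 h'.2.1 fun φ h1 h2 h3 => by
    have e := (h.2.2 φ h1 h2 h3).symm.trans (h'.2.2 φ h1 h2 h3)
    exact mul_left_cancel₀ (by positivity) e

theorem isWeakDeriv_weakDeriv (h : IsWeakDeriv D α u g) : IsWeakDeriv D α u (weakDeriv D α u) := by
  have : ∃ g, IsWeakDeriv D α u g := ⟨g, h⟩
  rw [weakDeriv, dif_pos this]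
  exact this.choose_spec

theorem IsWeakDeriv.weakDeriv_ae_eq (hD : IsOpen D) (h : IsWeakDeriv D α u g) :
    weakDeriv D α u =ᵐ[volume.restrict D] g :=
  (isWeakDeriv_weakDeriv h).ae_unique hD h

theorem locallyIntegrableOn_congr {E : Type*} [TopologicalSpace E] [MeasurableSpace E]
    [OpensMeasurableSpace E] {μ : Measure E} {D : Set E} {g g' : E → ℝ}
    (h : g =ᵐ[μ.restrict D] g') (hg : LocallyIntegrableOn g D μ) : LocallyIntegrableOn g' D μ := by
  intro x hx
  obtain ⟨U, hU, hi⟩ := hg x hx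
  refine ⟨U ∩ D, inter_mem hU self_mem_nhdsWithin, ?_⟩
  exact (hi.mono_set Set.inter_subset_left).congr_fun_ae
    (ae_restrict_of_ae_restrict_of_subset Set.inter_subset_right h)

theorem IsWeakDeriv.congr {u' : Plane → ℝ} (h : IsWeakDeriv D α u g)
    (hu : u =ᵐ[volume.restrict D] u') (hg : g =ᵐ[volume.restrict D] g') :
    IsWeakDeriv D α u' g' := by
  refine ⟨locallyIntegrableOn_congr hu h.1, locallyIntegrableOn_congr hg h.2.1,
    fun φ h1 h2 h3 => ?_⟩
  have e1 : ∫ x in D, u' x * mderiv α φ x = ∫ x in D, u x * mderiv α φ x :=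
    integral_congr_ae (hu.mono fun x hx => by simp only [hx])
  have e2 : ∫ x in D, g' x * φ x = ∫ x in D, g x * φ x :=
    integral_congr_ae (hg.mono fun x hx => by simp only [hx])
  rw [e1, e2, h.2.2 φ h1 h2 h3]

theorem MemHs.isWeakDeriv {s : ℕ} (h : MemHs D s u) (hα : α.1 + α.2 ≤ s) :
    IsWeakDeriv D α u (weakDeriv D α u) := by
  obtain ⟨g, hg, -⟩ := h.2 α hα
  exact isWeakDeriv_weakDeriv hg

theorem MemHs.memLp_weakDeriv (hD : IsOpen D) {s : ℕ} (h : MemHs D s u) (hα : α.1 + α.2 ≤ s) :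
    MemLp (weakDeriv D α u) 2 (volume.restrict D) := by
  obtain ⟨g, hg, hg2⟩ := h.2 α hα
  exact (memLp_congr_ae (hg.weakDeriv_ae_eq hD)).2 hg2

theorem IsWeakDeriv.mono {D' : Set Plane} (h : IsWeakDeriv D α u g) (hDD : D' ⊆ D) :
    IsWeakDeriv D' α u g := by
  refine ⟨h.1.mono_set hDD, h.2.1.mono_set hDD, fun φ h1 h2 h3 => ?_⟩
  have e := h.2.2 φ h1 h2 (h3.trans hDD)
  rwa [setIntegral_mul_test ((tsupport_mderiv_subset φ α).trans (h3.trans hDD)),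
    setIntegral_mul_test (h3.trans hDD),
    ← setIntegral_mul_test ((tsupport_mderiv_subset φ α).trans h3),
    ← setIntegral_mul_test h3] at e

theorem IsWeakDeriv.sub {u' : Plane → ℝ} (h : IsWeakDeriv D α u g) (h' : IsWeakDeriv D α u' g') :
    IsWeakDeriv D α (fun x => u x - u' x) (fun x => g x - g' x) := by
  refine ⟨h.1.sub h'.1, h.2.1.sub h'.2.1, fun φ h1 h2 h3 => ?_⟩
  have hc := (contDiff_mderiv h1 α).continuous
  have hc2 := hasCompactSupport_mderiv h2 α
  have hc3 := (tsupport_mderiv_subset φ α).trans h3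
  simp only [sub_mul]
  rw [integral_sub (integrable_mul_test h.1 hc hc2 hc3).integrableOn
    (integrable_mul_test h'.1 hc hc2 hc3).integrableOn,
    integral_sub (integrable_mul_test h.2.1 h1.continuous h2 h3).integrableOn
    (integrable_mul_test h'.2.1 h1.continuous h2 h3).integrableOn,
    h.2.2 φ h1 h2 h3, h'.2.2 φ h1 h2 h3, mul_sub]

theorem isWeakDeriv_zero_index (hu : LocallyIntegrableOn u D) : IsWeakDeriv D (0, 0) u u :=
  ⟨hu, hu, fun φ _ _ _ => by simp⟩

/-- A derivative of a weak derivative. -/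
theorem IsWeakDeriv.of_add {β : ℕ × ℕ} {k : Plane → ℝ} (h : IsWeakDeriv D α u g)
    (hk : IsWeakDeriv D (α + β) u k) : IsWeakDeriv D β g k := by
  refine ⟨h.2.1, hk.2.1, fun φ h1 h2 h3 => ?_⟩
  have e1 := hk.2.2 φ h1 h2 h3
  have e2 := h.2.2 (mderiv β φ) (contDiff_mderiv h1 β) (hasCompactSupport_mderiv h2 β)
    ((tsupport_mderiv_subset φ β).trans h3)
  rw [mderiv_mderiv h1, e1] at e2
  have e3 : ((-1 : ℝ)) ^ (α.1 + α.2) * (-1) ^ (α.1 + α.2) = 1 := by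
    rw [← mul_pow]; simp
  calc ∫ x in D, g x * mderiv β φ x
      = (-1) ^ (α.1 + α.2) * ((-1) ^ (α.1 + α.2) * ∫ x in D, g x * mderiv β φ x) := by
        rw [← mul_assoc, e3, one_mul]
    _ = (-1) ^ (α.1 + α.2) * ((-1) ^ (α.1 + β.1 + (α.2 + β.2)) * ∫ x in D, k x * φ x) := by
        rw [← e2]; rfl
    _ = _ := by
        rw [← mul_assoc, show α.1 + β.1 + (α.2 + β.2) = (α.1 + α.2) + (β.1 + β.2) by ring,
          pow_add _ (α.1 + α.2), ← mul_assoc, e3, one_mul]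

theorem isWeakDeriv_pderiv {f : Plane → ℝ} (hf : ContDiff ℝ ∞ f) (i : Fin 2) :
    IsWeakDeriv D (unitIdx i) f (pderiv i f) := by
  refine ⟨hf.continuous.locallyIntegrable.locallyIntegrableOn _,
    (contDiff_pderiv hf i).continuous.locallyIntegrable.locallyIntegrableOn _,
    fun φ h1 h2 h3 => ?_⟩
  rw [mderiv_unitIdx, setIntegral_mul_test ((tsupport_pderiv_subset φ i).trans h3),
    setIntegral_mul_test h3]
  have e1 : (-1 : ℝ) ^ ((unitIdx i).1 + (unitIdx i).2) = -1 := by fin_cases i <;> simp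
  rw [e1, neg_one_mul]
  have hloc : ∀ {k : Plane → ℝ}, ContDiff ℝ ∞ k → LocallyIntegrableOn k Set.univ :=
    fun hk => hk.continuous.locallyIntegrable.locallyIntegrableOn _
  refine integral_mul_fderiv_eq_neg_fderiv_mul_of_integrable ?_ ?_ ?_
    (fun x _ => hf.differentiable (by simp) x) (fun x _ => h1.differentiable (by simp) x)
  · exact integrable_mul_test (hloc (contDiff_pderiv hf i)) h1.continuous h2 (Set.subset_univ _)
  · exact integrable_mul_test (hloc hf) (contDiff_pderiv h1 i).continuous
      (hasCompactSupport_pderiv h2 i) (Set.subset_univ _)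
  · exact integrable_mul_test (hloc hf) h1.continuous h2 (Set.subset_univ _)

/-- Classical derivatives are weak derivatives. -/
theorem isWeakDeriv_mderiv {f : Plane → ℝ} (hf : ContDiff ℝ ∞ f) (α : ℕ × ℕ) :
    IsWeakDeriv D α f (mderiv α f) := by
  have hloc : ∀ {k : Plane → ℝ}, ContDiff ℝ ∞ k → LocallyIntegrableOn k D :=
    fun hk => hk.continuous.locallyIntegrable.locallyIntegrableOn _
  have step : ∀ (β : ℕ × ℕ) (i : Fin 2), IsWeakDeriv D β f (mderiv β f) →
      IsWeakDeriv D (β + unitIdx i) f (mderiv (β + unitIdx i) f) := by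
    intro β i h
    refine ⟨hloc hf, hloc (contDiff_mderiv hf _), fun φ h1 h2 h3 => ?_⟩
    rw [← mderiv_pderiv h1, h.2.2 (pderiv i φ) (contDiff_pderiv h1 i) (hasCompactSupport_pderiv h2 i)
      ((tsupport_pderiv_subset φ i).trans h3)]
    have := (isWeakDeriv_pderiv (D := D) (contDiff_mderiv hf β) i).2.2 φ h1 h2 h3
    rw [mderiv_unitIdx, pderiv_mderiv hf] at this
    rw [this, ← mul_assoc, ← pow_add]
    congr 2
    simp only [Prod.fst_add, Prod.snd_add]; ring
  obtain ⟨a, b⟩ := α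
  have h0 : ∀ b, IsWeakDeriv D (0, b) f (mderiv (0, b) f) := by
    intro b
    induction b with
    | zero => exact isWeakDeriv_zero_index (hloc hf)
    | succ b ih => exact step (0, b) 1 ih
  induction a with
  | zero => exact h0 b
  | succ a ih => exact step (a, b) 0 ih


/-! ### Mollification -/

/-- The convolution of `G` with `η`. -/
noncomputable def moll (η G : Plane → ℝ) : Plane → ℝ := fun x => ∫ t, G t * η (x - t)

theorem moll_eq_convolution (η G : Plane → ℝ) :
    moll η G = convolution G η (ContinuousLinearMap.lsmul ℝ ℝ) volume := by
  ext x; simp [moll, convolution_def]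

theorem contDiff_moll {η G : Plane → ℝ} (hη : ContDiff ℝ ∞ η) (hc : HasCompactSupport η)
    (hG : LocallyIntegrable G) : ContDiff ℝ ∞ (moll η G) := by
  rw [moll_eq_convolution]
  exact hc.contDiff_convolution_right _ hG hη

theorem pderiv_moll {η G : Plane → ℝ} (hη : ContDiff ℝ ∞ η) (hc : HasCompactSupport η)
    (hG : LocallyIntegrable G) (i : Fin 2) : pderiv i (moll η G) = moll (pderiv i η) G := by
  ext x
  have h := hc.hasFDerivAt_convolution_right (ContinuousLinearMap.lsmul ℝ ℝ) hG
    (hη.of_le (by simp)) x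
  rw [pderiv, moll_eq_convolution, h.fderiv, convolution_precompR_apply _ hG (hc.fderiv ℝ)
    (hη.continuous_fderiv (by simp)), moll_eq_convolution]
  rfl

theorem iterate_pderiv_moll {η G : Plane → ℝ} (hη : ContDiff ℝ ∞ η) (hc : HasCompactSupport η)
    (hG : LocallyIntegrable G) (i : Fin 2) (n : ℕ) :
    (pderiv i)^[n] (moll η G) = moll ((pderiv i)^[n] η) G ∧
      HasCompactSupport ((pderiv i)^[n] η) := by
  induction n with
  | zero => exact ⟨rfl, hc⟩
  | succ n ih =>
    simp only [Function.iterate_succ_apply', ih.1]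
    exact ⟨pderiv_moll (contDiff_iterate_pderiv hη i n) ih.2 hG i, hasCompactSupport_pderiv ih.2 i⟩

theorem mderiv_moll {η G : Plane → ℝ} (hη : ContDiff ℝ ∞ η) (hc : HasCompactSupport η)
    (hG : LocallyIntegrable G) (α : ℕ × ℕ) : mderiv α (moll η G) = moll (mderiv α η) G := by
  have h1 := iterate_pderiv_moll hη hc hG 1 α.2
  rw [mderiv, h1.1, (iterate_pderiv_moll (contDiff_iterate_pderiv hη 1 _) h1.2 hG 0 α.1).1, mderiv]

/-- Mollification commutes with weak derivatives away from the boundary. -/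
theorem mderiv_moll_eq {D : Set Plane} {α : ℕ × ℕ} {u g η : Plane → ℝ}
    (hw : IsWeakDeriv D α u g) (hη : ContDiff ℝ ∞ η) (hc : HasCompactSupport η)
    (hu : LocallyIntegrable (D.indicator u)) (hD : MeasurableSet D) {y : Plane}
    (hy : ∀ t, y - t ∈ tsupport η → t ∈ D) :
    mderiv α (moll η (D.indicator u)) y = moll η (D.indicator g) y := by
  rw [mderiv_moll hη hc hu]
  have hψ : (fun t => η (y + (-1 : ℝ) • t)) = fun t => η (y - t) := by
    ext t; congr 1; simp [sub_eq_add_neg]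
  -- The reflected mollifier is the test function, and `hy` places its support inside `D`. The signs
  -- from the weak derivative and from the reflection cancel.
  have h1 : ContDiff ℝ ∞ fun t => η (y - t) := hψ ▸ contDiff_comp_homothety hη y (-1)
  let e : Plane ≃ₜ Plane := Homeomorph.subLeft y
  have h2 : HasCompactSupport fun t => η (y - t) := hc.comp_homeomorph e
  have h3 : tsupport (fun t => η (y - t)) ⊆ D := by
    intro t ht
    have : tsupport (fun t => η (y - t)) = e ⁻¹' tsupport η :=
      tsupport_comp_eq_preimage η e
    rw [this] at ht
    exact hy t ht
  have h4 := hw.2.2 _ h1 h2 h3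
  rw [← hψ, mderiv_comp_homothety hη] at h4
  have h5 : (-1 : ℝ) ^ (α.1 + α.2) ≠ 0 := by positivity
  have e1 : moll (mderiv α η) (D.indicator u) y = ∫ x in D, u x * mderiv α η (y - x) := by
    rw [moll, ← integral_indicator hD]
    congr 1; ext x; by_cases hx : x ∈ D <;> simp [hx]
  have e2 : moll η (D.indicator g) y = ∫ x in D, g x * η (y - x) := by
    rw [moll, ← integral_indicator hD]
    congr 1; ext x; by_cases hx : x ∈ D <;> simp [hx]
  rw [e1, e2]
  refine mul_left_cancel₀ h5 ?_
  rw [← integral_const_mul]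
  have e3 : (fun t => η (y + (-1 : ℝ) • t)) = fun t => η (y - t) := hψ
  simp only [Pi.smul_apply, smul_eq_mul, neg_smul, one_smul, ← sub_eq_add_neg] at h4
  rw [← h4]
  congr 1; ext x; ring

theorem lintegral_enorm_normed (φ : ContDiffBump (0 : Plane)) :
    ∫⁻ x, ‖φ.normed volume x‖ₑ = 1 := by
  have hi : Integrable (φ.normed volume) :=
    φ.contDiff_normed (n := 0) |>.continuous.integrable_of_hasCompactSupport
      φ.hasCompactSupport_normed
  rw [← ofReal_integral_norm_eq_lintegral_enorm hi]
  simp [Real.norm_eq_abs, abs_of_nonneg (φ.nonneg_normed _), φ.integral_normed]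

/-- `‖η (x - t)‖ₑ` is a probability density in `t`, so the square of the average is at most the
average of the squares; then Tonelli's theorem, with mass one in `x` as well. -/
theorem l2sq_moll_le (φ : ContDiffBump (0 : Plane)) {G : Plane → ℝ} (hG : Measurable G) :
    l2sq volume (moll (φ.normed volume) G) ≤ l2sq volume G := by
  set η := φ.normed volume with hη
  have hηm : Measurable η := (φ.contDiff_normed (n := 0)).continuous.measurable
  have hpt : ∀ x, ‖moll η G x‖ₑ ^ 2 ≤ ∫⁻ t, ‖η (x - t)‖ₑ * ‖G t‖ₑ ^ 2 := by
    intro x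
    have hm : Measurable fun t => ‖η (x - t)‖ₑ := by fun_prop
    have h1 : ‖moll η G x‖ₑ ≤ ∫⁻ t, ‖G t‖ₑ ∂(volume.withDensity fun t => ‖η (x - t)‖ₑ) := by
      rw [lintegral_withDensity_eq_lintegral_mul _ hm (by fun_prop)]
      refine (enorm_integral_le_lintegral_enorm _).trans_eq ?_
      simp [enorm_mul, mul_comm]
    have h2 : (volume.withDensity fun t => ‖η (x - t)‖ₑ) Set.univ = 1 := by
      rw [withDensity_apply _ MeasurableSet.univ, Measure.restrict_univ,
        lintegral_sub_left_eq_self (fun t => ‖η t‖ₑ) x, lintegral_enorm_normed]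
    calc ‖moll η G x‖ₑ ^ 2
        ≤ (∫⁻ t, ‖G t‖ₑ ∂(volume.withDensity fun t => ‖η (x - t)‖ₑ)) ^ 2 := by gcongr
      _ ≤ _ := lintegral_sq_le (by fun_prop)
      _ = _ := by
          rw [h2, one_mul, lintegral_withDensity_eq_lintegral_mul _ hm (by fun_prop)]
          rfl
  calc l2sq volume (moll η G) ≤ ∫⁻ x, ∫⁻ t, ‖η (x - t)‖ₑ * ‖G t‖ₑ ^ 2 := lintegral_mono hpt
    _ = ∫⁻ t, ∫⁻ x, ‖η (x - t)‖ₑ * ‖G t‖ₑ ^ 2 := lintegral_lintegral_swap (by fun_prop)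
    _ = ∫⁻ t, ‖G t‖ₑ ^ 2 := by
        congr 1; ext t
        rw [lintegral_mul_const _ (by fun_prop), lintegral_sub_right_eq_self (fun x => ‖η x‖ₑ) t,
          lintegral_enorm_normed, one_mul]

theorem l2sq_comp_homothety {f : Plane → ℝ} (hf : Measurable f) (w : Plane) {μ : ℝ}
    (hμ : 1 / 2 ≤ μ) : l2sq volume (fun x => f (w + μ • x)) ≤ 4 * l2sq volume f := by
  have h0 : μ ≠ 0 := by positivity
  have hm : Measurable fun x => ‖f (w + x)‖ₑ ^ 2 := by fun_prop
  rw [l2sq, ← lintegral_map (f := fun x => ‖f (w + x)‖ₑ ^ 2) hm (measurable_const_smul μ),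
    Measure.map_addHaar_smul _ h0, lintegral_smul_measure, lintegral_add_left_eq_self
      (fun x => ‖f x‖ₑ ^ 2) w]
  change _ * l2sq volume f ≤ _
  gcongr
  rw [abs_of_nonneg (by positivity)]
  refine ENNReal.ofReal_le_of_le_toReal ?_
  rw [inv_le_comm₀ (by positivity) (by norm_num)]
  norm_num
  nlinarith

/-- Mollify at scale `φ.rOut`, then compose with a contraction. -/
noncomputable def mollDil (φ : ContDiffBump (0 : Plane)) (w : Plane) (μ : ℝ) (G : Plane → ℝ) : Plane → ℝ :=
  fun x => moll (φ.normed volume) G (w + μ • x)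

/-- Used to turn uniform closeness on a set of measure `M` into smallness of the squared `L²` norm.
-/
theorem exists_sq_mul_le {M δ : ℝ≥0∞} (hM : M ≠ ⊤) (hδ : 0 < δ) :
    ∃ κ : ℝ, 0 < κ ∧ ENNReal.ofReal κ ^ 2 * M ≤ δ := by
  have ht : Tendsto (fun κ : ℝ => ENNReal.ofReal κ ^ 2 * M) (𝓝[>] 0) (𝓝 0) := by
    have h1 : Tendsto (fun κ : ℝ => ENNReal.ofReal κ ^ 2) (𝓝[>] 0) (𝓝 0) := by
      have : Continuous fun κ : ℝ => ENNReal.ofReal κ ^ 2 :=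
        (ENNReal.continuous_pow 2).comp ENNReal.continuous_ofReal
      simpa using (this.tendsto 0).mono_left nhdsWithin_le_nhds
    simpa using ENNReal.Tendsto.mul_const h1 (.inr hM)
  obtain ⟨κ, h1, h2⟩ := ((ENNReal.tendsto_nhds_zero.1 ht δ hδ).and self_mem_nhdsWithin).exists
  exact ⟨κ, h2, h1⟩

/-- The standard three-term argument: the operators `mollDil` are bounded on `L²` uniformly in `n`,
and on continuous functions of compact support they converge uniformly on `D`. -/
theorem tendsto_mollDil {D : Set Plane} (hDm : MeasurableSet D) {x0 : Plane} {R : ℝ}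
    (hR : ∀ x ∈ D, ‖x0 - x‖ ≤ R)
    (φ : ℕ → ContDiffBump (0 : Plane)) (hφ : Tendsto (fun n => (φ n).rOut) atTop (𝓝 0))
    {μ : ℕ → ℝ} (hμ : ∀ n, 1 / 2 ≤ μ n) (hμ1 : ∀ n, μ n ≤ 1) (hμt : Tendsto μ atTop (𝓝 1))
    {G : Plane → ℝ} (hGm : Measurable G) (hG : MemLp G 2 volume) :
    Tendsto (fun n => l2sq (volume.restrict D)
      (fun x => mollDil (φ n) ((1 - μ n) • x0) (μ n) G x - G x)) atTop (𝓝 0) := by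
  have hDfin : volume D < ⊤ := by
    refine (measure_mono (t := Metric.closedBall x0 R) fun x hx => ?_).trans_lt
      measure_closedBall_lt_top
    rw [Metric.mem_closedBall, dist_comm, dist_eq_norm]; exact hR x hx
  rw [ENNReal.tendsto_nhds_zero]
  intro δ hδ
  -- The final estimate costs `2 * 4 + 2 * (2 + 2) = 16` multiples of `δ' ^ 2`, so 20 is enough.
  obtain ⟨δ', hδ'0, hδ'⟩ : ∃ δ' : ℝ≥0∞, δ' ≠ 0 ∧ 20 * δ' ^ 2 ≤ δ := by
    rcases eq_or_ne δ ⊤ with rfl | hδt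
    · exact ⟨1, by simp, le_top⟩
    · refine ⟨ENNReal.ofReal (Real.sqrt (δ.toReal / 20)), ?_, ?_⟩
      · have : 0 < δ.toReal := ENNReal.toReal_pos hδ.ne' hδt
        simp only [ne_eq, ENNReal.ofReal_eq_zero, not_le]; positivity
      · rw [← ENNReal.ofReal_pow (Real.sqrt_nonneg _), Real.sq_sqrt (by positivity)]
        rw [show (20 : ℝ≥0∞) = ENNReal.ofReal 20 by norm_num, ← ENNReal.ofReal_mul (by norm_num),
          mul_div_cancel₀ _ (by norm_num), ENNReal.ofReal_toReal hδt]
  obtain ⟨ψ, hψc, hψn, hψ, hψ2⟩ := hG.exists_hasCompactSupport_eLpNorm_sub_le (by simp) hδ'0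
  have hGψ : l2sq volume (fun x => G x - ψ x) ≤ δ' ^ 2 := by
    rw [l2sq_eq_eLpNorm]
    exact pow_le_pow_left₀ (by positivity) hψn 2
  have hψu : UniformContinuous ψ := hψc.uniformContinuous_of_continuous hψ
  obtain ⟨κ, hκ0, hκ⟩ : ∃ κ : ℝ, 0 < κ ∧ ENNReal.ofReal κ ^ 2 * volume D ≤ δ' ^ 2 :=
    exists_sq_mul_le hDfin.ne (by positivity)
  obtain ⟨τ, hτ0, hτ⟩ := Metric.uniformContinuous_iff.1 hψu (κ / 2) (by positivity)
  have hev1 : ∀ᶠ n in atTop, (φ n).rOut < τ / 2 := hφ.eventually_lt_const (by positivity)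
  have hev2 : ∀ᶠ n in atTop, (1 - μ n) * R < τ / 2 := by
    have : Tendsto (fun n => (1 - μ n) * R) atTop (𝓝 0) := by
      simpa using (hμt.const_sub 1).mul_const R
    exact this.eventually_lt_const (by positivity)
  filter_upwards [hev1, hev2] with n h1 h2
  set w := (1 - μ n) • x0 with hw
  have hloc : ∀ {k : Plane → ℝ}, MemLp k 2 volume → LocallyIntegrable k :=
    fun hk => hk.locallyIntegrable (by norm_num)
  have hηc : Continuous ((φ n).normed volume) := ((φ n).contDiff_normed (n := 0)).continuous
  have hlin : ∀ x, mollDil (φ n) w (μ n) G x =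
      mollDil (φ n) w (μ n) (fun x => G x - ψ x) x + mollDil (φ n) w (μ n) ψ x := by
    intro x
    have hex : ∀ {k : Plane → ℝ}, MemLp k 2 volume →
        Integrable fun t => k t * (φ n).normed volume (w + μ n • x - t) := fun {k} hk => by
      have := (φ n).hasCompactSupport_normed (μ := volume) |>.convolutionExists_right
        (ContinuousLinearMap.lsmul ℝ ℝ) (hloc hk) hηc (w + μ n • x)
      exact this
    simp only [mollDil, moll]
    have := integral_add (hex (hG.sub hψ2)) (hex hψ2)
    simp only [Pi.sub_apply] at this
    rw [← this]
    congr 1; ext t; ring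
  have hS : l2sq (volume.restrict D) (mollDil (φ n) w (μ n) (fun x => G x - ψ x)) ≤ 4 * δ' ^ 2 := by
    have hm : Measurable fun x => G x - ψ x := hGm.sub hψ.measurable
    have hmm : Measurable (moll ((φ n).normed volume) fun x => G x - ψ x) :=
      (contDiff_moll (φ n).contDiff_normed (φ n).hasCompactSupport_normed
        (hloc (hG.sub hψ2))).continuous.measurable
    calc _ ≤ l2sq volume (mollDil (φ n) w (μ n) (fun x => G x - ψ x)) :=
          l2sq_mono_measure Measure.restrict_le_self
      _ ≤ 4 * l2sq volume (moll ((φ n).normed volume) fun x => G x - ψ x) :=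
          l2sq_comp_homothety hmm w (hμ n)
      _ ≤ 4 * δ' ^ 2 := by gcongr; exact (l2sq_moll_le _ hm).trans hGψ
  have hψd : l2sq (volume.restrict D) (fun x => mollDil (φ n) w (μ n) ψ x - ψ x) ≤ δ' ^ 2 := by
    refine (l2sq_le_of_bound hDm (M := ENNReal.ofReal κ) fun x hx => ?_).trans hκ
    rw [← ofReal_norm]
    apply ENNReal.ofReal_le_ofReal
    rw [← dist_eq_norm]
    set y := w + μ n • x with hy
    -- The dilation moves a point of `D` by at most `(1 - μ n) * R`. This displacement and the
    -- averaging each cost `κ / 2`.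
    have hyx : dist y x < τ / 2 := by
      have : y - x = (1 - μ n) • (x0 - x) := by rw [hy, hw]; module
      rw [dist_eq_norm, this, norm_smul, Real.norm_of_nonneg (by linarith [hμ1 n])]
      refine lt_of_le_of_lt ?_ h2
      exact mul_le_mul_of_nonneg_left (hR x hx) (by linarith [hμ1 n])
    have h3 := (φ n).dist_normed_convolution_le (μ := volume) (x₀ := y) (g := ψ) (ε := κ / 2)
      hψ.aestronglyMeasurable fun z hz => by
        have : dist z y < τ := (Metric.mem_ball.1 hz).trans (h1.trans (by linarith))
        exact (hτ this).le
    have h4 : convolution ((φ n).normed volume) ψ (ContinuousLinearMap.lsmul ℝ ℝ) volume y =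
        mollDil (φ n) w (μ n) ψ x := by
      rw [convolution_lsmul_swap]
      simp only [mollDil, moll, smul_eq_mul, mul_comm (ψ _)]
      rfl
    rw [h4] at h3
    have h5 : dist (ψ y) (ψ x) < κ / 2 := hτ (hyx.trans (by linarith))
    linarith [dist_triangle (mollDil (φ n) w (μ n) ψ x) (ψ y) (ψ x)]
  have hm1 : AEStronglyMeasurable (mollDil (φ n) w (μ n) (fun x => G x - ψ x))
      (volume.restrict D) := by
    refine Continuous.aestronglyMeasurable ?_
    exact (contDiff_moll (φ n).contDiff_normed (φ n).hasCompactSupport_normed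
        (hloc (hG.sub hψ2))).continuous.comp (by fun_prop)
  have hm2 : AEStronglyMeasurable (fun x => mollDil (φ n) w (μ n) ψ x - ψ x)
      (volume.restrict D) := by
    refine Continuous.aestronglyMeasurable ?_
    exact ((contDiff_moll (φ n).contDiff_normed (φ n).hasCompactSupport_normed
        (hloc hψ2)).continuous.comp (by fun_prop)).sub hψ
  calc l2sq (volume.restrict D) (fun x => mollDil (φ n) w (μ n) G x - G x)
      = l2sq (volume.restrict D) (fun x => mollDil (φ n) w (μ n) (fun x => G x - ψ x) x +
          ((mollDil (φ n) w (μ n) ψ x - ψ x) - (G x - ψ x))) := by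
        congr 1; ext x; rw [hlin]; ring
    _ ≤ 2 * (4 * δ' ^ 2) + 2 * (2 * δ' ^ 2 + 2 * δ' ^ 2) := by
        refine (l2sq_add_le hm1).trans ?_
        gcongr
        refine (l2sq_sub_le hm2).trans ?_
        gcongr
        exact (l2sq_mono_measure Measure.restrict_le_self).trans hGψ
    _ ≤ 20 * δ' ^ 2 := by
        ring_nf
        gcongr
        norm_num
    _ ≤ δ := hδ'


/-! ### Density of smooth functions on bounded convex domains -/

/-- Smooth functions on the plane are dense in `H^s(D)`. -/
theorem exists_smooth_approx {D : Set Plane} (hDo : IsOpen D) (hDc : Convex ℝ D)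
    (hDb : Bornology.IsBounded D) (hne : D.Nonempty) {s : ℕ} {u : Plane → ℝ} (hu : MemHs D s u) :
    ∃ φ : ℕ → Plane → ℝ, (∀ n, ContDiff ℝ ∞ (φ n)) ∧ ∀ α : ℕ × ℕ, α.1 + α.2 ≤ s →
      Tendsto (fun n => l2sq (volume.restrict D)
        (fun x => mderiv α (φ n) x - weakDeriv D α u x)) atTop (𝓝 0) := by
  obtain ⟨x0, hx0⟩ := hne
  obtain ⟨r, hr0, hr⟩ := Metric.isOpen_iff.1 hDo x0 hx0
  obtain ⟨R, hR⟩ : ∃ R : ℝ, ∀ x ∈ D, ‖x0 - x‖ ≤ R := by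
    obtain ⟨R, hR⟩ := hDb.subset_closedBall x0
    exact ⟨R, fun x hx => by
      rw [← dist_eq_norm, dist_comm]; exact Metric.mem_closedBall.1 (hR hx)⟩
  have hDm := hDo.measurableSet
  -- A measurable representative, so that `D.indicator U` is measurable on the whole plane.
  let U : Plane → ℝ := hu.1.1.mk u
  have hUm : Measurable U := hu.1.1.stronglyMeasurable_mk.measurable
  have hUu : u =ᵐ[volume.restrict D] U := hu.1.1.ae_eq_mk
  -- Contraction ratios towards `x0`, at least `1 / 2` and tending to 1. The mollification radius
  -- below is `(1 - μ n) * r / 2`, so that the contracted domain keeps its distance from the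
  -- boundary.
  let μ : ℕ → ℝ := fun n => 1 - 1 / ((n : ℝ) + 2)
  have hpos : ∀ n : ℕ, 0 < 1 / ((n : ℝ) + 2) := fun n => by positivity
  have hμ : ∀ n, 1 / 2 ≤ μ n := by
    intro n
    have : 1 / ((n : ℝ) + 2) ≤ 1 / 2 := by gcongr; linarith [(Nat.cast_nonneg n : (0 : ℝ) ≤ n)]
    simp only [μ]; linarith
  have hμ1 : ∀ n, μ n ≤ 1 := fun n => by simp only [μ]; linarith [hpos n]
  have hlim : Tendsto (fun n : ℕ => 1 / ((n : ℝ) + 2)) atTop (𝓝 0) := by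
    have h := (tendsto_one_div_add_atTop_nhds_zero_nat (𝕜 := ℝ)).comp (tendsto_add_atTop_nat 1)
    refine h.congr fun n => ?_
    simp only [Function.comp, Nat.cast_add, Nat.cast_one]; ring_nf
  have hμt : Tendsto μ atTop (𝓝 1) := by simpa [μ] using hlim.const_sub 1
  let φ : ℕ → ContDiffBump (0 : Plane) := fun n =>
    ⟨1 / ((n : ℝ) + 2) * r / 4, 1 / ((n : ℝ) + 2) * r / 2, by positivity, by
      have := mul_pos (hpos n) hr0; linarith⟩
  have hφ : Tendsto (fun n => (φ n).rOut) atTop (𝓝 0) := by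
    simpa [φ] using (hlim.mul_const r).div_const 2
  have hMem : ∀ {k : Plane → ℝ}, MemLp k 2 (volume.restrict D) → MemLp (D.indicator k) 2 volume :=
    fun hk => (memLp_indicator_iff_restrict hDm).2 hk
  have hUL : MemLp U 2 (volume.restrict D) := (memLp_congr_ae hUu).1 hu.1
  have hUloc : LocallyIntegrable (D.indicator U) := (hMem hUL).locallyIntegrable (by norm_num)
  let V : ℕ → Plane → ℝ := fun n => moll ((φ n).normed volume) (D.indicator U)
  have hV : ∀ n, ContDiff ℝ ∞ (V n) := fun n =>
    contDiff_moll (φ n).contDiff_normed (φ n).hasCompactSupport_normed hUloc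
  refine ⟨fun n x => V n ((1 - μ n) • x0 + μ n • x), fun n => contDiff_comp_homothety (hV n) _ _,
    fun α hα => ?_⟩
  have hwd := hu.isWeakDeriv hα
  have hgL := hu.memLp_weakDeriv hDo hα
  let g : Plane → ℝ := hgL.1.mk _
  have hgm : Measurable g := hgL.1.stronglyMeasurable_mk.measurable
  have hgg : weakDeriv D α u =ᵐ[volume.restrict D] g := hgL.1.ae_eq_mk
  have hgL' : MemLp g 2 (volume.restrict D) := (memLp_congr_ae hgg).1 hgL
  have hw : IsWeakDeriv D α U g := hwd.congr hUu hgg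
  have hmain := tendsto_mollDil hDm hR φ hφ hμ hμ1 hμt (hgm.indicator hDm) (hMem hgL')
  have hmd : ∀ n, ∀ x ∈ D, mderiv α (fun x => V n ((1 - μ n) • x0 + μ n • x)) x =
      μ n ^ (α.1 + α.2) * mollDil (φ n) ((1 - μ n) • x0) (μ n) (D.indicator g) x := by
    intro n x hx
    rw [mderiv_comp_homothety (hV n)]
    simp only [Pi.smul_apply, smul_eq_mul, mollDil]
    congr 1
    refine mderiv_moll_eq hw (φ n).contDiff_normed (φ n).hasCompactSupport_normed hUloc hDm
      fun t ht => ?_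
    rw [(φ n).tsupport_normed_eq, mem_closedBall_zero_iff] at ht
    have hc : 1 - μ n = 1 / ((n : ℝ) + 2) := by simp only [μ]; ring
    have hcpos : 0 < 1 - μ n := hc ▸ hpos n
    have hrO : (φ n).rOut = (1 - μ n) * r / 2 := by rw [hc]
    set z := (1 - μ n) • x0 + μ n • x - t with hz
    -- The point `t` is the convex combination of this point, which lies in the ball of radius `r`
    -- about `x0`, and of `x`, with weights `1 - μ n` and `μ n`.
    have h1 : x0 - (1 - μ n)⁻¹ • z ∈ D := by
      refine hr ?_
      rw [Metric.mem_ball, dist_eq_norm, sub_sub_cancel_left, norm_neg, norm_smul, norm_inv,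
        Real.norm_of_nonneg hcpos.le, inv_mul_lt_iff₀ hcpos]
      refine ht.trans_lt ?_
      rw [hrO]; nlinarith [mul_pos hcpos hr0]
    have h2 := hDc h1 hx hcpos.le (by linarith [hμ n]) (by ring : (1 - μ n) + μ n = 1)
    convert h2 using 1
    rw [smul_sub, smul_smul, mul_inv_cancel₀ hcpos.ne', one_smul, hz]
    abel
  -- Each derivative of the dilated function carries a factor `μ n`; the second term measures how
  -- far the resulting power is from 1.
  have hbound : ∀ n, l2sq (volume.restrict D)
      (fun x => mderiv α (fun x => V n ((1 - μ n) • x0 + μ n • x)) x - weakDeriv D α u x) ≤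
      2 * l2sq (volume.restrict D) (fun x => mollDil (φ n) ((1 - μ n) • x0) (μ n)
        (D.indicator g) x - D.indicator g x) +
      2 * (ENNReal.ofReal ((μ n ^ (α.1 + α.2) - 1) ^ 2) * l2sq (volume.restrict D) g) := by
    intro n
    have hmol : AEStronglyMeasurable (mollDil (φ n) ((1 - μ n) • x0) (μ n) (D.indicator g))
        (volume.restrict D) := by
      refine Continuous.aestronglyMeasurable ?_
      exact (contDiff_moll (φ n).contDiff_normed (φ n).hasCompactSupport_normed
        ((hMem hgL').locallyIntegrable (by norm_num))).continuous.comp (by fun_prop)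
    have hcm : AEStronglyMeasurable (fun x => μ n ^ (α.1 + α.2) *
        (mollDil (φ n) ((1 - μ n) • x0) (μ n) (D.indicator g) x - D.indicator g x))
        (volume.restrict D) :=
      (hmol.sub (hgm.indicator hDm).aestronglyMeasurable).const_mul _
    have hμp : ‖μ n ^ (α.1 + α.2)‖ₑ ^ 2 ≤ 1 := by
      rw [enorm_sq_eq_ofReal, ENNReal.ofReal_le_one]
      have h0 : (0 : ℝ) ≤ μ n := by linarith [hμ n]
      exact pow_le_one₀ (by positivity) (pow_le_one₀ h0 (hμ1 n))
    calc _ = l2sq (volume.restrict D) (fun x => μ n ^ (α.1 + α.2) *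
            (mollDil (φ n) ((1 - μ n) • x0) (μ n) (D.indicator g) x - D.indicator g x) +
            (μ n ^ (α.1 + α.2) - 1) * g x) := by
          refine l2sq_congr_ae ?_
          filter_upwards [hgg, ae_restrict_mem hDm] with x hx hxD
          rw [hmd n x hxD, hx, Set.indicator_of_mem hxD]; ring
      _ ≤ _ := by
          refine (l2sq_add_le hcm).trans ?_
          rw [l2sq_const_mul, l2sq_const_mul, enorm_sq_eq_ofReal (_ - 1)]
          gcongr
          exact mul_le_of_le_one_left (by positivity) hμp
  refine tendsto_of_tendsto_of_tendsto_of_le_of_le tendsto_const_nhds ?_ (fun _ => bot_le) hbound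
  have ht : Tendsto (fun n => ENNReal.ofReal ((μ n ^ (α.1 + α.2) - 1) ^ 2)) atTop (𝓝 0) := by
    have h1 : Tendsto (fun n => (μ n ^ (α.1 + α.2) - 1) ^ 2) atTop (𝓝 0) := by
      have := ((hμt.pow (α.1 + α.2)).sub_const 1).pow 2
      simpa using this
    simpa using ENNReal.tendsto_ofReal h1
  have h2 := (ENNReal.Tendsto.const_mul (a := 2) hmain (.inr (by simp))).add
    (ENNReal.Tendsto.const_mul (a := 2)
      (ENNReal.Tendsto.mul_const (b := l2sq (volume.restrict D) g) ht
        (.inr (l2sq_lt_top hgL').ne)) (.inr (by simp)))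
  simpa using h2

/-! ### Continuous representatives -/

theorem semiSq_zero (μ : Measure Plane) (f : Plane → ℝ) : semiSq μ 0 f = l2sq μ f := by
  simp [semiSq]

theorem semiSq_one (μ : Measure Plane) (f : Plane → ℝ) :
    semiSq μ 1 f = ∑ i, l2sq μ (pderiv i f) := by
  simp [semiSq, Finset.Nat.antidiagonal_succ, mderiv, add_comm]

theorem sum_sum_pderiv_le (μ : Measure Plane) {f : Plane → ℝ} (hf : ContDiff ℝ ∞ f) :
    ∑ i, ∑ j, l2sq μ (pderiv i (pderiv j f)) ≤ 2 * semiSq μ 2 f := by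
  have h : semiSq μ 2 f = l2sq μ (pderiv 1 (pderiv 1 f)) + l2sq μ (pderiv 0 (pderiv 1 f)) +
      l2sq μ (pderiv 0 (pderiv 0 f)) := by
    simp [semiSq, Finset.Nat.antidiagonal_succ, mderiv, add_assoc]
  simp only [Fin.sum_univ_two]
  rw [h, pderiv_comm hf 1 0, mul_add, mul_add, two_mul, two_mul, two_mul]
  generalize l2sq μ (pderiv 1 (pderiv 1 f)) = a
  generalize l2sq μ (pderiv 0 (pderiv 0 f)) = b
  generalize l2sq μ (pderiv 0 (pderiv 1 f)) = c
  calc b + c + (c + a) ≤ b + c + (c + a) + (a + b) := le_self_add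
    _ = _ := by ring

/-- The squared `H²` norm of a smooth function. -/
noncomputable def h2Sq (μ : Measure Plane) (f : Plane → ℝ) : ℝ≥0∞ := ∑ k ∈ Finset.range 3, semiSq μ k f

/-- The Sobolev embedding `H² ⊆ C` holds on the closure of `D` for smooth functions. -/
def SobolevBound (D : Set Plane) : Prop :=
  ∃ C : ℝ≥0∞, C ≠ ⊤ ∧ ∀ f : Plane → ℝ, ContDiff ℝ ∞ f → ∀ x ∈ closure D,
    ‖f x‖ₑ ^ 2 ≤ C * h2Sq (volume.restrict D) f

/-- The Sobolev bound applied to `φ n - φ m` makes the approximations uniformly Cauchy on the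
closure. Their uniform limit is continuous and coincides with `u` almost everywhere, as both are
`L²` limits of the same sequence. The uniform convergence is retained because it also identifies
traces. -/
theorem exists_continuousOn_limit {D : Set Plane} (hDo : IsOpen D) (hDb : Bornology.IsBounded D)
    (hS : SobolevBound D) {s : ℕ} (hs : 2 ≤ s) {u : Plane → ℝ} (hu : MemHs D s u)
    {φ : ℕ → Plane → ℝ} (hφ : ∀ n, ContDiff ℝ ∞ (φ n))
    (hlim : ∀ α : ℕ × ℕ, α.1 + α.2 ≤ s → Tendsto (fun n => l2sq (volume.restrict D)
        (fun x => mderiv α (φ n) x - weakDeriv D α u x)) atTop (𝓝 0)) :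
    ∃ f : Plane → ℝ, ContinuousOn f (closure D) ∧ f =ᵐ[volume.restrict D] u ∧
      TendstoUniformlyOn φ f atTop (closure D) := by
  obtain ⟨C, hC, hSob⟩ := hS
  set E : ℕ → ℝ≥0∞ := fun n => ∑ k ∈ Finset.range 3, ∑ α ∈ Finset.HasAntidiagonal.antidiagonal k,
    l2sq (volume.restrict D) (fun x => mderiv α (φ n) x - weakDeriv D α u x) with hE
  have hE0 : Tendsto E atTop (𝓝 0) := by
    have : Tendsto E atTop (𝓝 (∑ k ∈ Finset.range 3,
        ∑ α ∈ Finset.HasAntidiagonal.antidiagonal k, 0)) := by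
      refine tendsto_finsetSum _ fun k hk => tendsto_finsetSum _ fun α hα => hlim α ?_
      rw [Finset.HasAntidiagonal.mem_antidiagonal.1 hα]
      have := Finset.mem_range.1 hk
      omega
    simpa using this
  have hkey : ∀ n m, ∀ x ∈ closure D, ‖φ n x - φ m x‖ₑ ^ 2 ≤ C * (2 * E n + 2 * E m) := by
    intro n m x hx
    refine (hSob (φ n - φ m) ((hφ n).sub (hφ m)) x hx).trans ?_
    gcongr
    simp only [h2Sq, semiSq, hE, Finset.mul_sum, ← Finset.sum_add_distrib]
    refine Finset.sum_le_sum fun k hk => Finset.sum_le_sum fun α hα => ?_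
    have hα' : α.1 + α.2 ≤ s := by
      rw [Finset.HasAntidiagonal.mem_antidiagonal.1 hα]
      have := Finset.mem_range.1 hk
      omega
    rw [mderiv_sub (hφ n) (hφ m)]
    have := l2sq_triangle (aestronglyMeasurable_of_contDiff (contDiff_mderiv (hφ n) α)
      (volume.restrict D)) (hu.memLp_weakDeriv hDo hα').1 (mderiv α (φ m))
    rw [l2sq_sub_comm (f := weakDeriv D α u)] at this
    exact this
  have hcauchy : UniformCauchySeqOn φ atTop (closure D) := by
    rw [Metric.uniformCauchySeqOn_iff]
    intro ε hε
    have ht : Tendsto (fun n => C * (4 * E n)) atTop (𝓝 0) := by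
      have := ENNReal.Tendsto.const_mul (a := C)
        (ENNReal.Tendsto.const_mul (a := 4) hE0 (.inr (by simp))) (.inr hC)
      simpa using this
    have hev := (ENNReal.tendsto_nhds_zero.1 ht (ENNReal.ofReal ((ε / 2) ^ 2)) (by
      rw [gt_iff_lt, ENNReal.ofReal_pos]; positivity))
    obtain ⟨N, hN⟩ := eventually_atTop.1 hev
    refine ⟨N, fun n hn m hm x hx => ?_⟩
    have h1 : ‖φ n x - φ m x‖ₑ ^ 2 ≤ ENNReal.ofReal ((ε / 2) ^ 2) := by
      refine (hkey n m x hx).trans ?_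
      rcases le_total (E n) (E m) with h | h
      · refine le_trans ?_ (hN m hm)
        gcongr
        calc 2 * E n + 2 * E m ≤ 2 * E m + 2 * E m := by gcongr
          _ = 4 * E m := by ring
      · refine le_trans ?_ (hN n hn)
        gcongr
        calc 2 * E n + 2 * E m ≤ 2 * E n + 2 * E n := by gcongr
          _ = 4 * E n := by ring
    rw [enorm_sq_eq_ofReal, ENNReal.ofReal_le_ofReal_iff (by positivity)] at h1
    rw [Real.dist_eq]
    have := abs_le_of_sq_le_sq' h1 (by positivity)
    rw [abs_lt]
    constructor <;> linarith [this.1, this.2]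
  let f : Plane → ℝ := fun x => limUnder atTop fun n => φ n x
  have hpt : ∀ x ∈ closure D, Tendsto (fun n => φ n x) atTop (𝓝 (f x)) := by
    intro x hx
    exact (hcauchy.cauchySeq hx).tendsto_limUnder
  have hunif : TendstoUniformlyOn φ f atTop (closure D) :=
    hcauchy.tendstoUniformlyOn_of_tendsto hpt
  have hfc : ContinuousOn f (closure D) :=
    hunif.continuousOn (Frequently.of_forall fun n => (hφ n).continuous.continuousOn)
  refine ⟨f, hfc, ?_, hunif⟩
  have hfD : AEStronglyMeasurable f (volume.restrict D) :=
    (hfc.mono subset_closure).aestronglyMeasurable hDo.measurableSet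
  refine ae_eq_of_tendsto_l2sq (φ := φ)
    (fun n => aestronglyMeasurable_of_contDiff (hφ n) _) hfD hu.1.1 ?_ ?_
  · have hDfin := hDb.measure_lt_top (μ := (volume : Measure Plane))
    rw [ENNReal.tendsto_nhds_zero]
    intro δ hδ
    obtain ⟨κ, hκ0, hκ⟩ := exists_sq_mul_le hDfin.ne hδ
    filter_upwards [Metric.tendstoUniformlyOn_iff.1 hunif κ hκ0] with n hn
    refine (l2sq_le_of_bound hDo.measurableSet (M := ENNReal.ofReal κ) fun x hx => ?_).trans hκ
    rw [← ofReal_norm, ← dist_eq_norm, dist_comm]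
    exact ENNReal.ofReal_le_ofReal (hn x (subset_closure hx)).le
  · have h0 := hlim (0, 0) (by simp)
    have hw0 : weakDeriv D (0, 0) u =ᵐ[volume.restrict D] u :=
      (isWeakDeriv_zero_index (hu.isWeakDeriv (α := (0, 0)) (by simp)).1).weakDeriv_ae_eq hDo
    refine h0.congr fun n => l2sq_congr_ae ?_
    filter_upwards [hw0] with x hx
    simp [hx]


/-! ### Geometry of triangles -/

theorem univ_eq_of_ne {i j k : Fin 3} (hij : i ≠ j) (hik : i ≠ k) (hjk : j ≠ k) :
    (Finset.univ : Finset (Fin 3)) = {i, j, k} := by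
  revert i j k; decide

theorem sum_eq_of_ne {M : Type*} [AddCommMonoid M] {i j k : Fin 3} (hij : i ≠ j) (hik : i ≠ k)
    (hjk : j ≠ k) (f : Fin 3 → M) : ∑ l, f l = f i + (f j + f k) := by
  rw [univ_eq_of_ne hij hik hjk, Finset.sum_insert (by simp [hij, hik]),
    Finset.sum_insert (by simp [hjk]), Finset.sum_singleton]

theorem eq_or_eq_or_eq_of_ne {i j k : Fin 3} (hij : i ≠ j) (hik : i ≠ k) (hjk : j ≠ k) (l : Fin 3) :
    l = i ∨ l = j ∨ l = k := by
  revert i j k l; decide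

/-- The vertices of a triangle as an affine basis of the plane. -/
noncomputable def triBasis (T : Tri) : AffineBasis (Fin 3) ℝ Plane where
  toFun := T.points
  ind' := T.independent
  tot' := by
    rw [T.independent.affineSpan_eq_top_iff_card_eq_finrank_add_one]
    simp

/-- Barycentric coordinates. -/
noncomputable def bary (T : Tri) (k : Fin 3) : Plane →ᵃ[ℝ] ℝ := (triBasis T).coord k

variable {T : Tri}

theorem bary_points (k l : Fin 3) : bary T k (T.points l) = if k = l then 1 else 0 :=
  (triBasis T).coord_apply k l

theorem sum_bary (x : Plane) : ∑ k, bary T k x = 1 := (triBasis T).sum_coord_apply_eq_one x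

theorem sum_bary_smul (x : Plane) : ∑ k, bary T k x • T.points k = x :=
  (triBasis T).linear_combination_coord_eq_self x

theorem bary_add (k : Fin 3) (x w : Plane) :
    bary T k (x + w) = bary T k x + (bary T k).linear w := by
  rw [add_comm x, ← vadd_eq_add, AffineMap.map_vadd, vadd_eq_add, add_comm]

theorem bary_linear_sub (k : Fin 3) (x y : Plane) :
    (bary T k).linear (x - y) = bary T k x - bary T k y := by
  have := (bary T k).linearMap_vsub x y
  simpa using this

theorem bary_sum (k : Fin 3) {w : Fin 3 → ℝ} (hw : ∑ l, w l = 1) :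
    bary T k (∑ l, w l • T.points l) = w k := by
  have h1 : ∑ l, w l • T.points l = T.points 0 + ∑ l, w l • (T.points l - T.points 0) := by
    simp only [smul_sub, Finset.sum_sub_distrib, ← Finset.sum_smul, hw, one_smul,
      add_sub_cancel]
  rw [h1, bary_add, map_sum]
  simp only [map_smul, bary_linear_sub, smul_eq_mul, bary_points, mul_sub, Finset.sum_sub_distrib,
    ← Finset.sum_mul, hw]
  simp

theorem mem_closedTri {x : Plane} : x ∈ closedTri T ↔ ∀ k, 0 ≤ bary T k x := by
  have := (triBasis T).convexHull_eq_nonneg_coord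
  change convexHull ℝ (Set.range T.points) = _ at this
  rw [closedTri, this]; rfl

theorem mem_openTri {x : Plane} : x ∈ openTri T ↔ ∀ k, 0 < bary T k x := by
  have := (triBasis T).interior_convexHull
  change interior (convexHull ℝ (Set.range T.points)) = _ at this
  rw [openTri, closedTri, this]; rfl

theorem convex_closedTri : Convex ℝ (closedTri T) := convex_convexHull ℝ _

theorem convex_openTri : Convex ℝ (openTri T) := convex_closedTri.interior

theorem isOpen_openTri : IsOpen (openTri T) := isOpen_interior

theorem openTri_subset : openTri T ⊆ closedTri T := interior_subset

theorem isCompact_closedTri : IsCompact (closedTri T) :=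
  (Set.finite_range _).isCompact_convexHull ℝ

theorem measurableSet_closedTri : MeasurableSet (closedTri T) :=
  isCompact_closedTri.isClosed.measurableSet

theorem isBounded_openTri : Bornology.IsBounded (openTri T) :=
  isCompact_closedTri.isBounded.subset openTri_subset

theorem points_mem (k : Fin 3) : T.points k ∈ closedTri T :=
  subset_convexHull ℝ _ (Set.mem_range_self k)

theorem nonempty_openTri : (openTri T).Nonempty := by
  refine ⟨∑ k, (1 / 3 : ℝ) • T.points k, mem_openTri.2 fun k => ?_⟩
  rw [bary_sum k (w := fun _ => 1 / 3) (by simp)]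
  norm_num

theorem closure_openTri : closure (openTri T) = closedTri T := by
  rw [openTri, convex_closedTri.closure_interior_eq_closure_of_nonempty_interior nonempty_openTri,
    isCompact_closedTri.isClosed.closure_eq]

theorem frontier_openTri : frontier (openTri T) = closedTri T \ openTri T := by
  rw [frontier, closure_openTri, isOpen_openTri.interior_eq]

theorem volume_restrict_openTri :
    (volume : Measure Plane).restrict (openTri T) = volume.restrict (closedTri T) := by
  refine Measure.restrict_congr_set ?_
  rw [openTri]
  exact interior_ae_eq_of_null_frontier (convex_closedTri.addHaar_frontier volume)

theorem volume_openTri_ne_zero : volume (openTri T) ≠ 0 :=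
  (isOpen_openTri.measure_pos volume nonempty_openTri).ne'

theorem bary_le_one {x : Plane} (hx : x ∈ closedTri T) (k : Fin 3) : bary T k x ≤ 1 := by
  rw [← sum_bary (T := T) x]
  exact Finset.single_le_sum (fun l _ => mem_closedTri.1 hx l) (Finset.mem_univ k)

theorem bary_parMap (x u v : Plane) (s t : ℝ) (l : Fin 3) :
    bary T l (parMap x u v s t) =
      bary T l x + s * (bary T l).linear u + t * (bary T l).linear v := by
  rw [parMap, bary_add, bary_add, map_smul, map_smul, smul_eq_mul, smul_eq_mul]

/-- Twice the signed area of a triangle. -/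
noncomputable def triDet (T : Tri) (i j k : Fin 3) : ℝ :=
  det2 (T.points j - T.points i) (T.points k - T.points i)

/-- The linear parts of two barycentric coordinates read off the coefficients of a combination of
the edge vectors, which are therefore independent. -/
theorem triDet_ne_zero {i j k : Fin 3} (hij : i ≠ j) (hik : i ≠ k) (hjk : j ≠ k) :
    triDet T i j k ≠ 0 := by
  intro h
  set u := T.points j - T.points i with hu
  set v := T.points k - T.points i with hv
  have hlin : ∀ s t : ℝ, s • u + t • v = 0 → s = 0 ∧ t = 0 := by
    intro s t hst
    have e1 := congrArg (bary T j).linear hst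
    have e2 := congrArg (bary T k).linear hst
    simp only [map_add, map_smul, map_zero, smul_eq_mul, hu, hv, bary_linear_sub, bary_points] at e1 e2
    simp [hij.symm, hik.symm, hjk, hjk.symm] at e1 e2
    exact ⟨e1, e2⟩
  have hd : u 0 * v 1 - u 1 * v 0 = 0 := h
  -- If the determinant vanishes, then `v₀ u - u₀ v = 0` and `v₁ u - u₁ v = 0`. Independence forces
  -- both coordinates of `u` to be zero, so `1 • u + 0 • v = 0` is a nontrivial relation.
  have h1 := hlin (v 0) (- u 0) (by
    ext i; fin_cases i
    · simp; ring
    · simp; linarith)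
  have h2 := hlin (v 1) (- u 1) (by
    ext i; fin_cases i
    · simp; linarith
    · simp; ring)
  have h3 := hlin 1 0 (by
    ext i; fin_cases i
    · simpa using h1.2
    · simpa using h2.2)
  exact one_ne_zero h3.1

/-- Area comparison: in the affine coordinates given by the two edges the disc lies in the unit
square, so `π r²` is at most the Jacobian, and `π ≥ 1`. -/
theorem sq_le_abs_triDet {i j k : Fin 3} (hij : i ≠ j) (hik : i ≠ k) (hjk : j ≠ k) {z : Plane}
    {r : ℝ} (hr : 0 ≤ r) (hball : Metric.ball z r ⊆ openTri T) : r ^ 2 ≤ |triDet T i j k| := by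
  set u := T.points j - T.points i with hu
  set v := T.points k - T.points i with hv
  have h1 := lintegral_parMap (T.points i) u v ((Metric.ball z r).indicator 1)
    (measurable_one.indicator measurableSet_ball) (triDet_ne_zero hij hik hjk)
  rw [lintegral_indicator_one measurableSet_ball, EuclideanSpace.volume_ball_fin_two] at h1
  have hmem : ∀ s t, parMap (T.points i) u v s t ∈ Metric.ball z r →
      s ∈ Set.Ioo (0 : ℝ) 1 ∧ t ∈ Set.Ioo (0 : ℝ) 1 := by
    intro s t hst
    have hx := hball hst
    have hp := mem_openTri.1 hx
    have hq := sum_bary (T := T) (parMap (T.points i) u v s t)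
    rw [sum_eq_of_ne hij hik hjk] at hq
    have ei := hp i
    have ej := hp j
    have ek := hp k
    simp only [bary_parMap, hu, hv, bary_linear_sub, bary_points] at ei ej ek hq
    simp [hij, hij.symm, hik, hik.symm, hjk, hjk.symm] at ei ej ek hq
    exact ⟨⟨ej, by linarith⟩, ⟨ek, by linarith⟩⟩
  have h2 : ∫⁻ s, ∫⁻ t, (Metric.ball z r).indicator 1 (parMap (T.points i) u v s t) ≤ (1 : ℝ≥0∞) := by
    calc _ ≤ ∫⁻ s : ℝ, (Set.Ioo (0 : ℝ) 1).indicator 1 s := by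
          refine lintegral_mono fun s => ?_
          by_cases hs : s ∈ Set.Ioo (0 : ℝ) 1
          · rw [Set.indicator_of_mem hs]
            calc _ ≤ ∫⁻ t : ℝ, (Set.Ioo (0 : ℝ) 1).indicator 1 t := by
                  refine lintegral_mono fun t => ?_
                  by_cases ht : parMap (T.points i) u v s t ∈ Metric.ball z r
                  · rw [Set.indicator_of_mem ht, Set.indicator_of_mem (hmem s t ht).2]; rfl
                  · rw [Set.indicator_of_notMem ht]; exact bot_le
              _ = 1 := by rw [lintegral_indicator_one measurableSet_Ioo]; simp
          · have : ∀ t, (Metric.ball z r).indicator (1 : Plane → ℝ≥0∞)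
                (parMap (T.points i) u v s t) = 0 :=
              fun t => Set.indicator_of_notMem (fun h => hs (hmem s t h).1) _
            simp [this]
      _ = 1 := by rw [lintegral_indicator_one measurableSet_Ioo]; simp
  have h3 : ENNReal.ofReal (r ^ 2) ≤ ENNReal.ofReal |triDet T i j k| := by
    calc ENNReal.ofReal (r ^ 2) ≤ ENNReal.ofReal r ^ 2 * ENNReal.ofReal Real.pi := by
          rw [ENNReal.ofReal_pow hr]
          refine le_mul_of_one_le_right (by positivity) ?_
          rw [ENNReal.one_le_ofReal]
          linarith [Real.pi_gt_three]
      _ ≤ ENNReal.ofReal |triDet T i j k| * 1 := by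
          rw [← h1]; exact mul_le_mul_right h2 _
      _ = _ := mul_one _
  exact (ENNReal.ofReal_le_ofReal_iff (abs_nonneg _)).1 h3

/-- A barycentric coordinate takes values between 0 and 1 on a disc of radius `r`, so the norm of
its gradient is at most `1 / r`. -/
theorem abs_bary_linear_le {z : Plane} {r : ℝ} (hr : 0 < r) (hball : Metric.ball z r ⊆ openTri T)
    (k : Fin 3) (w : Plane) : |(bary T k).linear w| ≤ ‖w‖ / r := by
  have key : ∀ w : Plane, ‖w‖ < r → |(bary T k).linear w| ≤ 1 := by
    intro w hw
    have h1 : z + w ∈ openTri T := hball (by simpa using hw)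
    have h2 : z ∈ openTri T := hball (Metric.mem_ball_self hr)
    have h3 := bary_add (T := T) k z w
    have a1 := mem_openTri.1 h1 k
    have a2 := mem_openTri.1 h2 k
    have a3 := bary_le_one (openTri_subset h1) k
    have a4 := bary_le_one (openTri_subset h2) k
    rw [abs_le]; constructor <;> linarith
  rw [le_div_iff₀ hr]
  by_contra! hlt
  have hw0 : 0 < |(bary T k).linear w| := by
    by_contra! h0
    have : |(bary T k).linear w| * r ≤ 0 := mul_nonpos_of_nonpos_of_nonneg h0 hr.le
    linarith [norm_nonneg w]
  set L := |(bary T k).linear w| with hL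
  -- The ball is open, so `w` is scaled to norm strictly below `r` while its image still exceeds 1.
  obtain ⟨c, hc1, hc2⟩ : ∃ c : ℝ, 1 / L < c ∧ c * ‖w‖ < r := by
    rcases eq_or_lt_of_le (norm_nonneg w) with h0 | h0
    · exact ⟨1 / L + 1, by linarith, by rw [← h0, mul_zero]; exact hr⟩
    · have : 1 / L < r / ‖w‖ := by
        rw [div_lt_div_iff₀ hw0 h0]; linarith
      obtain ⟨c, h1, h2⟩ := exists_between this
      exact ⟨c, h1, by rwa [lt_div_iff₀ h0] at h2⟩
  have hc0 : 0 < c := lt_trans (by positivity) hc1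
  have h5 := key (c • w) (by rwa [norm_smul, Real.norm_of_nonneg hc0.le])
  rw [map_smul, smul_eq_mul, abs_mul, abs_of_pos hc0, ← hL] at h5
  rw [div_lt_iff₀ hw0] at hc1
  linarith

/-! ### Sobolev and trace estimates on triangles -/

/-- Some barycentric coordinate of `x`, say at vertex `k`, is at least `1 / 3`. The parallelogram at
`x` spanned by half the vectors to the other two vertices stays in the triangle, and its area is `1
/ 4` of `bary T k x` times `|triDet|`, hence at least `r² / 12`. The Sobolev estimate at its corner
`x` applies. -/
theorem sobolev_tri {h r : ℝ} (hdiam : ∀ x ∈ closedTri T, ∀ y ∈ closedTri T, ‖x - y‖ ≤ h)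
    {z : Plane} (hr : 0 < r) (hball : Metric.ball z r ⊆ openTri T)
    {f : Plane → ℝ} (hf : ContDiff ℝ ∞ f) {x : Plane} (hx : x ∈ closedTri T) :
    ENNReal.ofReal (r ^ 2 / 12) * ‖f x‖ₑ ^ 2 ≤
      8 * (semiSq (volume.restrict (openTri T)) 0 f +
        ENNReal.ofReal (h ^ 2) * semiSq (volume.restrict (openTri T)) 1 f +
        ENNReal.ofReal (h ^ 2) ^ 2 * semiSq (volume.restrict (openTri T)) 2 f) := by
  obtain ⟨k, hk⟩ : ∃ k, 1 / 3 ≤ bary T k x := by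
    by_contra! hlt
    have h1 := sum_bary (T := T) x
    rw [Fin.sum_univ_three] at h1
    linarith [hlt 0, hlt 1, hlt 2]
  obtain ⟨i, j, hij, hik, hjk⟩ : ∃ i j : Fin 3, i ≠ j ∧ i ≠ k ∧ j ≠ k := by
    clear hk; revert k; decide
  set u : Plane := (1 / 2 : ℝ) • (T.points i - x) with hu
  set v : Plane := (1 / 2 : ℝ) • (T.points j - x) with hv
  have hsum := sum_bary (T := T) x
  rw [sum_eq_of_ne hik.symm hjk.symm hij] at hsum
  have hdet : det2 u v = 1 / 4 * (bary T k x * triDet T k i j) := by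
    have hxe := sum_bary_smul (T := T) x
    rw [sum_eq_of_ne hik.symm hjk.symm hij] at hxe
    have hx0 := congrArg (fun y : Plane => y 0) hxe
    have hx1 := congrArg (fun y : Plane => y 1) hxe
    simp only [PiLp.add_apply, PiLp.smul_apply, smul_eq_mul] at hx0 hx1
    have hki : bary T k x = 1 - bary T i x - bary T j x := by linarith
    simp only [det2, triDet, hu, hv, PiLp.smul_apply, PiLp.sub_apply, smul_eq_mul]
    rw [← hx0, ← hx1, hki]
    ring
  have hdge : r ^ 2 / 12 ≤ |det2 u v| := by
    rw [hdet, abs_mul, abs_mul, abs_of_nonneg (by linarith : 0 ≤ bary T k x)]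
    have := sq_le_abs_triDet hik.symm hjk.symm hij hr.le hball
    rw [abs_of_pos (by norm_num : (0 : ℝ) < 1 / 4)]
    nlinarith [sq_nonneg r]
  have hd0 : det2 u v ≠ 0 := by
    -- The area bound is strictly positive, which rules out degeneracy.
    intro h0; rw [h0, abs_zero] at hdge; nlinarith [sq_pos_of_pos hr]
  have hsub : ∀ s ∈ Set.Ioo (0 : ℝ) 1, ∀ t ∈ Set.Ioo (0 : ℝ) 1, parMap x u v s t ∈ openTri T := by
    intro s hs t ht
    rw [mem_openTri]
    intro l
    have hl := mem_closedTri.1 hx l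
    rw [bary_parMap, hu, hv, map_smul, map_smul, bary_linear_sub, bary_linear_sub, bary_points,
      bary_points]
    rcases eq_or_eq_or_eq_of_ne hij hik hjk l with rfl | rfl | rfl
    · simp only [if_true, hij, if_false, smul_eq_mul]
      nlinarith [hs.1, hs.2, ht.1, ht.2]
    · simp only [if_true, hij.symm, if_false, smul_eq_mul]
      nlinarith [hs.1, hs.2, ht.1, ht.2]
    · simp only [hik.symm, hjk.symm, if_false, smul_eq_mul]
      nlinarith [hs.1, hs.2, ht.1, ht.2]
  have hnorm : ∀ l, ‖(1 / 2 : ℝ) • (T.points l - x)‖ ≤ h := by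
    intro l
    have h1 := hdiam _ (points_mem l) _ hx
    rw [norm_smul]
    norm_num
    linarith [norm_nonneg (T.points l - x)]
  have hmain := sobolev_parallelogram_le isOpen_openTri.measurableSet hsub hd0 hf (hnorm i) (hnorm j)
  calc ENNReal.ofReal (r ^ 2 / 12) * ‖f x‖ₑ ^ 2 ≤ ENNReal.ofReal |det2 u v| * ‖f x‖ₑ ^ 2 := by
        gcongr
    _ ≤ _ := hmain
    _ ≤ 4 * semiSq (volume.restrict (openTri T)) 0 f +
        8 * ENNReal.ofReal (h ^ 2) * semiSq (volume.restrict (openTri T)) 1 f +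
        4 * ENNReal.ofReal (h ^ 2) ^ 2 * (2 * semiSq (volume.restrict (openTri T)) 2 f) := by
        rw [semiSq_zero, semiSq_one]
        gcongr
        exact sum_sum_pderiv_le _ hf
    _ ≤ 8 * semiSq (volume.restrict (openTri T)) 0 f +
        8 * ENNReal.ofReal (h ^ 2) * semiSq (volume.restrict (openTri T)) 1 f +
        4 * ENNReal.ofReal (h ^ 2) ^ 2 * (2 * semiSq (volume.restrict (openTri T)) 2 f) := by
        gcongr; norm_num
    _ = _ := by ring

theorem setLIntegral_hausdorff_image {γ : ℝ → Plane} (hγ : Isometry γ) (I : Set ℝ)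
    (F : Plane → ℝ≥0∞) :
    ∫⁻ x in γ '' I, F x ∂(Measure.hausdorffMeasure 1) = ∫⁻ t in I, F (γ t) := by
  have hme : MeasurableEmbedding γ := hγ.isClosedEmbedding.measurableEmbedding
  have h1 : (Measure.hausdorffMeasure 1 : Measure Plane).restrict (γ '' I) =
      (Measure.map γ volume).restrict (γ '' I) := by
    rw [← hausdorffMeasure_real, hγ.map_hausdorffMeasure (.inl zero_le_one),
      Measure.restrict_restrict_of_subset (Set.image_subset_range _ _)]
  rw [h1, hme.restrict_map, Set.preimage_image_eq _ hγ.injective, hme.lintegral_map]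

theorem isometry_line (A : Plane) {e : Plane} (he : ‖e‖ = 1) : Isometry fun t : ℝ => A + t • e := by
  refine Isometry.of_dist_eq fun s t => ?_
  rw [dist_add_left, dist_eq_norm, ← sub_smul, norm_smul, he, mul_one, Real.dist_eq, Real.norm_eq_abs]

/-- The boundary is covered by six half-edges, one for each permutation: `σ 0` is the starting
vertex, `σ 1` the other end, `σ 2` the opposite vertex. Over a half-edge the parallelogram spanned
with half the vector to the opposite vertex lies in the triangle. With a unit tangent its
determinant is `triDet / (2 L)`, at least `r² / (2 h)`. Six half-edges with constant 2 each give 12.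
-/
theorem trace_tri {h r : ℝ} (hdiam : ∀ x ∈ closedTri T, ∀ y ∈ closedTri T, ‖x - y‖ ≤ h)
    {z : Plane} (hr : 0 < r) (hball : Metric.ball z r ⊆ openTri T)
    {f : Plane → ℝ} (hf : ContDiff ℝ ∞ f) :
    ENNReal.ofReal (r ^ 2 / (2 * h)) * l2sq (bdryMeasure (openTri T)) f ≤
      12 * (l2sq (volume.restrict (openTri T)) f +
        ENNReal.ofReal (h ^ 2) * ∑ i, l2sq (volume.restrict (openTri T)) (pderiv i f)) := by
  classical
  let L : Equiv.Perm (Fin 3) → ℝ := fun σ => ‖T.points (σ 1) - T.points (σ 0)‖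
  let e : Equiv.Perm (Fin 3) → Plane := fun σ => (L σ)⁻¹ • (T.points (σ 1) - T.points (σ 0))
  let v : Equiv.Perm (Fin 3) → Plane := fun σ => (1 / 2 : ℝ) • (T.points (σ 2) - T.points (σ 0))
  let γ : Equiv.Perm (Fin 3) → ℝ → Plane := fun σ t => T.points (σ 0) + t • e σ
  have hne : ∀ (σ : Equiv.Perm (Fin 3)) {a b : Fin 3}, a ≠ b → σ a ≠ σ b :=
    fun σ a b hab => σ.injective.ne hab
  have hL : ∀ σ, 0 < L σ := by
    intro σ
    rw [norm_pos_iff, sub_ne_zero]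
    exact T.independent.injective.ne (hne σ (by decide))
  have hLh : ∀ σ, L σ ≤ h := fun σ => hdiam _ (points_mem _) _ (points_mem _)
  have he : ∀ σ, ‖e σ‖ = 1 := fun σ => by
    simp only [e]
    rw [norm_smul, norm_inv, norm_norm, inv_mul_cancel₀ (hL σ).ne']
  have hdet : ∀ σ, det2 (e σ) (v σ) = triDet T (σ 0) (σ 1) (σ 2) / (2 * L σ) := by
    intro σ
    have := (hL σ).ne'
    simp only [det2, e, v, triDet, PiLp.smul_apply, smul_eq_mul]
    field_simp
  have hdge : ∀ σ, r ^ 2 / (2 * h) ≤ |det2 (e σ) (v σ)| := by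
    intro σ
    rw [hdet, abs_div, abs_of_pos (by linarith [hL σ] : 0 < 2 * L σ)]
    have h1 := sq_le_abs_triDet (hne σ (by decide : (0 : Fin 3) ≠ 1))
      (hne σ (by decide : (0 : Fin 3) ≠ 2)) (hne σ (by decide : (1 : Fin 3) ≠ 2)) hr.le hball
    have h2 := hLh σ
    have h3 := hL σ
    gcongr
  have hd0 : ∀ σ, det2 (e σ) (v σ) ≠ 0 := by
    intro σ h0
    have h1 := hdge σ
    rw [h0, abs_zero] at h1
    have : 0 < r ^ 2 / (2 * h) := div_pos (by positivity) (by linarith [hL σ, hLh σ])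
    linarith
  have hcover : frontier (openTri T) ⊆ ⋃ σ, γ σ '' Set.Icc 0 (L σ / 2) := by
    intro x hx
    rw [frontier_openTri] at hx
    obtain ⟨k, hk⟩ : ∃ k, bary T k x = 0 := by
      by_contra! hne
      exact hx.2 (mem_openTri.2 fun k => lt_of_le_of_ne (mem_closedTri.1 hx.1 k) (hne k).symm)
    -- Start from the end point with the larger barycentric coordinate, so that `x` lies in its half
    -- of the edge.
    obtain ⟨σ, hσ, hσ1⟩ : ∃ σ : Equiv.Perm (Fin 3), σ 2 = k ∧ bary T (σ 1) x ≤ bary T (σ 0) x := by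
      obtain ⟨σ, τ, h1, h2, h3, h4⟩ : ∃ σ τ : Equiv.Perm (Fin 3), σ 2 = k ∧ τ 2 = k ∧
          σ 0 = τ 1 ∧ σ 1 = τ 0 := by
        clear hk; revert k; decide
      rcases le_total (bary T (σ 1) x) (bary T (σ 0) x) with h | h
      · exact ⟨σ, h1, h⟩
      · exact ⟨τ, h2, by rw [← h3, ← h4]; exact h⟩
    have hsum := sum_bary (T := T) x
    have hxe := sum_bary_smul (T := T) x
    rw [sum_eq_of_ne (hne σ (by decide : (0 : Fin 3) ≠ 1))
      (hne σ (by decide : (0 : Fin 3) ≠ 2)) (hne σ (by decide : (1 : Fin 3) ≠ 2)), hσ, hk] at hsum hxe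
    refine Set.mem_iUnion.2 ⟨σ, bary T (σ 1) x * L σ, ⟨?_, ?_⟩, ?_⟩
    · exact mul_nonneg (mem_closedTri.1 hx.1 _) (hL σ).le
    · have : bary T (σ 1) x ≤ 1 / 2 := by linarith
      nlinarith [hL σ]
    · simp only [γ, e]
      rw [smul_smul, mul_assoc, mul_inv_cancel₀ (hL σ).ne', mul_one]
      conv_rhs => rw [← hxe]
      have : bary T (σ 0) x = 1 - bary T (σ 1) x := by linarith
      rw [this]
      module
  have hsub : ∀ σ, ∀ t ∈ Set.Icc (0 : ℝ) (L σ / 2), ∀ s ∈ Set.Ioo (0 : ℝ) 1,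
      parMap (T.points (σ 0)) (e σ) (v σ) t s ∈ closedTri T := by
    intro σ t ht s hs
    rw [mem_closedTri]
    intro l
    have h01 := hne σ (by decide : (0 : Fin 3) ≠ 1)
    have h02 := hne σ (by decide : (0 : Fin 3) ≠ 2)
    have h12 := hne σ (by decide : (1 : Fin 3) ≠ 2)
    have hq : t * (L σ)⁻¹ ≤ 1 / 2 := by
      rw [← div_eq_mul_inv, div_le_iff₀ (hL σ)]; linarith [ht.2]
    have hq0 : 0 ≤ t * (L σ)⁻¹ := mul_nonneg ht.1 (inv_nonneg.2 (hL σ).le)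
    rw [bary_parMap, map_smul, map_smul, bary_linear_sub, bary_linear_sub, bary_points,
      bary_points, bary_points]
    rcases eq_or_eq_or_eq_of_ne h01 h02 h12 l with rfl | rfl | rfl
    · simp only [if_true, h01, h02, if_false, smul_eq_mul]
      linarith [hs.2]
    · simp only [if_true, h01.symm, h12, if_false, smul_eq_mul]
      linarith [hs.2]
    · simp only [if_true, h02.symm, h12.symm, if_false, smul_eq_mul]
      linarith [hs.1]
  have hσ : ∀ σ, ENNReal.ofReal (r ^ 2 / (2 * h)) *
      ∫⁻ t in Set.Icc 0 (L σ / 2), ‖f (γ σ t)‖ₑ ^ 2 ≤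
      2 * (l2sq (volume.restrict (openTri T)) f +
        ENNReal.ofReal (h ^ 2) * ∑ i, l2sq (volume.restrict (openTri T)) (pderiv i f)) := by
    intro σ
    have h1 := trace_parallelogram_le measurableSet_Icc measurableSet_closedTri (hsub σ) (hd0 σ) hf
    -- The parallelogram may touch the boundary of the triangle, which is a null set.
    rw [← volume_restrict_openTri] at h1
    have h2 : ‖v σ‖ ≤ h := by
      have := hdiam _ (points_mem (σ 2)) _ (points_mem (σ 0))
      simp only [v, norm_smul]
      norm_num
      linarith [norm_nonneg (T.points (σ 2) - T.points (σ 0))]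
    calc _ ≤ ENNReal.ofReal |det2 (e σ) (v σ)| *
            ∫⁻ t in Set.Icc 0 (L σ / 2), ‖f (γ σ t)‖ₑ ^ 2 := by
          gcongr; exact hdge σ
      _ ≤ _ := h1
      _ ≤ 2 * l2sq (volume.restrict (openTri T)) f + 2 * (ENNReal.ofReal (h ^ 2) *
            ∑ i, l2sq (volume.restrict (openTri T)) (pderiv i f)) := by
          gcongr
          exact (l2sq_dirDeriv_le hf _ _).trans (by gcongr)
      _ = _ := by ring
  calc ENNReal.ofReal (r ^ 2 / (2 * h)) * l2sq (bdryMeasure (openTri T)) f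
      ≤ ENNReal.ofReal (r ^ 2 / (2 * h)) * ∑ σ, ∫⁻ t in Set.Icc 0 (L σ / 2), ‖f (γ σ t)‖ₑ ^ 2 := by
        gcongr
        calc l2sq (bdryMeasure (openTri T)) f
            ≤ ∫⁻ x in ⋃ σ, γ σ '' Set.Icc 0 (L σ / 2), ‖f x‖ₑ ^ 2
                ∂(Measure.hausdorffMeasure 1) := lintegral_mono_set hcover
          _ ≤ ∑' σ, ∫⁻ x in γ σ '' Set.Icc 0 (L σ / 2), ‖f x‖ₑ ^ 2
                ∂(Measure.hausdorffMeasure 1) := lintegral_iUnion_le _ _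
          _ = _ := by
              rw [tsum_fintype]
              exact Finset.sum_congr rfl fun σ _ =>
                setLIntegral_hausdorff_image (isometry_line _ (he σ)) _ _
    _ ≤ ∑ _σ : Equiv.Perm (Fin 3), 2 * (l2sq (volume.restrict (openTri T)) f +
        ENNReal.ofReal (h ^ 2) * ∑ i, l2sq (volume.restrict (openTri T)) (pderiv i f)) := by
        rw [Finset.mul_sum]
        exact Finset.sum_le_sum fun σ _ => hσ σ
    _ = _ := by
        rw [Finset.sum_const, Finset.card_univ, Fintype.card_perm]
        simp only [Fintype.card_fin, nsmul_eq_mul, ← mul_assoc]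
        norm_num [Nat.factorial]


/-! ### Lagrange interpolation on triangles -/

variable {T : Tri}

/-- The Lagrange node with multi-index `i`. -/
noncomputable def lagNode (T : Tri) (p : ℕ) (i : Fin 3 → ℕ) : Plane := ∑ k, ((i k : ℝ) / p) • T.points k

theorem sum_div_eq_one {p : ℕ} (hp : 1 ≤ p) {i : Fin 3 → ℕ} (hi : ∑ k, i k = p) :
    ∑ k, ((i k : ℝ) / p) = 1 := by
  rw [← Finset.sum_div, ← Nat.cast_sum, hi]
  exact div_self (by positivity)

theorem bary_lagNode {p : ℕ} (hp : 1 ≤ p) {i : Fin 3 → ℕ} (hi : ∑ k, i k = p) (k : Fin 3) :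
    bary T k (lagNode T p i) = i k / p :=
  bary_sum k (sum_div_eq_one hp hi)

theorem lagNode_mem {p : ℕ} (hp : 1 ≤ p) {i : Fin 3 → ℕ} (hi : ∑ k, i k = p) :
    lagNode T p i ∈ closedTri T :=
  mem_closedTri.2 fun k => by rw [bary_lagNode hp hi]; positivity

/-- Barycentric coordinates as polynomials. -/
noncomputable def baryPoly (T : Tri) (k : Fin 3) : MvPolynomial (Fin 2) ℝ :=
  MvPolynomial.C (bary T k 0) + ∑ i : Fin 2,
    MvPolynomial.C ((bary T k).linear (EuclideanSpace.single i 1)) * MvPolynomial.X i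

theorem polyFun_baryPoly (k : Fin 3) (x : Plane) : polyFun (baryPoly T k) x = bary T k x := by
  have h := bary_add (T := T) k 0 x
  rw [zero_add] at h
  rw [h]
  conv_rhs => rw [plane_eq_sum x]
  simp [polyFun, baryPoly, mul_comm]

theorem pderiv_baryPoly (k : Fin 3) (i : Fin 2) : MvPolynomial.pderiv i (baryPoly T k) =
    MvPolynomial.C ((bary T k).linear (EuclideanSpace.single i 1)) := by
  unfold baryPoly
  fin_cases i <;> simp [MvPolynomial.pderiv_X]

theorem totalDegree_baryPoly (k : Fin 3) : (baryPoly T k).totalDegree ≤ 1 := by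
  unfold baryPoly
  refine (MvPolynomial.totalDegree_add _ _).trans (max_le (by simp) ?_)
  refine (MvPolynomial.totalDegree_finsetSum _ _).trans (Finset.sup_le fun i _ => ?_)
  refine (MvPolynomial.totalDegree_mul _ _).trans ?_
  simp

/-- One factor of a Lagrange basis polynomial. -/
noncomputable def lagFactor (T : Tri) (p : ℕ) (n : ℕ) (k : Fin 3) (j : ℕ) : MvPolynomial (Fin 2) ℝ :=
  MvPolynomial.C ((n : ℝ) - j)⁻¹ * (MvPolynomial.C (p : ℝ) * baryPoly T k - MvPolynomial.C (j : ℝ))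

/-- The Lagrange basis polynomial of the node with multi-index `i`. -/
noncomputable def lagBasis (T : Tri) (p : ℕ) (i : Fin 3 → ℕ) : MvPolynomial (Fin 2) ℝ :=
  ∏ k, ∏ j ∈ Finset.range (i k), lagFactor T p (i k) k j

theorem polyFun_lagFactor (p n : ℕ) (k : Fin 3) (j : ℕ) (x : Plane) :
    polyFun (lagFactor T p n k j) x = ((n : ℝ) - j)⁻¹ * (p * bary T k x - j) := by
  rw [← polyFun_baryPoly]
  simp [polyFun, lagFactor]

theorem polyFun_lagBasis (p : ℕ) (i : Fin 3 → ℕ) (x : Plane) : polyFun (lagBasis T p i) x =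
    ∏ k, ∏ j ∈ Finset.range (i k), polyFun (lagFactor T p (i k) k j) x := by
  simp [polyFun, lagBasis, map_prod]

/-- At the node `m` the factors become `(m k - j) / (i k - j)` for `j < i k`. They all equal 1 when
`m = i`. Otherwise equal sums force `m k < i k` for some `k`, and the factor with `j = m k`
vanishes. -/
theorem polyFun_lagBasis_node {p : ℕ} (hp : 1 ≤ p) {i m : Fin 3 → ℕ} (hi : ∑ k, i k = p)
    (hm : ∑ k, m k = p) :
    polyFun (lagBasis T p i) (lagNode T p m) = if i = m then 1 else 0 := by
  have hp0 : (p : ℝ) ≠ 0 := by positivity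
  rw [polyFun_lagBasis]
  split_ifs with h
  · subst h
    refine Finset.prod_eq_one fun k _ => Finset.prod_eq_one fun j hj => ?_
    rw [polyFun_lagFactor, bary_lagNode hp hi, mul_div_cancel₀ _ hp0]
    have : (j : ℝ) < i k := by exact_mod_cast Finset.mem_range.1 hj
    exact inv_mul_cancel₀ (by linarith)
  · obtain ⟨k, hk⟩ : ∃ k, m k < i k := by
      by_contra! hle
      refine h (funext fun k => ?_)
      have := (Finset.sum_eq_sum_iff_of_le fun k _ => hle k).1 (hi.trans hm.symm)
      exact this k (Finset.mem_univ k)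
    refine Finset.prod_eq_zero (Finset.mem_univ k)
      (Finset.prod_eq_zero (Finset.mem_range.2 hk) ?_)
    rw [polyFun_lagFactor, bary_lagNode hp hm, mul_div_cancel₀ _ hp0, sub_self, mul_zero]

theorem totalDegree_lagBasis (p : ℕ) (i : Fin 3 → ℕ) :
    (lagBasis T p i).totalDegree ≤ ∑ k, i k := by
  refine (MvPolynomial.totalDegree_finsetProd _ _).trans (Finset.sum_le_sum fun k _ => ?_)
  refine (MvPolynomial.totalDegree_finsetProd _ _).trans ?_
  calc _ ≤ ∑ j ∈ Finset.range (i k), 1 := Finset.sum_le_sum fun j _ => by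
        unfold lagFactor
        refine (MvPolynomial.totalDegree_mul _ _).trans ?_
        rw [MvPolynomial.totalDegree_C, zero_add]
        refine (MvPolynomial.totalDegree_sub _ _).trans (max_le ?_
          (by rw [MvPolynomial.totalDegree_C]; exact Nat.zero_le _))
        refine (MvPolynomial.totalDegree_mul _ _).trans ?_
        rw [MvPolynomial.totalDegree_C, zero_add]
        exact totalDegree_baryPoly k
    _ = i k := by simp

/-- The multi-indices of the Lagrange nodes. -/
def nodeIdx (p : ℕ) : Finset (Fin 3 → ℕ) := Finset.Nat.antidiagonalTuple 3 p

theorem mem_nodeIdx {p : ℕ} {i : Fin 3 → ℕ} : i ∈ nodeIdx p ↔ ∑ k, i k = p :=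
  Finset.Nat.mem_antidiagonalTuple

/-- The Lagrange interpolation polynomial with given nodal values. -/
noncomputable def lagInterp (T : Tri) (p : ℕ) (c : (Fin 3 → ℕ) → ℝ) : MvPolynomial (Fin 2) ℝ :=
  ∑ i ∈ nodeIdx p, MvPolynomial.C (c i) * lagBasis T p i

theorem polyFun_lagInterp (p : ℕ) (c : (Fin 3 → ℕ) → ℝ) (x : Plane) :
    polyFun (lagInterp T p c) x = ∑ i ∈ nodeIdx p, c i * polyFun (lagBasis T p i) x := by
  simp [polyFun, lagInterp]

theorem polyFun_lagInterp_node {p : ℕ} (hp : 1 ≤ p) (c : (Fin 3 → ℕ) → ℝ) {m : Fin 3 → ℕ}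
    (hm : m ∈ nodeIdx p) : polyFun (lagInterp T p c) (lagNode T p m) = c m := by
  rw [polyFun_lagInterp, Finset.sum_eq_single_of_mem m hm]
  · rw [polyFun_lagBasis_node hp (mem_nodeIdx.1 hm) (mem_nodeIdx.1 hm), if_pos rfl, mul_one]
  · intro i hi hne
    rw [polyFun_lagBasis_node hp (mem_nodeIdx.1 hi) (mem_nodeIdx.1 hm), if_neg hne, mul_zero]

theorem totalDegree_lagInterp (p : ℕ) (c : (Fin 3 → ℕ) → ℝ) :
    (lagInterp T p c).totalDegree ≤ p := by
  refine (MvPolynomial.totalDegree_finsetSum _ _).trans (Finset.sup_le fun i hi => ?_)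
  refine (MvPolynomial.totalDegree_mul _ _).trans ?_
  rw [MvPolynomial.totalDegree_C, zero_add]
  exact (totalDegree_lagBasis p i).trans_eq (mem_nodeIdx.1 hi)

/-- Exponent pairs of total degree at most `p` embed into the nodes by completing the pair to a
triple with sum `p`. This is the half of the dimension count that surjectivity of nodal evaluation
does not supply. -/
theorem card_nodeIdx_ge (p : ℕ) :
    Module.finrank ℝ (MvPolynomial.restrictTotalDegree (Fin 2) ℝ p) ≤ Fintype.card (nodeIdx p) := by
  let S : Set (Fin 2 →₀ ℕ) := {n | (n.sum fun _ e => e) ≤ p}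
  have hs : ∀ n : Fin 2 →₀ ℕ, (n.sum fun _ e => e) = n 0 + n 1 := fun n => by
    rw [Finsupp.sum_fintype _ _ (by simp), Fin.sum_univ_two]
  change Module.finrank ℝ (MvPolynomial.restrictSupport ℝ S) ≤ _
  rw [Module.finrank_eq_nat_card_basis (MvPolynomial.basisRestrictSupport ℝ S),
    ← Nat.card_eq_fintype_card]
  let F : S → nodeIdx p := fun n => ⟨![n.1 0, n.1 1, p - n.1 0 - n.1 1], by
    have h := n.2
    simp only [S, Set.mem_ofPred_eq, hs] at h
    rw [mem_nodeIdx, Fin.sum_univ_three]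
    simp
    omega⟩
  refine Nat.card_le_card_of_injective F fun n m hnm => ?_
  have h := congrArg Subtype.val hnm
  have h0 := congrFun h 0
  have h1 := congrFun h 1
  ext a
  fin_cases a
  · simpa [F] using h0
  · simpa [F] using h1

/-- Polynomials of degree at most `p` are determined by their values at the Lagrange nodes. -/
theorem eq_of_eq_at_nodes {p : ℕ} (hp : 1 ≤ p) {q q' : MvPolynomial (Fin 2) ℝ}
    (hq : q.totalDegree ≤ p) (hq' : q'.totalDegree ≤ p)
    (h : ∀ i ∈ nodeIdx p, polyFun q (lagNode T p i) = polyFun q' (lagNode T p i)) : q = q' := by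
  let V := MvPolynomial.restrictTotalDegree (Fin 2) ℝ p
  let ev : V →ₗ[ℝ] (nodeIdx p → ℝ) :=
    { toFun := fun q i => polyFun q.1 (lagNode T p i)
      map_add' := fun q r => by ext i; simp [polyFun]
      map_smul' := fun c q => by ext i; simp [polyFun] }
  -- The Lagrange basis attains all nodal values; equality of dimensions then turns surjectivity
  -- into injectivity.
  have hsurj : Function.Surjective ev := by
    intro c
    let c' : (Fin 3 → ℕ) → ℝ := fun i => if hi : i ∈ nodeIdx p then c ⟨i, hi⟩ else 0
    refine ⟨⟨lagInterp T p c', (MvPolynomial.mem_restrictTotalDegree _ _ _).2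
      (totalDegree_lagInterp p c')⟩, ?_⟩
    ext i
    change polyFun (lagInterp T p c') (lagNode T p i) = _
    rw [polyFun_lagInterp_node hp _ i.2]
    simp only [c', dif_pos i.2]
  have hfin : Module.finrank ℝ V = Module.finrank ℝ (nodeIdx p → ℝ) := by
    rw [Module.finrank_fintype_fun_eq_card]
    refine le_antisymm (card_nodeIdx_ge p) ?_
    have := LinearMap.finrank_le_finrank_of_surjective hsurj
    rwa [Module.finrank_fintype_fun_eq_card] at this
  have hinj : Function.Injective ev :=
    (LinearMap.injective_iff_surjective_of_finrank_eq_finrank hfin).2 hsurj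
  have := @hinj ⟨q, (MvPolynomial.mem_restrictTotalDegree _ _ _).2 hq⟩
    ⟨q', (MvPolynomial.mem_restrictTotalDegree _ _ _).2 hq'⟩ (funext fun i => h i i.2)
  exact congrArg Subtype.val this

theorem isLagrange_lagrangePoly {p : ℕ} (hp : 1 ≤ p) (f : Plane → ℝ) :
    IsLagrange T p f (lagrangePoly T p f) := by
  have h : ∃ q, IsLagrange T p f q :=
    ⟨lagInterp T p fun i => f (lagNode T p i), totalDegree_lagInterp p _, fun i hi =>
      polyFun_lagInterp_node hp (fun i => f (lagNode T p i)) (mem_nodeIdx.2 hi)⟩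
  rw [lagrangePoly, dif_pos h]
  exact h.choose_spec

theorem IsLagrange.eval_node {p : ℕ} {f : Plane → ℝ} {q : MvPolynomial (Fin 2) ℝ}
    (h : IsLagrange T p f q) {i : Fin 3 → ℕ} (hi : i ∈ nodeIdx p) :
    polyFun q (lagNode T p i) = f (lagNode T p i) := h.2 i (mem_nodeIdx.1 hi)

/-- Scaled bounds on a polynomial and its derivatives up to order two on a triangle. -/
def PolyBound (T : Tri) (r M : ℝ) (q : MvPolynomial (Fin 2) ℝ) : Prop :=
  ∀ x ∈ closedTri T, |polyFun q x| ≤ M ∧ (∀ i, |polyFun (MvPolynomial.pderiv i q) x| * r ≤ M) ∧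
    ∀ i j, |polyFun (MvPolynomial.pderiv i (MvPolynomial.pderiv j q)) x| * r ^ 2 ≤ M

theorem polyFun_mul (q q' : MvPolynomial (Fin 2) ℝ) (x : Plane) :
    polyFun (q * q') x = polyFun q x * polyFun q' x := by simp [polyFun]

/-- Leibniz's rule; a second derivative of a product has four terms, whence the factor 4. -/
theorem PolyBound.mul {r M M' : ℝ} (hr : 0 ≤ r) {q q' : MvPolynomial (Fin 2) ℝ}
    (h : PolyBound T r M q) (h' : PolyBound T r M' q') : PolyBound T r (4 * M * M') (q * q') := by
  intro x hx
  obtain ⟨a, b, c⟩ := h x hx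
  obtain ⟨a', b', c'⟩ := h' x hx
  have hM : 0 ≤ M := (abs_nonneg _).trans a
  have hM' : 0 ≤ M' := (abs_nonneg _).trans a'
  have hMM : 0 ≤ M * M' := mul_nonneg hM hM'
  have hprod : ∀ {s t : ℝ}, 0 ≤ s → s ≤ M → 0 ≤ t → t ≤ M' → s * t ≤ M * M' :=
    fun h1 h2 h3 h4 => mul_le_mul h2 h4 h3 hM
  refine ⟨?_, fun i => ?_, fun i j => ?_⟩
  · rw [polyFun_mul, abs_mul]
    have := hprod (abs_nonneg _) a (abs_nonneg _) a'
    linarith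
  · rw [Derivation.leibniz, polyFun_add]
    simp only [Pi.add_apply, smul_eq_mul, polyFun_mul]
    have h1 := hprod (abs_nonneg _) a (by positivity) (b' i)
    have h2 := hprod (by positivity) (b i) (abs_nonneg _) a'
    calc _ ≤ (|polyFun q x| * |polyFun (MvPolynomial.pderiv i q') x| +
          |polyFun q' x| * |polyFun (MvPolynomial.pderiv i q) x|) * r := by
          gcongr
          refine (abs_add_le _ _).trans_eq ?_
          rw [abs_mul, abs_mul]
      _ = |polyFun q x| * (|polyFun (MvPolynomial.pderiv i q') x| * r) +
          |polyFun (MvPolynomial.pderiv i q) x| * r * |polyFun q' x| := by ring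
      _ ≤ _ := by linarith
  · rw [Derivation.leibniz, map_add, smul_eq_mul, smul_eq_mul, Derivation.leibniz,
      Derivation.leibniz]
    simp only [polyFun_add, Pi.add_apply, smul_eq_mul, polyFun_mul]
    have h1 := hprod (abs_nonneg _) a (by positivity) (c' i j)
    have h2 := hprod (by positivity) (b i) (by positivity) (b' j)
    have h3 := hprod (by positivity) (b j) (by positivity) (b' i)
    have h4 := hprod (by positivity) (c i j) (abs_nonneg _) a'
    calc _ ≤ ((|polyFun q x| * |polyFun (MvPolynomial.pderiv i (MvPolynomial.pderiv j q')) x| +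
          |polyFun (MvPolynomial.pderiv j q') x| * |polyFun (MvPolynomial.pderiv i q) x|) +
          (|polyFun q' x| * |polyFun (MvPolynomial.pderiv i (MvPolynomial.pderiv j q)) x| +
          |polyFun (MvPolynomial.pderiv j q) x| * |polyFun (MvPolynomial.pderiv i q') x|)) * r ^ 2 := by
          gcongr
          refine (abs_add_le _ _).trans (add_le_add ?_ ?_) <;>
          · refine (abs_add_le _ _).trans_eq ?_
            rw [abs_mul, abs_mul]
      _ = |polyFun q x| * (|polyFun (MvPolynomial.pderiv i (MvPolynomial.pderiv j q')) x| * r ^ 2) +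
          |polyFun (MvPolynomial.pderiv i q) x| * r * (|polyFun (MvPolynomial.pderiv j q') x| * r) +
          |polyFun (MvPolynomial.pderiv j q) x| * r * (|polyFun (MvPolynomial.pderiv i q') x| * r) +
          |polyFun (MvPolynomial.pderiv i (MvPolynomial.pderiv j q)) x| * r ^ 2 * |polyFun q' x| := by
          ring
      _ ≤ _ := by linarith

theorem polyBound_C (r c : ℝ) : PolyBound T r |c| (MvPolynomial.C c) := by
  intro x _
  simp [polyFun]

theorem PolyBound.add {r M M' : ℝ} {q q' : MvPolynomial (Fin 2) ℝ} (hr : 0 ≤ r)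
    (h : PolyBound T r M q) (h' : PolyBound T r M' q') : PolyBound T r (M + M') (q + q') := by
  intro x hx
  obtain ⟨a, b, c⟩ := h x hx
  obtain ⟨a', b', c'⟩ := h' x hx
  refine ⟨?_, fun i => ?_, fun i j => ?_⟩
  · rw [polyFun_add]
    exact (abs_add_le _ _).trans (add_le_add a a')
  · rw [map_add, polyFun_add]
    refine (mul_le_mul_of_nonneg_right (abs_add_le _ _) hr).trans ?_
    rw [add_mul]
    exact add_le_add (b i) (b' i)
  · rw [map_add, map_add, polyFun_add]
    refine (mul_le_mul_of_nonneg_right (abs_add_le _ _) (sq_nonneg r)).trans ?_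
    rw [add_mul]
    exact add_le_add (c i j) (c' i j)

theorem PolyBound.mono {r M M' : ℝ} {q : MvPolynomial (Fin 2) ℝ} (h : PolyBound T r M q)
    (hM : M ≤ M') : PolyBound T r M' q := fun x hx =>
  ⟨(h x hx).1.trans hM, fun i => ((h x hx).2.1 i).trans hM, fun i j => ((h x hx).2.2 i j).trans hM⟩

theorem PolyBound.const_mul {r M : ℝ} {q : MvPolynomial (Fin 2) ℝ} (h : PolyBound T r M q) (c : ℝ) :
    PolyBound T r (|c| * M) (MvPolynomial.C c * q) := by
  have h1 : ∀ q' : MvPolynomial (Fin 2) ℝ, ∀ x, polyFun (MvPolynomial.C c * q') x = c * polyFun q' x :=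
    fun q' x => by simp [polyFun]
  intro x hx
  obtain ⟨a, b, d⟩ := h x hx
  simp only [MvPolynomial.pderiv_C_mul, h1, abs_mul, mul_assoc]
  exact ⟨mul_le_mul_of_nonneg_left a (abs_nonneg c),
    fun i => mul_le_mul_of_nonneg_left (b i) (abs_nonneg c),
    fun i j => mul_le_mul_of_nonneg_left (d i j) (abs_nonneg c)⟩

theorem polyBound_sum {ι : Type*} {r M : ℝ} (hr : 0 ≤ r) (s : Finset ι)
    {q : ι → MvPolynomial (Fin 2) ℝ} (h : ∀ i ∈ s, PolyBound T r M (q i)) :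
    PolyBound T r (s.card * M) (∑ i ∈ s, q i) := by
  classical
  induction s using Finset.induction_on with
  | empty => simpa using polyBound_C (T := T) r 0
  | insert a s ha ih =>
    rw [Finset.sum_insert ha, Finset.card_insert_of_notMem ha]
    refine ((h a (by simp)).add hr (ih fun i hi => h i (by simp [hi]))).mono ?_
    push_cast; linarith

theorem polyBound_prod {ι : Type*} {r M : ℝ} (hr : 0 ≤ r) (s : Finset ι)
    {q : ι → MvPolynomial (Fin 2) ℝ} (h : ∀ i ∈ s, PolyBound T r M (q i)) :
    PolyBound T r ((4 * M) ^ s.card) (∏ i ∈ s, q i) := by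
  classical
  induction s using Finset.induction_on with
  | empty => simpa using polyBound_C (T := T) r 1
  | insert a s ha ih =>
    rw [Finset.prod_insert ha, Finset.card_insert_of_notMem ha, pow_succ']
    exact (h a (by simp)).mul hr (ih fun i hi => h i (by simp [hi]))

/-- The factor is affine: before normalisation its values lie between `-p` and `p` and its gradient
is at most `p / r`. The normalising denominator `n - j` is a positive integer. -/
theorem polyBound_lagFactor {z : Plane} {r : ℝ} (hr : 0 < r) (hball : Metric.ball z r ⊆ openTri T)
    {p n : ℕ} (hnp : n ≤ p) (k : Fin 3) {j : ℕ} (hj : j < n) :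
    PolyBound T r p (lagFactor T p n k j) := by
  have hinv : |((n : ℝ) - j)⁻¹| ≤ 1 := by
    have : (j : ℝ) + 1 ≤ n := by exact_mod_cast hj
    rw [abs_of_pos (inv_pos.2 (by linarith))]
    exact inv_le_one_of_one_le₀ (by linarith)
  have h1 : PolyBound T r p (MvPolynomial.C (p : ℝ) * baryPoly T k - MvPolynomial.C (j : ℝ)) := by
    intro x hx
    have b0 := mem_closedTri.1 hx k
    have b1 := bary_le_one hx k
    have hjp : (j : ℝ) ≤ p := by exact_mod_cast (hj.le.trans hnp)
    have hp0 : (0 : ℝ) ≤ p := Nat.cast_nonneg p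
    refine ⟨?_, fun i => ?_, fun i j' => ?_⟩
    · have : polyFun (MvPolynomial.C (p : ℝ) * baryPoly T k - MvPolynomial.C (j : ℝ)) x =
          p * bary T k x - j := by
        rw [← polyFun_baryPoly]; simp [polyFun]
      rw [this, abs_le]
      constructor <;> nlinarith [(Nat.cast_nonneg j : (0 : ℝ) ≤ j)]
    · have : polyFun (MvPolynomial.pderiv i
          (MvPolynomial.C (p : ℝ) * baryPoly T k - MvPolynomial.C (j : ℝ))) x =
          p * (bary T k).linear (EuclideanSpace.single i 1) := by
        simp [polyFun, pderiv_baryPoly]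
      rw [this, abs_mul, abs_of_nonneg hp0, mul_assoc]
      refine mul_le_of_le_one_right hp0 ?_
      have := abs_bary_linear_le hr hball k (EuclideanSpace.single i 1)
      rwa [PiLp.norm_single, norm_one, le_div_iff₀ hr] at this
    · have : polyFun (MvPolynomial.pderiv i (MvPolynomial.pderiv j'
          (MvPolynomial.C (p : ℝ) * baryPoly T k - MvPolynomial.C (j : ℝ)))) x = 0 := by
        simp [polyFun, pderiv_baryPoly]
      rw [this]; simp
  refine (h1.const_mul _).mono ?_
  exact mul_le_of_le_one_left (Nat.cast_nonneg p) hinv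

/-- For each of the three vertices a product of at most `p` factors with bound `p` costs `(4 p) ^
p`; the outer product costs a further factor 4 for each vertex. -/
theorem polyBound_lagBasis {z : Plane} {r : ℝ} (hr : 0 < r) (hball : Metric.ball z r ⊆ openTri T)
    {p : ℕ} (hp : 1 ≤ p) {i : Fin 3 → ℕ} (hi : i ∈ nodeIdx p) :
    PolyBound T r ((4 * (4 * p : ℝ) ^ p) ^ 3) (lagBasis T p i) := by
  have hle : ∀ k, i k ≤ p := fun k => by
    rw [← mem_nodeIdx.1 hi]
    exact Finset.single_le_sum (fun _ _ => Nat.zero_le _) (Finset.mem_univ k)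
  have h1 : ∀ k ∈ Finset.univ, PolyBound T r ((4 * p : ℝ) ^ p)
      (∏ j ∈ Finset.range (i k), lagFactor T p (i k) k j) := by
    intro k _
    refine (polyBound_prod hr.le _ fun j hj =>
      polyBound_lagFactor hr hball (hle k) k (Finset.mem_range.1 hj)).mono ?_
    rw [Finset.card_range]
    refine pow_le_pow_right₀ ?_ (hle k)
    have : (1 : ℝ) ≤ p := by exact_mod_cast hp
    linarith
  have := polyBound_prod hr.le Finset.univ h1
  rw [Finset.card_univ, Fintype.card_fin] at this
  exact this

/-- Inverse estimate: nodal values control a polynomial and its derivatives. -/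
theorem polyBound_of_nodes {z : Plane} {r : ℝ} (hr : 0 < r) (hball : Metric.ball z r ⊆ openTri T)
    {p : ℕ} (hp : 1 ≤ p) {q : MvPolynomial (Fin 2) ℝ} (hq : q.totalDegree ≤ p) {N : ℝ}
    (hN : ∀ i ∈ nodeIdx p, |polyFun q (lagNode T p i)| ≤ N) :
    PolyBound T r (((nodeIdx p).card * (4 * (4 * p : ℝ) ^ p) ^ 3) * N) q := by
  -- By unisolvence `q` equals its own Lagrange expansion, so the bounds on the basis transfer.
  have hq' : q = lagInterp T p fun i => polyFun q (lagNode T p i) :=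
    eq_of_eq_at_nodes hp hq (totalDegree_lagInterp p _) fun i hi =>
      (polyFun_lagInterp_node hp (fun i => polyFun q (lagNode T p i)) hi).symm
  rw [hq', lagInterp, mul_assoc]
  refine polyBound_sum hr.le _ fun i hi => ?_
  refine ((polyBound_lagBasis hr hball hp hi).const_mul _).mono ?_
  rw [mul_comm]
  gcongr
  exact hN i hi


/-! ### Interpolation error on one element -/

variable {T : Tri}

theorem semiSq_sub_le (μ : Measure Plane) (k : ℕ) {f g : Plane → ℝ} (hf : ContDiff ℝ ∞ f)
    (hg : ContDiff ℝ ∞ g) : semiSq μ k (f - g) ≤ 2 * semiSq μ k f + 2 * semiSq μ k g := by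
  unfold semiSq
  rw [Finset.mul_sum, Finset.mul_sum, ← Finset.sum_add_distrib]
  refine Finset.sum_le_sum fun α _ => ?_
  rw [mderiv_sub hf hg]
  exact l2sq_sub_le (aestronglyMeasurable_of_contDiff (contDiff_mderiv hf α) μ)

/-- The triangle lies in a disc of radius `h` about a vertex, and `π ≤ 4`. -/
theorem volume_closedTri_le {h : ℝ} (hh : 0 ≤ h)
    (hdiam : ∀ x ∈ closedTri T, ∀ y ∈ closedTri T, ‖x - y‖ ≤ h) :
    volume (closedTri T) ≤ 4 * ENNReal.ofReal (h ^ 2) := by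
  have hsub : closedTri T ⊆ Metric.closedBall (T.points 0) h := fun x hx => by
    rw [Metric.mem_closedBall, dist_eq_norm]
    exact hdiam x hx _ (points_mem 0)
  refine (measure_mono hsub).trans ?_
  rw [EuclideanSpace.volume_closedBall_fin_two, mul_comm, ← ENNReal.ofReal_pow hh]
  gcongr
  calc _ = ENNReal.ofReal Real.pi := by
        rw [← NNReal.coe_real_pi, ENNReal.ofReal_coe_nnreal]
    _ ≤ ENNReal.ofReal 4 := ENNReal.ofReal_le_ofReal Real.pi_le_four
    _ = 4 := by simp

theorem PolyBound.mderiv_le {r M : ℝ} {q : MvPolynomial (Fin 2) ℝ} (hq : PolyBound T r M q)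
    {α : ℕ × ℕ} (hα : α.1 + α.2 ≤ 2) {x : Plane} (hx : x ∈ closedTri T) :
    |mderiv α (polyFun q) x| * r ^ (α.1 + α.2) ≤ M := by
  obtain ⟨h0, h1, h2⟩ := hq x hx
  obtain ⟨i, j⟩ := α
  rw [mderiv_polyFun]
  simp only at hα ⊢
  have hi : i ≤ 2 := by omega
  have hj : j ≤ 2 := by omega
  interval_cases i <;> interval_cases j <;> try omega
  · rw [add_zero, pow_zero, mul_one]; exact h0
  · rw [zero_add, pow_one]; exact h1 1
  · rw [zero_add]; exact h2 1 1
  · rw [add_zero, pow_one]; exact h1 0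
  · exact h2 0 1
  · rw [add_zero]; exact h2 0 0

theorem PolyBound.semiSq_le {r M : ℝ} (hr : 0 ≤ r) {q : MvPolynomial (Fin 2) ℝ}
    (hq : PolyBound T r M q) {k : ℕ} (hk : k ≤ 2) :
    ENNReal.ofReal (r ^ 2) ^ k * semiSq (volume.restrict (openTri T)) k (polyFun q) ≤
      3 * (‖M‖ₑ ^ 2 * volume (closedTri T)) := by
  unfold semiSq
  rw [Finset.mul_sum]
  have h1 : ∀ α ∈ Finset.HasAntidiagonal.antidiagonal k, ENNReal.ofReal (r ^ 2) ^ k *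
      l2sq (volume.restrict (openTri T)) (mderiv α (polyFun q)) ≤
      ‖M‖ₑ ^ 2 * volume (closedTri T) := by
    intro α hα
    have hα' := Finset.HasAntidiagonal.mem_antidiagonal.1 hα
    have : ENNReal.ofReal (r ^ 2) ^ k = ‖r ^ k‖ₑ ^ 2 := by
      rw [enorm_sq_eq_ofReal, ← ENNReal.ofReal_pow (sq_nonneg r)]
      congr 1; ring
    rw [this, ← l2sq_const_mul, volume_restrict_openTri]
    refine l2sq_le_of_bound measurableSet_closedTri fun x hx => ?_
    rw [Real.enorm_eq_ofReal_abs, Real.enorm_eq_ofReal_abs]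
    refine ENNReal.ofReal_le_ofReal (le_trans ?_ (le_abs_self M))
    have := hq.mderiv_le (by omega : α.1 + α.2 ≤ 2) hx
    rw [hα', mul_comm] at this
    rwa [abs_mul, abs_of_nonneg (pow_nonneg hr k)]
  refine (Finset.sum_le_card_nsmul _ _ _ h1).trans ?_
  rw [Finset.Nat.card_antidiagonal, nsmul_eq_mul]
  gcongr
  exact_mod_cast (by omega : k + 1 ≤ 3)

/-- The geometric hypotheses on a mesh element: the diameter is at most `h` and there is an
inscribed disc of radius `ρ h`. -/
def Regular (T : Tri) (ρ h : ℝ) : Prop :=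
  (∀ x ∈ closedTri T, ∀ y ∈ closedTri T, ‖x - y‖ ≤ h) ∧
    ∃ z : Plane, Metric.ball z (ρ * h) ⊆ openTri T

/-- Split `f - q = (f - P) - (q - P)` with `P` the averaged polynomial. The first part is small by
iterated Poincaré. The second is a polynomial of degree at most `p`, controlled by its nodal values,
that is, by those of `f - P` (Sobolev) and of `f - q`. The tolerance `N` is there because the
estimate is applied to smooth approximations of `v`, which `q` interpolates only in the limit. -/
theorem semiSq_sub_polyFun_le {ρ : ℝ} (hρ : 0 < ρ) {n p : ℕ} (hp : 1 ≤ p) (hn : 2 ≤ n)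
    (hnp : n ≤ p + 1) : ∃ C : ℝ≥0∞, C ≠ ⊤ ∧ ∀ (T : Tri) (h : ℝ), 0 < h → Regular T ρ h →
      ∀ f : Plane → ℝ, ContDiff ℝ ∞ f → ∀ q : MvPolynomial (Fin 2) ℝ, q.totalDegree ≤ p →
      ∀ N : ℝ≥0∞, (∀ i ∈ nodeIdx p, ‖f (lagNode T p i) - polyFun q (lagNode T p i)‖ₑ ^ 2 ≤ N) →
      ∀ k ≤ 2, ENNReal.ofReal (h ^ 2) ^ k *
          semiSq (volume.restrict (openTri T)) k (f - polyFun q) ≤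
        C * (ENNReal.ofReal (h ^ 2) ^ n * semiSq (volume.restrict (openTri T)) n f +
          ENNReal.ofReal (h ^ 2) * N) := by
  set K : ℝ := (nodeIdx p).card * (4 * (4 * p : ℝ) ^ p) ^ 3 with hK
  set R : ℝ≥0∞ := ∑ k ∈ Finset.range 3, (ENNReal.ofReal (ρ ^ 2) ^ k)⁻¹ with hR
  set K1 : ℝ≥0∞ := (ENNReal.ofReal (ρ ^ 2 / 12))⁻¹ * (24 * 8 ^ n) with hK1
  have hρ1 : ENNReal.ofReal (ρ ^ 2 / 12) ≠ 0 := by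
    rw [Ne, ENNReal.ofReal_eq_zero, not_le]; positivity
  have hρ2 : ENNReal.ofReal (ρ ^ 2) ≠ 0 := by
    rw [Ne, ENNReal.ofReal_eq_zero, not_le]; positivity
  have hRt : R ≠ ⊤ := ENNReal.sum_ne_top.2 fun k _ => ENNReal.inv_ne_top.2 (pow_ne_zero _ hρ2)
  have h8 : (8 : ℝ≥0∞) ^ n ≠ ⊤ := ENNReal.pow_ne_top (by simp)
  have hK1t : K1 ≠ ⊤ := ENNReal.mul_ne_top (ENNReal.inv_ne_top.2 hρ1)
    (ENNReal.mul_ne_top (by simp) h8)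
  refine ⟨2 * 8 ^ n + 48 * R * ‖K‖ₑ ^ 2 * (1 + K1), ENNReal.add_ne_top.2
    ⟨ENNReal.mul_ne_top (by simp) h8, ENNReal.mul_ne_top (ENNReal.mul_ne_top
      (ENNReal.mul_ne_top (by simp) hRt) (by simp)) (by simp [hK1t])⟩, ?_⟩
  rintro T h hh ⟨hdiam, z, hball⟩ f hf q hq N hN k hk
  set μ : Measure Plane := volume.restrict (openTri T)
  set H := ENNReal.ofReal (h ^ 2) with hH
  have hr : 0 < ρ * h := mul_pos hρ hh
  obtain ⟨P, hP, hPk⟩ := exists_poly_semiSq_le isOpen_openTri.measurableSet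
    (convex_openTri (T := T)) isBounded_openTri (h := h)
    (fun x hx y hy => hdiam y (openTri_subset hy) x (openTri_subset hx)) volume_openTri_ne_zero n hf
  set A := H ^ n * semiSq μ n f with hA
  have hsm : ContDiff ℝ ∞ (f - polyFun P) := hf.sub (contDiff_polyFun P)
  -- In scaled form the orders 0, 1 and 2 all have the same bound; `8 ^ (n - k)` is enlarged to `8 ^
  -- n`.
  have hE : ∀ k ≤ 2, H ^ k * semiSq μ k (f - polyFun P) ≤ 8 ^ n * A := by
    intro k hk
    calc _ ≤ H ^ k * ((8 * H) ^ (n - k) * semiSq μ n f) := by gcongr; exact hPk k (hk.trans hn)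
      _ = 8 ^ (n - k) * (H ^ (k + (n - k)) * semiSq μ n f) := by rw [mul_pow, pow_add]; ring
      _ ≤ 8 ^ n * A := by
          rw [Nat.add_sub_cancel' (hk.trans hn)]
          gcongr
          · norm_num
          · exact Nat.sub_le _ _
  -- The Sobolev constant 8 times three terms bounded by `8 ^ n * A` gives the 24 in `K1`.
  have hnode : ∀ x ∈ closedTri T, H * ‖f x - polyFun P x‖ₑ ^ 2 ≤ K1 * A := by
    intro x hx
    have h1 := sobolev_tri hdiam hr hball hsm hx
    have h2 : ENNReal.ofReal ((ρ * h) ^ 2 / 12) = ENNReal.ofReal (ρ ^ 2 / 12) * H := by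
      rw [hH, ← ENNReal.ofReal_mul (by positivity)]; congr 1; ring
    rw [h2] at h1
    rw [hK1, mul_assoc, ← ENNReal.mul_le_iff_le_inv hρ1 ENNReal.ofReal_ne_top, ← mul_assoc]
    refine h1.trans ?_
    have e0 := hE 0 (by norm_num)
    have e1 := hE 1 (by norm_num)
    have e2 := hE 2 le_rfl
    rw [pow_zero, one_mul] at e0
    rw [pow_one] at e1
    calc _ ≤ 8 * (8 ^ n * A + 8 ^ n * A + 8 ^ n * A) :=
          mul_le_mul_right (add_le_add (add_le_add e0 e1) e2) _
      _ = _ := by ring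
  obtain ⟨i0, hi0, hmax⟩ := Finset.exists_max_image (nodeIdx p)
    (fun i => |polyFun (q - P) (lagNode T p i)|)
    ⟨![p, 0, 0], mem_nodeIdx.2 (by simp [Fin.sum_univ_three])⟩
  set M := |polyFun (q - P) (lagNode T p i0)| with hM
  have hMle : H * ‖M‖ₑ ^ 2 ≤ 2 * (H * N) + 2 * (K1 * A) := by
    have h1 : ‖M‖ₑ = ‖(f (lagNode T p i0) - polyFun P (lagNode T p i0)) -
        (f (lagNode T p i0) - polyFun q (lagNode T p i0))‖ₑ := by
      rw [hM, Real.enorm_eq_ofReal_abs, abs_abs, ← Real.enorm_eq_ofReal_abs, polyFun_sub]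
      congr 1; simp
    rw [h1]
    calc _ ≤ H * (2 * ‖f (lagNode T p i0) - polyFun P (lagNode T p i0)‖ₑ ^ 2 +
          2 * ‖f (lagNode T p i0) - polyFun q (lagNode T p i0)‖ₑ ^ 2) := by
          gcongr; exact enorm_sub_sq_le _ _
      _ = 2 * (H * ‖f (lagNode T p i0) - polyFun q (lagNode T p i0)‖ₑ ^ 2) +
          2 * (H * ‖f (lagNode T p i0) - polyFun P (lagNode T p i0)‖ₑ ^ 2) := by ring
      _ ≤ _ := by
          have h2 := hnode _ (lagNode_mem hp (mem_nodeIdx.1 hi0))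
          have h3 := hN i0 hi0
          exact add_le_add (mul_le_mul_right (mul_le_mul_right h3 _) _) (mul_le_mul_right h2 _)
  have hqP : (q - P).totalDegree ≤ p :=
    (MvPolynomial.totalDegree_sub _ _).trans (max_le hq (by omega))
  have hPB := polyBound_of_nodes hr hball hp hqP hmax
  -- The pointwise bound becomes an `L²` bound through the area of the triangle, which supplies the
  -- factor `H` in front of the squared nodal values.
  have hqk : H ^ k * semiSq μ k (polyFun (q - P)) ≤
      R * (24 * ‖K‖ₑ ^ 2 * (H * N + K1 * A)) := by
    have h1 := hPB.semiSq_le hr.le hk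
    have h2 : ENNReal.ofReal ((ρ * h) ^ 2) = ENNReal.ofReal (ρ ^ 2) * H := by
      rw [hH, ← ENNReal.ofReal_mul (by positivity)]; congr 1; ring
    rw [h2, mul_pow, mul_assoc] at h1
    have h3 := (ENNReal.mul_le_iff_le_inv (pow_ne_zero k hρ2)
      (ENNReal.pow_ne_top ENNReal.ofReal_ne_top)).1 h1
    refine h3.trans ?_
    have h4 : (ENNReal.ofReal (ρ ^ 2) ^ k)⁻¹ ≤ R :=
      Finset.single_le_sum (f := fun k => (ENNReal.ofReal (ρ ^ 2) ^ k)⁻¹)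
        (fun _ _ => zero_le) (Finset.mem_range.2 (by omega))
    refine mul_le_mul' h4 ?_
    calc 3 * (‖K * M‖ₑ ^ 2 * volume (closedTri T)) ≤ 3 * (‖K * M‖ₑ ^ 2 * (4 * H)) := by
          gcongr; exact volume_closedTri_le hh.le hdiam
      _ = 12 * ‖K‖ₑ ^ 2 * (H * ‖M‖ₑ ^ 2) := by rw [enorm_mul]; ring
      _ ≤ 12 * ‖K‖ₑ ^ 2 * (2 * (H * N) + 2 * (K1 * A)) := by gcongr
      _ = _ := by ring
  have hsplit : f - polyFun q = (f - polyFun P) - polyFun (q - P) := by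
    rw [polyFun_sub]; ring
  rw [hsplit]
  calc _ ≤ H ^ k * (2 * semiSq μ k (f - polyFun P) + 2 * semiSq μ k (polyFun (q - P))) := by
        gcongr; exact semiSq_sub_le μ k hsm (contDiff_polyFun _)
    _ = 2 * (H ^ k * semiSq μ k (f - polyFun P)) +
        2 * (H ^ k * semiSq μ k (polyFun (q - P))) := by ring
    _ ≤ 2 * (8 ^ n * A) + 2 * (R * (24 * ‖K‖ₑ ^ 2 * (H * N + K1 * A))) := by
        exact add_le_add (mul_le_mul_right (hE k hk) _) (mul_le_mul_right hqk _)
    _ ≤ 2 * (8 ^ n * (A + H * N)) +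
        2 * (R * (24 * ‖K‖ₑ ^ 2 * ((1 + K1) * (A + H * N)))) := by
        gcongr
        · exact le_self_add
        · calc H * N + K1 * A ≤ H * N + K1 * A + (A + K1 * (H * N)) := le_self_add
            _ = _ := by ring
    _ = _ := by ring


/-! ### Traces as limits of smooth functions -/

theorem MemHs.mono_order {D : Set Plane} {s t : ℕ} {u : Plane → ℝ} (h : MemHs D s u) (hts : t ≤ s) :
    MemHs D t u := ⟨h.1, fun α hα => h.2 α (hα.trans hts)⟩

theorem memLp_of_continuousOn_isCompact {X : Type*} [TopologicalSpace X] [T2Space X]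
    [MeasurableSpace X] [BorelSpace X] {μ : Measure X} {K : Set X} (hK : IsCompact K) (hμ : μ K ≠ ⊤)
    {f : X → ℝ} (hf : ContinuousOn f K) : MemLp f 2 (μ.restrict K) := by
  obtain ⟨M, hM⟩ := hK.exists_bound_of_continuousOn hf
  refine memLp_of_l2sq_lt_top (hf.aestronglyMeasurable hK.measurableSet) ?_
  refine (l2sq_le_of_bound hK.measurableSet (M := ENNReal.ofReal M) fun x hx => ?_).trans_lt
    (ENNReal.mul_lt_top (ENNReal.pow_lt_top ENNReal.ofReal_lt_top) hμ.lt_top)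
  rw [← ofReal_norm]
  exact ENNReal.ofReal_le_ofReal (hM x hx)

theorem memLp_of_contDiff {D : Set Plane} (hDb : Bornology.IsBounded D) {f : Plane → ℝ}
    (hf : ContDiff ℝ ∞ f) : MemLp f 2 (volume.restrict D) :=
  (memLp_of_continuousOn_isCompact hDb.isCompact_closure hDb.isCompact_closure.measure_ne_top
    hf.continuous.continuousOn).mono_measure (Measure.restrict_mono subset_closure le_rfl)

theorem isWeakDeriv_sub_smooth {D : Set Plane} {u w f : Plane → ℝ} {α : ℕ × ℕ} {g : Plane → ℝ}
    (hu : IsWeakDeriv D α u g) (hf : ContDiff ℝ ∞ f)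
    (hw : w =ᵐ[volume.restrict D] fun x => u x - f x) :
    IsWeakDeriv D α w (fun x => g x - mderiv α f x) :=
  (hu.sub (isWeakDeriv_mderiv hf α)).congr hw.symm (ae_eq_refl _)

theorem MemHs.sub_smooth {D : Set Plane} (hDo : IsOpen D) (hDb : Bornology.IsBounded D) {s : ℕ}
    {u w f : Plane → ℝ} (hu : MemHs D s u) (hf : ContDiff ℝ ∞ f)
    (hw : w =ᵐ[volume.restrict D] fun x => u x - f x) : MemHs D s w := by
  refine ⟨(memLp_congr_ae hw).2 (hu.1.sub (memLp_of_contDiff hDb hf)), fun α hα => ⟨_,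
    isWeakDeriv_sub_smooth (hu.isWeakDeriv hα) hf hw,
    (hu.memLp_weakDeriv hDo hα).sub (memLp_of_contDiff hDb (contDiff_mderiv hf α))⟩⟩

theorem weakGrad_eq (D : Set Plane) (u : Plane → ℝ) (i : Fin 2) :
    weakGrad D u i = weakDeriv D (unitIdx i) u := by
  fin_cases i <;> rfl

theorem unitIdx_sum (i : Fin 2) : (unitIdx i).1 + (unitIdx i).2 = 1 := by
  fin_cases i <;> rfl

theorem MemHs.memLp_weakGrad {D : Set Plane} (hDo : IsOpen D) {s : ℕ} (hs : 1 ≤ s) {u : Plane → ℝ}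
    (hu : MemHs D s u) (i : Fin 2) : MemLp (weakGrad D u i) 2 (volume.restrict D) := by
  rw [weakGrad_eq]
  exact hu.memLp_weakDeriv hDo ((unitIdx_sum i).trans_le hs)

section trace

variable {D : Set Plane} {ν : Measure Plane} {K L : ℝ≥0∞} {u w g g' : Plane → ℝ}

/-- A trace inequality for smooth functions. -/
def TraceBound (D : Set Plane) (ν : Measure Plane) (K L : ℝ≥0∞) : Prop :=
  ν ≤ bdryMeasure D ∧ K ≠ ⊤ ∧ L ≠ ⊤ ∧ ∀ f : Plane → ℝ, ContDiff ℝ ∞ f →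
    l2sq ν f ≤ K * l2sq (volume.restrict D) f + L * ∑ i, l2sq (volume.restrict D) (pderiv i f)

theorem tendsto_zero_of_le_mul {a : ℕ → ℝ≥0∞} {b : ℕ → ℝ≥0∞} (hb : Tendsto b atTop (𝓝 0))
    (h : ∀ n, a n ≤ b n) : Tendsto a atTop (𝓝 0) :=
  tendsto_of_tendsto_of_tendsto_of_le_of_le tendsto_const_nhds hb (fun _ => zero_le) h

theorem l2sq_le_diff {X : Type*} [MeasurableSpace X] {μ : Measure X} {f g : X → ℝ}
    (hf : AEStronglyMeasurable f μ) (hg : AEStronglyMeasurable g μ) :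
    l2sq μ f ≤ 2 * l2sq μ (fun x => f x - g x) + 2 * l2sq μ g := by
  have := l2sq_add_le (g := g) (hf.sub hg)
  simp only [Pi.sub_apply, sub_add_cancel] at this
  exact this

/-- The trace inequality passes to the limit along the defining sequence. One factor 2 is lost on
each side, which gives the 4. -/
theorem IsTrace.l2sq_le (hDo : IsOpen D) (hB : TraceBound D ν K L) (h : IsTrace D u g) :
    l2sq ν g ≤ 4 * (K * l2sq (volume.restrict D) u +
      L * ∑ i, l2sq (volume.restrict D) (weakGrad D u i)) := by
  obtain ⟨hν, hK, hL, hB⟩ := hB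
  obtain ⟨hu, hg, φ, hφ, h0, h1, h2⟩ := h
  have h2' : Tendsto (fun n => l2sq ν (fun x => φ n x - g x)) atTop (𝓝 0) :=
    tendsto_zero_of_le_mul h2 fun n => l2sq_mono_measure hν
  have h3 := l2sq_le_of_tendsto (fun n => aestronglyMeasurable_of_contDiff (hφ n) ν) h2'
    (B := fun n => K * (2 * l2sq (volume.restrict D) (fun x => φ n x - u x) +
        2 * l2sq (volume.restrict D) u) +
      L * ∑ i, (2 * l2sq (volume.restrict D) (fun x => pderiv i (φ n) x - weakGrad D u i x) +
        2 * l2sq (volume.restrict D) (weakGrad D u i)))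
    (b := K * (2 * 0 + 2 * l2sq (volume.restrict D) u) +
      L * ∑ i, (2 * 0 + 2 * l2sq (volume.restrict D) (weakGrad D u i))) ?_ ?_
  · refine h3.trans_eq ?_
    simp only [mul_zero, zero_add, ← Finset.mul_sum]
    ring
  · refine (ENNReal.Tendsto.const_mul ((ENNReal.Tendsto.const_mul h0 (.inr (by simp))).add_const _)
      (.inr hK)).add (ENNReal.Tendsto.const_mul ?_ (.inr hL))
    exact tendsto_finsetSum _ fun i _ =>
      (ENNReal.Tendsto.const_mul (h1 i) (.inr (by simp))).add_const _
  · intro n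
    refine (hB _ (hφ n)).trans ?_
    gcongr with i _
    · exact l2sq_le_diff (aestronglyMeasurable_of_contDiff (hφ n) _) hu.1.1
    · exact l2sq_le_diff (aestronglyMeasurable_of_contDiff (contDiff_pderiv (hφ n) i) _)
        (hu.memLp_weakGrad hDo le_rfl i).1

/-- The difference of two approximating sequences tends to zero in `H¹`, hence in `L²(ν)` by the
trace inequality. As `ν` may be a part of the boundary measure, the inequality is needed only on
that part. -/
theorem IsTrace.ae_unique (hDo : IsOpen D) (hB : TraceBound D ν K L) (h : IsTrace D u g)
    (h' : IsTrace D u g') : g =ᵐ[ν] g' := by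
  obtain ⟨hν, hK, hL, hB⟩ := hB
  obtain ⟨hu, hg, φ, hφ, h0, h1, h2⟩ := h
  obtain ⟨-, hg', ψ, hψ, h0', h1', h2'⟩ := h'
  have hgν := hg.1.mono_measure hν
  have hgν' := hg'.1.mono_measure hν
  have mφ := fun n => aestronglyMeasurable_of_contDiff (hφ n) ν
  have hb : Tendsto (fun n => K * (2 * l2sq (volume.restrict D) (fun x => φ n x - u x) +
        2 * l2sq (volume.restrict D) (fun x => ψ n x - u x)) +
      L * ∑ i, (2 * l2sq (volume.restrict D) (fun x => pderiv i (φ n) x - weakGrad D u i x) +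
        2 * l2sq (volume.restrict D) (fun x => pderiv i (ψ n) x - weakGrad D u i x)))
      atTop (𝓝 (K * (2 * 0 + 2 * 0) + L * ∑ _i : Fin 2, (2 * 0 + 2 * 0))) := by
    have c2 : ∀ {a : ℕ → ℝ≥0∞}, Tendsto a atTop (𝓝 0) →
        Tendsto (fun n => 2 * a n) atTop (𝓝 (2 * 0)) := fun h =>
      ENNReal.Tendsto.const_mul h (.inr (by simp))
    exact (ENNReal.Tendsto.const_mul ((c2 h0).add (c2 h0')) (.inr hK)).add
      (ENNReal.Tendsto.const_mul (tendsto_finsetSum _ fun i _ => (c2 (h1 i)).add (c2 (h1' i)))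
        (.inr hL))
  simp only [mul_zero, add_zero, Finset.sum_const_zero] at hb
  have hd : Tendsto (fun n => l2sq ν (fun x => φ n x - ψ n x)) atTop (𝓝 0) := by
    refine tendsto_zero_of_le_mul hb fun n => ?_
    have hsm : ContDiff ℝ ∞ (φ n - ψ n) := (hφ n).sub (hψ n)
    refine (hB (φ n - ψ n) hsm).trans ?_
    gcongr with i _
    · have := l2sq_triangle (aestronglyMeasurable_of_contDiff (hφ n) (volume.restrict D))
        hu.1.1 (ψ n)
      rwa [l2sq_sub_comm (f := u)] at this
    · have h3 := l2sq_triangle (aestronglyMeasurable_of_contDiff (contDiff_pderiv (hφ n) i)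
        (volume.restrict D)) (hu.memLp_weakGrad hDo le_rfl i).1 (pderiv i (ψ n))
      rw [l2sq_sub_comm (f := weakGrad D u i)] at h3
      have h4 : pderiv i (φ n - ψ n) = pderiv i (φ n) - pderiv i (ψ n) := by
        rw [← mderiv_unitIdx, ← mderiv_unitIdx, ← mderiv_unitIdx, mderiv_sub (hφ n) (hψ n)]
      rw [h4]
      exact h3
  have e2 : Tendsto (fun n => l2sq ν (fun x => φ n x - g x)) atTop (𝓝 0) :=
    tendsto_zero_of_le_mul h2 fun n => l2sq_mono_measure hν
  have e2' : Tendsto (fun n => l2sq ν (fun x => ψ n x - g' x)) atTop (𝓝 0) :=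
    tendsto_zero_of_le_mul h2' fun n => l2sq_mono_measure hν
  refine ae_eq_of_tendsto_l2sq mφ hgν hgν' e2 ?_
  have hs := (ENNReal.Tendsto.const_mul hd (.inr (by simp : (2 : ℝ≥0∞) ≠ ⊤))).add
    (ENNReal.Tendsto.const_mul e2' (.inr (by simp : (2 : ℝ≥0∞) ≠ ⊤)))
  simp only [mul_zero, add_zero] at hs
  exact tendsto_zero_of_le_mul hs fun n =>
    l2sq_triangle (mφ n) (aestronglyMeasurable_of_contDiff (hψ n) ν) _

theorem IsTrace.trace (h : IsTrace D u g) : IsTrace D u (trace D u) := by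
  have h' : ∃ g, IsTrace D u g := ⟨g, h⟩
  rw [DGDyn.trace, dif_pos h']
  exact h'.choose_spec

theorem l2sq_trace_le (hDo : IsOpen D) (hB : TraceBound D ν K L) (u : Plane → ℝ) :
    l2sq ν (trace D u) ≤ 4 * (K * l2sq (volume.restrict D) u +
      L * ∑ i, l2sq (volume.restrict D) (weakGrad D u i)) := by
  by_cases h : ∃ g, IsTrace D u g
  · obtain ⟨g, hg⟩ := h
    exact hg.trace.l2sq_le hDo hB
  -- Without a trace the default value 0 satisfies the bound trivially.
  · rw [DGDyn.trace, dif_neg h]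
    simp [l2sq]

/-- Uniform convergence up to a boundary of finite length implies convergence in `L²` of the
boundary, so the continuous representative is a trace. -/
theorem isTrace_of_tendstoUniformlyOn (hDb : Bornology.IsBounded D)
    (hfin : Measure.hausdorffMeasure 1 (frontier D) ≠ ⊤) {s : ℕ} (hs : 1 ≤ s) (hu : MemHs D s u)
    {φ : ℕ → Plane → ℝ} (hφ : ∀ n, ContDiff ℝ ∞ (φ n))
    (hlim : ∀ α : ℕ × ℕ, α.1 + α.2 ≤ s → Tendsto (fun n => l2sq (volume.restrict D)
        (fun x => mderiv α (φ n) x - weakDeriv D α u x)) atTop (𝓝 0)) (hDo : IsOpen D)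
    (hg : ContinuousOn g (closure D)) (hunif : TendstoUniformlyOn φ g atTop (closure D)) :
    IsTrace D u g := by
  have hcl : frontier D ⊆ closure D := frontier_subset_closure
  have hcK : IsCompact (frontier D) := hDb.isCompact_closure.of_isClosed_subset isClosed_frontier hcl
  refine ⟨hu.mono_order hs, memLp_of_continuousOn_isCompact hcK hfin (hg.mono hcl), φ, hφ, ?_, ?_, ?_⟩
  · have h0 := hlim (0, 0) (Nat.zero_le _)
    refine h0.congr fun n => l2sq_congr_ae ?_
    have h2 := (isWeakDeriv_zero_index (hu.isWeakDeriv (α := (0, 0)) (Nat.zero_le _)).1).weakDeriv_ae_eq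
      hDo
    filter_upwards [h2] with x hx
    rw [hx]; rfl
  · intro i
    refine (hlim (unitIdx i) ((unitIdx_sum i).trans_le hs)).congr fun n => ?_
    rw [mderiv_unitIdx, weakGrad_eq]
  · rw [ENNReal.tendsto_nhds_zero]
    intro ε hε
    obtain ⟨κ, hκ, hκε⟩ := exists_sq_mul_le hfin hε
    filter_upwards [Metric.tendstoUniformlyOn_iff.1 hunif κ hκ] with n hn
    refine (l2sq_le_of_bound isClosed_frontier.measurableSet fun x hx => ?_).trans hκε
    rw [← ofReal_norm]
    refine ENNReal.ofReal_le_ofReal ?_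
    have := (hn x (hcl hx)).le
    rwa [dist_comm, dist_eq_norm] at this

theorem IsTrace.sub_smooth (hDo : IsOpen D) (hDb : Bornology.IsBounded D)
    (hfin : Measure.hausdorffMeasure 1 (frontier D) ≠ ⊤) (h : IsTrace D u g) {f : Plane → ℝ}
    (hf : ContDiff ℝ ∞ f) (hw : w =ᵐ[volume.restrict D] fun x => u x - f x) :
    IsTrace D w (fun x => g x - f x) := by
  have hcK : IsCompact (frontier D) :=
    hDb.isCompact_closure.of_isClosed_subset isClosed_frontier frontier_subset_closure
  obtain ⟨hu, hg, φ, hφ, h0, h1, h2⟩ := h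
  refine ⟨hu.sub_smooth hDo hDb hf hw,
    hg.sub (memLp_of_continuousOn_isCompact hcK hfin hf.continuous.continuousOn),
    fun n => φ n - f, fun n => (hφ n).sub hf, ?_, fun i => ?_, ?_⟩
  · refine h0.congr fun n => l2sq_congr_ae ?_
    filter_upwards [hw] with x hx
    rw [hx, Pi.sub_apply]; ring
  · refine (h1 i).congr fun n => l2sq_congr_ae ?_
    have h3 := (isWeakDeriv_sub_smooth (hu.isWeakDeriv (unitIdx_sum i).le) hf hw).weakDeriv_ae_eq hDo
    rw [weakGrad_eq, weakGrad_eq]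
    filter_upwards [h3] with x hx
    rw [hx, mderiv_unitIdx]
    have h4 : pderiv i (φ n - f) = pderiv i (φ n) - pderiv i f := by
      rw [← mderiv_unitIdx, ← mderiv_unitIdx, ← mderiv_unitIdx, mderiv_sub (hφ n) hf]
    rw [h4, Pi.sub_apply]; ring
  · refine h2.congr fun n => ?_
    congr 1
    funext x
    exact (sub_sub_sub_cancel_right (φ n x) (g x) (f x)).symm

end trace

theorem ae_comp_isometry {γ : ℝ → Plane} (hγ : Isometry γ) {I : Set ℝ}
    {P : Plane → Prop} (h : ∀ᵐ x ∂(Measure.hausdorffMeasure 1 : Measure Plane).restrict (γ '' I), P x) :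
    ∀ᵐ t ∂volume.restrict I, P (γ t) := by
  have hme : MeasurableEmbedding γ := hγ.isClosedEmbedding.measurableEmbedding
  have h1 : (Measure.hausdorffMeasure 1 : Measure Plane).restrict (γ '' I) =
      (Measure.map γ volume).restrict (γ '' I) := by
    rw [← hausdorffMeasure_real, hγ.map_hausdorffMeasure (.inl zero_le_one),
      Measure.restrict_restrict_of_subset (Set.image_subset_range _ _)]
  rw [h1, hme.restrict_map, Set.preimage_image_eq _ hγ.injective] at h
  exact hme.ae_map_iff.1 h


/-! ### Weak seminorms and traces on one element -/

variable {T : Tri}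

/-- `|u|²_{H^k(D)} = ∑_{|α| = k} ‖∂^α u‖²_{L²(D)}`, with weak derivatives. -/
noncomputable def wSemi (D : Set Plane) (k : ℕ) (u : Plane → ℝ) : ℝ≥0∞ :=
  ∑ α ∈ Finset.HasAntidiagonal.antidiagonal k, l2sq (volume.restrict D) (weakDeriv D α u)

/-- A single triangle is regular with some constants. This suffices for qualitative facts such as
finiteness and uniqueness, where uniformity in the mesh plays no role. -/
theorem exists_regular (T : Tri) : ∃ ρ h : ℝ, 0 < ρ ∧ 0 < h ∧ Regular T ρ h := by
  obtain ⟨z, hz⟩ := nonempty_openTri (T := T)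
  obtain ⟨r, hr, hball⟩ := Metric.isOpen_iff.1 isOpen_openTri z hz
  have hh : 0 < Metric.diam (closedTri T) + 1 := by linarith [Metric.diam_nonneg (s := closedTri T)]
  refine ⟨r / (Metric.diam (closedTri T) + 1), Metric.diam (closedTri T) + 1, div_pos hr hh, hh,
    fun x hx y hy => ?_, z, ?_⟩
  · rw [← dist_eq_norm]
    exact (Metric.dist_le_diam_of_mem isCompact_closedTri.isBounded hx hy).trans (by linarith)
  · rwa [div_mul_cancel₀ _ hh.ne']

theorem sobolevBound_openTri (T : Tri) : SobolevBound (openTri T) := by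
  obtain ⟨ρ, h, hρ, hh, hdiam, z, hball⟩ := exists_regular T
  have hr : 0 < ρ * h := mul_pos hρ hh
  have h0 : ENNReal.ofReal ((ρ * h) ^ 2 / 12) ≠ 0 := by
    rw [Ne, ENNReal.ofReal_eq_zero, not_le]; positivity
  set H := ENNReal.ofReal (h ^ 2) with hH
  have hHt : H ≠ ⊤ := ENNReal.ofReal_ne_top
  refine ⟨(ENNReal.ofReal ((ρ * h) ^ 2 / 12))⁻¹ * (8 * (1 + H + H ^ 2)),
    ENNReal.mul_ne_top (ENNReal.inv_ne_top.2 h0) (ENNReal.mul_ne_top (by simp)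
      (by simp [hHt])), fun f hf x hx => ?_⟩
  rw [closure_openTri] at hx
  rw [mul_assoc, ← ENNReal.mul_le_iff_le_inv h0 ENNReal.ofReal_ne_top]
  refine (sobolev_tri hdiam hr hball hf hx).trans ?_
  set μ : Measure Plane := volume.restrict (openTri T)
  have h2 : h2Sq μ f = semiSq μ 0 f + semiSq μ 1 f + semiSq μ 2 f := by
    simp [h2Sq, Finset.sum_range_succ]
  rw [h2, mul_assoc]
  gcongr
  calc _ ≤ semiSq μ 0 f + H * semiSq μ 1 f + H ^ 2 * semiSq μ 2 f +
        ((semiSq μ 1 f + semiSq μ 2 f) + H * (semiSq μ 0 f + semiSq μ 2 f) +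
        H ^ 2 * (semiSq μ 0 f + semiSq μ 1 f)) := le_self_add
    _ = _ := by ring

theorem traceBound_tri {ρ h : ℝ} (hρ : 0 < ρ) (hh : 0 < h) (hT : Regular T ρ h) :
    TraceBound (openTri T) (bdryMeasure (openTri T)) ((ENNReal.ofReal (ρ ^ 2 * h / 2))⁻¹ * 12)
      ((ENNReal.ofReal (ρ ^ 2 * h / 2))⁻¹ * (12 * ENNReal.ofReal (h ^ 2))) := by
  have h0 : ENNReal.ofReal (ρ ^ 2 * h / 2) ≠ 0 := by
    rw [Ne, ENNReal.ofReal_eq_zero, not_le]; positivity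
  refine ⟨le_rfl, ENNReal.mul_ne_top (ENNReal.inv_ne_top.2 h0) (by simp), ENNReal.mul_ne_top
    (ENNReal.inv_ne_top.2 h0) (ENNReal.mul_ne_top (by simp) ENNReal.ofReal_ne_top), fun f hf => ?_⟩
  obtain ⟨hdiam, z, hball⟩ := hT
  have h1 := trace_tri hdiam (mul_pos hρ hh) hball hf
  have h2 : (ρ * h) ^ 2 / (2 * h) = ρ ^ 2 * h / 2 := by field_simp
  rw [h2, ENNReal.mul_le_iff_le_inv h0 ENNReal.ofReal_ne_top] at h1
  refine h1.trans_eq ?_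
  ring

/-- The trace inequality for the constant function 1 bounds the perimeter by a multiple of the area.
-/
theorem hausdorffMeasure_frontier_openTri_ne_top (T : Tri) :
    Measure.hausdorffMeasure 1 (frontier (openTri T)) ≠ ⊤ := by
  obtain ⟨ρ, h, hρ, hh, hT⟩ := exists_regular T
  obtain ⟨-, hK, hL, hB⟩ := traceBound_tri hρ hh hT
  have h1 := hB (fun _ => 1) contDiff_const
  have h2 : ∀ μ : Measure Plane, l2sq μ (fun _ => (1 : ℝ)) = μ Set.univ := fun μ => by simp [l2sq]
  have h3 : ∀ i, pderiv i (fun _ : Plane => (1 : ℝ)) = fun _ => 0 := fun i => by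
    funext x; simp [pderiv]
  rw [h2, h2, bdryMeasure, Measure.restrict_apply_univ, Measure.restrict_apply_univ] at h1
  refine ne_top_of_le_ne_top ?_ h1
  have h4 : l2sq (volume.restrict (openTri T)) (fun _ => (0 : ℝ)) = 0 := by simp [l2sq]
  simp only [h3, h4, Finset.sum_const_zero, mul_zero, add_zero]
  exact ENNReal.mul_ne_top hK isBounded_openTri.measure_lt_top.ne

theorem wSemi_zero {D : Set Plane} (hDo : IsOpen D) {u : Plane → ℝ} (hu : LocallyIntegrableOn u D) :
    wSemi D 0 u = l2sq (volume.restrict D) u := by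
  simp only [wSemi, Finset.Nat.antidiagonal_zero, Finset.sum_singleton]
  exact l2sq_congr_ae ((isWeakDeriv_zero_index hu).weakDeriv_ae_eq hDo)

theorem wSemi_one (D : Set Plane) (u : Plane → ℝ) :
    wSemi D 1 u = ∑ i, l2sq (volume.restrict D) (weakGrad D u i) := by
  simp only [wSemi, weakGrad_eq, Finset.Nat.antidiagonal_succ, Finset.Nat.antidiagonal_zero,
    Fin.sum_univ_two, unitIdx_zero, unitIdx_one]
  simp [add_comm]

/-- A weak derivative of a weak derivative is the weak derivative of the summed index. For a fixed
first direction the second derivatives are distinct terms of the seminorm, so two directions give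
the factor 2. -/
theorem sum_weakGrad_weakGrad_le {D : Set Plane} (hDo : IsOpen D) {u : Plane → ℝ}
    (hu : MemHs D 2 u) : ∑ i, ∑ j, l2sq (volume.restrict D) (weakGrad D (weakGrad D u i) j) ≤
      2 * wSemi D 2 u := by
  have h1 : ∀ i, ∑ j, l2sq (volume.restrict D) (weakGrad D (weakGrad D u i) j) ≤ wSemi D 2 u := by
    intro i
    refine le_trans (le_of_eq ?_) (sum_antidiagonal_unitIdx_le
      (fun α => l2sq (volume.restrict D) (weakDeriv D α u)) 1 i)
    have h2 : ∀ j, l2sq (volume.restrict D) (weakGrad D (weakGrad D u i) j) =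
        l2sq (volume.restrict D) (weakDeriv D (unitIdx j + unitIdx i) u) := by
      intro j
      rw [weakGrad_eq, weakGrad_eq]
      have hi := hu.isWeakDeriv (α := unitIdx i) ((unitIdx_sum i).trans_le one_le_two)
      have hij := hu.isWeakDeriv (α := unitIdx i + unitIdx j) (by
        have := unitIdx_sum i
        have := unitIdx_sum j
        simp only [Prod.fst_add, Prod.snd_add]; omega)
      rw [add_comm (unitIdx j)]
      exact l2sq_congr_ae ((hi.of_add hij).weakDeriv_ae_eq hDo)
    simp only [h2, Finset.Nat.antidiagonal_succ, Finset.Nat.antidiagonal_zero,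
      Fin.sum_univ_two, unitIdx_zero, unitIdx_one]
    simp [add_comm]
  refine (Finset.sum_le_sum fun i _ => h1 i).trans_eq ?_
  simp

theorem elTrace_le {ρ h : ℝ} (hρ : 0 < ρ) (hh : 0 < h) (hT : Regular T ρ h) {w : Plane → ℝ}
    (hw : LocallyIntegrableOn w (openTri T)) :
    ENNReal.ofReal (ρ ^ 2 * h / 2) * l2sq (bdryMeasure (openTri T)) (elTrace T w) ≤
      48 * (wSemi (openTri T) 0 w + ENNReal.ofReal (h ^ 2) * wSemi (openTri T) 1 w) := by
  have h0 : ENNReal.ofReal (ρ ^ 2 * h / 2) ≠ 0 := by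
    rw [Ne, ENNReal.ofReal_eq_zero, not_le]; positivity
  rw [ENNReal.mul_le_iff_le_inv h0 ENNReal.ofReal_ne_top]
  refine (l2sq_trace_le isOpen_openTri (traceBound_tri hρ hh hT) w).trans_eq ?_
  rw [wSemi_zero isOpen_openTri hw, wSemi_one]
  ring

theorem elGradTrace_le {ρ h : ℝ} (hρ : 0 < ρ) (hh : 0 < h) (hT : Regular T ρ h) {w : Plane → ℝ}
    (hw : MemHs (openTri T) 2 w) :
    ENNReal.ofReal (ρ ^ 2 * h / 2) * ∑ i, l2sq (bdryMeasure (openTri T)) (elGradTrace T w i) ≤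
      96 * (wSemi (openTri T) 1 w + ENNReal.ofReal (h ^ 2) * wSemi (openTri T) 2 w) := by
  have h0 : ENNReal.ofReal (ρ ^ 2 * h / 2) ≠ 0 := by
    rw [Ne, ENNReal.ofReal_eq_zero, not_le]; positivity
  rw [ENNReal.mul_le_iff_le_inv h0 ENNReal.ofReal_ne_top]
  refine (Finset.sum_le_sum fun i _ =>
    l2sq_trace_le isOpen_openTri (traceBound_tri hρ hh hT) (weakGrad (openTri T) w i)).trans ?_
  rw [← Finset.mul_sum, Finset.sum_add_distrib, ← Finset.mul_sum, ← Finset.mul_sum, ← wSemi_one]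
  refine (mul_le_mul_right (add_le_add_right (mul_le_mul_right
    (sum_weakGrad_weakGrad_le isOpen_openTri hw) _) _) _).trans ?_
  set R := (ENNReal.ofReal (ρ ^ 2 * h / 2))⁻¹
  set H := ENNReal.ofReal (h ^ 2)
  set W1 := wSemi (openTri T) 1 w
  set W2 := wSemi (openTri T) 2 w
  calc _ = R * (48 * W1 + 96 * (H * W2)) := by ring
    _ ≤ R * (96 * W1 + 96 * (H * W2)) := by gcongr; norm_num
    _ = _ := by ring

theorem contRep_spec {X : Type*} [TopologicalSpace X] [MeasureSpace X] {U : Set X} {u f : X → ℝ}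
    (hf : ContinuousOn f (closure U)) (hfu : f =ᵐ[volume.restrict U] u) :
    ContinuousOn (contRep U u) (closure U) ∧ contRep U u =ᵐ[volume.restrict U] u := by
  have h : ∃ f : X → ℝ, ContinuousOn f (closure U) ∧ f =ᵐ[volume.restrict U] u := ⟨f, hf, hfu⟩
  rw [contRep, dif_pos h]
  exact h.choose_spec

theorem eqOn_closure_of_ae_eq {X : Type*} [TopologicalSpace X] [MeasureSpace X]
    [(volume : Measure X).IsOpenPosMeasure] {U : Set X} (hU : IsOpen U)
    {f g : X → ℝ} (hf : ContinuousOn f (closure U)) (hg : ContinuousOn g (closure U))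
    (h : f =ᵐ[volume.restrict U] g) : Set.EqOn f g (closure U) := by
  have h1 : Set.EqOn f g U := Measure.eqOn_open_of_ae_eq h hU (hf.mono subset_closure)
    (hg.mono subset_closure)
  exact h1.of_subset_closure hf hg subset_closure le_rfl

theorem contRep_eq {X : Type*} [TopologicalSpace X] [MeasureSpace X]
    [(volume : Measure X).IsOpenPosMeasure] {U : Set X} (hU : IsOpen U) {u f : X → ℝ}
    (hf : ContinuousOn f (closure U)) (hfu : f =ᵐ[volume.restrict U] u) :
    Set.EqOn (contRep U u) f (closure U) := by
  obtain ⟨h1, h2⟩ := contRep_spec hf hfu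
  exact eqOn_closure_of_ae_eq hU h1 hf (h2.trans hfu.symm)

/-- The smooth estimate is applied to approximations `φ j` of `u` with the fixed polynomial `q`, the
interpolant of the continuous representative. As `φ j` converges uniformly, its values at the nodes
approach those of `q` and the tolerance `N j` tends to zero. The limit costs a factor 4 and the sum
over at most three multi-indices a factor 3. -/
theorem wSemi_sub_polyFun_le {ρ : ℝ} (hρ : 0 < ρ) {n p : ℕ} (hp : 1 ≤ p) (hn : 2 ≤ n)
    (hnp : n ≤ p + 1) : ∃ C : ℝ≥0∞, C ≠ ⊤ ∧ ∀ (T : Tri) (h : ℝ), 0 < h → Regular T ρ h →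
      ∀ s, n ≤ s → ∀ u V : Plane → ℝ, MemHs (openTri T) s u → ContinuousOn V (closedTri T) →
      V =ᵐ[volume.restrict (openTri T)] u → ∀ q : MvPolynomial (Fin 2) ℝ, IsLagrange T p V q →
      ∀ w : Plane → ℝ, w =ᵐ[volume.restrict (openTri T)] (fun x => u x - polyFun q x) →
      ∀ k ≤ 2, ENNReal.ofReal (h ^ 2) ^ k * wSemi (openTri T) k w ≤
        C * (ENNReal.ofReal (h ^ 2) ^ n * wSemi (openTri T) n u) := by
  obtain ⟨C, hC, hmain⟩ := semiSq_sub_polyFun_le hρ hp hn hnp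
  refine ⟨12 * C, ENNReal.mul_ne_top (by simp) hC, ?_⟩
  intro T h hh hT s hns u V hu hV hVu q hq w hw k hk
  set D := openTri T with hD
  have hDo : IsOpen D := isOpen_openTri
  set H := ENNReal.ofReal (h ^ 2) with hH
  have hH0 : H ≠ 0 := by rw [hH, Ne, ENNReal.ofReal_eq_zero, not_le]; positivity
  have hHt : H ≠ ⊤ := ENNReal.ofReal_ne_top
  obtain ⟨φ, hφ, hlim⟩ := exists_smooth_approx hDo convex_openTri isBounded_openTri
    nonempty_openTri hu
  obtain ⟨f, hf, hfu, hunif⟩ := exists_continuousOn_limit hDo isBounded_openTri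
    (sobolevBound_openTri T) (hn.trans hns) hu hφ hlim
  rw [closure_openTri] at hf hunif
  have hfV : Set.EqOn f V (closedTri T) := by
    rw [← closure_openTri] at hf hV ⊢
    exact eqOn_closure_of_ae_eq hDo hf hV (hfu.trans hVu.symm)
  let N : ℕ → ℝ≥0∞ := fun j =>
    ∑ i ∈ nodeIdx p, ‖φ j (lagNode T p i) - polyFun q (lagNode T p i)‖ₑ ^ 2
  have hN : Tendsto N atTop (𝓝 0) := by
    rw [← Finset.sum_const_zero (s := nodeIdx p)]
    refine tendsto_finsetSum _ fun i hi => ?_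
    have hmem := lagNode_mem (T := T) hp (mem_nodeIdx.1 hi)
    have h1 := hunif.tendsto_at hmem
    rw [hfV hmem, ← hq.eval_node hi] at h1
    have h2 := (ENNReal.continuous_ofReal.tendsto _).comp ((h1.sub_const
      (polyFun q (lagNode T p i))).pow 2)
    simpa [Function.comp_def, enorm_sq_eq_ofReal] using h2
  have hHk0 : H ^ k ≠ 0 := pow_ne_zero _ hH0
  have hHkt : H ^ k ≠ ⊤ := ENNReal.pow_ne_top hHt
  have hterm : ∀ α ∈ Finset.HasAntidiagonal.antidiagonal k,
      H ^ k * l2sq (volume.restrict D) (weakDeriv D α w) ≤ 4 * C * (H ^ n * wSemi D n u) := by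
    intro α hα
    have hα' := Finset.HasAntidiagonal.mem_antidiagonal.1 hα
    have hαs : α.1 + α.2 ≤ s := by omega
    have hwd := (isWeakDeriv_sub_smooth (hu.isWeakDeriv hαs) (contDiff_polyFun q)
      hw).weakDeriv_ae_eq hDo
    have hψ : ∀ j, ContDiff ℝ ∞ (φ j - polyFun q) := fun j => (hφ j).sub (contDiff_polyFun q)
    have ht : Tendsto (fun j => l2sq (volume.restrict D)
        (fun x => mderiv α (φ j - polyFun q) x - weakDeriv D α w x)) atTop (𝓝 0) := by
      refine (hlim α hαs).congr fun j => l2sq_congr_ae ?_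
      filter_upwards [hwd] with x hx
      rw [hx, mderiv_sub (hφ j) (contDiff_polyFun q), Pi.sub_apply]; ring
    rw [ENNReal.mul_le_iff_le_inv hHk0 hHkt]
    have hB : Tendsto (fun j => (H ^ k)⁻¹ * (C * (H ^ n *
        ∑ β ∈ Finset.HasAntidiagonal.antidiagonal n, (2 * l2sq (volume.restrict D)
          (fun x => mderiv β (φ j) x - weakDeriv D β u x) +
          2 * l2sq (volume.restrict D) (weakDeriv D β u)) + H * N j))) atTop
        (𝓝 ((H ^ k)⁻¹ * (C * (H ^ n *
        ∑ β ∈ Finset.HasAntidiagonal.antidiagonal n, (2 * 0 +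
          2 * l2sq (volume.restrict D) (weakDeriv D β u)) + H * 0)))) := by
      refine ENNReal.Tendsto.const_mul (ENNReal.Tendsto.const_mul
        (((ENNReal.Tendsto.const_mul (tendsto_finsetSum _ fun β hβ => ?_)
          (.inr (ENNReal.pow_ne_top hHt)))).add (ENNReal.Tendsto.const_mul hN (.inr hHt)))
          (.inr hC)) (.inr (ENNReal.inv_ne_top.2 hHk0))
      have hβ' := Finset.HasAntidiagonal.mem_antidiagonal.1 hβ
      exact (ENNReal.Tendsto.const_mul (hlim β (by omega)) (.inr (by simp))).add_const _
    have hfin := l2sq_le_of_tendsto (fun j => aestronglyMeasurable_of_contDiff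
      (contDiff_mderiv (hψ j) α) _) ht hB fun j => ?_
    · refine hfin.trans_eq ?_
      simp only [mul_zero, zero_add, add_zero, ← Finset.mul_sum]
      rw [← wSemi]
      ring
    · rw [← ENNReal.mul_le_iff_le_inv hHk0 hHkt]
      have h1 := hmain T h hh hT (φ j) (hφ j) q hq.1 (N j) (fun i hi =>
        Finset.single_le_sum (f := fun i => ‖φ j (lagNode T p i) - polyFun q (lagNode T p i)‖ₑ ^ 2)
          (fun _ _ => zero_le) hi) k hk
      refine (mul_le_mul_right (Finset.single_le_sum
        (f := fun α => l2sq (volume.restrict D) (mderiv α (φ j - polyFun q)))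
          (fun _ _ => zero_le) hα) _).trans (h1.trans ?_)
      refine mul_le_mul_right (add_le_add_left (mul_le_mul_right (Finset.sum_le_sum fun β hβ => ?_) _)
        _) _
      have hβ' := Finset.HasAntidiagonal.mem_antidiagonal.1 hβ
      exact l2sq_le_diff (aestronglyMeasurable_of_contDiff (contDiff_mderiv (hφ j) β) _)
        (hu.memLp_weakDeriv hDo (by omega)).1
  unfold wSemi
  rw [Finset.mul_sum]
  refine (Finset.sum_le_card_nsmul _ _ _ hterm).trans ?_
  rw [Finset.Nat.card_antidiagonal, nsmul_eq_mul]
  have hk3 : ((k + 1 : ℕ) : ℝ≥0∞) ≤ 3 := by exact_mod_cast (by omega : k + 1 ≤ 3)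
  calc _ ≤ 3 * (4 * C * (H ^ n * wSemi D n u)) := by gcongr
    _ = 12 * C * (H ^ n * wSemi D n u) := by ring

/-- Turns the chosen trace into an explicit function, so that pointwise estimates on boundary edges
become available. -/
theorem elTrace_ae_eq {s : ℕ} (hs : 2 ≤ s) {u V : Plane → ℝ} (hu : MemHs (openTri T) s u)
    (hV : ContinuousOn V (closedTri T)) (hVu : V =ᵐ[volume.restrict (openTri T)] u)
    {q : MvPolynomial (Fin 2) ℝ} {w : Plane → ℝ}
    (hw : w =ᵐ[volume.restrict (openTri T)] (fun x => u x - polyFun q x)) :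
    elTrace T w =ᵐ[bdryMeasure (openTri T)] fun x => V x - polyFun q x := by
  obtain ⟨φ, hφ, hlim⟩ := exists_smooth_approx isOpen_openTri convex_openTri isBounded_openTri
    nonempty_openTri hu
  obtain ⟨f, hf, hfu, hunif⟩ := exists_continuousOn_limit isOpen_openTri isBounded_openTri
    (sobolevBound_openTri T) hs hu hφ hlim
  rw [← closure_openTri] at hV
  have hfV : Set.EqOn f V (closure (openTri T)) :=
    eqOn_closure_of_ae_eq isOpen_openTri hf hV (hfu.trans hVu.symm)
  have h1 := isTrace_of_tendstoUniformlyOn isBounded_openTri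
    (hausdorffMeasure_frontier_openTri_ne_top T) (one_le_two.trans hs) hu hφ hlim isOpen_openTri hV
    (hunif.congr_right hfV)
  have h2 := h1.sub_smooth isOpen_openTri isBounded_openTri
    (hausdorffMeasure_frontier_openTri_ne_top T) (contDiff_polyFun q) hw
  obtain ⟨ρ, h, hρ, hh, hT⟩ := exists_regular T
  exact h2.trace.ae_unique isOpen_openTri (traceBound_tri hρ hh hT) h2


/-! ### The rectangle -/

theorem pt_eq_add_fst (x y : ℝ) : pt x y = pt 0 y + x • EuclideanSpace.single (0 : Fin 2) (1 : ℝ) := by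
  ext i; fin_cases i <;> simp [pt]

theorem pt_eq_add_snd (x y : ℝ) : pt x y = pt x 0 + y • EuclideanSpace.single (1 : Fin 2) (1 : ℝ) := by
  ext i; fin_cases i <;> simp [pt]

theorem isometry_pt_fst (y : ℝ) : Isometry fun x => pt x y := by
  rw [show (fun x => pt x y) = _ from funext fun x => pt_eq_add_fst x y]
  exact isometry_line _ (by simp)

theorem isometry_pt_snd (x : ℝ) : Isometry fun y => pt x y := by
  rw [show (fun y => pt x y) = _ from funext fun y => pt_eq_add_snd x y]
  exact isometry_line _ (by simp)

variable {a b c d : ℝ}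

theorem isOpen_rect : IsOpen (rect a b c d) := by
  have h0 : Continuous fun x : Plane => x 0 := by fun_prop
  have h1 : Continuous fun x : Plane => x 1 := by fun_prop
  exact (isOpen_lt continuous_const h0).inter ((isOpen_lt h0 continuous_const).inter
    ((isOpen_lt continuous_const h1).inter (isOpen_lt h1 continuous_const)))

theorem convex_rect : Convex ℝ (rect a b c d) := by
  rintro x ⟨h1, h2, h3, h4⟩ y ⟨h1', h2', h3', h4'⟩ s t hs ht hst
  simp only [rect, Set.mem_ofPred_eq, PiLp.add_apply, PiLp.smul_apply, smul_eq_mul]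
  obtain rfl : t = 1 - s := by linarith
  refine ⟨?_, ?_, ?_, ?_⟩ <;>
  · rcases hs.eq_or_lt with rfl | hs'
    · linarith
    · nlinarith

/-- The closed rectangle. -/
def closedRect (a b c d : ℝ) : Set Plane := {x | a ≤ x 0 ∧ x 0 ≤ b ∧ c ≤ x 1 ∧ x 1 ≤ d}

theorem closure_rect_subset : closure (rect a b c d) ⊆ closedRect a b c d := by
  have h0 : Continuous fun x : Plane => x 0 := by fun_prop
  have h1 : Continuous fun x : Plane => x 1 := by fun_prop
  refine closure_minimal (fun x hx => ⟨hx.1.le, hx.2.1.le, hx.2.2.1.le, hx.2.2.2.le⟩) ?_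
  exact (isClosed_le continuous_const h0).inter ((isClosed_le h0 continuous_const).inter
    ((isClosed_le continuous_const h1).inter (isClosed_le h1 continuous_const)))

theorem closure_rect (hab : a < b) (hcd : c < d) : closure (rect a b c d) = closedRect a b c d := by
  refine closure_rect_subset.antisymm fun x hx => ?_
  obtain ⟨h1, h2, h3, h4⟩ := hx
  set m := pt ((a + b) / 2) ((c + d) / 2) with hm
  have hlim : Tendsto (fun n : ℕ => x + (1 / ((n : ℝ) + 1)) • (m - x)) atTop (𝓝 x) := by
    have := (tendsto_one_div_add_atTop_nhds_zero_nat (𝕜 := ℝ)).smul_const (m - x)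
    simpa using this.const_add x
  refine mem_closure_of_tendsto hlim (Eventually.of_forall fun n => ?_)
  have ht : 0 < 1 / ((n : ℝ) + 1) := by positivity
  have ht1 : 1 / ((n : ℝ) + 1) ≤ 1 := by
    rw [div_le_one (by positivity)]; linarith [(Nat.cast_nonneg n : (0 : ℝ) ≤ n)]
  generalize 1 / ((n : ℝ) + 1) = t at ht ht1
  simp only [rect, Set.mem_ofPred_eq, PiLp.add_apply, PiLp.smul_apply, PiLp.sub_apply, smul_eq_mul,
    hm, pt_zero, pt_one]
  refine ⟨?_, ?_, ?_, ?_⟩ <;> nlinarith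

theorem frontier_rect_subset : frontier (rect a b c d) ⊆
    ((fun y => pt a y) '' Set.Icc c d ∪ (fun y => pt b y) '' Set.Icc c d) ∪
    ((fun x => pt x c) '' Set.Icc a b ∪ (fun x => pt x d) '' Set.Icc a b) := by
  rintro x ⟨hx, hx'⟩
  rw [isOpen_rect.interior_eq] at hx'
  obtain ⟨h1, h2, h3, h4⟩ := closure_rect_subset hx
  by_cases ha : x 0 = a
  · exact .inl (.inl ⟨x 1, ⟨h3, h4⟩, by simp only [← ha, pt_self]⟩)
  by_cases hb : x 0 = b
  · exact .inl (.inr ⟨x 1, ⟨h3, h4⟩, by simp only [← hb, pt_self]⟩)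
  by_cases hc : x 1 = c
  · exact .inr (.inl ⟨x 0, ⟨h1, h2⟩, by simp only [← hc, pt_self]⟩)
  by_cases hd : x 1 = d
  · exact .inr (.inr ⟨x 0, ⟨h1, h2⟩, by simp only [← hd, pt_self]⟩)
  · exact absurd ⟨lt_of_le_of_ne h1 (Ne.symm ha), lt_of_le_of_ne h2 hb,
      lt_of_le_of_ne h3 (Ne.symm hc), lt_of_le_of_ne h4 hd⟩ hx'

theorem hausdorffMeasure_frontier_rect_ne_top :
    Measure.hausdorffMeasure 1 (frontier (rect a b c d)) ≠ ⊤ := by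
  have h : ∀ {γ : ℝ → Plane}, Isometry γ → ∀ s t : ℝ,
      Measure.hausdorffMeasure 1 (γ '' Set.Icc s t) < ⊤ := by
    intro γ hγ s t
    rw [hγ.hausdorffMeasure_image (.inl zero_le_one), hausdorffMeasure_real]
    exact measure_Icc_lt_top
  refine ne_top_of_le_ne_top ?_ (measure_mono frontier_rect_subset)
  refine ne_top_of_le_ne_top (ENNReal.add_ne_top.2 ⟨?_, ?_⟩) (measure_union_le _ _) <;>
  refine ne_top_of_le_ne_top (ENNReal.add_ne_top.2 ⟨?_, ?_⟩) (measure_union_le _ _)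
  · exact (h (isometry_pt_snd a) _ _).ne
  · exact (h (isometry_pt_snd b) _ _).ne
  · exact (h (isometry_pt_fst c) _ _).ne
  · exact (h (isometry_pt_fst d) _ _).ne

theorem norm_sub_le_of_mem_closedRect {x y : Plane} (hx : x ∈ closedRect a b c d)
    (hy : y ∈ closedRect a b c d) : ‖x - y‖ ≤ (b - a) + (d - c) := by
  obtain ⟨h1, h2, h3, h4⟩ := hx
  obtain ⟨h1', h2', h3', h4'⟩ := hy
  rw [plane_eq_sum (x - y)]
  refine (norm_add_le _ _).trans (add_le_add ?_ ?_)
  · rw [norm_smul, PiLp.norm_single, norm_one, mul_one, Real.norm_eq_abs, abs_le, PiLp.sub_apply]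
    constructor <;> linarith
  · rw [norm_smul, PiLp.norm_single, norm_one, mul_one, Real.norm_eq_abs, abs_le, PiLp.sub_apply]
    constructor <;> linarith

theorem isBounded_rect : Bornology.IsBounded (rect a b c d) := by
  refine Metric.isBounded_iff.2 ⟨(b - a) + (d - c), fun x hx y hy => ?_⟩
  rw [dist_eq_norm]
  exact norm_sub_le_of_mem_closedRect (closure_rect_subset (subset_closure hx))
    (closure_rect_subset (subset_closure hy))

theorem nonempty_rect (hab : a < b) (hcd : c < d) : (rect a b c d).Nonempty := by
  refine ⟨pt ((a + b) / 2) ((c + d) / 2), ?_⟩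
  simp only [rect, Set.mem_ofPred_eq, pt_zero, pt_one]
  refine ⟨?_, ?_, ?_, ?_⟩ <;> linarith

/-- Move half the length of the interval towards the farther end point. -/
theorem exists_inward (hab : a < b) {x : ℝ} (h1 : a ≤ x) (h2 : x ≤ b) :
    ∃ σ : ℝ, |σ| = (b - a) / 2 ∧ ∀ s ∈ Set.Ioo (0 : ℝ) 1, a < x + s * σ ∧ x + s * σ < b := by
  rcases le_total x ((a + b) / 2) with h | h
  · refine ⟨(b - a) / 2, abs_of_pos (by linarith), fun s hs => ⟨?_, ?_⟩⟩ <;> nlinarith [hs.1, hs.2]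
  · refine ⟨-((b - a) / 2), by rw [abs_neg, abs_of_pos (by linarith)], fun s hs => ⟨?_, ?_⟩⟩ <;>
      nlinarith [hs.1, hs.2]

theorem norm_pt_le (x y : ℝ) : ‖pt x y‖ ≤ |x| + |y| := by
  rw [plane_eq_sum (pt x y), pt_zero, pt_one]
  refine (norm_add_le _ _).trans ?_
  simp [norm_smul]

theorem sobolevBound_rect (hab : a < b) (hcd : c < d) : SobolevBound (rect a b c d) := by
  set r := (b - a) + (d - c) with hr
  set H := ENNReal.ofReal (r ^ 2) with hH
  have hHt : H ≠ ⊤ := ENNReal.ofReal_ne_top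
  set δ := (b - a) / 2 * ((d - c) / 2) with hδ
  have hδ0 : 0 < δ := mul_pos (by linarith) (by linarith)
  have h0 : ENNReal.ofReal δ ≠ 0 := by rwa [Ne, ENNReal.ofReal_eq_zero, not_le]
  refine ⟨(ENNReal.ofReal δ)⁻¹ * (8 * (1 + H + H ^ 2)), ENNReal.mul_ne_top (ENNReal.inv_ne_top.2 h0)
    (ENNReal.mul_ne_top (by simp) (by simp [hHt])), fun f hf x hx => ?_⟩
  obtain ⟨h1, h2, h3, h4⟩ := closure_rect_subset hx
  obtain ⟨σ, hσ, hσs⟩ := exists_inward hab h1 h2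
  obtain ⟨τ, hτ, hτs⟩ := exists_inward hcd h3 h4
  -- From any point of the closed rectangle, a rectangle with half the side lengths fits inside in
  -- the inward directions.
  have hdet : |det2 (pt σ 0) (pt 0 τ)| = δ := by simp [det2, abs_mul, hσ, hτ, hδ]
  have hmain := sobolev_parallelogram_le (A := x) (u := pt σ 0) (v := pt 0 τ)
    (isOpen_rect (a := a) (b := b) (c := c) (d := d)).measurableSet
    (fun s hs t ht => by
      simp only [rect, parMap, Set.mem_ofPred_eq, PiLp.add_apply, PiLp.smul_apply, smul_eq_mul,
        pt_zero, pt_one, mul_zero, add_zero]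
      exact ⟨(hσs s hs).1, (hσs s hs).2, (hτs t ht).1, (hτs t ht).2⟩)
    (by rw [← abs_pos, hdet]; exact hδ0) hf (r := r)
    ((norm_pt_le _ _).trans (by rw [hσ, abs_zero]; linarith))
    ((norm_pt_le _ _).trans (by rw [hτ, abs_zero]; linarith))
  rw [hdet] at hmain
  rw [mul_assoc, ← ENNReal.mul_le_iff_le_inv h0 ENNReal.ofReal_ne_top]
  refine hmain.trans ?_
  set μ : Measure Plane := volume.restrict (rect a b c d)
  have h2 : h2Sq μ f = semiSq μ 0 f + semiSq μ 1 f + semiSq μ 2 f := by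
    simp [h2Sq, Finset.sum_range_succ]
  rw [h2, ← semiSq_zero, ← semiSq_one]
  calc _ ≤ 4 * semiSq μ 0 f + 8 * H * semiSq μ 1 f + 4 * H ^ 2 * (2 * semiSq μ 2 f) := by
        gcongr; exact sum_sum_pderiv_le _ hf
    _ ≤ 4 * semiSq μ 0 f + 8 * H * semiSq μ 1 f + 4 * H ^ 2 * (2 * semiSq μ 2 f) +
        (4 * semiSq μ 0 f + 8 * (semiSq μ 1 f + semiSq μ 2 f) +
        8 * (H * (semiSq μ 0 f + semiSq μ 2 f)) +
        8 * (H ^ 2 * (semiSq μ 0 f + semiSq μ 1 f))) := le_self_add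
    _ = _ := by ring

theorem traceBound_side (hab : a < b) (hcd : c < d) {y : ℝ} (hy : y = c ∨ y = d) :
    ∃ K L, TraceBound (rect a b c d)
      ((Measure.hausdorffMeasure 1).restrict ((fun x => pt x y) '' Set.Ioo a b)) K L := by
  set e : Plane := EuclideanSpace.single 0 1 with he
  -- The full height `d - c`, pointing inwards: upwards from the bottom side and downwards from the
  -- top side.
  set v : Plane := pt 0 (c + d - 2 * y) with hv
  have hdet : |det2 e v| = d - c := by
    have : det2 e v = c + d - 2 * y := by simp [det2, he, hv]
    rw [this]
    rcases hy with rfl | rfl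
    · rw [abs_of_pos] <;> linarith
    · rw [abs_of_neg] <;> linarith
  have h0 : ENNReal.ofReal (d - c) ≠ 0 := by
    rw [Ne, ENNReal.ofReal_eq_zero, not_le]; linarith
  refine ⟨(ENNReal.ofReal (d - c))⁻¹ * 2, (ENNReal.ofReal (d - c))⁻¹ *
    (2 * ENNReal.ofReal (‖v‖ ^ 2)), Measure.restrict_mono ?_ le_rfl, ENNReal.mul_ne_top
    (ENNReal.inv_ne_top.2 h0) (by simp), ENNReal.mul_ne_top (ENNReal.inv_ne_top.2 h0)
    (ENNReal.mul_ne_top (by simp) ENNReal.ofReal_ne_top), fun f hf => ?_⟩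
  · rintro _ ⟨x, hx, rfl⟩
    rw [frontier, isOpen_rect.interior_eq, closure_rect hab hcd]
    refine ⟨⟨hx.1.le, hx.2.le, ?_, ?_⟩, fun h => ?_⟩
    · rw [pt_one]; rcases hy with rfl | rfl <;> linarith
    · rw [pt_one]; rcases hy with rfl | rfl <;> linarith
    · have h3 := h.2.2.1
      have h4 := h.2.2.2
      simp only [pt_one] at h3 h4
      rcases hy with rfl | rfl <;> linarith
  · have h1 := trace_parallelogram_le (A := pt 0 y) (e := e) (v := v) (I := Set.Ioo a b)
      measurableSet_Ioo (isOpen_rect (a := a) (b := b) (c := c) (d := d)).measurableSet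
      (fun t ht s hs => by
        simp only [rect, parMap, Set.mem_ofPred_eq, PiLp.add_apply, PiLp.smul_apply, smul_eq_mul,
          pt_zero, pt_one, he, hv]
        simp only [PiLp.single_apply]
        refine ⟨by simpa using ht.1, by simpa using ht.2, ?_, ?_⟩ <;>
        · simp
          rcases hy with rfl | rfl <;> nlinarith [hs.1, hs.2])
      (by rw [← abs_pos, hdet]; linarith) hf
    have h2 : l2sq ((Measure.hausdorffMeasure 1).restrict ((fun x => pt x y) '' Set.Ioo a b)) f =
        ∫⁻ t in Set.Ioo a b, ‖f (pt 0 y + t • e)‖ₑ ^ 2 := by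
      rw [l2sq, setLIntegral_hausdorff_image (isometry_pt_fst y)]
      exact lintegral_congr fun t => by rw [pt_eq_add_fst t y]
    rw [hdet, ← h2, ENNReal.mul_le_iff_le_inv h0 ENNReal.ofReal_ne_top] at h1
    refine h1.trans ?_
    calc _ ≤ (ENNReal.ofReal (d - c))⁻¹ * (2 * l2sq (volume.restrict (rect a b c d)) f +
          2 * (ENNReal.ofReal (‖v‖ ^ 2) * ∑ i, l2sq (volume.restrict (rect a b c d)) (pderiv i f))) := by
          gcongr; exact l2sq_dirDeriv_le hf v _
      _ = _ := by ring

theorem contRep_rect (hab : a < b) (hcd : c < d) {s : ℕ} (hs : 2 ≤ s) {v : Plane → ℝ}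
    (hv : MemHs (rect a b c d) s v) :
    ContinuousOn (contRep (rect a b c d) v) (closure (rect a b c d)) ∧
      contRep (rect a b c d) v =ᵐ[volume.restrict (rect a b c d)] v ∧
      ∀ y, y = c ∨ y = d → sideTrace a b c d v y =ᵐ[volume.restrict (Set.Ioo a b)]
        fun x => contRep (rect a b c d) v (pt x y) := by
  obtain ⟨φ, hφ, hlim⟩ := exists_smooth_approx isOpen_rect convex_rect isBounded_rect
    (nonempty_rect hab hcd) hv
  obtain ⟨f, hf, hfu, hunif⟩ := exists_continuousOn_limit isOpen_rect isBounded_rect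
    (sobolevBound_rect hab hcd) hs hv hφ hlim
  obtain ⟨h1, h2⟩ := contRep_spec hf hfu
  have heq := contRep_eq isOpen_rect hf hfu
  refine ⟨h1, h2, fun y hy => ?_⟩
  obtain ⟨K, L, hB⟩ := traceBound_side hab hcd hy
  have htr := isTrace_of_tendstoUniformlyOn isBounded_rect hausdorffMeasure_frontier_rect_ne_top
    (one_le_two.trans hs) hv hφ hlim isOpen_rect h1 (hunif.congr_right heq.symm)
  -- The continuous representative is one trace and `trace` is another; they agree almost everywhere
  -- on the side.
  exact ae_comp_isometry (isometry_pt_fst y) (htr.trace.ae_unique isOpen_rect hB htr)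


/-! ### Quasi-uniform meshes -/

section mesh

variable {a b c d ρ : ℝ} {𝒯 : Finset Tri} {T T' : Tri}

theorem diam_le_meshSize (hT : T ∈ 𝒯) : Metric.diam (closedTri T) ≤ meshSize 𝒯 :=
  le_csSup (𝒯.finite_toSet.image _).bddAbove ⟨T, hT, rfl⟩

theorem norm_sub_le_meshSize (hT : T ∈ 𝒯) : ∀ x ∈ closedTri T, ∀ y ∈ closedTri T,
    ‖x - y‖ ≤ meshSize 𝒯 := fun x hx y hy => by
  rw [← dist_eq_norm]
  exact (Metric.dist_le_diam_of_mem isCompact_closedTri.isBounded hx hy).trans (diam_le_meshSize hT)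

theorem IsMesh.nonempty (hab : a < b) (hcd : c < d) (hM : IsMesh (rect a b c d) 𝒯) :
    𝒯.Nonempty := by
  obtain ⟨x, hx⟩ := nonempty_rect hab hcd
  have := subset_closure hx
  rw [hM.2] at this
  obtain ⟨T, hT, -⟩ := Set.mem_iUnion₂.1 this
  exact ⟨T, hT⟩

theorem meshSize_pos (hT : T ∈ 𝒯) : 0 < meshSize 𝒯 := by
  have h1 := norm_sub_le_meshSize hT _ (points_mem 0) _ (points_mem 1)
  have h2 : 0 < ‖T.points 0 - T.points 1‖ := by
    rw [norm_pos_iff, sub_ne_zero]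
    exact T.independent.injective.ne (by decide)
  linarith

theorem QuasiUniform.regular (hQ : QuasiUniform ρ 𝒯) (hT : T ∈ 𝒯) : Regular T ρ (meshSize 𝒯) :=
  ⟨norm_sub_le_meshSize hT, hQ T hT⟩

theorem IsMesh.closedTri_subset (hM : IsMesh (rect a b c d) 𝒯) (hT : T ∈ 𝒯) :
    closedTri T ⊆ closure (rect a b c d) := by
  rw [hM.2]
  exact Set.subset_biUnion_of_mem (u := fun T => closedTri T) hT

theorem IsMesh.meshSize_le (hab : a < b) (hcd : c < d) (hM : IsMesh (rect a b c d) 𝒯) :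
    meshSize 𝒯 ≤ (b - a) + (d - c) := by
  obtain ⟨T, hT⟩ := hM.nonempty hab hcd
  refine csSup_le ⟨_, T, hT, rfl⟩ ?_
  rintro _ ⟨T', hT', rfl⟩
  refine Metric.diam_le_of_forall_dist_le (by linarith) fun x hx y hy => ?_
  rw [dist_eq_norm]
  exact norm_sub_le_of_mem_closedRect (closure_rect_subset (hM.closedTri_subset hT' hx))
    (closure_rect_subset (hM.closedTri_subset hT' hy))

theorem IsMesh.openTri_subset (hab : a < b) (hcd : c < d) (hM : IsMesh (rect a b c d) 𝒯)
    (hT : T ∈ 𝒯) : openTri T ⊆ rect a b c d := by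
  have h1 : openTri T ⊆ interior (closure (rect a b c d)) :=
    interior_mono (hM.closedTri_subset hT)
  rwa [convex_rect.interior_closure_eq_interior_of_nonempty_interior
    (by rw [isOpen_rect.interior_eq]; exact nonempty_rect hab hcd), isOpen_rect.interior_eq] at h1

theorem IsMesh.inter_subset_frontier (hM : IsMesh (rect a b c d) 𝒯) (hT : T ∈ 𝒯) (hT' : T' ∈ 𝒯)
    (hne : T ≠ T') : closedTri T ∩ closedTri T' ⊆ frontier (openTri T) := by
  rintro x ⟨hx, hx'⟩
  rw [frontier_openTri]
  refine ⟨hx, fun ho => ?_⟩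
  rw [← closure_openTri, mem_closure_iff] at hx'
  obtain ⟨y, hy, hy'⟩ := hx' _ isOpen_openTri ho
  exact Set.disjoint_left.1 (hM.1 T hT T' hT' hne) hy hy'

theorem IsMesh.mem_frontier (hab : a < b) (hcd : c < d) (hM : IsMesh (rect a b c d) 𝒯) (hT : T ∈ 𝒯)
    {x : Plane} (hx : x ∈ closedTri T) (hx' : x ∉ rect a b c d) : x ∈ frontier (openTri T) := by
  rw [frontier_openTri]
  exact ⟨hx, fun h => hx' (hM.openTri_subset hab hcd hT h)⟩

open Classical in
/-- Boundedly many elements meet at a point. -/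
theorem IsMesh.card_le (hρ : 0 < ρ) (hM : IsMesh (rect a b c d) 𝒯) (hQ : QuasiUniform ρ 𝒯)
    (x : Plane) : ((𝒯.filter fun T => x ∈ closedTri T).card : ℝ≥0∞) ≤ ENNReal.ofReal (ρ ^ 2)⁻¹ := by
  set S := 𝒯.filter fun T => x ∈ closedTri T with hS
  rcases S.eq_empty_or_nonempty with h0 | ⟨T0, hT0⟩
  · rw [h0]; simp
  have hSm : ∀ T ∈ S, T ∈ 𝒯 := fun T hT => (Finset.mem_filter.1 hT).1
  set h := meshSize 𝒯 with hh
  have hpos : 0 < h := meshSize_pos (hSm T0 hT0)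
  have h1 : ∀ T ∈ S, volume (Metric.ball (0 : Plane) (ρ * h)) ≤ volume (openTri T) := by
    intro T hT
    obtain ⟨z, hz⟩ := hQ T (hSm T hT)
    rw [← Measure.addHaar_ball_center volume z]
    exact measure_mono hz
  -- The elements through `x` are disjoint, lie in the disc of radius `h` about `x`, and each
  -- contains a disc of radius `ρ * h`. Comparing areas bounds their number by `ρ⁻²`.
  have h2 : ∑ T ∈ S, volume (openTri T) = volume (⋃ T ∈ S, openTri T) :=
    (measure_biUnion_finset (fun T hT T' hT' hne => hM.1 T (hSm T hT) T' (hSm T' hT') hne)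
      fun T _ => isOpen_openTri.measurableSet).symm
  have h3 : (⋃ T ∈ S, openTri T) ⊆ Metric.closedBall x h := by
    refine Set.iUnion₂_subset fun T hT y hy => ?_
    rw [Metric.mem_closedBall, dist_eq_norm]
    exact norm_sub_le_meshSize (hSm T hT) y (DGDyn.openTri_subset hy) x (Finset.mem_filter.1 hT).2
  have h4 : (S.card : ℝ≥0∞) * volume (Metric.ball (0 : Plane) (ρ * h)) ≤
      volume (Metric.closedBall x h) := by
    rw [← nsmul_eq_mul]
    exact (Finset.card_nsmul_le_sum _ _ _ h1).trans (h2.trans_le (measure_mono h3))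
  rw [EuclideanSpace.volume_ball_fin_two, EuclideanSpace.volume_closedBall_fin_two,
    mul_comm (_ ^ 2) _, mul_comm (_ ^ 2) _, mul_left_comm,
    ENNReal.mul_le_mul_iff_right (by simp [Real.pi_pos]) (by simp),
    ENNReal.ofReal_mul hρ.le, mul_pow, ← mul_assoc] at h4
  have h5 : ENNReal.ofReal h ^ 2 ≠ 0 := by
    refine pow_ne_zero _ ?_
    rwa [Ne, ENNReal.ofReal_eq_zero, not_le]
  have h6 : (S.card : ℝ≥0∞) * ENNReal.ofReal ρ ^ 2 ≤ 1 := by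
    refine (ENNReal.mul_le_mul_iff_left h5 (ENNReal.pow_ne_top ENNReal.ofReal_ne_top)).1 ?_
    rwa [one_mul]
  rw [ENNReal.ofReal_inv_of_pos (by positivity), ENNReal.ofReal_pow hρ.le]
  exact ENNReal.le_inv_iff_mul_le.2 h6

open Classical in
-- Sum the indicators pointwise: a point is counted at most `κ` times.
theorem sum_setLIntegral_le {X ι : Type*} [MeasurableSpace X] {μ : Measure X} (S : Finset ι)
    {A : ι → Set X} {B : Set X} (hA : ∀ i ∈ S, MeasurableSet (A i)) (hB : MeasurableSet B)
    (hAB : ∀ i ∈ S, A i ⊆ B)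
    {κ : ℝ≥0∞} (hκ : κ ≠ ⊤) (hmult : ∀ x ∈ B, ((S.filter fun i => x ∈ A i).card : ℝ≥0∞) ≤ κ)
    {f : X → ℝ≥0∞} (hf : AEMeasurable f (μ.restrict B)) :
    ∑ i ∈ S, ∫⁻ x in A i, f x ∂μ ≤ κ * ∫⁻ x in B, f x ∂μ := by
  have h1 : ∀ i ∈ S, ∫⁻ x in A i, f x ∂μ = ∫⁻ x in B, (A i).indicator f x ∂μ := by
    intro i hi
    rw [lintegral_indicator (hA i hi), Measure.restrict_restrict (hA i hi),
      Set.inter_eq_self_of_subset_left (hAB i hi)]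
  rw [Finset.sum_congr rfl h1, ← lintegral_finsetSum' _ fun i hi => hf.indicator (hA i hi),
    ← lintegral_const_mul' _ _ hκ]
  refine setLIntegral_mono' hB fun x hx => ?_
  calc ∑ i ∈ S, (A i).indicator f x = ∑ i ∈ S.filter (fun i => x ∈ A i), f x := by
        rw [Finset.sum_filter]
        exact Finset.sum_congr rfl fun i _ => by rw [Set.indicator_apply]
    _ = ((S.filter fun i => x ∈ A i).card : ℝ≥0∞) * f x := by rw [Finset.sum_const, nsmul_eq_mul]
    _ ≤ κ * f x := by gcongr; exact hmult x hx

theorem l2sq_combine_le {X : Type*} [MeasurableSpace X] {μ : Measure X} {F : ℝ → ℝ → ℝ}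
    (hF : ∀ s t, ‖F s t‖ₑ ^ 2 ≤ 2 * ‖s‖ₑ ^ 2 + 2 * ‖t‖ₑ ^ 2) {f g : X → ℝ}
    (hf : AEStronglyMeasurable f μ) :
    l2sq μ (fun x => F (f x) (g x)) ≤ 2 * l2sq μ f + 2 * l2sq μ g := by
  unfold l2sq
  refine (lintegral_mono fun x => hF (f x) (g x)).trans_eq ?_
  rw [lintegral_add_left' ((aemeasurable_enorm_sq hf).const_mul 2),
    lintegral_const_mul' _ _ (by simp), lintegral_const_mul' _ _ (by simp)]

theorem ifaceMeasure_comm (T T' : Tri) : ifaceMeasure T T' = ifaceMeasure T' T := by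
  rw [ifaceMeasure, ifaceMeasure, Set.inter_comm]

open Classical in
-- `F` stands for the difference or the half-sum. The interfaces of `T` lie in its boundary and
-- cover each point at most `ρ⁻²` times, whether or not whole edges match.
theorem IsMesh.sum_iface_le (hρ : 0 < ρ) (hM : IsMesh (rect a b c d) 𝒯) (hQ : QuasiUniform ρ 𝒯)
    {F : ℝ → ℝ → ℝ} (hF : ∀ s t, ‖F s t‖ₑ ^ 2 ≤ 2 * ‖s‖ₑ ^ 2 + 2 * ‖t‖ₑ ^ 2)
    {g : Tri → Plane → ℝ} (hg : ∀ T, AEStronglyMeasurable (g T) (bdryMeasure (openTri T))) :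
    ∑ T ∈ 𝒯, ∑ T' ∈ 𝒯.erase T, l2sq (ifaceMeasure T T') (fun x => F (g T x) (g T' x)) ≤
      4 * (ENNReal.ofReal (ρ ^ 2)⁻¹ * ∑ T ∈ 𝒯, l2sq (bdryMeasure (openTri T)) (g T)) := by
  have hle : ∀ T ∈ 𝒯, ∀ T' ∈ 𝒯.erase T, ifaceMeasure T T' ≤ bdryMeasure (openTri T) :=
    fun T hT T' hT' => Measure.restrict_mono (hM.inter_subset_frontier hT (Finset.mem_of_mem_erase hT')
      (Finset.ne_of_mem_erase hT').symm) le_rfl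
  have h1 : ∀ T ∈ 𝒯, ∑ T' ∈ 𝒯.erase T, l2sq (ifaceMeasure T T') (g T) ≤
      ENNReal.ofReal (ρ ^ 2)⁻¹ * l2sq (bdryMeasure (openTri T)) (g T) := by
    intro T hT
    refine sum_setLIntegral_le (𝒯.erase T) (A := fun T' => closedTri T ∩ closedTri T')
      (fun T' _ => measurableSet_closedTri.inter measurableSet_closedTri)
      isClosed_frontier.measurableSet (fun T' hT' => hM.inter_subset_frontier hT
        (Finset.mem_of_mem_erase hT') (Finset.ne_of_mem_erase hT').symm) ENNReal.ofReal_ne_top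
      (fun x _ => ?_) (aemeasurable_enorm_sq (hg T))
    refine le_trans ?_ (hM.card_le hρ hQ x)
    refine Nat.cast_le.2 (Finset.card_le_card fun T' hT' => ?_)
    simp only [Finset.mem_filter] at hT'
    obtain ⟨h3, h4⟩ := hT'
    exact Finset.mem_filter.2 ⟨Finset.mem_of_mem_erase h3, h4.2⟩
  -- Interfaces are symmetric, so the contribution of the neighbour equals that of the element.
  have h2 : ∑ T ∈ 𝒯, ∑ T' ∈ 𝒯.erase T, l2sq (ifaceMeasure T T') (g T') =
      ∑ T ∈ 𝒯, ∑ T' ∈ 𝒯.erase T, l2sq (ifaceMeasure T T') (g T) := by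
    rw [Finset.sum_comm' (t' := 𝒯) (s' := fun T => 𝒯.erase T)]
    · exact Finset.sum_congr rfl fun T _ => Finset.sum_congr rfl fun T' _ => by
        rw [ifaceMeasure_comm]
    · intro T T'
      simp only [Finset.mem_erase]
      tauto
  calc _ ≤ ∑ T ∈ 𝒯, ∑ T' ∈ 𝒯.erase T, (2 * l2sq (ifaceMeasure T T') (g T) +
        2 * l2sq (ifaceMeasure T T') (g T')) :=
        Finset.sum_le_sum fun T hT => Finset.sum_le_sum fun T' hT' =>
          l2sq_combine_le hF ((hg T).mono_measure (hle T hT T' hT'))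
    _ = 4 * ∑ T ∈ 𝒯, ∑ T' ∈ 𝒯.erase T, l2sq (ifaceMeasure T T') (g T) := by
        simp only [Finset.sum_add_distrib, ← Finset.mul_sum]
        rw [h2]; ring
    _ ≤ _ := by
        have h3 := Finset.sum_le_sum h1
        rw [← Finset.mul_sum] at h3
        exact mul_le_mul_right h3 _

theorem restrict_image_isometry {γ : ℝ → Plane} (hγ : Isometry γ) (I : Set ℝ) :
    (Measure.hausdorffMeasure 1 : Measure Plane).restrict (γ '' I) =
      (volume.restrict I).map γ := by
  have hme : MeasurableEmbedding γ := hγ.isClosedEmbedding.measurableEmbedding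
  have h1 : (Measure.hausdorffMeasure 1 : Measure Plane).restrict (γ '' I) =
      (Measure.map γ volume).restrict (γ '' I) := by
    rw [← hausdorffMeasure_real, hγ.map_hausdorffMeasure (.inl zero_le_one),
      Measure.restrict_restrict_of_subset (Set.image_subset_range _ _)]
  rw [h1, hme.restrict_map, Set.preimage_image_eq _ hγ.injective]

/-- The ordinates of the periodic edge shared by `T` and `T'`. -/
def perSet (a b : ℝ) (T T' : Tri) : Set ℝ := {y | pt a y ∈ closedTri T ∧ pt b y ∈ closedTri T'}

theorem isClosed_perSet (a b : ℝ) (T T' : Tri) : IsClosed (perSet a b T T') :=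
  (isCompact_closedTri.isClosed.preimage (isometry_pt_snd a).continuous).inter
    (isCompact_closedTri.isClosed.preimage (isometry_pt_snd b).continuous)

theorem periodicMeasure_eq (a b : ℝ) (T T' : Tri) :
    periodicMeasure a b T T' = (volume.restrict (perSet a b T T')).map fun y => pt a y := by
  rw [← restrict_image_isometry (isometry_pt_snd a), periodicMeasure]
  congr 1
  ext x
  constructor
  · rintro ⟨rfl, h1, h2⟩
    exact ⟨x 1, ⟨by rwa [pt_self], h2⟩, pt_self x⟩
  · rintro ⟨y, ⟨h1, h2⟩, rfl⟩
    exact ⟨rfl, h1, h2⟩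

open Classical in
-- Both sides are parametrised by the ordinate, so the shifted trace becomes an ordinary trace on
-- the right side. Multiplicity on one side is counted by the elements that contain the opposite
-- point.
theorem IsMesh.sum_periodic_le (hab : a < b) (hcd : c < d) (hρ : 0 < ρ)
    (hM : IsMesh (rect a b c d) 𝒯) (hQ : QuasiUniform ρ 𝒯)
    {F : ℝ → ℝ → ℝ} (hF : ∀ s t, ‖F s t‖ₑ ^ 2 ≤ 2 * ‖s‖ₑ ^ 2 + 2 * ‖t‖ₑ ^ 2)
    {g : Tri → Plane → ℝ} (hg : ∀ T, AEStronglyMeasurable (g T) (bdryMeasure (openTri T))) :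
    ∑ T ∈ 𝒯, ∑ T' ∈ 𝒯, l2sq (periodicMeasure a b T T') (fun x => F (g T x) (g T' (pt b (x 1)))) ≤
      4 * (ENNReal.ofReal (ρ ^ 2)⁻¹ * ∑ T ∈ 𝒯, l2sq (bdryMeasure (openTri T)) (g T)) := by
  have hmap : ∀ (x : ℝ) (T T' : Tri), (volume.restrict (perSet a b T T')).map (fun y => pt x y) =
      (Measure.hausdorffMeasure 1).restrict ((fun y => pt x y) '' perSet a b T T') := fun x T T' =>
    (restrict_image_isometry (isometry_pt_snd x) _).symm
  have hme : ∀ x : ℝ, MeasurableEmbedding fun y => pt x y := fun x =>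
    (isometry_pt_snd x).isClosedEmbedding.measurableEmbedding
  have hsa : ∀ T ∈ 𝒯, ∀ T', (fun y => pt a y) '' perSet a b T T' ⊆ frontier (openTri T) := by
    rintro T hT T' _ ⟨y, hy, rfl⟩
    exact hM.mem_frontier hab hcd hT hy.1 fun h => lt_irrefl _ h.1
  have hsb : ∀ T, ∀ T' ∈ 𝒯, (fun y => pt b y) '' perSet a b T T' ⊆ frontier (openTri T') := by
    rintro T T' hT' _ ⟨y, hy, rfl⟩
    exact hM.mem_frontier hab hcd hT' hy.2 fun h => lt_irrefl _ h.2.1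
  have hchange : ∀ T ∈ 𝒯, ∀ T' ∈ 𝒯, l2sq (periodicMeasure a b T T')
      (fun x => F (g T x) (g T' (pt b (x 1)))) ≤
      2 * l2sq ((Measure.hausdorffMeasure 1).restrict ((fun y => pt a y) '' perSet a b T T')) (g T) +
      2 * l2sq ((Measure.hausdorffMeasure 1).restrict ((fun y => pt b y) '' perSet a b T T'))
        (g T') := by
    intro T hT T' hT'
    rw [periodicMeasure_eq, ← hmap, ← hmap]
    simp only [l2sq, (hme _).lintegral_map, pt_one]
    refine l2sq_combine_le (f := fun y => g T (pt a y)) (g := fun y => g T' (pt b y)) hF ?_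
    refine AEStronglyMeasurable.comp_measurable (f := fun y => pt a y) (g := g T) ?_
      (hme a).measurable
    rw [hmap]
    exact (hg T).mono_measure (Measure.restrict_mono (hsa T hT T') le_rfl)
  have hmeas : ∀ (x : ℝ) (T T' : Tri), MeasurableSet ((fun y => pt x y) '' perSet a b T T') :=
    fun x T T' => (hme x).measurableSet_image.2 (isClosed_perSet a b T T').measurableSet
  have h1 : ∀ T ∈ 𝒯, ∑ T' ∈ 𝒯, l2sq ((Measure.hausdorffMeasure 1).restrict
      ((fun y => pt a y) '' perSet a b T T')) (g T) ≤
      ENNReal.ofReal (ρ ^ 2)⁻¹ * l2sq (bdryMeasure (openTri T)) (g T) := by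
    intro T hT
    refine sum_setLIntegral_le 𝒯 (fun T' _ => hmeas a T T') isClosed_frontier.measurableSet
      (fun T' _ => hsa T hT T') ENNReal.ofReal_ne_top (fun x _ => ?_) (aemeasurable_enorm_sq (hg T))
    refine le_trans ?_ (hM.card_le hρ hQ (pt b (x 1)))
    refine Nat.cast_le.2 (Finset.card_le_card fun T' hT' => ?_)
    obtain ⟨h3, y, hy, hyx⟩ := Finset.mem_filter.1 hT'
    refine Finset.mem_filter.2 ⟨h3, ?_⟩
    rw [← hyx]
    exact hy.2
  have h2 : ∀ T' ∈ 𝒯, ∑ T ∈ 𝒯, l2sq ((Measure.hausdorffMeasure 1).restrict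
      ((fun y => pt b y) '' perSet a b T T')) (g T') ≤
      ENNReal.ofReal (ρ ^ 2)⁻¹ * l2sq (bdryMeasure (openTri T')) (g T') := by
    intro T' hT'
    refine sum_setLIntegral_le 𝒯 (fun T _ => hmeas b T T') isClosed_frontier.measurableSet
      (fun T _ => hsb T T' hT') ENNReal.ofReal_ne_top (fun x _ => ?_) (aemeasurable_enorm_sq (hg T'))
    refine le_trans ?_ (hM.card_le hρ hQ (pt a (x 1)))
    refine Nat.cast_le.2 (Finset.card_le_card fun T hT => ?_)
    obtain ⟨h3, y, hy, hyx⟩ := Finset.mem_filter.1 hT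
    refine Finset.mem_filter.2 ⟨h3, ?_⟩
    rw [← hyx]
    exact hy.1
  refine (Finset.sum_le_sum fun T hT => Finset.sum_le_sum fun T' hT' => hchange T hT T' hT').trans ?_
  simp only [Finset.sum_add_distrib, ← Finset.mul_sum]
  have h1' := Finset.sum_le_sum h1
  have h2' := Finset.sum_le_sum h2
  rw [Finset.sum_comm] at h2'
  rw [← Finset.mul_sum] at h1' h2'
  refine (add_le_add (mul_le_mul_right h1' 2) (mul_le_mul_right h2' 2)).trans_eq ?_
  ring

end mesh


/-! ### The interior part of the energy norm -/

theorem MemHs.mono_set {D D' : Set Plane} {s : ℕ} {u : Plane → ℝ} (hDo : IsOpen D)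
    (h : MemHs D s u) (hDD : D' ⊆ D) : MemHs D' s u :=
  ⟨h.1.mono_measure (Measure.restrict_mono hDD le_rfl), fun _ hα => ⟨_, (h.isWeakDeriv hα).mono hDD,
    (h.memLp_weakDeriv hDo hα).mono_measure (Measure.restrict_mono hDD le_rfl)⟩⟩

theorem wSemi_subset {D D' : Set Plane} {s n : ℕ} {u : Plane → ℝ}
    (hDo' : IsOpen D') (h : MemHs D s u) (hDD : D' ⊆ D) (hns : n ≤ s) :
    wSemi D' n u = ∑ α ∈ Finset.HasAntidiagonal.antidiagonal n,
      l2sq (volume.restrict D') (weakDeriv D α u) :=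
  Finset.sum_congr rfl fun α hα => l2sq_congr_ae (((h.isWeakDeriv (by
    rw [Finset.HasAntidiagonal.mem_antidiagonal.1 hα]; exact hns)).mono hDD).weakDeriv_ae_eq hDo')

theorem wSemi_le_hsNormSq (D : Set Plane) {s n : ℕ} (hns : n ≤ s) (u : Plane → ℝ) :
    wSemi D n u ≤ hsNormSq D s u := by
  refine Finset.sum_le_sum_of_subset fun α hα => ?_
  have := Finset.HasAntidiagonal.mem_antidiagonal.1 hα
  simp only [Finset.mem_filter, Finset.mem_product, Finset.mem_range]
  omega

theorem aestronglyMeasurable_trace (D : Set Plane) (u : Plane → ℝ) :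
    AEStronglyMeasurable (trace D u) (bdryMeasure D) := by
  by_cases h : ∃ g, IsTrace D u g
  · obtain ⟨g, hg⟩ := h
    exact hg.trace.2.1.1
  · rw [trace, dif_neg h]
    exact aestronglyMeasurable_const

theorem enorm_half_add_sq_le (s t : ℝ) :
    ‖(s + t) / 2‖ₑ ^ 2 ≤ 2 * ‖s‖ₑ ^ 2 + 2 * ‖t‖ₑ ^ 2 := by
  refine le_trans ?_ (enorm_add_sq_le s t)
  rw [enorm_sq_eq_ofReal, enorm_sq_eq_ofReal]
  refine ENNReal.ofReal_le_ofReal ?_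
  nlinarith [sq_nonneg (s + t)]

section bulk

variable {a b c d ρ : ℝ} {𝒯 : Finset Tri}

theorem IsMesh.sum_wSemi_le (hab : a < b) (hcd : c < d) (hM : IsMesh (rect a b c d) 𝒯) {s n : ℕ}
    (hns : n ≤ s) {v : Plane → ℝ} (hv : MemHs (rect a b c d) s v) :
    ∑ T ∈ 𝒯, wSemi (openTri T) n v ≤ hsNormSq (rect a b c d) s v := by
  refine le_trans ?_ (wSemi_le_hsNormSq _ hns v)
  rw [Finset.sum_congr rfl fun T hT =>
    wSemi_subset isOpen_openTri hv (hM.openTri_subset hab hcd hT) hns, Finset.sum_comm]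
  refine Finset.sum_le_sum fun α _ => ?_
  unfold l2sq
  rw [← lintegral_biUnion_finset (fun T hT T' hT' hne => hM.1 T hT T' hT' hne)
    fun T _ => isOpen_openTri.measurableSet]
  exact lintegral_mono_set (Set.iUnion₂_subset fun T hT => hM.openTri_subset hab hcd hT)

theorem interp_eq {Ω : Set Plane} (hM : IsMesh Ω 𝒯) {T : Tri} (hT : T ∈ 𝒯)
    (p : ℕ) (v : Plane → ℝ) {x : Plane} (hx : x ∈ openTri T) :
    interp Ω 𝒯 p v x = polyFun (lagrangePoly T p (contRep Ω v)) x := by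
  unfold interp
  rw [Finset.sum_eq_single_of_mem T hT, Set.indicator_of_mem hx]
  · rfl
  · intro T' hT' hne
    exact Set.indicator_of_notMem (fun hx' => Set.disjoint_left.1 (hM.1 T' hT' T hT hne) hx' hx) _

theorem sub_interp_ae_eq {Ω : Set Plane} (hM : IsMesh Ω 𝒯) {T : Tri} (hT : T ∈ 𝒯)
    (p : ℕ) (v : Plane → ℝ) : (fun x => v x - interp Ω 𝒯 p v x) =ᵐ[volume.restrict (openTri T)]
      fun x => v x - polyFun (lagrangePoly T p (contRep Ω v)) x :=
  (ae_restrict_iff' isOpen_openTri.measurableSet).2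
    (Eventually.of_forall fun x hx => by simp only [interp_eq hM hT p v hx])

/-- Trades the weight `ρ² h / 2` of the trace inequality for the penalty weight: `h² * (γ / h) = (2
γ / ρ²) * (ρ² h / 2)`. -/
theorem ofReal_mul_le_of_le {X Y : ℝ≥0∞} {h : ℝ} (hh : 0 < h) (hρ : 0 < ρ)
    (hXY : ENNReal.ofReal (ρ ^ 2 * h / 2) * X ≤ Y) {γ : ℝ} (hγ : 0 < γ) :
    ENNReal.ofReal (h ^ 2) * (ENNReal.ofReal (γ / h) * X) ≤ ENNReal.ofReal (2 * γ / ρ ^ 2) * Y := by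
  refine le_trans (le_of_eq ?_) (mul_le_mul_right hXY _)
  rw [← mul_assoc, ← mul_assoc, ← ENNReal.ofReal_mul (by positivity),
    ← ENNReal.ofReal_mul (by positivity)]
  congr 2
  field_simp

/-- The interior part of the energy norm of the interpolation error. -/
theorem exists_bulkSq_le (hab : a < b) (hcd : c < d) {γ : ℝ} (hγ : 0 < γ) (hρ : 0 < ρ) {s p : ℕ}
    (hs : 2 ≤ s) (hp : 1 ≤ p) : ∃ C : ℝ≥0∞, C ≠ ⊤ ∧ ∀ 𝒯 : Finset Tri, IsMesh (rect a b c d) 𝒯 →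
      QuasiUniform ρ 𝒯 → ∀ v : Plane → ℝ, MemHs (rect a b c d) s v →
      bulkSq a b γ 𝒯 (fun x => v x - interp (rect a b c d) 𝒯 p v x) ≤
        C * (ENNReal.ofReal (meshSize 𝒯 ^ 2) ^ min (s - 1) p * hsNormSq (rect a b c d) s v) := by
  set m := min (s - 1) p with hm
  have hm1 : 1 ≤ m := le_min (by omega) hp
  have hms : m + 1 ≤ s := by have := min_le_left (s - 1) p; omega
  have hmp : m + 1 ≤ p + 1 := Nat.succ_le_succ (min_le_right _ _)
  -- The approximation order is `m + 1 = min s (p + 1)`: both the regularity and the degree allow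
  -- it, and it is at least 2.
  obtain ⟨C, hC, hmain⟩ := wSemi_sub_polyFun_le hρ hp (by omega : 2 ≤ m + 1) hmp
  set κ := ENNReal.ofReal (ρ ^ 2)⁻¹ with hκ
  set G1 := ENNReal.ofReal (2 * γ / ρ ^ 2)
  set G2 := ENNReal.ofReal (2 * γ⁻¹ / ρ ^ 2)
  have hκt : κ ≠ ⊤ := ENNReal.ofReal_ne_top
  have hG1 : G1 ≠ ⊤ := ENNReal.ofReal_ne_top
  have hG2 : G2 ≠ ⊤ := ENNReal.ofReal_ne_top
  have t2 : ∀ {x y : ℝ≥0∞}, x ≠ ⊤ → y ≠ ⊤ → x * y ≠ ⊤ := ENNReal.mul_ne_top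
  refine ⟨C + 8 * κ * (G1 * (96 * C)) + 8 * κ * (G2 * (192 * C)), ENNReal.add_ne_top.2
    ⟨ENNReal.add_ne_top.2 ⟨hC, t2 (t2 (by simp) hκt) (t2 hG1 (t2 (by simp) hC))⟩,
      t2 (t2 (by simp) hκt) (t2 hG2 (t2 (by simp) hC))⟩, ?_⟩
  intro 𝒯 hM hQ v hv
  set w : Plane → ℝ := fun x => v x - interp (rect a b c d) 𝒯 p v x with hw
  set h := meshSize 𝒯 with hh
  set V := contRep (rect a b c d) v with hV
  have hh0 : 0 < h := by
    obtain ⟨T, hT⟩ := hM.nonempty hab hcd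
    exact meshSize_pos hT
  set H := ENNReal.ofReal (h ^ 2) with hH
  have hH0 : H ≠ 0 := by rw [hH, Ne, ENNReal.ofReal_eq_zero, not_le]; positivity
  have hHt : H ≠ ⊤ := ENNReal.ofReal_ne_top
  obtain ⟨hVc, hVv, -⟩ := contRep_rect hab hcd hs hv
  have hsub : ∀ T ∈ 𝒯, openTri T ⊆ rect a b c d := fun T hT => hM.openTri_subset hab hcd hT
  have hvT : ∀ T ∈ 𝒯, MemHs (openTri T) s v := fun T hT => hv.mono_set isOpen_rect (hsub T hT)
  have hwT : ∀ T ∈ 𝒯, MemHs (openTri T) s w := fun T hT =>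
    (hvT T hT).sub_smooth isOpen_openTri isBounded_openTri (contDiff_polyFun _)
      (sub_interp_ae_eq hM hT p v)
  set E := ∑ T ∈ 𝒯, wSemi (openTri T) (m + 1) v with hE
  have hEv : E ≤ hsNormSq (rect a b c d) s v := hM.sum_wSemi_le hab hcd hms hv
  have hk : ∀ T ∈ 𝒯, ∀ k ≤ 2, H ^ k * wSemi (openTri T) k w ≤
      C * (H ^ (m + 1) * wSemi (openTri T) (m + 1) v) := fun T hT k hk =>
    hmain T h hh0 (hQ.regular hT) s hms v V (hvT T hT) (hVc.mono (hM.closedTri_subset hT))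
      (ae_restrict_of_ae_restrict_of_subset (hsub T hT) hVv) _ (isLagrange_lagrangePoly hp V) w
      (sub_interp_ae_eq hM hT p v) k hk
  -- One factor `H = h²` is split off on the right. The estimates below are multiplied by `H` and
  -- cancelled at the end, which avoids negative powers of `h`.
  have hsum : ∀ {f : Tri → ℝ≥0∞} {K : ℝ≥0∞}, (∀ T ∈ 𝒯, f T ≤
      K * (C * (H ^ (m + 1) * wSemi (openTri T) (m + 1) v))) →
      ∑ T ∈ 𝒯, f T ≤ H * (K * C * (H ^ m * hsNormSq (rect a b c d) s v)) := by
    intro f K hf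
    refine (Finset.sum_le_sum hf).trans ?_
    simp only [← Finset.mul_sum]
    calc K * (C * (H ^ (m + 1) * E)) ≤ K * (C * (H ^ (m + 1) * hsNormSq (rect a b c d) s v)) := by
          gcongr
      _ = _ := by rw [pow_succ]; ring
  set B := H ^ m * hsNormSq (rect a b c d) s v with hB
  have hcancel : ∀ {x y : ℝ≥0∞}, H * x ≤ H * y → x ≤ y := fun h =>
    (ENNReal.mul_le_mul_iff_right hH0 hHt).1 h
  have hbroken : brokenH1Sq 𝒯 w ≤ C * B := by
    refine hcancel ?_
    simp only [brokenH1Sq, ← wSemi_one, Finset.mul_sum]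
    refine (hsum (K := 1) fun T hT => ?_).trans_eq (by rw [one_mul])
    rw [one_mul]
    simpa using hk T hT 1 one_le_two
  have htr : ENNReal.ofReal (ρ ^ 2 * h / 2) *
      ∑ T ∈ 𝒯, l2sq (bdryMeasure (openTri T)) (elTrace T w) ≤ H * (96 * C * B) := by
    rw [Finset.mul_sum]
    refine hsum fun T hT => (elTrace_le hρ hh0 (hQ.regular hT)
      ((hwT T hT).isWeakDeriv (α := (0, 0)) (Nat.zero_le _)).1).trans ?_
    have h0 := hk T hT 0 (by norm_num)
    have h1 := hk T hT 1 (by norm_num)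
    rw [pow_zero, one_mul] at h0
    rw [pow_one] at h1
    refine (mul_le_mul_right (add_le_add h0 h1) 48).trans_eq ?_
    ring
  have hgr : ENNReal.ofReal (ρ ^ 2 * h / 2) *
      ∑ T ∈ 𝒯, ∑ i, l2sq (bdryMeasure (openTri T)) (elGradTrace T w i) ≤ 192 * C * B := by
    refine hcancel ?_
    rw [Finset.mul_sum, Finset.mul_sum]
    refine hsum fun T hT => (mul_le_mul_right (elGradTrace_le hρ hh0 (hQ.regular hT)
      ((hwT T hT).mono_order hs)) H).trans ?_
    have h1 := hk T hT 1 (by norm_num)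
    have h2 := hk T hT 2 le_rfl
    rw [pow_one] at h1
    calc _ = 96 * (H * wSemi (openTri T) 1 w + H ^ 2 * wSemi (openTri T) 2 w) := by ring
      _ ≤ _ := mul_le_mul_right (add_le_add h1 h2) 96
      _ = _ := by ring
  have hjump : interiorJumpSq 𝒯 w + periodicJumpSq a b 𝒯 w ≤
      8 * κ * ∑ T ∈ 𝒯, l2sq (bdryMeasure (openTri T)) (elTrace T w) := by
    have h1 := hM.sum_iface_le hρ hQ (F := fun s t => s - t) enorm_sub_sq_le
      (g := fun T => elTrace T w) fun T => aestronglyMeasurable_trace _ _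
    have h2 := hM.sum_periodic_le hab hcd hρ hQ (F := fun s t => s - t) enorm_sub_sq_le
      (g := fun T => elTrace T w) fun T => aestronglyMeasurable_trace _ _
    refine (add_le_add ((mul_le_of_le_one_left' (by simp : (2⁻¹ : ℝ≥0∞) ≤ 1)).trans h1) h2).trans_eq ?_
    ring
  have hmean : interiorMeanGradSq 𝒯 w + periodicMeanGradSq a b 𝒯 w ≤
      8 * κ * ∑ T ∈ 𝒯, ∑ i, l2sq (bdryMeasure (openTri T)) (elGradTrace T w i) := by
    have h1 : ∀ i : Fin 2, _ := fun i => hM.sum_iface_le hρ hQ (F := fun s t => (s + t) / 2)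
      enorm_half_add_sq_le (g := fun T => elGradTrace T w i)
      fun T => aestronglyMeasurable_trace _ _
    have h2 : ∀ i : Fin 2, _ := fun i => hM.sum_periodic_le hab hcd hρ hQ
      (F := fun s t => (s + t) / 2) enorm_half_add_sq_le (g := fun T => elGradTrace T w i)
      fun T => aestronglyMeasurable_trace _ _
    have e1 : interiorMeanGradSq 𝒯 w ≤ 4 * (κ *
        ∑ T ∈ 𝒯, ∑ i, l2sq (bdryMeasure (openTri T)) (elGradTrace T w i)) := by
      refine (mul_le_of_le_one_left' (by simp : (2⁻¹ : ℝ≥0∞) ≤ 1)).trans ?_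
      simp only [Fin.sum_univ_two, Finset.sum_add_distrib]
      refine (add_le_add (h1 0) (h1 1)).trans_eq ?_
      ring
    have e2 : periodicMeanGradSq a b 𝒯 w ≤ 4 * (κ *
        ∑ T ∈ 𝒯, ∑ i, l2sq (bdryMeasure (openTri T)) (elGradTrace T w i)) := by
      unfold periodicMeanGradSq
      simp only [Fin.sum_univ_two, Finset.sum_add_distrib]
      refine (add_le_add (h2 0) (h2 1)).trans_eq ?_
      ring
    refine (add_le_add e1 e2).trans_eq ?_
    ring
  have hσ1 : ENNReal.ofReal (penalty γ 𝒯) * (interiorJumpSq 𝒯 w + periodicJumpSq a b 𝒯 w) ≤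
      8 * κ * (G1 * (96 * C)) * B := by
    refine hcancel ?_
    have h1 := ofReal_mul_le_of_le hh0 hρ htr hγ
    calc _ ≤ H * (ENNReal.ofReal (γ / h) *
          (8 * κ * ∑ T ∈ 𝒯, l2sq (bdryMeasure (openTri T)) (elTrace T w))) := by
          gcongr; exact le_of_eq rfl
      _ = 8 * κ * (H * (ENNReal.ofReal (γ / h) *
          ∑ T ∈ 𝒯, l2sq (bdryMeasure (openTri T)) (elTrace T w))) := by ring
      _ ≤ 8 * κ * (G1 * (H * (96 * C * B))) := by gcongr
      _ = _ := by ring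
  have hσ2 : ENNReal.ofReal (1 / penalty γ 𝒯) *
      (interiorMeanGradSq 𝒯 w + periodicMeanGradSq a b 𝒯 w) ≤ 8 * κ * (G2 * (192 * C)) * B := by
    refine hcancel ?_
    have h1 := ofReal_mul_le_of_le hh0 hρ hgr (inv_pos.2 hγ)
    -- The reciprocal penalty `h / γ` is `h² * (γ⁻¹ / h)`, so the same conversion serves with `γ⁻¹`
    -- in place of `γ`.
    have h2 : ENNReal.ofReal (1 / penalty γ 𝒯) = H * ENNReal.ofReal (γ⁻¹ / h) := by
      rw [hH, ← ENNReal.ofReal_mul (by positivity), penalty]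
      congr 1
      field_simp
      rfl
    rw [h2]
    calc _ ≤ H * (H * ENNReal.ofReal (γ⁻¹ / h) * (8 * κ *
          ∑ T ∈ 𝒯, ∑ i, l2sq (bdryMeasure (openTri T)) (elGradTrace T w i))) := by gcongr
      _ = H * (8 * κ * (H * (ENNReal.ofReal (γ⁻¹ / h) *
          ∑ T ∈ 𝒯, ∑ i, l2sq (bdryMeasure (openTri T)) (elGradTrace T w i)))) := by ring
      _ ≤ H * (8 * κ * (G2 * (192 * C * B))) := by gcongr
      _ = _ := by ring
  refine (add_le_add (add_le_add hbroken hσ1) hσ2).trans_eq ?_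
  ring

end bulk


/-! ### Sobolev functions of one variable -/

section weak1

variable {J : Set ℝ} {u g g' : ℝ → ℝ}

theorem tsupport_deriv_subset (φ : ℝ → ℝ) : tsupport (deriv φ) ⊆ tsupport φ :=
  closure_minimal (support_deriv_subset) (isClosed_tsupport φ)

theorem contDiff_deriv {φ : ℝ → ℝ} (h : ContDiff ℝ ∞ φ) : ContDiff ℝ ∞ (deriv φ) :=
  (contDiff_infty_iff_deriv.1 h).2

theorem IsWeakDeriv1.ae_unique (hJ : IsOpen J) (h : IsWeakDeriv1 J u g) (h' : IsWeakDeriv1 J u g') :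
    g =ᵐ[volume.restrict J] g' :=
  ae_eq_of_forall_test hJ h.2.1 h'.2.1 fun φ h1 h2 h3 =>
    neg_injective ((h.2.2 φ h1 h2 h3).symm.trans (h'.2.2 φ h1 h2 h3))

theorem isWeakDeriv1_weakDeriv1 (h : IsWeakDeriv1 J u g) : IsWeakDeriv1 J u (weakDeriv1 J u) := by
  have : ∃ g, IsWeakDeriv1 J u g := ⟨g, h⟩
  rw [weakDeriv1, dif_pos this]
  exact this.choose_spec

theorem IsWeakDeriv1.weakDeriv1_ae_eq (hJ : IsOpen J) (h : IsWeakDeriv1 J u g) :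
    weakDeriv1 J u =ᵐ[volume.restrict J] g :=
  (isWeakDeriv1_weakDeriv1 h).ae_unique hJ h

theorem IsWeakDeriv1.congr {u' : ℝ → ℝ} (h : IsWeakDeriv1 J u g)
    (hu : u =ᵐ[volume.restrict J] u') (hg : g =ᵐ[volume.restrict J] g') :
    IsWeakDeriv1 J u' g' := by
  refine ⟨locallyIntegrableOn_congr hu h.1, locallyIntegrableOn_congr hg h.2.1,
    fun φ h1 h2 h3 => ?_⟩
  have e1 : ∫ x in J, u' x * deriv φ x = ∫ x in J, u x * deriv φ x :=
    integral_congr_ae (hu.mono fun x hx => by simp only [hx])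
  have e2 : ∫ x in J, g' x * φ x = ∫ x in J, g x * φ x :=
    integral_congr_ae (hg.mono fun x hx => by simp only [hx])
  rw [e1, e2, h.2.2 φ h1 h2 h3]

theorem IsWeakDeriv1.mono {J' : Set ℝ} (h : IsWeakDeriv1 J u g) (hJJ : J' ⊆ J) :
    IsWeakDeriv1 J' u g := by
  refine ⟨h.1.mono_set hJJ, h.2.1.mono_set hJJ, fun φ h1 h2 h3 => ?_⟩
  have e := h.2.2 φ h1 h2 (h3.trans hJJ)
  rwa [setIntegral_mul_test ((tsupport_deriv_subset φ).trans (h3.trans hJJ)),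
    setIntegral_mul_test (h3.trans hJJ),
    ← setIntegral_mul_test ((tsupport_deriv_subset φ).trans h3),
    ← setIntegral_mul_test h3] at e

theorem IsWeakDeriv1.sub {u' : ℝ → ℝ} (h : IsWeakDeriv1 J u g) (h' : IsWeakDeriv1 J u' g') :
    IsWeakDeriv1 J (fun x => u x - u' x) (fun x => g x - g' x) := by
  refine ⟨h.1.sub h'.1, h.2.1.sub h'.2.1, fun φ h1 h2 h3 => ?_⟩
  have hc := (contDiff_deriv h1).continuous
  have hc2 := h2.deriv
  have hc3 := (tsupport_deriv_subset φ).trans h3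
  simp only [sub_mul]
  rw [integral_sub (integrable_mul_test h.1 hc hc2 hc3).integrableOn
    (integrable_mul_test h'.1 hc hc2 hc3).integrableOn,
    integral_sub (integrable_mul_test h.2.1 h1.continuous h2 h3).integrableOn
    (integrable_mul_test h'.2.1 h1.continuous h2 h3).integrableOn,
    h.2.2 φ h1 h2 h3, h'.2.2 φ h1 h2 h3]
  ring

/-- A primitive is absolutely continuous, so it may be integrated by parts against a test function;
the boundary terms vanish because the test function is zero at `a` and `b`. -/
theorem isWeakDeriv1_primitive {a b : ℝ} (hab : a < b) (hg : IntegrableOn g (Set.Ioo a b)) :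
    IsWeakDeriv1 (Set.Ioo a b) (fun x => ∫ t in a..x, g t) g := by
  have hg' : IntervalIntegrable g volume a b :=
    (intervalIntegrable_iff_integrableOn_Ioo_of_le hab.le).2 hg
  have hac := hg'.absolutelyContinuousOnInterval_intervalIntegral (c := a) (by simp)
  have hcont := hac.continuousOn
  rw [Set.uIcc_of_le hab.le] at hcont
  refine ⟨(hcont.mono Set.Ioo_subset_Icc_self).locallyIntegrableOn measurableSet_Ioo,
    hg.locallyIntegrableOn, fun φ h1 h2 h3 => ?_⟩
  have hφ : AbsolutelyContinuousOnInterval φ a b :=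
    (h1.of_le (by simp)).contDiffOn.absolutelyContinuousOnInterval
  have hparts := hac.integral_mul_deriv_eq_deriv_mul hφ
  have hz : ∀ x, x ∉ Set.Ioo a b → φ x = 0 := fun x hx =>
    image_eq_zero_of_notMem_tsupport fun h => hx (h3 h)
  rw [hz a (by simp), hz b (by simp), mul_zero, mul_zero, sub_self, zero_sub] at hparts
  rw [← integral_Ioc_eq_integral_Ioo, ← integral_Ioc_eq_integral_Ioo,
    ← intervalIntegral.integral_of_le hab.le, ← intervalIntegral.integral_of_le hab.le, hparts]
  congr 1
  refine intervalIntegral.integral_congr_ae ?_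
  filter_upwards [hg'.ae_hasDerivAt_integral] with x hx hxm
  rw [(hx (Set.uIoc_subset_uIcc hxm) a (by simp)).deriv]

theorem exists_Ioo_of_isCompact {a b : ℝ} {K : Set ℝ} (hK : IsCompact K) (hne : K.Nonempty)
    (hKs : K ⊆ Set.Ioo a b) : ∃ l r, a < l ∧ r < b ∧ l < r ∧ K ⊆ Set.Ioo l r := by
  have h1 := hKs (hK.sInf_mem hne)
  have h2 := hKs (hK.sSup_mem hne)
  have h3 : ∀ x ∈ K, sInf K ≤ x := fun x hx => csInf_le hK.bddBelow hx
  have h4 : ∀ x ∈ K, x ≤ sSup K := fun x hx => le_csSup hK.bddAbove hx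
  obtain ⟨x, hx⟩ := hne
  refine ⟨(a + sInf K) / 2, (b + sSup K) / 2, by linarith [h1.1], by linarith [h2.2],
    by linarith [h1.1, h2.2, h3 x hx, h4 x hx], fun y hy => ⟨?_, ?_⟩⟩
  · linarith [h1.1, h3 y hy]
  · linarith [h2.2, h4 y hy]

/-- The primitive of a test function with integral zero is a test function. -/
theorem exists_primitive_test {a b : ℝ} {χ : ℝ → ℝ} (h1 : ContDiff ℝ ∞ χ) {K : Set ℝ}
    (hK : IsCompact K) (hne : K.Nonempty) (hKs : K ⊆ Set.Ioo a b) (h2 : ∀ x, x ∉ K → χ x = 0)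
    (h0 : ∫ x, χ x = 0) : ∃ φ : ℝ → ℝ, ContDiff ℝ ∞ φ ∧ HasCompactSupport φ ∧
      tsupport φ ⊆ Set.Ioo a b ∧ deriv φ = χ := by
  obtain ⟨l, r, hl, hr, hlr, hKlr⟩ := exists_Ioo_of_isCompact hK hne hKs
  let φ : ℝ → ℝ := fun x => ∫ t in l..x, χ t
  have hd : ∀ x, HasDerivAt φ (χ x) x := fun x =>
    intervalIntegral.integral_hasDerivAt_right (h1.continuous.intervalIntegrable _ _)
      (h1.continuous.stronglyMeasurableAtFilter _ _) h1.continuous.continuousAt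
  have hder : deriv φ = χ := funext fun x => (hd x).deriv
  have hsupp : Function.support φ ⊆ Set.Icc l r := by
    intro x hx
    by_contra hx'
    refine hx ?_
    simp only [Set.mem_Icc, not_and_or, not_le] at hx'
    rcases hx' with hx' | hx'
    · refine intervalIntegral.integral_zero_ae (Eventually.of_forall fun t ht => h2 t fun htK => ?_)
      rw [Set.uIoc_of_ge hx'.le] at ht
      exact absurd (hKlr htK).1 (not_lt.2 ht.2)
    · change ∫ t in l..x, χ t = 0
      rw [intervalIntegral.integral_eq_integral_of_support_subset, h0]
      intro t ht
      have htK : t ∈ K := by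
        by_contra h
        exact ht (h2 t h)
      exact ⟨(hKlr htK).1, (hKlr htK).2.le.trans hx'.le⟩
  have hts : tsupport φ ⊆ Set.Icc l r := closure_minimal hsupp isClosed_Icc
  refine ⟨φ, contDiff_infty_iff_deriv.2 ⟨fun x => (hd x).differentiableAt, by rwa [hder]⟩,
    HasCompactSupport.of_support_subset_isCompact isCompact_Icc hsupp,
    hts.trans fun x hx => ⟨hl.trans_le hx.1, hx.2.trans_lt hr⟩, hder⟩

/-- Du Bois-Reymond's argument: with `θ` of integral one, `ψ - (∫ ψ) θ` has integral zero and is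
therefore the derivative of a test function. Testing with that primitive shows that `u` acts on
every `ψ` as the constant `∫ u θ`. -/
theorem ae_const_of_isWeakDeriv1_zero {a b : ℝ} (hab : a < b)
    (h : IsWeakDeriv1 (Set.Ioo a b) u 0) : ∃ c : ℝ, u =ᵐ[volume.restrict (Set.Ioo a b)] fun _ => c := by
  let f : ContDiffBump ((a + b) / 2) := ⟨(b - a) / 8, (b - a) / 4, by linarith, by linarith⟩
  set θ := f.normed volume with hθ
  have hθ1 : ContDiff ℝ ∞ θ := f.contDiff_normed
  have hθc : HasCompactSupport θ := f.hasCompactSupport_normed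
  have hθs : tsupport θ ⊆ Set.Ioo a b := by
    rw [hθ, f.tsupport_normed_eq, Real.closedBall_eq_Icc]
    intro x hx
    simp only [f] at hx
    exact ⟨by linarith [hx.1], by linarith [hx.2]⟩
  have hθi : ∫ x, θ x = 1 := f.integral_normed
  set c := ∫ x in Set.Ioo a b, u x * θ x with hc
  refine ⟨c, ae_eq_of_forall_test isOpen_Ioo h.1
    (continuous_const.locallyIntegrable.locallyIntegrableOn _) fun ψ p1 p2 p3 => ?_⟩
  set lam := ∫ x, ψ x with hlam
  have hθint : Integrable θ := hθ1.continuous.integrable_of_hasCompactSupport hθc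
  have hψint : Integrable ψ := p1.continuous.integrable_of_hasCompactSupport p2
  obtain ⟨φ, q1, q2, q3, q4⟩ := exists_primitive_test (a := a) (b := b)
    (χ := fun x => ψ x - lam * θ x) (p1.sub (contDiff_const.mul hθ1))
    (K := tsupport ψ ∪ tsupport θ) (p2.isCompact.union hθc.isCompact)
    ⟨(a + b) / 2, .inr (by
      rw [hθ, f.tsupport_normed_eq]
      exact Metric.mem_closedBall_self f.rOut_pos.le)⟩ (Set.union_subset p3 hθs) (fun x hx => by
      rw [Set.mem_union, not_or] at hx
      rw [image_eq_zero_of_notMem_tsupport hx.1, image_eq_zero_of_notMem_tsupport hx.2]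
      ring) (by
      rw [integral_sub hψint (hθint.const_mul lam), integral_const_mul, hθi, mul_one, sub_self])
  have e := h.2.2 φ q1 q2 q3
  simp only [Pi.zero_apply, zero_mul, integral_zero, neg_zero, q4, mul_sub] at e
  have i1 := (integrable_mul_test h.1 p1.continuous p2 p3).integrableOn (s := Set.Ioo a b)
  have i2 := (integrable_mul_test h.1 hθ1.continuous hθc hθs).integrableOn (s := Set.Ioo a b)
  have e2 : ∀ x, u x * (lam * θ x) = lam * (u x * θ x) := fun x => by ring
  simp only [e2] at e
  rw [integral_sub i1 (i2.const_mul lam), integral_const_mul, sub_eq_zero] at e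
  rw [e, integral_const_mul, mul_comm]
  congr 1
  rw [hlam]
  symm
  exact setIntegral_eq_integral_of_forall_compl_eq_zero fun x hx =>
    image_eq_zero_of_notMem_tsupport fun h => hx (p3 h)

theorem IsWeakDeriv1.exists_ae_eq_primitive {a b : ℝ} (hab : a < b)
    (h : IsWeakDeriv1 (Set.Ioo a b) u g) (hg : IntegrableOn g (Set.Ioo a b)) :
    ∃ c : ℝ, u =ᵐ[volume.restrict (Set.Ioo a b)] fun x => c + ∫ t in a..x, g t := by
  have h1 := h.sub (isWeakDeriv1_primitive hab hg)
  simp only [sub_self] at h1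
  obtain ⟨c, hc⟩ := ae_const_of_isWeakDeriv1_zero hab h1
  refine ⟨c, hc.mono fun x hx => ?_⟩
  simp only at hx ⊢
  linarith

theorem isWeakDeriv1_of_contDiff {f : ℝ → ℝ} (hf : ContDiff ℝ ∞ f) (J : Set ℝ) :
    IsWeakDeriv1 J f (deriv f) := by
  refine ⟨hf.continuous.locallyIntegrable.locallyIntegrableOn _,
    (contDiff_deriv hf).continuous.locallyIntegrable.locallyIntegrableOn _, fun φ h1 h2 h3 => ?_⟩
  rw [setIntegral_mul_test ((tsupport_deriv_subset φ).trans h3), setIntegral_mul_test h3]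
  have hloc : ∀ {k : ℝ → ℝ}, ContDiff ℝ ∞ k → LocallyIntegrableOn k Set.univ :=
    fun hk => hk.continuous.locallyIntegrable.locallyIntegrableOn _
  refine integral_mul_deriv_eq_deriv_mul_of_integrable
    (fun x _ => (hf.differentiable (by simp) x).hasDerivAt)
    (fun x _ => (h1.differentiable (by simp) x).hasDerivAt) ?_ ?_ ?_
  · exact integrable_mul_test (hloc hf) (contDiff_deriv h1).continuous h2.deriv (Set.subset_univ _)
  · exact integrable_mul_test (hloc (contDiff_deriv hf)) h1.continuous h2 (Set.subset_univ _)
  · exact integrable_mul_test (hloc hf) h1.continuous h2 (Set.subset_univ _)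

end weak1

/-! ### Iterated weak derivatives on an interval and their continuous representatives. -/

section MemHs1

variable {J : Set ℝ} {u : ℝ → ℝ}

theorem MemHs1.congr {s : ℕ} {u' : ℝ → ℝ} (h : MemHs1 J s u) (hu : u =ᵐ[volume.restrict J] u') :
    MemHs1 J s u' := by
  induction s with
  | zero => exact (memLp_congr_ae hu).1 h
  | succ s ih =>
    obtain ⟨h1, g, hg, hgs⟩ := h
    exact ⟨ih h1, g, hg.congr hu (ae_eq_refl _), hgs⟩

theorem MemHs1.memLp {s : ℕ} (h : MemHs1 J s u) : MemLp u 2 (volume.restrict J) := by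
  induction s with
  | zero => exact h
  | succ s ih => exact ih h.1

theorem MemHs1.weakDeriv1 (hJ : IsOpen J) {s : ℕ} (h : MemHs1 J (s + 1) u) :
    IsWeakDeriv1 J u (weakDeriv1 J u) ∧ MemHs1 J s (weakDeriv1 J u) := by
  obtain ⟨-, g, hg, hgs⟩ := h
  exact ⟨isWeakDeriv1_weakDeriv1 hg, hgs.congr (hg.weakDeriv1_ae_eq hJ).symm⟩

theorem MemHs1.iterate (hJ : IsOpen J) {s k : ℕ} (h : MemHs1 J (s + k) u) :
    MemHs1 J s ((DGDyn.weakDeriv1 J)^[k] u) := by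
  induction k generalizing u with
  | zero => exact h
  | succ k ih => exact ih (h.weakDeriv1 hJ).2

theorem MemHs1.memLp_iterate (hJ : IsOpen J) {s k : ℕ} (h : MemHs1 J s u) (hk : k ≤ s) :
    MemLp ((DGDyn.weakDeriv1 J)^[k] u) 2 (volume.restrict J) := by
  obtain ⟨t, rfl⟩ := Nat.exists_eq_add_of_le' hk
  exact (h.iterate hJ).memLp

theorem MemHs1.isWeakDeriv1_iterate (hJ : IsOpen J) {s k : ℕ} (h : MemHs1 J s u) (hk : k < s) :
    IsWeakDeriv1 J ((DGDyn.weakDeriv1 J)^[k] u) ((DGDyn.weakDeriv1 J)^[k + 1] u) := by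
  obtain ⟨t, rfl⟩ := Nat.exists_eq_add_of_le' (Nat.succ_le_of_lt hk)
  have h1 : MemHs1 J (t + 1 + k) u := by rwa [add_assoc, add_comm 1 k]
  rw [Function.iterate_succ_apply']
  exact ((h1.iterate hJ).weakDeriv1 hJ).1

theorem l2sq_iterate_le {s k : ℕ} (hk : k ≤ s) (u : ℝ → ℝ) :
    l2sq (volume.restrict J) ((DGDyn.weakDeriv1 J)^[k] u) ≤ hsNormSq1 J s u := by
  induction s generalizing u k with
  | zero => rw [Nat.le_zero.1 hk]; exact le_rfl
  | succ s ih =>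
    rw [hsNormSq1]
    rcases k with _ | k
    · exact (ih (Nat.zero_le s) u).trans le_self_add
    · exact (ih (Nat.le_of_succ_le_succ hk) (DGDyn.weakDeriv1 J u)).trans le_add_self

/-- `g 0, …, g (n - 1)` are continuous on `[a, b]` and each is a primitive of the next one. -/
structure PrimitiveChain (a b : ℝ) (n : ℕ) (g : ℕ → ℝ → ℝ) : Prop where
  integrable : ∀ k ≤ n, IntegrableOn (g k) (Set.Icc a b)
  continuousOn : ∀ k < n, ContinuousOn (g k) (Set.Icc a b)
  sub_eq : ∀ k < n, ∀ x ∈ Set.Icc a b, ∀ y ∈ Set.Icc a b, g k y - g k x = ∫ t in x..y, g (k + 1) t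

/-- Below order `n` each iterated weak derivative is replaced by its absolutely continuous
representative; the one of order `n` is kept as an integrable function. -/
theorem MemHs1.exists_primitiveChain {a b : ℝ} (hab : a < b) {s n : ℕ} (hn : n ≤ s)
    (h : MemHs1 (Set.Ioo a b) s u) : ∃ g : ℕ → ℝ → ℝ, PrimitiveChain a b n g ∧
      ∀ k ≤ n, (DGDyn.weakDeriv1 (Set.Ioo a b))^[k] u =ᵐ[volume.restrict (Set.Ioo a b)] g k := by
  set U : ℕ → ℝ → ℝ := fun k => (DGDyn.weakDeriv1 (Set.Ioo a b))^[k] u with hU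
  have hint : ∀ k ≤ n, IntegrableOn (U k) (Set.Ioo a b) := fun k hk =>
    (h.memLp_iterate isOpen_Ioo (hk.trans hn)).integrable one_le_two
  have hint' : ∀ k ≤ n, IntegrableOn (U k) (Set.Icc a b) := fun k hk =>
    by rw [integrableOn_Icc_iff_integrableOn_Ioo]; exact hint k hk
  have hprim : ∀ k, ∃ c : ℝ, k < n →
      U k =ᵐ[volume.restrict (Set.Ioo a b)] fun x => c + ∫ t in a..x, U (k + 1) t := by
    intro k
    by_cases hk : k < n
    · obtain ⟨c, hc⟩ := (h.isWeakDeriv1_iterate isOpen_Ioo (hk.trans_le hn)).exists_ae_eq_primitive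
        hab (hint (k + 1) hk)
      exact ⟨c, fun _ => hc⟩
    · exact ⟨0, fun hk' => absurd hk' hk⟩
  choose c hc using hprim
  set g : ℕ → ℝ → ℝ := fun k => if k < n then fun x => c k + ∫ t in a..x, U (k + 1) t else U k with hg
  have hgk : ∀ k, k < n → g k = fun x => c k + ∫ t in a..x, U (k + 1) t := fun k hk => if_pos hk
  have hUg : ∀ k ≤ n, U k =ᵐ[volume.restrict (Set.Ioo a b)] g k := by
    intro k hk
    rcases hk.lt_or_eq with hk | rfl
    · rw [hgk k hk]; exact hc k hk
    · simp only [hg, lt_irrefl, if_false]; rfl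
  have hII : ∀ k ≤ n, ∀ x ∈ Set.Icc a b, ∀ y ∈ Set.Icc a b, IntervalIntegrable (U k) volume x y :=
    fun k hk x hx y hy => ((hint' k hk).mono_set (Set.uIcc_subset_Icc hx hy)).intervalIntegrable
  refine ⟨g, ⟨fun k hk => ?_, fun k hk => ?_, fun k hk x hx y hy => ?_⟩, hUg⟩
  · rw [integrableOn_Icc_iff_integrableOn_Ioo]
    exact (hint k hk).congr_fun_ae (hUg k hk)
  · rw [hgk k hk]
    refine continuousOn_const.add ?_
    have := intervalIntegral.continuousOn_primitive_interval (μ := volume) (f := U (k + 1)) (a := a)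
      (b := b) (by rw [Set.uIcc_of_le hab.le]; exact hint' (k + 1) hk)
    rwa [Set.uIcc_of_le hab.le] at this
  · have ha : a ∈ Set.Icc a b := Set.left_mem_Icc.2 hab.le
    rw [hgk k hk]
    simp only
    -- The formula holds with `U (k + 1)` as integrand; passing to `g (k + 1)` changes it on a null
    -- set only, the end point `b` being discarded as well.
    rw [add_sub_add_left_eq_sub, intervalIntegral.integral_interval_sub_left
      (hII _ hk a ha y hy) (hII _ hk a ha x hx)]
    have h1 := (ae_restrict_iff' measurableSet_Ioo).1 (hUg (k + 1) hk)
    refine intervalIntegral.integral_congr_ae ?_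
    have h2 : ∀ᵐ t : ℝ, t ≠ b := by simp [ae_iff]
    filter_upwards [h1, h2] with t ht htb htm
    refine ht ⟨?_, ?_⟩
    · rcases le_total x y with hxy | hxy
      · rw [Set.uIoc_of_le hxy] at htm; exact hx.1.trans_lt htm.1
      · rw [Set.uIoc_of_ge hxy] at htm; exact hy.1.trans_lt htm.1
    · refine lt_of_le_of_ne ?_ htb
      rcases le_total x y with hxy | hxy
      · rw [Set.uIoc_of_le hxy] at htm; exact htm.2.trans hy.2
      · rw [Set.uIoc_of_ge hxy] at htm; exact htm.2.trans hx.2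

end MemHs1


/-! ### Interpolation error on a boundary edge -/

variable {T : Tri}

theorem sum_bary_mul_coord (x : Plane) (m : Fin 2) : ∑ k, bary T k x * T.points k m = x m := by
  have h := congrArg (fun z : Plane => z m) (sum_bary_smul (T := T) x)
  simpa [Fin.sum_univ_three] using h

theorem sum_bary_mul_sub (x : Plane) (y : ℝ) :
    ∑ k, bary T k x * (T.points k 1 - y) = x 1 - y := by
  simp only [mul_sub, Finset.sum_sub_distrib, ← Finset.sum_mul, sum_bary, one_mul,
    sum_bary_mul_coord]

/-- The edge from vertex `i` to vertex `j` lies on the line at height `y` and is oriented to the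
right. -/
structure IsEdge (T : Tri) (y : ℝ) (i j k : Fin 3) : Prop where
  ij : i ≠ j
  ik : i ≠ k
  jk : j ≠ k
  hi : T.points i 1 = y
  hj : T.points j 1 = y
  hk : T.points k 1 ≠ y
  lt : T.points i 0 < T.points j 0

variable {y : ℝ} {i j k : Fin 3}

/-- The height above the line is the barycentric average of the heights of the vertices, and only
vertex `k` lies off the line. -/
theorem IsEdge.bary_eq_zero (e : IsEdge T y i j k) (x : ℝ) : bary T k (pt x y) = 0 := by
  have h := sum_bary_mul_sub (T := T) (pt x y) y
  rw [sum_eq_of_ne e.ij e.ik e.jk, e.hi, e.hj, pt_one, sub_self, mul_zero, mul_zero, zero_add,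
    zero_add, mul_eq_zero] at h
  exact h.resolve_right (sub_ne_zero.2 e.hk)

theorem IsEdge.edgeAbs_eq (e : IsEdge T y i j k) :
    edgeAbs T y = Set.Icc (T.points i 0) (T.points j 0) := by
  ext x
  have h0 := e.bary_eq_zero x
  have h1 := sum_bary (T := T) (pt x y)
  have h2 := sum_bary_mul_coord (T := T) (pt x y) 0
  rw [sum_eq_of_ne e.ij e.ik e.jk, h0, add_zero] at h1
  rw [sum_eq_of_ne e.ij e.ik e.jk, h0, zero_mul, add_zero, pt_zero] at h2
  have hlt := e.lt
  have hbi : bary T i (pt x y) = 1 - bary T j (pt x y) := by linarith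
  rw [hbi] at h2
  change pt x y ∈ closedTri T ↔ _
  rw [mem_closedTri]
  constructor
  · intro h
    have hi := h i
    have hj := h j
    rw [hbi] at hi
    constructor <;> nlinarith
  · rintro ⟨hl, hr⟩ m
    rcases eq_or_eq_or_eq_of_ne e.ij e.ik e.jk m with rfl | rfl | rfl
    · rw [hbi]
      by_contra! hneg
      nlinarith
    · by_contra! hneg
      nlinarith
    · exact h0.ge

theorem IsEdge.edgeInt_eq (e : IsEdge T y i j k) :
    edgeInt T y = Set.Ioo (T.points i 0) (T.points j 0) := by
  rw [edgeInt, e.edgeAbs_eq, interior_Icc]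

/-- The triangle lies on one side of the line, so a point on the line puts all its barycentric
weight on vertices of the line. With at most one such vertex the intersection would be at most a
point, which has empty interior; three are impossible as the triangle is nondegenerate. -/
theorem exists_isEdge {ε : ℝ} (hε : ε ≠ 0) (hs : ∀ x ∈ closedTri T, 0 ≤ ε * (x 1 - y))
    (hne : (edgeInt T y).Nonempty) : ∃ i j k, IsEdge T y i j k := by
  obtain ⟨x, hx⟩ := hne
  obtain ⟨δ, hδ, hball⟩ := Metric.isOpen_iff.1 isOpen_interior x hx
  have hx1 : x ∈ edgeAbs T y := interior_subset hx
  have hx2 : x + δ / 2 ∈ edgeAbs T y := interior_subset (hball (by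
    rw [Metric.mem_ball, Real.dist_eq, add_sub_cancel_left, abs_of_pos (by linarith)]
    linarith))
  have key : ∀ t ∈ edgeAbs T y, ∀ m, bary T m (pt t y) = 0 ∨ T.points m 1 = y := by
    intro t ht m
    have h := congrArg (fun z => ε * z) (sum_bary_mul_sub (T := T) (pt t y) y)
    simp only [pt_one, sub_self, mul_zero, Finset.mul_sum] at h
    have hnn : ∀ m ∈ Finset.univ, 0 ≤ ε * (bary T m (pt t y) * (T.points m 1 - y)) := fun m _ => by
      have h1 := mem_closedTri.1 ht m
      have h2 := hs _ (points_mem m)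
      calc 0 ≤ bary T m (pt t y) * (ε * (T.points m 1 - y)) := mul_nonneg h1 h2
        _ = _ := by ring
    have := (Finset.sum_eq_zero_iff_of_nonneg hnn).1 h m (Finset.mem_univ m)
    rcases mul_eq_zero.1 this with h | h
    · exact absurd h hε
    · exact (mul_eq_zero.1 h).imp id sub_eq_zero.1
  obtain ⟨k, hk⟩ : ∃ k, T.points k 1 ≠ y := by
    by_contra! hall
    have h := sum_bary_mul_sub (T := T) (pt 0 (y + 1)) y
    simp [hall] at h
  obtain ⟨i, j, hij, hi, hj⟩ : ∃ i j, i ≠ j ∧ T.points i 1 = y ∧ T.points j 1 = y := by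
    by_contra! hcon
    have huniq : ∀ t ∈ edgeAbs T y, ∃ m, T.points m 1 = y ∧ pt t y = T.points m := by
      intro t ht
      obtain ⟨m, hm⟩ : ∃ m, bary T m (pt t y) ≠ 0 := by
        by_contra! hall
        have := sum_bary (T := T) (pt t y)
        simp [hall] at this
      have hmy := (key t ht m).resolve_left hm
      have hz : ∀ l, l ≠ m → bary T l (pt t y) = 0 := fun l hl =>
        (key t ht l).resolve_right fun hly => hcon l m hl hly hmy
      have h1 := sum_bary (T := T) (pt t y)
      have h2 := sum_bary_smul (T := T) (pt t y)
      rw [Finset.sum_eq_single_of_mem m (Finset.mem_univ m) fun l _ hl => hz l hl] at h1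
      rw [Finset.sum_eq_single_of_mem m (Finset.mem_univ m) fun l _ hl => by rw [hz l hl, zero_smul],
        h1, one_smul] at h2
      exact ⟨m, hmy, h2.symm⟩
    obtain ⟨m, hm, hxm⟩ := huniq x hx1
    obtain ⟨m', hm', hxm'⟩ := huniq _ hx2
    have hmm : m = m' := by
      by_contra hne
      exact hcon m m' hne hm hm'
    rw [← hmm, ← hxm] at hxm'
    have := congrArg (fun z : Plane => z 0) hxm'
    simp only [pt_zero] at this
    linarith
  have hik : i ≠ k := fun h => hk (h ▸ hi)
  have hjk : j ≠ k := fun h => hk (h ▸ hj)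
  have h0 : T.points i 0 ≠ T.points j 0 := fun h => hij (T.independent.injective (by
    rw [← pt_self (T.points i), ← pt_self (T.points j), h, hi, hj]))
  rcases h0.lt_or_gt with h | h
  · exact ⟨i, j, k, hij, hik, hjk, hi, hj, hk, h⟩
  · exact ⟨j, i, k, hij.symm, hjk, hik, hj, hi, hk, h⟩

theorem hasDerivAt_polyFun_pt (q : MvPolynomial (Fin 2) ℝ) (x y : ℝ) :
    HasDerivAt (fun x => polyFun q (pt x y)) (polyFun (MvPolynomial.pderiv 0 q) (pt x y)) x := by
  have h := hasDerivAt_along (contDiff_polyFun q) (pt 0 y) (EuclideanSpace.single 0 1) x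
  have hd : dirDeriv (EuclideanSpace.single 0 1) (polyFun q) = pderiv 0 (polyFun q) := by
    funext x; simp [dirDeriv]
  rw [← pt_eq_add_fst, hd] at h
  rw [show (fun x => polyFun q (pt x y)) = _ from funext fun x => by rw [pt_eq_add_fst x y],
    ← pderiv_polyFun]
  exact h

theorem continuous_polyFun_pt (q : MvPolynomial (Fin 2) ℝ) (y : ℝ) :
    Continuous fun x => polyFun q (pt x y) :=
  (contDiff_polyFun q).continuous.comp (isometry_pt_fst y).continuous

/-- The `k`-th derivative of the Taylor polynomial of order `n` at `l`, in the first variable. -/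
noncomputable def taylorPoly (n : ℕ) (g : ℕ → ℝ → ℝ) (l : ℝ) (k : ℕ) : MvPolynomial (Fin 2) ℝ :=
  ∑ j ∈ Finset.range (n - k), MvPolynomial.C (g (k + j) l / j.factorial) *
    (MvPolynomial.X 0 - MvPolynomial.C l) ^ j

theorem pderiv_taylorPoly {n : ℕ} (g : ℕ → ℝ → ℝ) (l : ℝ) {k : ℕ} (hk : k < n) :
    MvPolynomial.pderiv 0 (taylorPoly n g l k) = taylorPoly n g l (k + 1) := by
  obtain ⟨m, rfl⟩ := Nat.exists_eq_add_of_lt hk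
  have h1 : k + m + 1 - k = m + 1 := by omega
  have h2 : k + m + 1 - (k + 1) = m := by omega
  rw [taylorPoly, taylorPoly, h1, h2, Finset.sum_range_succ', map_add, map_sum]
  have h3 : MvPolynomial.pderiv (0 : Fin 2) (MvPolynomial.C (g (k + 0) l / (Nat.factorial 0)) *
      (MvPolynomial.X 0 - MvPolynomial.C l) ^ 0) = 0 := by simp
  rw [h3, add_zero]
  refine Finset.sum_congr rfl fun j _ => ?_
  rw [MvPolynomial.pderiv_C_mul, Derivation.leibniz_pow]
  have h4 : MvPolynomial.pderiv (0 : Fin 2) (MvPolynomial.X 0 - MvPolynomial.C l) = 1 := by simp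
  rw [h4, Nat.add_sub_cancel, smul_eq_mul, mul_one, nsmul_eq_mul, ← mul_assoc,
    ← MvPolynomial.C_eq_coe_nat, ← MvPolynomial.C_mul]
  congr 2
  rw [show k + (j + 1) = k + 1 + j by ring, Nat.factorial_succ]
  have : (j.factorial : ℝ) ≠ 0 := by positivity
  push_cast
  field_simp

theorem polyFun_taylorPoly_self {n : ℕ} (g : ℕ → ℝ → ℝ) (l y : ℝ) {k : ℕ} (hk : k < n) :
    polyFun (taylorPoly n g l k) (pt l y) = g k l := by
  obtain ⟨m, rfl⟩ := Nat.exists_eq_add_of_lt hk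
  have h1 : k + m + 1 - k = m + 1 := by omega
  rw [taylorPoly, h1, Finset.sum_range_succ']
  simp [polyFun]

theorem totalDegree_taylorPoly (n : ℕ) (g : ℕ → ℝ → ℝ) (l : ℝ) (k : ℕ) :
    (taylorPoly n g l k).totalDegree ≤ n - 1 := by
  refine (MvPolynomial.totalDegree_finsetSum _ _).trans (Finset.sup_le fun j hj => ?_)
  refine (MvPolynomial.totalDegree_mul _ _).trans ?_
  rw [MvPolynomial.totalDegree_C, zero_add]
  refine (MvPolynomial.totalDegree_pow _ _).trans ?_
  have h1 : (MvPolynomial.X 0 - MvPolynomial.C l : MvPolynomial (Fin 2) ℝ).totalDegree ≤ 1 := by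
    refine (MvPolynomial.totalDegree_sub _ _).trans (max_le ?_ ?_)
    · rw [MvPolynomial.totalDegree_X]
    · rw [MvPolynomial.totalDegree_C]; exact Nat.zero_le _
  have := Finset.mem_range.1 hj
  calc _ ≤ j * 1 := Nat.mul_le_mul_left j h1
    _ ≤ n - 1 := by omega

/-- Descending in the order of the derivative: at order `n - 1` the error is an increment of `g (n -
1)`, bounded by the integral of `|g n|`. Each integration from `l`, where error and Taylor
polynomial match, gains a factor `r - l`. -/
theorem PrimitiveChain.abs_sub_taylorPoly_le {a b : ℝ} {n : ℕ} {g : ℕ → ℝ → ℝ}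
    (hg : PrimitiveChain a b n g) {l r : ℝ} (hal : a ≤ l) (hlr : l ≤ r) (hrb : r ≤ b) (y : ℝ) (j : ℕ) :
    ∀ k, k + j + 1 = n → ∀ x ∈ Set.Icc l r,
      |g k x - polyFun (taylorPoly n g l k) (pt x y)| ≤ (r - l) ^ j * ∫ t in l..r, |g n t| := by
  have hII : ∀ k ≤ n, ∀ x ∈ Set.Icc l r, ∀ z ∈ Set.Icc l r, IntervalIntegrable (g k) volume x z :=
    fun k hk x hx z hz => ((hg.integrable k hk).mono_set (Set.uIcc_subset_Icc
      ⟨hal.trans hx.1, hx.2.trans hrb⟩ ⟨hal.trans hz.1, hz.2.trans hrb⟩)).intervalIntegrable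
  have hl : l ∈ Set.Icc l r := Set.left_mem_Icc.2 hlr
  have hr : r ∈ Set.Icc l r := Set.right_mem_Icc.2 hlr
  induction j with
  | zero =>
    intro k hk x hx
    have h1 : polyFun (taylorPoly n g l k) (pt x y) = g k l := by
      rw [taylorPoly, show n - k = 1 by omega]
      simp [polyFun]
    rw [h1, hg.sub_eq k (by omega) l ⟨hal, hlr.trans hrb⟩ x ⟨hal.trans hx.1, hx.2.trans hrb⟩,
      pow_zero, one_mul, show k + 1 = n by omega]
    refine (intervalIntegral.abs_integral_le_integral_abs hx.1).trans ?_
    exact intervalIntegral.integral_mono_interval le_rfl hx.1 hx.2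
      (Eventually.of_forall fun t => abs_nonneg _) (hII n le_rfl l hl r hr).abs
  | succ j ih =>
    intro k hk x hx
    set B := (r - l) ^ j * ∫ t in l..r, |g n t|
    have hih := ih (k + 1) (by omega)
    have h1 : ∫ t in l..x, polyFun (taylorPoly n g l (k + 1)) (pt t y) =
        polyFun (taylorPoly n g l k) (pt x y) - g k l := by
      rw [← polyFun_taylorPoly_self g l y (by omega : k < n)]
      refine intervalIntegral.integral_eq_sub_of_hasDerivAt
        (f := fun t => polyFun (taylorPoly n g l k) (pt t y)) (fun t _ => ?_)
        ((continuous_polyFun_pt _ y).intervalIntegrable _ _)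
      rw [← pderiv_taylorPoly g l (by omega : k < n)]
      exact hasDerivAt_polyFun_pt _ t y
    have h2 := hg.sub_eq k (by omega) l ⟨hal, hlr.trans hrb⟩ x ⟨hal.trans hx.1, hx.2.trans hrb⟩
    have h3 : g k x - polyFun (taylorPoly n g l k) (pt x y) =
        ∫ t in l..x, (g (k + 1) t - polyFun (taylorPoly n g l (k + 1)) (pt t y)) := by
      rw [intervalIntegral.integral_sub (hII (k + 1) (by omega) l hl x hx)
        ((continuous_polyFun_pt _ y).intervalIntegrable _ _), h1, ← h2]
      ring
    rw [h3]
    have h4 := intervalIntegral.norm_integral_le_of_norm_le_const (a := l) (b := x) (C := B)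
      (f := fun t => g (k + 1) t - polyFun (taylorPoly n g l (k + 1)) (pt t y)) fun t ht => by
        rw [Set.uIoc_of_le hx.1] at ht
        exact hih t ⟨ht.1.le, ht.2.trans hx.2⟩
    rw [Real.norm_eq_abs] at h4
    refine h4.trans ?_
    have hB : 0 ≤ B := (abs_nonneg _).trans (hih l hl)
    rw [abs_of_nonneg (by linarith [hx.1]), pow_succ]
    calc B * (x - l) ≤ B * (r - l) := by gcongr; exact hx.2
      _ = _ := by ring

theorem polyFun_lagBasis_eq_zero (p : ℕ) {m : Fin 3 → ℕ} (hm : m k ≠ 0) {x : Plane}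
    (hx : bary T k x = 0) : polyFun (lagBasis T p m) x = 0 := by
  rw [polyFun_lagBasis]
  refine Finset.prod_eq_zero (Finset.mem_univ k)
    (Finset.prod_eq_zero (Finset.mem_range.2 (Nat.pos_of_ne_zero hm)) ?_)
  rw [polyFun_lagFactor, hx]
  simp

/-- The tangential derivative of a polynomial on an edge is controlled by the nodes on the edge. -/
theorem IsEdge.abs_pderiv_le (e : IsEdge T y i j k) {z : Plane} {r : ℝ} (hr : 0 < r)
    (hball : Metric.ball z r ⊆ openTri T) {p : ℕ} (hp : 1 ≤ p) {q : MvPolynomial (Fin 2) ℝ}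
    (hq : q.totalDegree ≤ p) {N : ℝ} (hN0 : 0 ≤ N)
    (hN : ∀ m ∈ nodeIdx p, m k = 0 → |polyFun q (lagNode T p m)| ≤ N) {x : ℝ}
    (hx : pt x y ∈ closedTri T) : |polyFun (MvPolynomial.pderiv 0 q) (pt x y)| * r ≤
      ((nodeIdx p).card * (4 * (4 * p : ℝ) ^ p) ^ 3) * N := by
  -- Dropping the nodal values off the edge does not change `q` on the edge, since the basis
  -- polynomials with `m k ≠ 0` contain the factor `bary T k`. The inverse estimate then sees only
  -- nodes of the edge.
  set c : (Fin 3 → ℕ) → ℝ := fun m => if m k = 0 then polyFun q (lagNode T p m) else 0 with hc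
  set q' := lagInterp T p c with hq'
  have hqe : q = lagInterp T p fun m => polyFun q (lagNode T p m) :=
    eq_of_eq_at_nodes hp hq (totalDegree_lagInterp p _) fun m hm =>
      (polyFun_lagInterp_node hp (fun m => polyFun q (lagNode T p m)) hm).symm
  have hline : ∀ t, polyFun q (pt t y) = polyFun q' (pt t y) := by
    intro t
    conv_lhs => rw [hqe]
    rw [hq', polyFun_lagInterp, polyFun_lagInterp]
    refine Finset.sum_congr rfl fun m _ => ?_
    by_cases hm : m k = 0
    · simp only [hc, if_pos hm]
    · rw [polyFun_lagBasis_eq_zero p hm (e.bary_eq_zero t), mul_zero, mul_zero]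
  have hder : polyFun (MvPolynomial.pderiv 0 q) (pt x y) =
      polyFun (MvPolynomial.pderiv 0 q') (pt x y) := by
    refine (hasDerivAt_polyFun_pt q x y).unique ?_
    rw [show (fun x => polyFun q (pt x y)) = _ from funext hline]
    exact hasDerivAt_polyFun_pt q' x y
  rw [hder]
  refine (polyBound_of_nodes hr hball hp (totalDegree_lagInterp p c) (N := N) (fun m hm => ?_)
    _ hx).2.1 0
  rw [polyFun_lagInterp_node hp c hm]
  by_cases hmk : m k = 0
  · simp only [hc, if_pos hmk]; exact hN m hm hmk
  · simp only [hc, if_neg hmk, abs_zero]; exact hN0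

theorem IsEdge.lagNode_eq (e : IsEdge T y i j k) {p : ℕ} (hp : 1 ≤ p) {m : Fin 3 → ℕ}
    (hm : m ∈ nodeIdx p) (hmk : m k = 0) :
    ∃ x ∈ Set.Icc (T.points i 0) (T.points j 0), lagNode T p m = pt x y := by
  have hm' := mem_nodeIdx.1 hm
  have h1 : lagNode T p m 1 = y := by
    have h2 := sum_bary_mul_sub (T := T) (lagNode T p m) y
    rw [sum_eq_of_ne e.ij e.ik e.jk, e.hi, e.hj, bary_lagNode hp hm' k, hmk] at h2
    simp at h2
    linarith
  have h2 : lagNode T p m = pt (lagNode T p m 0) y := by rw [← h1, pt_self]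
  refine ⟨_, ?_, h2⟩
  rw [← e.edgeAbs_eq]
  change pt _ y ∈ closedTri T
  rw [← h2]
  exact lagNode_mem hp hm'

theorem lagNode_single {p : ℕ} (hp : 1 ≤ p) (i : Fin 3) :
    Pi.single i p ∈ nodeIdx p ∧ lagNode T p (Pi.single i p) = T.points i := by
  refine ⟨mem_nodeIdx.2 (by simp), ?_⟩
  have hp0 : (p : ℝ) ≠ 0 := by positivity
  rw [lagNode, Finset.sum_eq_single_of_mem i (Finset.mem_univ i)]
  · rw [Pi.single_eq_same, div_self hp0, one_smul]
  · intro l _ hl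
    rw [Pi.single_eq_of_ne hl, Nat.cast_zero, zero_div, zero_smul]

theorem IsEdge.points_eq (e : IsEdge T y i j k) :
    T.points i = pt (T.points i 0) y ∧ T.points j = pt (T.points j 0) y := by
  constructor
  · conv_lhs => rw [← pt_self (T.points i), e.hi]
  · conv_lhs => rw [← pt_self (T.points j), e.hj]

/-- The interpolation error for the tangential derivative on a boundary edge. -/
theorem IsEdge.abs_deriv_sub_le (e : IsEdge T y i j k) {ρ h : ℝ} (hρ : 0 < ρ) (hh : 0 < h)
    (hT : Regular T ρ h) {n p : ℕ} (hp : 1 ≤ p) (hn : 2 ≤ n) (hnp : n ≤ p + 1) {a b : ℝ}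
    {g : ℕ → ℝ → ℝ} (hg : PrimitiveChain a b n g) (hai : a ≤ T.points i 0) (hjb : T.points j 0 ≤ b)
    {V : Plane → ℝ} (hV : ∀ x ∈ Set.Icc (T.points i 0) (T.points j 0), V (pt x y) = g 0 x)
    {q : MvPolynomial (Fin 2) ℝ} (hq : IsLagrange T p V q) :
    ∀ x ∈ Set.Icc (T.points i 0) (T.points j 0),
      |g 1 x - polyFun (MvPolynomial.pderiv 0 q) (pt x y)| ≤
        (1 + ((nodeIdx p).card * (4 * (4 * p : ℝ) ^ p) ^ 3) / ρ) * h ^ (n - 2) *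
          ∫ t in T.points i 0..T.points j 0, |g n t| := by
  intro x hx
  obtain ⟨hdiam, z, hball⟩ := hT
  set K : ℝ := (nodeIdx p).card * (4 * (4 * p : ℝ) ^ p) ^ 3 with hK
  set l := T.points i 0
  set r := T.points j 0
  set A := ∫ t in l..r, |g n t|
  have hlr : l ≤ r := e.lt.le
  have hA : 0 ≤ A := intervalIntegral.integral_nonneg hlr fun t _ => abs_nonneg _
  have hL : r - l ≤ h := by
    have h1 := hdiam _ (points_mem j) _ (points_mem i)
    have h2 := PiLp.norm_apply_le (T.points j - T.points i) 0
    rw [PiLp.sub_apply, Real.norm_eq_abs] at h2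
    exact (le_abs_self _).trans (h2.trans h1)
  have hL0 : 0 ≤ r - l := sub_nonneg.2 hlr
  set P := taylorPoly n g l 0
  have h0 : ∀ t ∈ Set.Icc l r, |g 0 t - polyFun P (pt t y)| ≤ h ^ (n - 1) * A := fun t ht => by
    refine (hg.abs_sub_taylorPoly_le hai hlr hjb y (n - 1) 0 (by omega) t ht).trans ?_
    gcongr
  have h1 : |g 1 x - polyFun (MvPolynomial.pderiv 0 P) (pt x y)| ≤ h ^ (n - 2) * A := by
    rw [pderiv_taylorPoly g l (by omega : 0 < n)]
    refine (hg.abs_sub_taylorPoly_le hai hlr hjb y (n - 2) 1 (by omega) x hx).trans ?_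
    gcongr
  -- The Taylor polynomial has degree at most `n - 1 ≤ p`, so the inverse estimate on the edge
  -- applies to `P - q`.
  have hdeg : (P - q).totalDegree ≤ p := (MvPolynomial.totalDegree_sub _ _).trans
    (max_le ((totalDegree_taylorPoly n g l 0).trans (by omega)) hq.1)
  have hxT : pt x y ∈ closedTri T := by
    have : x ∈ edgeAbs T y := by rw [e.edgeAbs_eq]; exact hx
    exact this
  -- At the nodes of the edge `q` equals `V`, so the values of `P - q` there are Taylor remainders,
  -- of size `h ^ (n - 1) * A`; differentiation loses one power of `h`.
  have h2 := e.abs_pderiv_le (mul_pos hρ hh) hball hp hdeg (N := h ^ (n - 1) * A) (by positivity)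
    (fun m hm hmk => by
      obtain ⟨t, ht, htm⟩ := e.lagNode_eq hp hm hmk
      rw [polyFun_sub, Pi.sub_apply, hq.eval_node hm, htm, hV t ht, abs_sub_comm]
      exact h0 t ht) hxT
  rw [← hK, map_sub, polyFun_sub, Pi.sub_apply] at h2
  have h3 : h ^ (n - 1) = h ^ (n - 2) * h := by rw [← pow_succ]; congr 1; omega
  have h4 : |polyFun (MvPolynomial.pderiv 0 P) (pt x y) - polyFun (MvPolynomial.pderiv 0 q) (pt x y)| ≤
      K / ρ * (h ^ (n - 2) * A) := by
    rw [h3] at h2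
    refine le_of_mul_le_mul_right (h2.trans_eq ?_) (mul_pos hρ hh)
    field_simp
  calc _ ≤ |g 1 x - polyFun (MvPolynomial.pderiv 0 P) (pt x y)| +
      |polyFun (MvPolynomial.pderiv 0 P) (pt x y) - polyFun (MvPolynomial.pderiv 0 q) (pt x y)| :=
        abs_sub_le _ _ _
    _ ≤ _ := add_le_add h1 h4
    _ = _ := by ring


/-! ### Norms and end-point values of the error on one boundary edge. -/

variable {a b c d ρ y : ℝ} {𝒯 : Finset Tri} {T : Tri}

/-- Estimates for a broken function on the boundary edge of `T` at height `y`. -/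
structure EdgeBound (T : Tri) (y : ℝ) (w : Plane → ℝ) (h : ℝ) (B : ℝ≥0∞) : Prop where
  sSup_mem : sSup (edgeAbs T y) ∈ edgeAbs T y
  sInf_mem : sInf (edgeAbs T y) ∈ edgeAbs T y
  l2sq_fun_le : l2sq (volume.restrict (edgeInt T y)) (edgeFun T y w) ≤
    ENNReal.ofReal h * (ENNReal.ofReal (h ^ 2) * B)
  l2sq_deriv_le : l2sq (volume.restrict (edgeInt T y)) (edgeDeriv T y w) ≤ ENNReal.ofReal h * B
  fun_sSup : contRep (edgeInt T y) (edgeFun T y w) (sSup (edgeAbs T y)) = 0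
  fun_sInf : contRep (edgeInt T y) (edgeFun T y w) (sInf (edgeAbs T y)) = 0
  deriv_sSup : ‖contRep (edgeInt T y) (edgeDeriv T y w) (sSup (edgeAbs T y))‖ₑ ^ 2 ≤ B
  deriv_sInf : ‖contRep (edgeInt T y) (edgeDeriv T y w) (sInf (edgeAbs T y))‖ₑ ^ 2 ≤ B

theorem enorm_sq_le_ofReal {x M : ℝ} (h : |x| ≤ M) : ‖x‖ₑ ^ 2 ≤ ENNReal.ofReal (M ^ 2) := by
  rw [Real.enorm_eq_ofReal_abs, ← ENNReal.ofReal_pow (abs_nonneg x)]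
  exact ENNReal.ofReal_le_ofReal (pow_le_pow_left₀ (abs_nonneg x) h 2)

theorem l2sq_Ioo_le {l r h M : ℝ} (hlr : r - l ≤ h) {f E : ℝ → ℝ}
    (hf : f =ᵐ[volume.restrict (Set.Ioo l r)] E) (hE : ∀ x ∈ Set.Icc l r, |E x| ≤ M) :
    l2sq (volume.restrict (Set.Ioo l r)) f ≤ ENNReal.ofReal h * ENNReal.ofReal (M ^ 2) := by
  calc l2sq (volume.restrict (Set.Ioo l r)) f
      ≤ ∫⁻ _ in Set.Ioo l r, ENNReal.ofReal (M ^ 2) := by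
        refine lintegral_mono_ae ?_
        filter_upwards [hf, ae_restrict_mem measurableSet_Ioo] with x hx hx'
        rw [hx]
        exact enorm_sq_le_ofReal (hE x (Set.Ioo_subset_Icc_self hx'))
    _ = ENNReal.ofReal (r - l) * ENNReal.ofReal (M ^ 2) := by
        rw [setLIntegral_const, Real.volume_Ioo, mul_comm]
    _ ≤ _ := by gcongr

theorem edgeBound_of {l r h M : ℝ} {w : Plane → ℝ} {E E' : ℝ → ℝ} {B : ℝ≥0∞} (hlr : l < r)
    (hrl : r - l ≤ h) (habs : edgeAbs T y = Set.Icc l r) (hint : edgeInt T y = Set.Ioo l r)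
    (hE : ContinuousOn E (Set.Icc l r)) (hE' : ContinuousOn E' (Set.Icc l r))
    (hf : edgeFun T y w =ᵐ[volume.restrict (Set.Ioo l r)] E)
    (hf' : edgeDeriv T y w =ᵐ[volume.restrict (Set.Ioo l r)] E') (hl : E l = 0) (hr : E r = 0)
    (hEM : ∀ x ∈ Set.Icc l r, |E x| ≤ h * M) (hEM' : ∀ x ∈ Set.Icc l r, |E' x| ≤ M)
    (hB : ENNReal.ofReal (M ^ 2) ≤ B) : EdgeBound T y w h B := by
  have hcl := closure_Ioo hlr.ne
  have hSup : sSup (edgeAbs T y) = r := by rw [habs, csSup_Icc hlr.le]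
  have hInf : sInf (edgeAbs T y) = l := by rw [habs, csInf_Icc hlr.le]
  have hl' : l ∈ Set.Icc l r := Set.left_mem_Icc.2 hlr.le
  have hr' : r ∈ Set.Icc l r := Set.right_mem_Icc.2 hlr.le
  have h1 : Set.EqOn (contRep (edgeInt T y) (edgeFun T y w)) E (Set.Icc l r) := by
    rw [hint, ← hcl]
    exact contRep_eq isOpen_Ioo (by rwa [hcl]) hf.symm
  have h2 : Set.EqOn (contRep (edgeInt T y) (edgeDeriv T y w)) E' (Set.Icc l r) := by
    rw [hint, ← hcl]
    exact contRep_eq isOpen_Ioo (by rwa [hcl]) hf'.symm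
  have hB' : ∀ x ∈ Set.Icc l r, ‖E' x‖ₑ ^ 2 ≤ B := fun x hx =>
    (enorm_sq_le_ofReal (hEM' x hx)).trans hB
  refine ⟨?_, ?_, ?_, ?_, ?_, ?_, ?_, ?_⟩
  · rwa [hSup, habs]
  · rwa [hInf, habs]
  · rw [hint]
    refine (l2sq_Ioo_le hrl hf hEM).trans ?_
    rw [mul_pow, ENNReal.ofReal_mul (sq_nonneg h)]
    exact mul_le_mul_right (mul_le_mul_right hB _) _
  · rw [hint]
    exact (l2sq_Ioo_le hrl hf' hEM').trans (mul_le_mul_right hB _)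
  · rw [hSup, h1 hr', hr]
  · rw [hInf, h1 hl', hl]
  · rw [hSup, h2 hr']; exact hB' r hr'
  · rw [hInf, h2 hl']; exact hB' l hl'

theorem ofReal_integral_abs_sq_le {l r h : ℝ} (hlr : l ≤ r) (hrl : r - l ≤ h) {f : ℝ → ℝ}
    (hf : IntegrableOn f (Set.Icc l r)) : ENNReal.ofReal ((∫ t in l..r, |f t|) ^ 2) ≤
      ENNReal.ofReal h * l2sq (volume.restrict (Set.Ioo l r)) f := by
  have hf' : IntegrableOn f (Set.Ioo l r) := hf.mono_set Set.Ioo_subset_Icc_self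
  have h1 : ENNReal.ofReal (∫ t in l..r, |f t|) = ∫⁻ t in Set.Ioo l r, ‖f t‖ₑ := by
    rw [intervalIntegral.integral_of_le hlr, integral_Ioc_eq_integral_Ioo]
    exact ofReal_integral_norm_eq_lintegral_enorm hf'
  rw [ENNReal.ofReal_pow (intervalIntegral.integral_nonneg hlr fun t _ => abs_nonneg _), h1]
  refine (lintegral_sq_le hf'.aestronglyMeasurable.enorm).trans ?_
  rw [Measure.restrict_apply_univ, Real.volume_Ioo]
  exact mul_le_mul_left (ENNReal.ofReal_le_ofReal hrl) _

theorem contDiff_polyFun_pt (q : MvPolynomial (Fin 2) ℝ) (y : ℝ) :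
    ContDiff ℝ ∞ fun x => polyFun q (pt x y) := by
  refine (contDiff_polyFun q).comp ?_
  rw [show (fun x => pt x y) = _ from funext fun x => pt_eq_add_fst x y]
  exact contDiff_const.add (contDiff_id.smul contDiff_const)

theorem IsMesh.side_height_sign (hab : a < b) (hcd : c < d) (hM : IsMesh (rect a b c d) 𝒯)
    (hT : T ∈ 𝒯) (hy : y = c ∨ y = d) :
    ∃ ε : ℝ, ε ≠ 0 ∧ ∀ x ∈ closedTri T, 0 ≤ ε * (x 1 - y) := by
  have h1 : closedTri T ⊆ closedRect a b c d := closure_rect hab hcd ▸ hM.closedTri_subset hT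
  rcases hy with rfl | rfl
  · exact ⟨1, one_ne_zero, fun x hx => by have := (h1 hx).2.2.1; linarith⟩
  · exact ⟨-1, by norm_num, fun x hx => by have := (h1 hx).2.2.2; linarith⟩

/-- On the edge the error and its tangential derivative are represented by `g 0 - q` and `g 1 - ∂₀
q`. The error vanishes at both end points because they are Lagrange nodes. Its size is obtained by
integrating the derivative error from the left end point, with a gain of `h`; Cauchy–Schwarz turns
the `L¹` norm of `g (k + 2)` into the `L²` norm with a factor `h`. -/
theorem IsMesh.edgeBound (hab : a < b) (hcd : c < d) (hρ : 0 < ρ) (hM : IsMesh (rect a b c d) 𝒯)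
    (hQ : QuasiUniform ρ 𝒯) (hT : T ∈ 𝒯) (hy : y = c ∨ y = d) {s k p : ℕ} (hs : 2 ≤ s) (hp : 1 ≤ p)
    (hkp : k + 2 ≤ p + 1) {v : Plane → ℝ} (hv : MemHs (rect a b c d) s v) {g : ℕ → ℝ → ℝ}
    (hg : PrimitiveChain a b (k + 2) g) (hg' : IsWeakDeriv1 (Set.Ioo a b) (g 0) (g 1))
    (hVg : ∀ x ∈ Set.Icc a b, contRep (rect a b c d) v (pt x y) = g 0 x)
    (hne : (edgeInt T y).Nonempty) :
    EdgeBound T y (fun x => v x - interp (rect a b c d) 𝒯 p v x) (meshSize 𝒯)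
      (ENNReal.ofReal (((1 + ((nodeIdx p).card * (4 * (4 * p : ℝ) ^ p) ^ 3) / ρ) *
        meshSize 𝒯 ^ k) ^ 2) * (ENNReal.ofReal (meshSize 𝒯) *
          l2sq (volume.restrict (edgeInt T y)) (g (k + 2)))) := by
  set h := meshSize 𝒯 with hh
  set V := contRep (rect a b c d) v with hV
  set q := lagrangePoly T p V with hq
  set K : ℝ := 1 + ((nodeIdx p).card * (4 * (4 * p : ℝ) ^ p) ^ 3) / ρ with hK
  have hh0 : 0 < h := meshSize_pos hT
  obtain ⟨ε, hε, hεs⟩ := hM.side_height_sign hab hcd hT hy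
  obtain ⟨i, j, m, e⟩ := exists_isEdge hε hεs hne
  set l := T.points i 0 with hl
  set r := T.points j 0 with hr
  have hsub : closedTri T ⊆ closedRect a b c d := closure_rect hab hcd ▸ hM.closedTri_subset hT
  have hal : a ≤ l := (hsub (points_mem i)).1
  have hrb : r ≤ b := (hsub (points_mem j)).2.1
  have hlr : l < r := e.lt
  have hIcc : Set.Icc l r ⊆ Set.Icc a b := Set.Icc_subset_Icc hal hrb
  have hrl : r - l ≤ h := by
    have h1 := norm_sub_le_meshSize hT _ (points_mem j) _ (points_mem i)
    have h2 := PiLp.norm_apply_le (T.points j - T.points i) 0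
    rw [PiLp.sub_apply, Real.norm_eq_abs] at h2
    exact (le_abs_self _).trans (h2.trans h1)
  have hLag : IsLagrange T p V q := isLagrange_lagrangePoly hp V
  have hab' := e.edgeAbs_eq
  have hin' := e.edgeInt_eq
  have hzero : ∀ t, T.points t = pt (T.points t 0) y → T.points t 0 ∈ Set.Icc a b →
      g 0 (T.points t 0) - polyFun q (pt (T.points t 0) y) = 0 := by
    intro t ht htab
    obtain ⟨h1, h2⟩ := lagNode_single (T := T) hp t
    have h3 := hLag.eval_node h1
    rw [h2, ht, hVg _ htab] at h3
    rw [h3, sub_self]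
  have hE' : ∀ x ∈ Set.Icc l r, |g 1 x - polyFun (MvPolynomial.pderiv 0 q) (pt x y)| ≤
      K * h ^ k * ∫ t in l..r, |g (k + 2) t| :=
    e.abs_deriv_sub_le hρ hh0 (hQ.regular hT) hp (by omega) hkp hg hal hrb
      (fun x hx => hVg x (hIcc hx)) hLag
  have hEl : g 0 l - polyFun q (pt l y) = 0 :=
    hzero i e.points_eq.1 (hIcc (Set.left_mem_Icc.2 hlr.le))
  have hc0 : ContinuousOn (g 0) (Set.Icc l r) := (hg.continuousOn 0 (by omega)).mono hIcc
  have hc1 : ContinuousOn (g 1) (Set.Icc l r) := (hg.continuousOn 1 (by omega)).mono hIcc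
  have hE : ∀ x ∈ Set.Icc l r, |g 0 x - polyFun q (pt x y)| ≤
      h * (K * h ^ k * ∫ t in l..r, |g (k + 2) t|) := by
    intro x hx
    have h1 : ∫ t in l..x, polyFun (MvPolynomial.pderiv 0 q) (pt t y) =
        polyFun q (pt x y) - polyFun q (pt l y) :=
      intervalIntegral.integral_eq_sub_of_hasDerivAt (f := fun t => polyFun q (pt t y))
        (fun t _ => hasDerivAt_polyFun_pt _ t y)
        ((continuous_polyFun_pt _ y).intervalIntegrable _ _)
    have h2 := hg.sub_eq 0 (by omega) l (hIcc (Set.left_mem_Icc.2 hlr.le)) x (hIcc hx)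
    have h3 : g 0 x - polyFun q (pt x y) =
        ∫ t in l..x, (g 1 t - polyFun (MvPolynomial.pderiv 0 q) (pt t y)) := by
      rw [intervalIntegral.integral_sub _ ((continuous_polyFun_pt _ y).intervalIntegrable _ _), h1]
      · rw [zero_add] at h2
        rw [← h2]; linarith
      · exact (hc1.mono (by
          rw [Set.uIcc_of_le hx.1]; exact Set.Icc_subset_Icc le_rfl hx.2)).intervalIntegrable
    rw [h3]
    have h4 := intervalIntegral.norm_integral_le_of_norm_le_const (a := l) (b := x)
      (C := K * h ^ k * ∫ t in l..r, |g (k + 2) t|)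
      (f := fun t => g 1 t - polyFun (MvPolynomial.pderiv 0 q) (pt t y)) fun t ht => by
        rw [Set.uIoc_of_le hx.1] at ht
        exact hE' t ⟨ht.1.le, ht.2.trans hx.2⟩
    rw [Real.norm_eq_abs, abs_of_nonneg (by linarith [hx.1] : 0 ≤ x - l), mul_comm] at h4
    refine h4.trans (mul_le_mul_of_nonneg_right (by linarith [hx.2]) ?_)
    exact (abs_nonneg _).trans (hE' x hx)
  have hVc := contRep_rect hab hcd hs hv
  have hTr := hM.openTri_subset hab hcd hT
  have hw : (fun x => v x - interp (rect a b c d) 𝒯 p v x) =ᵐ[volume.restrict (openTri T)]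
      fun x => v x - polyFun q x := sub_interp_ae_eq hM hT p v
  have htr := elTrace_ae_eq hs (hv.mono_set isOpen_rect hTr)
    (hVc.1.mono (hM.closedTri_subset hT)) (ae_restrict_of_ae_restrict_of_subset hTr hVc.2.1) hw
  have hmem : ∀ x ∈ Set.Ioo l r, pt x y ∈ closedTri T := fun x hx => by
    have : x ∈ edgeAbs T y := hab' ▸ Set.Ioo_subset_Icc_self hx
    exact this
  have hf : edgeFun T y (fun x => v x - interp (rect a b c d) 𝒯 p v x)
      =ᵐ[volume.restrict (Set.Ioo l r)] fun x => g 0 x - polyFun q (pt x y) := by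
    have h1 : (fun x => pt x y) '' Set.Ioo l r ⊆ frontier (openTri T) := by
      rintro _ ⟨x, hx, rfl⟩
      refine hM.mem_frontier hab hcd hT (hmem x hx) fun hx' => ?_
      rcases hy with rfl | rfl
      · exact lt_irrefl _ hx'.2.2.1
      · exact lt_irrefl _ hx'.2.2.2
    have h2 := ae_comp_isometry (isometry_pt_fst y) (ae_restrict_of_ae_restrict_of_subset h1 htr)
    filter_upwards [h2, ae_restrict_mem measurableSet_Ioo] with x hx hx'
    rw [← hVg x (hIcc (Set.Ioo_subset_Icc_self hx'))]
    exact hx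
  have hQ' : deriv (fun x => polyFun q (pt x y)) =
      fun x => polyFun (MvPolynomial.pderiv 0 q) (pt x y) :=
    funext fun x => (hasDerivAt_polyFun_pt q x y).deriv
  have hf' : edgeDeriv T y (fun x => v x - interp (rect a b c d) 𝒯 p v x)
      =ᵐ[volume.restrict (Set.Ioo l r)]
        fun x => g 1 x - polyFun (MvPolynomial.pderiv 0 q) (pt x y) := by
    have h1 := (hg'.mono (Set.Ioo_subset_Ioo hal hrb)).sub
      (isWeakDeriv1_of_contDiff (contDiff_polyFun_pt q y) (Set.Ioo l r))
    rw [hQ'] at h1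
    have h2 := (h1.congr hf.symm (ae_eq_refl _)).weakDeriv1_ae_eq isOpen_Ioo
    rw [edgeDeriv, hin']
    exact h2
  refine edgeBound_of hlr hrl hab' hin' (hc0.sub (continuous_polyFun_pt q y).continuousOn)
    (hc1.sub (continuous_polyFun_pt _ y).continuousOn) hf hf' hEl
    (hzero j e.points_eq.2 (hIcc (Set.right_mem_Icc.2 hlr.le))) hE hE' ?_
  rw [mul_pow, ENNReal.ofReal_mul (sq_nonneg _), hin']
  exact mul_le_mul_right (ofReal_integral_abs_sq_le hlr.le hrl
    ((hg.integrable _ le_rfl).mono_set hIcc)) _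


/-! ### Summation over the horizontal sides and assembly of the energy norm. -/

variable {a b c d ρ y : ℝ} {𝒯 : Finset Tri}

theorem edgeInt_subset (hab : a < b) (hcd : c < d) (hM : IsMesh (rect a b c d) 𝒯) {T : Tri}
    (hT : T ∈ 𝒯) (y : ℝ) : edgeInt T y ⊆ Set.Ioo a b := by
  have h1 : edgeAbs T y ⊆ Set.Icc a b := fun x hx => by
    have h2 : pt x y ∈ closedRect a b c d := closure_rect hab hcd ▸ hM.closedTri_subset hT hx
    exact ⟨h2.1, h2.2.1⟩
  rw [← interior_Icc]
  exact interior_mono h1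

theorem IsMesh.sum_edge_l2sq_le (hab : a < b) (hcd : c < d) (hρ : 0 < ρ)
    (hM : IsMesh (rect a b c d) 𝒯) (hQ : QuasiUniform ρ 𝒯) (y : ℝ) {f : ℝ → ℝ}
    (hf : AEStronglyMeasurable f (volume.restrict (Set.Ioo a b))) :
    ∑ T ∈ 𝒯, l2sq (volume.restrict (edgeInt T y)) f ≤
      ENNReal.ofReal (ρ ^ 2)⁻¹ * l2sq (volume.restrict (Set.Ioo a b)) f := by
  classical
  refine sum_setLIntegral_le 𝒯 (fun T _ => isOpen_interior.measurableSet) measurableSet_Ioo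
    (fun T hT => edgeInt_subset hab hcd hM hT y) ENNReal.ofReal_ne_top (fun x _ => ?_)
    (hf.enorm.pow_const 2)
  refine le_trans ?_ (hM.card_le hρ hQ (pt x y))
  refine Nat.cast_le.2 (Finset.card_le_card fun T hT => ?_)
  simp only [Finset.mem_filter] at hT ⊢
  have h1 : x ∈ edgeAbs T y := interior_subset hT.2
  exact ⟨hT.1, h1⟩

theorem sum_ite_le_mul {ι : Type*} (S : Finset ι) (P : ι → Prop) [DecidablePred P] (B : ℝ≥0∞)
    {κ : ℝ≥0∞} (h : ((S.filter P).card : ℝ≥0∞) ≤ κ) :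
    (∑ i ∈ S, if P i then B else 0) ≤ κ * B := by
  rw [← Finset.sum_filter, Finset.sum_const, nsmul_eq_mul]
  exact mul_le_mul_left h B

theorem card_filter_le_add {ι : Type*} (S : Finset ι) (P Q R : ι → Prop) [DecidablePred P]
    [DecidablePred Q] [DecidablePred R] (h : ∀ i ∈ S, P i → Q i ∨ R i) {κ : ℝ≥0∞}
    (hQ : ((S.filter Q).card : ℝ≥0∞) ≤ κ) (hR : ((S.filter R).card : ℝ≥0∞) ≤ κ) :
    ((S.filter P).card : ℝ≥0∞) ≤ κ + κ := by
  classical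
  have h1 : S.filter P ⊆ S.filter Q ∪ S.filter R := fun i hi => by
    simp only [Finset.mem_filter, Finset.mem_union] at hi ⊢
    exact (h i hi.1 hi.2).imp (⟨hi.1, ·⟩) (⟨hi.1, ·⟩)
  calc ((S.filter P).card : ℝ≥0∞) ≤ ((S.filter Q).card + (S.filter R).card : ℕ) :=
        Nat.cast_le.2 ((Finset.card_le_card h1).trans (Finset.card_union_le _ _))
    _ ≤ κ + κ := by rw [Nat.cast_add]; exact add_le_add hQ hR

/-- Bounds on the boundary edges at height `y` sum up to bounds on the side. -/
theorem IsMesh.side_le (hρ : 0 < ρ) (hM : IsMesh (rect a b c d) 𝒯) (hQ : QuasiUniform ρ 𝒯)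
    {w : Plane → ℝ} {h : ℝ} {B : Tri → ℝ≥0∞}
    (hB : ∀ T ∈ 𝒯, (edgeInt T y).Nonempty → EdgeBound T y w h (B T)) :
    sideL2Sq 𝒯 y w ≤ ENNReal.ofReal (h ^ 2) * (ENNReal.ofReal h * ∑ T ∈ 𝒯, B T) ∧
      sideH1Sq 𝒯 y w ≤ ENNReal.ofReal h * ∑ T ∈ 𝒯, B T ∧ ridgeJumpSq a b 𝒯 y w = 0 ∧
      ridgeMeanGradSq a b 𝒯 y w ≤ 8 * ENNReal.ofReal (ρ ^ 2)⁻¹ * ∑ T ∈ 𝒯, B T := by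
  classical
  have hempty : ∀ T, ¬ (edgeInt T y).Nonempty → ∀ f : ℝ → ℝ,
      l2sq (volume.restrict (edgeInt T y)) f = 0 := fun T hT f => by
    rw [Set.not_nonempty_iff_eq_empty.1 hT, Measure.restrict_empty, l2sq, lintegral_zero_measure]
  refine ⟨?_, ?_, ?_, ?_⟩
  · rw [sideL2Sq, ← mul_assoc, Finset.mul_sum]
    refine Finset.sum_le_sum fun T hT => ?_
    by_cases hne : (edgeInt T y).Nonempty
    · refine (hB T hT hne).l2sq_fun_le.trans (le_of_eq ?_)
      ring
    · rw [hempty T hne]; exact zero_le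
  · rw [sideH1Sq, Finset.mul_sum]
    refine Finset.sum_le_sum fun T hT => ?_
    by_cases hne : (edgeInt T y).Nonempty
    · exact (hB T hT hne).l2sq_deriv_le
    · rw [hempty T hne]; exact zero_le
  · rw [ridgeJumpSq]
    refine Finset.sum_eq_zero fun T hT => Finset.sum_eq_zero fun T' hT' => ?_
    split_ifs with hS
    -- Both one-sided values vanish, at the identified corners too, so no jump remains.
    · rw [(hB T hT hS.1).fun_sSup, (hB T' hT' hS.2.1).fun_sInf]
      simp
    · rfl
  · set κ := ENNReal.ofReal (ρ ^ 2)⁻¹ with hκ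
    have hle : ridgeMeanGradSq a b 𝒯 y w ≤ ∑ T ∈ 𝒯, ∑ T' ∈ 𝒯,
        ((if ShareRidge a b y T T' then 2 * B T else 0) +
          if ShareRidge a b y T T' then 2 * B T' else 0) := by
      rw [ridgeMeanGradSq]
      refine Finset.sum_le_sum fun T hT => Finset.sum_le_sum fun T' hT' => ?_
      split_ifs with hS
      · exact (enorm_half_add_sq_le _ _).trans (add_le_add
          (mul_le_mul_right (hB T hT hS.1).deriv_sSup 2)
          (mul_le_mul_right (hB T' hT' hS.2.1).deriv_sInf 2))
      · exact zero_le
    -- For fixed `T`, a partner `T'` contains the right end point of the edge of `T` or the corner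
    -- `(a, y)`, so there are at most `2 κ` partners. Fixing `T'` instead leads to the corner `(b,
    -- y)`.
    have h1 : ∑ T ∈ 𝒯, ∑ T' ∈ 𝒯, (if ShareRidge a b y T T' then 2 * B T else 0) ≤
        ∑ T ∈ 𝒯, (κ + κ) * (2 * B T) := by
      refine Finset.sum_le_sum fun T hT => sum_ite_le_mul 𝒯 _ _ ?_
      refine card_filter_le_add 𝒯 _ _ _ (fun T' hT' hS => ?_)
        (hM.card_le hρ hQ (pt (sSup (edgeAbs T y)) y)) (hM.card_le hρ hQ (pt a y))
      have h2 : pt (sInf (edgeAbs T' y)) y ∈ closedTri T' := (hB T' hT' hS.2.1).sInf_mem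
      rcases hS.2.2 with h3 | h3
      · exact .inl (h3 ▸ h2)
      · exact .inr (h3.2 ▸ h2)
    have h2 : ∑ T ∈ 𝒯, ∑ T' ∈ 𝒯, (if ShareRidge a b y T T' then 2 * B T' else 0) ≤
        ∑ T' ∈ 𝒯, (κ + κ) * (2 * B T') := by
      rw [Finset.sum_comm]
      refine Finset.sum_le_sum fun T' hT' => sum_ite_le_mul 𝒯 (fun T => ShareRidge a b y T T') _ ?_
      refine card_filter_le_add 𝒯 _ _ _ (fun T hT hS => ?_)
        (hM.card_le hρ hQ (pt (sInf (edgeAbs T' y)) y)) (hM.card_le hρ hQ (pt b y))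
      have h2 : pt (sSup (edgeAbs T y)) y ∈ closedTri T := (hB T hT hS.1).sSup_mem
      rcases hS.2.2 with h3 | h3
      · exact .inl (h3 ▸ h2)
      · exact .inr (h3.1 ▸ h2)
    refine hle.trans ?_
    simp only [Finset.sum_add_distrib]
    refine (add_le_add h1 h2).trans (le_of_eq ?_)
    rw [← Finset.mul_sum, ← Finset.mul_sum]
    ring

/-- The side terms of the energy norm of the interpolation error, at height `y`. -/
theorem exists_side_le (hab : a < b) (hcd : c < d) (hρ : 0 < ρ) {s p : ℕ} (hs : 2 ≤ s)
    (hp : 1 ≤ p) : ∃ C : ℝ≥0∞, C ≠ ⊤ ∧ ∀ 𝒯 : Finset Tri, IsMesh (rect a b c d) 𝒯 →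
      QuasiUniform ρ 𝒯 → ∀ y, y = c ∨ y = d → ∀ v : Plane → ℝ, MemHs (rect a b c d) s v →
      MemHs1 (Set.Ioo a b) s (sideTrace a b c d v y) → ∃ R : ℝ≥0∞,
      R ≤ C * (ENNReal.ofReal (meshSize 𝒯 ^ 2) ^ min (s - 1) p *
        hsNormSq1 (Set.Ioo a b) s (sideTrace a b c d v y)) ∧
      sideL2Sq 𝒯 y (fun x => v x - interp (rect a b c d) 𝒯 p v x) ≤
        ENNReal.ofReal (meshSize 𝒯 ^ 2) * R ∧
      sideH1Sq 𝒯 y (fun x => v x - interp (rect a b c d) 𝒯 p v x) ≤ R ∧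
      ridgeJumpSq a b 𝒯 y (fun x => v x - interp (rect a b c d) 𝒯 p v x) = 0 ∧
      ENNReal.ofReal (meshSize 𝒯) *
        ridgeMeanGradSq a b 𝒯 y (fun x => v x - interp (rect a b c d) 𝒯 p v x) ≤
        8 * ENNReal.ofReal (ρ ^ 2)⁻¹ * R := by
  -- With this `k` the highest derivative used on the side is `k + 2 = min s (p + 1)`.
  obtain ⟨k, hk⟩ : ∃ k, min (s - 1) p = k + 1 := ⟨min (s - 1) p - 1, by omega⟩
  set K : ℝ := 1 + ((nodeIdx p).card * (4 * (4 * p : ℝ) ^ p) ^ 3) / ρ with hK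
  refine ⟨ENNReal.ofReal (K ^ 2) * ENNReal.ofReal (ρ ^ 2)⁻¹,
    ENNReal.mul_ne_top ENNReal.ofReal_ne_top ENNReal.ofReal_ne_top, ?_⟩
  intro 𝒯 hM hQ y hy v hv hu
  set h := meshSize 𝒯 with hh
  set u := sideTrace a b c d v y with hu'
  have hh0 : 0 ≤ h := by
    obtain ⟨T, hT⟩ := hM.nonempty hab hcd
    exact (meshSize_pos hT).le
  have hks : k + 2 ≤ s := by omega
  obtain ⟨g, hg, hgu⟩ := hu.exists_primitiveChain hab hks
  have hVc := contRep_rect hab hcd hs hv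
  have hg0 : u =ᵐ[volume.restrict (Set.Ioo a b)] g 0 := hgu 0 (by omega)
  have hg1 : IsWeakDeriv1 (Set.Ioo a b) (g 0) (g 1) :=
    (hu.isWeakDeriv1_iterate isOpen_Ioo (k := 0) (by omega)).congr hg0 (hgu 1 (by omega))
  have hmaps : Set.MapsTo (fun x => pt x y) (Set.Icc a b) (closure (rect a b c d)) := by
    intro x hx
    rw [closure_rect hab hcd]
    rcases hy with rfl | rfl
    · exact ⟨hx.1, hx.2, le_rfl, hcd.le⟩
    · exact ⟨hx.1, hx.2, hcd.le, le_rfl⟩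
  -- Both functions are continuous on `[a, b]` and agree almost everywhere, so they agree at every
  -- point, in particular at the nodes.
  have hVg : ∀ x ∈ Set.Icc a b, contRep (rect a b c d) v (pt x y) = g 0 x := by
    have hcl : closure (Set.Ioo a b) = Set.Icc a b := closure_Ioo hab.ne
    have := eqOn_closure_of_ae_eq (U := Set.Ioo a b) isOpen_Ioo
      (f := fun x => contRep (rect a b c d) v (pt x y)) (g := g 0)
      (by rw [hcl]; exact hVc.1.comp (isometry_pt_fst y).continuous.continuousOn hmaps)
      (by rw [hcl]; exact hg.continuousOn 0 (by omega)) ((hVc.2.2 y hy).symm.trans hg0)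
    rwa [hcl] at this
  obtain ⟨h1, h2, h3, h4⟩ := hM.side_le (a := a) (b := b) (y := y) hρ hQ fun T hT hne =>
    hM.edgeBound hab hcd hρ hQ hT hy hs hp (by omega : k + 2 ≤ p + 1) hv hg hg1 hVg hne
  refine ⟨_, ?_, h1, h2, h3, ?_⟩
  · rw [← Finset.mul_sum, ← Finset.mul_sum, hk]
    have hmeas : AEStronglyMeasurable (g (k + 2)) (volume.restrict (Set.Ioo a b)) :=
      (((hg.integrable _ le_rfl).mono_set Set.Ioo_subset_Icc_self)).aestronglyMeasurable
    have h5 := hM.sum_edge_l2sq_le hab hcd hρ hQ y hmeas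
    have h6 : l2sq (volume.restrict (Set.Ioo a b)) (g (k + 2)) ≤ hsNormSq1 (Set.Ioo a b) s u := by
      refine le_trans (le_of_eq ?_) (l2sq_iterate_le hks u)
      refine lintegral_congr_ae ?_
      filter_upwards [hgu (k + 2) le_rfl] with x hx
      rw [hx]
    -- The power count: one `h` from the edge length, `h ^ (2 * k)` from the Taylor estimate and one
    -- `h` from Cauchy–Schwarz, in total `h ^ (2 * (k + 1))`.
    have h7 : ENNReal.ofReal h * (ENNReal.ofReal ((K * h ^ k) ^ 2) * ENNReal.ofReal h) =
        ENNReal.ofReal (K ^ 2) * ENNReal.ofReal (h ^ 2) ^ (k + 1) := by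
      rw [← ENNReal.ofReal_pow (sq_nonneg h), ← ENNReal.ofReal_mul (sq_nonneg _),
        ← ENNReal.ofReal_mul hh0, ← ENNReal.ofReal_mul (sq_nonneg _)]
      congr 1
      ring
    calc _ = ENNReal.ofReal h * (ENNReal.ofReal ((K * h ^ k) ^ 2) * ENNReal.ofReal h) *
          ∑ T ∈ 𝒯, l2sq (volume.restrict (edgeInt T y)) (g (k + 2)) := by ring
      _ ≤ ENNReal.ofReal h * (ENNReal.ofReal ((K * h ^ k) ^ 2) * ENNReal.ofReal h) *
          (ENNReal.ofReal (ρ ^ 2)⁻¹ * hsNormSq1 (Set.Ioo a b) s u) :=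
        mul_le_mul_right (h5.trans (mul_le_mul_right h6 _)) _
      _ = _ := by rw [h7]; ring
  · refine (mul_le_mul_right h4 _).trans (le_of_eq ?_)
    ring

/-- The element and side estimates are added up. The `L²` term on the sides has a spare factor `h²`,
bounded through the size of the rectangle. The weight `β / σ = β h / γ` of the ridge means supplies
the missing power of `h`. -/
theorem exists_energyNorm_sq_le (hab : a < b) (hcd : c < d) {α β γ : ℝ} (hβ : 0 < β)
    (hγ : 0 < γ) (hρ : 0 < ρ) {s p : ℕ} (hs : 2 ≤ s) (hp : 1 ≤ p) :
    ∃ C : ℝ≥0∞, C ≠ ⊤ ∧ ∀ 𝒯 : Finset Tri, IsMesh (rect a b c d) 𝒯 → QuasiUniform ρ 𝒯 →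
      ∀ v : Plane → ℝ, MemHsGamma a b c d s v →
      energyNorm a b c d α β γ 𝒯 (fun x => v x - interp (rect a b c d) 𝒯 p v x) ≤
        (C * (ENNReal.ofReal (meshSize 𝒯 ^ 2) ^ min (s - 1) p *
          (hsNormSq (rect a b c d) s v + (hsNormSq1 (Set.Ioo a b) s (sideTrace a b c d v c) +
            hsNormSq1 (Set.Ioo a b) s (sideTrace a b c d v d))))) ^ (1 / 2 : ℝ) := by
  obtain ⟨C₁, hC₁, hbulk⟩ := exists_bulkSq_le hab hcd hγ hρ hs hp
  obtain ⟨C₂, hC₂, hside⟩ := exists_side_le hab hcd hρ hs hp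
  set L := (b - a) + (d - c) with hL
  set A : ℝ≥0∞ := ENNReal.ofReal α * ENNReal.ofReal (L ^ 2) + ENNReal.ofReal β +
    ENNReal.ofReal (β / γ) * (8 * ENNReal.ofReal (ρ ^ 2)⁻¹) with hA
  have hAt : A ≠ ⊤ := ENNReal.add_ne_top.2 ⟨ENNReal.add_ne_top.2
    ⟨ENNReal.mul_ne_top ENNReal.ofReal_ne_top ENNReal.ofReal_ne_top, ENNReal.ofReal_ne_top⟩,
    ENNReal.mul_ne_top ENNReal.ofReal_ne_top
      (ENNReal.mul_ne_top (by norm_num) ENNReal.ofReal_ne_top)⟩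
  refine ⟨C₁ + A * C₂, ENNReal.add_ne_top.2 ⟨hC₁, ENNReal.mul_ne_top hAt hC₂⟩, ?_⟩
  intro 𝒯 hM hQ v hv
  obtain ⟨R, hR, a1, a2, a3, a4⟩ := hside 𝒯 hM hQ c (.inl rfl) v hv.1 hv.2.1
  obtain ⟨S, hS, b1, b2, b3, b4⟩ := hside 𝒯 hM hQ d (.inr rfl) v hv.1 hv.2.2
  have hb := hbulk 𝒯 hM hQ v hv.1
  set w := fun x => v x - interp (rect a b c d) 𝒯 p v x with hw
  set h := meshSize 𝒯 with hh
  have hh0 : 0 < h := by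
    obtain ⟨T, hT⟩ := hM.nonempty hab hcd
    exact meshSize_pos hT
  have hhL : ENNReal.ofReal (h ^ 2) ≤ ENNReal.ofReal (L ^ 2) :=
    ENNReal.ofReal_le_ofReal (pow_le_pow_left₀ hh0.le (hM.meshSize_le hab hcd) 2)
  have e1 : ENNReal.ofReal α * (sideL2Sq 𝒯 c w + sideL2Sq 𝒯 d w) ≤
      ENNReal.ofReal α * ENNReal.ofReal (L ^ 2) * (R + S) := by
    rw [mul_assoc, mul_add (ENNReal.ofReal (L ^ 2))]
    exact mul_le_mul_right (add_le_add (a1.trans (mul_le_mul_left hhL R))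
      (b1.trans (mul_le_mul_left hhL S))) _
  have e2 : ENNReal.ofReal β * (sideH1Sq 𝒯 c w + sideH1Sq 𝒯 d w) ≤ ENNReal.ofReal β * (R + S) :=
    mul_le_mul_right (add_le_add a2 b2) _
  have e3 : ENNReal.ofReal (β / penalty γ 𝒯) * (ridgeMeanGradSq a b 𝒯 c w +
      ridgeMeanGradSq a b 𝒯 d w) ≤
      ENNReal.ofReal (β / γ) * (8 * ENNReal.ofReal (ρ ^ 2)⁻¹) * (R + S) := by
    have : β / penalty γ 𝒯 = β / γ * h := by rw [penalty, ← hh]; field_simp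
    rw [this, ENNReal.ofReal_mul (by positivity), mul_assoc, mul_assoc, mul_add, mul_add _ R]
    exact mul_le_mul_right (add_le_add a4 b4) _
  rw [energyNorm]
  refine ENNReal.rpow_le_rpow ?_ (by norm_num)
  rw [a3, b3, add_zero, mul_zero, add_zero]
  set H := ENNReal.ofReal (h ^ 2) ^ min (s - 1) p with hH
  set N := hsNormSq (rect a b c d) s v
  set N₁ := hsNormSq1 (Set.Ioo a b) s (sideTrace a b c d v c)
  set N₂ := hsNormSq1 (Set.Ioo a b) s (sideTrace a b c d v d)
  calc _ ≤ C₁ * (H * N) + ENNReal.ofReal α * ENNReal.ofReal (L ^ 2) * (R + S) +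
        ENNReal.ofReal β * (R + S) +
        ENNReal.ofReal (β / γ) * (8 * ENNReal.ofReal (ρ ^ 2)⁻¹) * (R + S) :=
      add_le_add (add_le_add (add_le_add hb e1) e2) e3
    _ = C₁ * (H * N) + A * (R + S) := by rw [hA]; ring
    _ ≤ C₁ * (H * N) + A * (C₂ * (H * N₁) + C₂ * (H * N₂)) :=
      add_le_add le_rfl (mul_le_mul_right (add_le_add hR hS) _)
    _ = C₁ * (H * N) + A * C₂ * (H * (N₁ + N₂)) := by ring
    _ ≤ C₁ * (H * (N + (N₁ + N₂))) + A * C₂ * (H * (N + (N₁ + N₂))) :=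
      add_le_add (mul_le_mul_right (mul_le_mul_right le_self_add _) _)
        (mul_le_mul_right (mul_le_mul_right le_add_self _) _)
    _ = _ := by ring

end DGDyn

theorem mainTheorem7 (a b c d : ℝ) (hab : a < b) (hcd : c < d)
    (α β γ : ℝ) (hα : 0 < α) (hβ : 0 < β) (hγ : 0 < γ)
    (ρ : ℝ) (hρ : 0 < ρ) (s p : ℕ) (hs : 2 ≤ s) (hp : 1 ≤ p) :
    ∃ C : ℝ, 0 < C ∧ ∀ 𝒯 : Finset DGDyn.Tri,
      DGDyn.IsMesh (DGDyn.rect a b c d) 𝒯 → DGDyn.QuasiUniform ρ 𝒯 →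
      ∀ v : DGDyn.Plane → ℝ, DGDyn.MemHsGamma a b c d s v →
        DGDyn.energyNorm a b c d α β γ 𝒯
            (fun x => v x - DGDyn.interp (DGDyn.rect a b c d) 𝒯 p v x) ≤
          ENNReal.ofReal (C * DGDyn.meshSize 𝒯 ^ min (s - 1) p) *
            DGDyn.hsGammaNorm a b c d s v := by
  obtain ⟨C, hC, hle⟩ := DGDyn.exists_energyNorm_sq_le (ρ := ρ) hab hcd (α := α) hβ hγ hρ hs hp
  -- Adding 1 makes the constant positive even when `C = 0`.
  refine ⟨Real.sqrt C.toReal + 1, by positivity, fun 𝒯 hM hQ v hv => ?_⟩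
  refine (hle 𝒯 hM hQ v hv).trans ?_
  have hh0 : 0 ≤ DGDyn.meshSize 𝒯 := by
    obtain ⟨T, hT⟩ := hM.nonempty hab hcd
    exact (DGDyn.meshSize_pos hT).le
  rw [DGDyn.hsGammaNorm, ← mul_assoc, ENNReal.mul_rpow_of_nonneg _ _ (by norm_num)]
  refine mul_le_mul_left ?_ _
  rw [← ENNReal.ofReal_pow (sq_nonneg _), ← ENNReal.ofReal_toReal hC,
    ← ENNReal.ofReal_mul ENNReal.toReal_nonneg,
    ENNReal.ofReal_rpow_of_nonneg (by positivity) (by norm_num), ← Real.sqrt_eq_rpow,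
    ENNReal.toReal_ofReal ENNReal.toReal_nonneg]
  refine ENNReal.ofReal_le_ofReal ?_
  rw [Real.sqrt_mul ENNReal.toReal_nonneg, ← pow_mul, mul_comm 2, pow_mul,
    Real.sqrt_sq (by positivity)]
  exact mul_le_mul_of_nonneg_right (by linarith) (by positivity)
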